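/- Let $R$ be a commutative ring and $I=[0,1]$. **Freehedra.** The freehedron $F_m$ is the cube $I^m$ whose facet $x_1=1$ is subdivided; its facets are included as follows ($1\le i\le m$): $d^0_i: F_{i-1}\times I^{m-i}\hookrightarrow F_m$ inserts $0$ as $i$-th coordinate; $d^1_i: F_{m-1}\hookrightarrow F_m$, for $i\ge 2$, inserts $1$ as $i$-th coordinate; $d^2_i: I^{i-1}\times F_{m-i}\hookrightarrow F_m$ is $(t,y)\mapsto\big(1,\tfrac{1+t_1}{2},\dots,\tfrac{1+t_{i-1}}2,\tfrac{y_1}{2},y_2,\dots,y_{m-i}\big)$; and $d^1_1=d^2_1$. **Cells.** A singular cell of $Y$ of type $(k,m,\ell)$ and dimension $N=k+m+\ell$ is a continuous map $I^k\times F_m\times I^\ell\to Y$ (cells of different types are different). Number the directions of $I^k\times F_m\times I^\ell$ so that $1,\dots,m$ are those of $F_m$, $m+1,\dots,m+\ell$ those of $I^\ell$, and $m+\ell+1,\dots,N$ those of $I^k$. Restriction to the faces defines operators $d^0_i,d^1_i$ ($1\le i\le N$) and $d^2_i$ ($1\le i\le m$) on cells: for $i\le m$ they are given by the faces of $F_m$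 above, and $d^0_i$, $d^1_i$, $d^2_i$ take type $(k,m,\ell)$ to type $(k,i-1,\ell+m-i)$, to type $(k,m-1,\ell)$ (for $i\ge2$), and to type $(k+i-1,m-i,\ell)$ respectively, where $d^1_1=d^2_1$ if $m\geq 1$; for $i>m$, $d^0_i$ and $d^1_i$ are the ordinary faces of the cube factors. A cell is degenerate if it does not depend on one of the coordinates of $I^k$ or of $I^\ell$. **Normalized complex.** On the free $R$-module on the cells of dimension $N$ put $$d=\sum_{i=1}^{N}(-1)^i(d^0_i-d^1_i)+\sum_{i=2}^{m}(-1)^{(i-1)N}d^2_i .$$ The span of the degenerate cells is a subcomplex, and $C^\odot_*(Y)$ is the quotient complex, with homology $H^\odot_*(Y)$. Let $C_\odot^*(Y)=\mathrm{Hom}_R(C^\odot_*(Y),R)$, with coboundary $\delta x=x\circ d$, and let $H_\odot^*(Y)$ be its cohomology. **Diagonal.** For a cell $u$ of type $(k,m,\ell)$ and dimension $N$ put $$\Delta_F(u)=\sum_{(K,L)} \mathrm{sgn}(K,L)\; d^0_{j_p}\cdots d^0_{j_1}u\otimes d^1_{i_q}\cdots d^1_{i_1}u\;+\;\sum \varepsilon\;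 d^0_{j_p}\cdots d^0_{j_{r+1}}d^2_{j_r}\cdots d^2_{j_1}u\otimes d^2_{t}\,d^1_{i_{q-1}}\cdots d^1_{i_1}u .$$ The first sum is over all decompositions of $\{1,\dots,N\}$ into disjoint sets $K=\{i_q<\dots<i_1\}$ and $L=\{j_p<\dots<j_1\}$, and $\mathrm{sgn}(K,L)$ is the sign of the unshuffle. The second sum is over all decompositions of $\{1,\dots,N\}$ into disjoint sets $K=\{1<i_{q-1}<\dots<i_1\}$ and $L$ with $|L|=p$, and over all $(r,t)\neq(0,1)$ with $0\le r<t\le a+1$, where $a=|L\cap\{2,\dots,m\}|$; the $r$ smallest elements of $L$ are written $j_{(s)}+1$ ($1\le s\le r$), $j_{(s)}=j_1+\dots+j_s$, its other elements are written $j_p+j_{(r)}<\dots<j_{r+1}+j_{(r)}$, and $$\varepsilon=(-1)^{(j_{(r)}+r)q+(p+1)(t+1)}\,\mathrm{sgn}(K,L).$$ The induced product of cochains is $(x\cdot y)(u)=(x\otimes y)(\Delta_F u)$, where a cochain of degree $p$ vanishes on cells of dimension $\ne p$. **Proposition.** There is a chain map $C_*(Y)\to C^\odot_*(Y)$ from the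 singular chain complex (with coefficients in $R$), natural in the topological space $Y$, that induces isomorphisms $H_*(Y)\cong H^\odot_*(Y)$ of homology and, dually, isomorphisms $H_\odot^*(Y)\cong H^*(Y)$ of cohomology. The product induced by $\Delta_F$ is well defined on $C_\odot^*(Y)$ and satisfies the Leibniz rule $\delta(x\cdot y)=\delta x\cdot y+(-1)^{|x|}x\cdot\delta y$; so it induces a product on $H_\odot^*(Y)$, and the isomorphism $H_\odot^*(Y)\cong H^*(Y)$ takes it to the cup product, and the cochain with value $1$ on all points to the unit. Thus $H_\odot^*(Y)\cong H^*(Y)$ as graded algebras. -/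

import Mathlib

open CategoryTheory

universe u

namespace Freehedral

noncomputable section

/-- The `j`-th coordinate (counted from `0`) of a point of the cube `I^n`. -/
def coord {n : ℕ} (x : Fin n → unitInterval) (j : ℕ) : unitInterval :=
  if h : j < n then x ⟨j, h⟩ else 0

/-- The map `t ↦ t / 2`, onto `[0, 1/2]`. -/
def lowerHalf (t : unitInterval) : unitInterval :=
  ⟨(t : ℝ) / 2, by constructor <;> linarith [t.2.1, t.2.2]⟩

/-- The map `t ↦ (1 + t) / 2`, onto `[1/2, 1]`. -/
def upperHalf (t : unitInterval) : unitInterval :=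
  ⟨(1 + (t : ℝ)) / 2, by constructor <;> linarith [t.2.1, t.2.2]⟩

lemma continuous_coord {n : ℕ} (j : ℕ) :
    Continuous (fun x : Fin n → unitInterval => coord x j) := by
  unfold coord
  split_ifs
  · exact continuous_apply _
  · exact continuous_const

lemma continuous_lowerHalf : Continuous lowerHalf := by
  unfold lowerHalf
  fun_prop

lemma continuous_upperHalf : Continuous upperHalf := by
  unfold upperHalf
  fun_prop

/-- The inclusion of the face `x_p = e` (`p` counted from `0`) into the cube `I^(n+1)`. -/
def cubeFace (n p : ℕ) (e : unitInterval) :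
    C(Fin n → unitInterval, Fin (n + 1) → unitInterval) where
  toFun x j :=
    if j.1 < p then coord x j.1 else if j.1 = p then e else coord x (j.1 - 1)
  continuous_toFun := by
    refine continuous_pi fun j => ?_
    split_ifs
    · exact continuous_coord _
    · exact continuous_const
    · exact continuous_coord _

/-- The inclusion of the face `d^2_i` into `I^k × F_m × I^l = I^(n+1)`, where `k + m + l = n + 1`
and `1 ≤ i ≤ m`. The freehedron `F_m` is the cube `I^m` in which the facet `x_1 = 1` is subdivided
into the faces `d^2_1, …, d^2_m`. The face `d^2_i` of `F_m` is a copy of `I^(i-1) × F_(m-i)`,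
included by `(t, y) ↦ (1, (1 + t_1)/2, …, (1 + t_(i-1))/2, y_1/2, y_2, …, y_(m-i))`. The
coordinates `t` become the last `i - 1` coordinates of `I^(k+i-1)`; the coordinates of `I^k` and of
`I^l` are not affected. -/
def specialFace (n k m i : ℕ) :
    C(Fin n → unitInterval, Fin (n + 1) → unitInterval) where
  toFun x j :=
    if j.1 < k then coord x j.1
    else if j.1 = k then 1
    else if j.1 < k + i then upperHalf (coord x (j.1 - 1))
    else if j.1 = k + i ∧ i < m then lowerHalf (coord x (j.1 - 1))
    else coord x (j.1 - 1)
  continuous_toFun := by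
    refine continuous_pi fun j => ?_
    split_ifs
    · exact continuous_coord _
    · exact continuous_const
    · exact continuous_upperHalf.comp (continuous_coord _)
    · exact continuous_lowerHalf.comp (continuous_coord _)
    · exact continuous_coord _

/-- A singular cell of dimension `n` of `Y`: a continuous map `I^k × F_m × I^l → Y`, where
`k + m + l = n`. As a space, `F_m` is the cube `I^m`, so that the map is a map on `I^n`; the first
`k` coordinates are those of `I^k`, the next `m` are those of `F_m`, the last `l` are those of
`I^l`. Maps with different `(k, m, l)` are different cells. -/
@[ext]
structure Cell (Y : Type u) [TopologicalSpace Y] (n : ℕ) where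
  k : ℕ
  m : ℕ
  l : ℕ
  dim_eq : k + m + l = n
  map : C(Fin n → unitInterval, Y)

namespace Cell

variable {Y Z : Type u} [TopologicalSpace Y] [TopologicalSpace Z] {n : ℕ}

/-- The cell of shape `(k, m, l)` with the given map (a default shape if `k + m + l ≠ n`, which
never happens below). -/
def ofShape (k m l : ℕ) (f : C(Fin n → unitInterval, Y)) : Cell Y n :=
  if h : k + m + l = n then ⟨k, m, l, h, f⟩ else ⟨0, 0, n, by omega, f⟩

/-- The position (counted from `0`) of the `i`-th direction of a cell. The directions of
`I^k × F_m × I^l` are numbered as follows: `1, …, m` are the directions of `F_m`,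
`m + 1, …, m + l` are those of `I^l`, and `m + l + 1, …, m + l + k` are those of `I^k`. -/
def pos (c : Cell Y n) (i : ℕ) : ℕ :=
  if i ≤ c.m + c.l then c.k + i - 1 else i - (c.m + c.l) - 1

/-- The face operator `d^0_i`, for `1 ≤ i ≤ n + 1`: the restriction to the face on which the `i`-th
coordinate is `0`. The face `d^0_i` of `F_m` is `F_(i-1) × I^(m-i)`. -/
def d0 (i : ℕ) (c : Cell Y (n + 1)) : Cell Y n :=
  if i ≤ c.m then
    ofShape c.k (i - 1) (c.l + (c.m - i)) (c.map.comp (cubeFace n (c.pos i) 0))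
  else if i ≤ c.m + c.l then
    ofShape c.k c.m (c.l - 1) (c.map.comp (cubeFace n (c.pos i) 0))
  else
    ofShape (c.k - 1) c.m c.l (c.map.comp (cubeFace n (c.pos i) 0))

/-- The face operator `d^2_i`, for `1 ≤ i ≤ m`: the restriction to the face
`I^(k+i-1) × F_(m-i) × I^l` of `I^k × F_m × I^l`. -/
def d2 (i : ℕ) (c : Cell Y (n + 1)) : Cell Y n :=
  ofShape (c.k + i - 1) (c.m - i) c.l (c.map.comp (specialFace n c.k c.m i))

/-- The face operator `d^1_i`, for `1 ≤ i ≤ n + 1`: the restriction to the face on which the `i`-th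
coordinate is `1`, except that `d^1_1 = d^2_1` if `m > 0`. The face `d^1_i` of `F_m` is `F_(m-1)`
for `2 ≤ i ≤ m`. -/
def d1 (i : ℕ) (c : Cell Y (n + 1)) : Cell Y n :=
  if i = 1 ∧ 0 < c.m then
    d2 1 c
  else if i ≤ c.m then
    ofShape c.k (c.m - 1) c.l (c.map.comp (cubeFace n (c.pos i) 1))
  else if i ≤ c.m + c.l then
    ofShape c.k c.m (c.l - 1) (c.map.comp (cubeFace n (c.pos i) 1))
  else
    ofShape (c.k - 1) c.m c.l (c.map.comp (cubeFace n (c.pos i) 1))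

/-- The face operators, indexed by their type `e = 0, 1, 2`. -/
def face (e : ℕ) (i : ℕ) (c : Cell Y (n + 1)) : Cell Y n :=
  if e = 0 then d0 i c else if e = 1 then d1 i c else d2 i c

/-- The list of the distinct faces of a cell of dimension `n` with freehedral part `F_m` (the face
`d^1_1 = d^2_1` is listed with type `2` if `m > 0`). -/
def Adm (n m e i : ℕ) : Prop :=
  (e = 0 ∧ 1 ≤ i ∧ i ≤ n) ∨ (e = 1 ∧ 1 ≤ i ∧ i ≤ n ∧ (i = 1 → m = 0)) ∨ (e = 2 ∧ 1 ≤ i ∧ i ≤ m)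

instance (n m e i : ℕ) : Decidable (Adm n m e i) := by unfold Adm; infer_instance

/-- The parameter `m` of a face. -/
def faceM (m e i : ℕ) : ℕ :=
  if e = 0 then (if i ≤ m then i - 1 else m)
  else if e = 1 then (if i ≤ m then m - 1 else m) else m - i

/-- The parameter `k` of a face. -/
def faceK (k m l e i : ℕ) : ℕ :=
  if e = 2 then k + i - 1 else if i ≤ m + l then k else k - 1

/-- The inclusion of a face. -/
def faceMap (n k m l e i : ℕ) : C(Fin n → unitInterval, Fin (n + 1) → unitInterval) :=
  if e = 2 then specialFace n k m i
  else cubeFace n (if i ≤ m + l then k + i - 1 else i - (m + l) - 1) (if e = 0 then 0 else 1)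

lemma face_spec (c : Cell Y (n + 1)) (e i : ℕ) (h : Adm (n + 1) c.m e i) :
    (face e i c).m = faceM c.m e i ∧ (face e i c).k = faceK c.k c.m c.l e i ∧
    (face e i c).map = c.map.comp (faceMap n c.k c.m c.l e i) := by
  obtain ⟨k, m, l, hd, f⟩ := c
  rcases h with ⟨rfl, h1, h2⟩ | ⟨rfl, h1, h2, h3⟩ | ⟨rfl, h1, h2⟩
  all_goals
    simp only [face, d0, d1, d2, ofShape, faceM, faceK, faceMap, pos] at *
    split_ifs
    all_goals first
      | (exfalso; omega)
      | (refine ⟨?_, ?_, ?_⟩ <;> rfl)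

lemma ext_aux {c c' : Cell Y n} (hm : c.m = c'.m) (hk : c.k = c'.k) (hf : c.map = c'.map) :
    c = c' := by
  have := c.dim_eq
  have := c'.dim_eq
  ext1
  · exact hk
  · exact hm
  · omega
  · exact hf

lemma coord_cubeFace (n p j : ℕ) (e : unitInterval) (x : Fin n → unitInterval) (hj : j < n + 1) :
    coord (cubeFace n p e x) j =
      if j < p then coord x j else if j = p then e else coord x (j - 1) := by
  simp [coord, cubeFace, hj]

lemma coord_specialFace (n k m i j : ℕ) (x : Fin n → unitInterval) (hj : j < n + 1) :
    coord (specialFace n k m i x) j =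
      if j < k then coord x j
      else if j = k then 1
      else if j < k + i then upperHalf (coord x (j - 1))
      else if j = k + i ∧ i < m then lowerHalf (coord x (j - 1))
      else coord x (j - 1) := by
  simp [coord, specialFace, hj]

/-- The coordinates of the inclusion of a face. -/
def faceVal (k m l e i : ℕ) (x : ℕ → unitInterval) (j : ℕ) : unitInterval :=
  if e = 2 then
      if j < k then x j
      else if j = k then 1
      else if j < k + i then upperHalf (x (j - 1))
      else if j = k + i ∧ i < m then lowerHalf (x (j - 1))
      else x (j - 1)
  else
    if j < (if i ≤ m + l then k + i - 1 else i - (m + l) - 1) then x j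
    else if j = (if i ≤ m + l then k + i - 1 else i - (m + l) - 1) then (if e = 0 then 0 else 1)
    else x (j - 1)

lemma coord_faceMap (n k m l e i j : ℕ) (x : Fin n → unitInterval) (hj : j < n + 1) :
    coord (faceMap n k m l e i x) j = faceVal k m l e i (coord x) j := by
  unfold faceMap faceVal
  by_cases he : e = 2
  · rw [if_pos he, if_pos he, coord_specialFace _ _ _ _ _ _ hj]
  · rw [if_neg he, if_neg he, coord_cubeFace _ _ _ _ _ hj]

lemma coord_ext {n : ℕ} {x y : Fin n → unitInterval} (h : ∀ j < n, coord x j = coord y j) :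
    x = y := by
  funext j
  simpa [coord] using h j.1 j.2

lemma upperHalf_zero : upperHalf 0 = lowerHalf 1 := by
  apply Subtype.ext; simp [upperHalf, lowerHalf]
lemma upperHalf_one : upperHalf 1 = 1 := by
  apply Subtype.ext; simp [upperHalf]
lemma lowerHalf_zero : lowerHalf 0 = 0 := by
  apply Subtype.ext; simp [lowerHalf]

/-- The involution on the pairs of a face (of type `e`, index `j`) and a face of that face (of type
`e'`, index `i`) which matches the two ways to reach a face of codimension two. -/
def partner (n m : ℕ) (q : (ℕ × ℕ) × (ℕ × ℕ)) : (ℕ × ℕ) × (ℕ × ℕ) :=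
  let e := q.1.1; let j := q.1.2; let e' := q.2.1; let i := q.2.2
  if e = 2 then
    if e' = 2 then ((2, i + j), (0, n - i))
    else if i ≤ n - j then ((e', i + j), (2, j))
    else if e' = 0 then ((2, i + j - n), (2, n - i))
    else ((1, i + j - n + 1), (2, j - 1))
  else if e' = 2 then
    if e = 0 ∨ m < j ∨ i + 1 < j then ((2, i), (e, j - i))
    else ((2, i + 1), (1, n + j - i - 2))
  else if i < j then ((e', i), (e, j - 1))
  else ((e', i + 1), (e, j))

/-- The exponent of the sign of a face in the differential. -/
def sgnExp (n e i : ℕ) : ℕ := if e = 0 then i else if e = 1 then i + 1 else (i - 1) * n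

lemma partner_spec (n k m l : ℕ) (hd : k + m + l = n + 2) (e j e' i a b a' b' : ℕ)
    (h1 : Adm (n + 2) m e j) (h2 : Adm (n + 1) (faceM m e j) e' i)
    (h : partner (n + 2) m ((e, j), (e', i)) = ((a, b), (a', b'))) :
    Adm (n + 2) m a b ∧ Adm (n + 1) (faceM m a b) a' b' ∧
    partner (n + 2) m ((a, b), (a', b')) = ((e, j), (e', i)) ∧ (a ≠ e ∨ b ≠ j) ∧
    faceM (faceM m a b) a' b' = faceM (faceM m e j) e' i := by
  unfold partner at h
  dsimp only at h
  unfold Adm at h1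
  rcases h1 with ⟨rfl, h1, h1'⟩ | ⟨rfl, h1, h1', h1''⟩ | ⟨rfl, h1, h1'⟩ <;>
  rcases h2 with ⟨rfl, h2, h2'⟩ | ⟨rfl, h2, h2', h2''⟩ | ⟨rfl, h2, h2'⟩ <;>
  simp [faceM] at h h2 h2' <;>
  (try split_ifs at h) <;>
  (try simp only [Prod.mk.injEq] at h) <;>
  obtain ⟨⟨rfl, rfl⟩, rfl, rfl⟩ := h <;>
  simp [Adm, faceM, partner] at * <;> grind

/-- The parameter `l` of a face. -/
def faceL (m l e i : ℕ) : ℕ :=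
  if e = 0 then (if i ≤ m then l + (m - i) else if i ≤ m + l then l - 1 else l)
  else if e = 1 then (if i ≤ m then l else if i ≤ m + l then l - 1 else l) else l

/-- Coordinates of a cubical face. -/
def insN (p : ℕ) (e : unitInterval) (x : ℕ → unitInterval) (j : ℕ) : unitInterval :=
  if j < p then x j else if j = p then e else x (j - 1)

/-- Coordinates of a special face. -/
def specN (k i : ℕ) (b : Prop) [Decidable b] (x : ℕ → unitInterval) (j : ℕ) : unitInterval :=
  if j < k then x j
  else if j = k then 1
  else if j < k + i then upperHalf (x (j - 1))
  else if j = k + i ∧ b then lowerHalf (x (j - 1))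
  else x (j - 1)

lemma ins_ins (p p' : ℕ) (e e' : unitInterval) (x : ℕ → unitInterval) (h : p' < p) :
    insN p e (insN p' e' x) = insN p' e' (insN (p - 1) e x) := by
  funext t; unfold insN; grind

lemma ins_spec_high (p k i : ℕ) (e : unitInterval) (x : ℕ → unitInterval) (b : Prop)
    [Decidable b] (h : k + i < p) (hi : 1 ≤ i) :
    insN p e (specN k i b x) = specN k i b (insN (p - 1) e x) := by
  funext t; unfold insN specN; grind

lemma ins_spec_end (p k i : ℕ) (e : unitInterval) (x : ℕ → unitInterval) (b : Prop)
    [Decidable b] (h : k + i ≤ p) (hi : 1 ≤ i) (hb : ¬ b) :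
    insN p e (specN k i b x) = specN k i b (insN (p - 1) e x) := by
  funext t; unfold insN specN; grind

lemma ins_spec_zero (p k i : ℕ) (x : ℕ → unitInterval) (b b' : Prop)
    [Decidable b] [Decidable b'] (h : p = k + i) (hi : 1 ≤ i) (hb : b) (hb' : ¬ b') :
    insN p 0 (specN k i b' x) = specN k i b (insN (p - 1) 0 x) := by
  have z3 := lowerHalf_zero
  funext t; unfold insN specN; grind

lemma ins_spec_low (p k i : ℕ) (e : unitInterval) (x : ℕ → unitInterval) (b : Prop)
    [Decidable b] (h : p < k) (hi : 1 ≤ i) :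
    insN p e (specN (k - 1) i b x) = specN k i b (insN p e x) := by
  funext t
  rcases lt_trichotomy t p with ht | ht | ht
  · have h1 : t < k := by omega
    have h2 : t < k - 1 := by omega
    simp [insN, specN, ht, h1, h2]
  · subst ht
    simp [insN, specN, h]
  · have h1 : ¬ t < p := by omega
    have h2 : t ≠ p := by omega
    rcases lt_trichotomy t k with h3 | h3 | h3
    · have h4 : t - 1 < k - 1 := by omega
      simp [insN, specN, h1, h2, h3, h4]
    · subst h3
      simp [insN, specN, h1, h2]
    · have h4 : ¬ t < k := by omega
      have h5 : t ≠ k := by omega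
      have h6 : ¬ t - 1 < k - 1 := by omega
      have h7 : t - 1 ≠ k - 1 := by omega
      have h8 : t - 1 < k - 1 + i ↔ t < k + i := by omega
      have h9 : t - 1 = k - 1 + i ↔ t = k + i := by omega
      have h10 : ¬ t - 1 < p := by omega
      have h11 : t - 1 ≠ p := by omega
      simp [insN, specN, h1, h2, h4, h5, h6, h7, h8, h9, h10, h11]

lemma ins_spec_mid (p k i : ℕ) (x : ℕ → unitInterval) (b : Prop)
    [Decidable b] (h : k < p) (h' : p ≤ k + i) (hi : 1 ≤ i) :
    insN p 1 (specN k i b x) = specN k (i + 1) b (insN (p - 1) 1 x) := by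
  have z2 := upperHalf_one
  funext t; unfold insN specN; grind

lemma spec_spec (k i j : ℕ) (x : ℕ → unitInterval) (b b' : Prop)
    [Decidable b] [Decidable b'] (hj : 1 ≤ j) (hi : 1 ≤ i) (hb : b) :
    specN k j b (specN (k + j - 1) i b' x) = specN k (i + j) b' (insN (k + j - 1) 0 x) := by
  have z1 := upperHalf_zero
  funext t; unfold insN specN; grind


/-- One representative of each pair that is exchanged by `partner`. -/
def Std (q : (ℕ × ℕ) × (ℕ × ℕ)) : Prop :=
  (q.1.1 = 2 → q.2.1 = 2) ∧ (q.1.1 ≠ 2 → q.2.1 ≠ 2 → q.2.2 < q.1.2)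

lemma partner_std (n m : ℕ) (q : (ℕ × ℕ) × (ℕ × ℕ)) (h : ¬ Std q) : Std (partner n m q) := by
  obtain ⟨⟨e, j⟩, e', i⟩ := q
  unfold Std partner at *
  grind

lemma std_shape (n k m l : ℕ) (hd : k + m + l = n + 2) (e j e' i a b a' b' : ℕ)
    (h1 : Adm (n + 2) m e j) (h2 : Adm (n + 1) (faceM m e j) e' i)
    (h : partner (n + 2) m ((e, j), (e', i)) = ((a, b), (a', b'))) (hs : Std ((e, j), (e', i))) :
    faceK (faceK k m l a b) (faceM m a b) (faceL m l a b) a' b' =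
      faceK (faceK k m l e j) (faceM m e j) (faceL m l e j) e' i ∧
    Odd (sgnExp (n + 2) a b + sgnExp (n + 1) a' b' +
      (sgnExp (n + 2) e j + sgnExp (n + 1) e' i)) := by
  unfold partner at h
  unfold Std at hs
  dsimp only at h hs
  unfold Adm at h1
  rcases h1 with ⟨rfl, h1, h1'⟩ | ⟨rfl, h1, h1', h1''⟩ | ⟨rfl, h1, h1'⟩ <;>
  rcases h2 with ⟨rfl, h2, h2'⟩ | ⟨rfl, h2, h2', h2''⟩ | ⟨rfl, h2, h2'⟩ <;>
  simp [faceM] at h h2 h2' hs <;>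
  (try simp only [hs, if_true] at h) <;>
  (try split_ifs at h) <;>
  (try simp only [Prod.mk.injEq] at h) <;>
  obtain ⟨⟨rfl, rfl⟩, rfl, rfl⟩ := h <;>
  simp only [faceM, faceK, faceL, sgnExp] at * <;> refine ⟨by grind, ?_⟩ <;>
  simp only [if_true, if_false, reduceIte, OfNat.ofNat_ne_zero, OfNat.ofNat_ne_one, one_ne_zero,
    zero_ne_one]
  · rw [Nat.odd_iff]; omega
  · rw [Nat.odd_iff]; omega
  · have : i ≤ j := by split_ifs at h2' <;> omega
    have h1 : (i-1) * (n+2) = (i - 1) * n + 2 * (i-1) := by ring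
    have h2 : (i-1) * (n+1) = (i - 1) * n + (i-1) := by ring
    rw [h1, h2, Nat.odd_iff]; omega
  · rw [Nat.odd_iff]; omega
  · rw [Nat.odd_iff]; omega
  · have : i ≤ j := by split_ifs at h2' <;> omega
    have h1 : (i-1) * (n+2) = (i - 1) * n + 2 * (i-1) := by ring
    have h2 : (i-1) * (n+1) = (i - 1) * n + (i-1) := by ring
    rw [h1, h2, Nat.odd_iff]; omega
  · obtain ⟨i, rfl⟩ := Nat.exists_eq_add_of_le h2
    simp only [Nat.add_sub_cancel, Nat.add_sub_cancel_left]
    have : 1 + i ≤ n + 2 := by split_ifs at h2' <;> omega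
    ring_nf
    rw [Nat.odd_iff]; omega
  · obtain ⟨i, rfl⟩ := Nat.exists_eq_add_of_le' h2
    obtain ⟨j, rfl⟩ := Nat.exists_eq_add_of_le' h1
    rw [show i + 1 + (j+1) - 1 = i+j+1 by omega, show n + 2 - (i+1) = n + 1 - i by omega]
    simp only [Nat.add_sub_cancel]
    ring_nf
    rw [Nat.odd_iff]; omega

lemma faceVal_spec (k m l i : ℕ) (x : ℕ → unitInterval) :
    faceVal k m l 2 i x = specN k i (i < m) x := by
  funext t; simp [faceVal, specN]

lemma faceVal_ins (k m l e i : ℕ) (x : ℕ → unitInterval) (he : e ≠ 2) :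
    faceVal k m l e i x = insN (if i ≤ m + l then k + i - 1 else i - (m + l) - 1)
      (if e = 0 then 0 else 1) x := by
  funext t; simp [faceVal, insN, he]

lemma std_val (n k m l : ℕ) (hd : k + m + l = n + 2) (e j e' i a b a' b' : ℕ)
    (h1 : Adm (n + 2) m e j) (h2 : Adm (n + 1) (faceM m e j) e' i)
    (h : partner (n + 2) m ((e, j), (e', i)) = ((a, b), (a', b'))) (hs : Std ((e, j), (e', i)))
    (x : ℕ → unitInterval) :
    faceVal k m l a b
      (faceVal (faceK k m l a b) (faceM m a b) (faceL m l a b) a' b' x) =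
    faceVal k m l e j
      (faceVal (faceK k m l e j) (faceM m e j) (faceL m l e j) e' i x) := by
  unfold partner at h
  unfold Std at hs
  dsimp only at h hs
  by_cases he : e = 2
  · -- two special faces
    obtain rfl : e' = 2 := hs.1 he
    subst he
    simp only [if_true, Prod.mk.injEq] at h
    obtain ⟨⟨rfl, rfl⟩, rfl, rfl⟩ := h
    simp only [Adm, faceM] at h1 h2
    simp only [faceVal_spec, faceM, faceK, faceL, reduceIte, OfNat.ofNat_ne_zero,
      OfNat.ofNat_ne_one]
    rw [faceVal_ins _ _ _ _ _ _ (by decide)]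
    simp only [if_true, reduceIte, OfNat.ofNat_ne_zero, OfNat.ofNat_ne_one, OfNat.zero_ne_ofNat]
    simp at h1 h2
    rw [spec_spec k i j x (j < m) (i < m - j) h1.1 h2.1 (by omega)]
    have hp : (if n + 2 - i ≤ m - (i + j) + l then k + (i + j) - 1 + (n + 2 - i) - 1
        else n + 2 - i - (m - (i + j) + l) - 1) = k + j - 1 := by split_ifs <;> omega
    rw [hp]
    funext t
    simp only [specN]
    grind
  · by_cases he' : e' = 2
    · subst he'
      have hm : 1 ≤ i ∧ i ≤ faceM m e j := by simpa [Adm] using h2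
      have hj : 1 ≤ j ∧ j ≤ n + 2 ∧ (e ≠ 0 → e = 1 ∧ (j = 1 → m = 0)) := by
        unfold Adm at h1; omega
      have hle : i ≤ m := by
        have : faceM m e j ≤ m := by unfold faceM; split_ifs <;> omega
        omega
      simp only [he, if_false, if_true] at h
      rw [faceVal_ins _ _ _ _ _ _ he, faceVal_spec]
      by_cases hc : e = 0 ∨ m < j ∨ i + 1 < j
      · simp only [hc, if_true, Prod.mk.injEq] at h
        obtain ⟨⟨rfl, rfl⟩, rfl, rfl⟩ := h
        rw [faceVal_ins _ _ _ _ _ _ he, faceVal_spec]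
        by_cases hjm : j ≤ m
        · have hi : i < j := by
            unfold faceM at hm; split_ifs at hm <;> omega
          rw [if_pos (show j ≤ m + l by omega)]
          have e1 : faceK k m l e j = k := by simp [faceK, he]; omega
          have e2 : (if j - i ≤ faceM m 2 i + faceL m l 2 i then faceK k m l 2 i + (j - i) - 1
              else j - i - (faceM m 2 i + faceL m l 2 i) - 1) = k + j - 1 - 1 := by
            simp only [faceM, faceL, faceK]; simp; split_ifs <;> omega
          rw [e1, e2]
          by_cases he0 : e = 0
          · subst he0
            simp only [if_true]
            by_cases hij : i + 1 = j
            · exact (ins_spec_zero _ k i x (i < m) (i < faceM m 0 j) (by omega) hm.1 (by omega)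
                (by simp [faceM, hjm]; omega)).symm
            · rw [← ins_spec_high (k + j - 1) k i 0 x (i < m) (by omega) hm.1]
              congr 1
              funext t
              simp only [specN, faceM]
              grind
          · rw [← ins_spec_high (k + j - 1) k i _ x (i < m) (by omega) hm.1]
            congr 1
            funext t
            simp only [specN, faceM]
            grind
        · have em : faceM m e j = m := by unfold faceM; split_ifs <;> omega
          rw [em] at hm ⊢
          by_cases hl : j ≤ m + l
          · rw [if_pos hl]
            have e1 : faceK k m l e j = k := by simp [faceK, he]; omega
            have e2 : (if j - i ≤ faceM m 2 i + faceL m l 2 i then faceK k m l 2 i + (j - i) - 1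
                else j - i - (faceM m 2 i + faceL m l 2 i) - 1) = k + j - 1 - 1 := by
              simp only [faceM, faceL, faceK]; simp; split_ifs <;> omega
            rw [e1, e2]
            by_cases hi : i < m
            · exact (ins_spec_high _ k i _ x _ (by omega) hm.1).symm
            · exact (ins_spec_end _ k i _ x _ (by omega) hm.1 hi).symm
          · rw [if_neg hl]
            have e1 : faceK k m l e j = k - 1 := by rw [faceK, if_neg he, if_neg hl]
            have e2 : (if j - i ≤ faceM m 2 i + faceL m l 2 i then faceK k m l 2 i + (j - i) - 1
                else j - i - (faceM m 2 i + faceL m l 2 i) - 1) = j - (m + l) - 1 := by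
              simp only [faceM, faceL, faceK]; simp; split_ifs <;> omega
            rw [e1, e2]
            exact (ins_spec_low _ k i _ x _ (by omega) hm.1).symm
      · simp only [hc, if_false, Prod.mk.injEq] at h
        obtain ⟨⟨rfl, rfl⟩, rfl, rfl⟩ := h
        have he1 : e = 1 := by omega
        subst he1
        rw [faceVal_spec, faceVal_ins _ _ _ _ _ _ (show (1 : ℕ) ≠ 2 by decide)]
        rw [if_pos (show j ≤ m + l by omega)]
        have em : faceM m 1 j = m - 1 := by simp [faceM]; omega
        have e1 : faceK k m l 1 j = k := by simp [faceK]; omega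
        have e2 : (if n + 2 + j - i - 2 ≤ faceM m 2 (i + 1) + faceL m l 2 (i + 1) then
            faceK k m l 2 (i + 1) + (n + 2 + j - i - 2) - 1
            else n + 2 + j - i - 2 - (faceM m 2 (i + 1) + faceL m l 2 (i + 1)) - 1) =
            k + j - 1 - 1 := by
          simp only [faceM, faceL, faceK]; simp
          rw [em] at hm
          split_ifs <;> omega
        rw [e1, e2]
        simp only [one_ne_zero, if_false]
        rw [ins_spec_mid (k + j - 1) k i x (i < faceM m 1 j) (by omega) (by omega) hm.1]
        funext t
        simp only [specN, em]
        grind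
    · have hij := hs.2 he he'
      simp only [he, he', hij, if_true, if_false, Prod.mk.injEq] at h
      obtain ⟨⟨rfl, rfl⟩, rfl, rfl⟩ := h
      have hj : 1 ≤ j ∧ j ≤ n + 2 := by unfold Adm at h1; omega
      have hi : 1 ≤ i ∧ i ≤ n + 1 := by unfold Adm at h2; omega
      rw [faceVal_ins _ _ _ _ _ _ he, faceVal_ins _ _ _ _ _ _ he, faceVal_ins _ _ _ _ _ _ he',
        faceVal_ins _ _ _ _ _ _ he']
      have ml : ∀ e j, e ≤ 1 → 1 ≤ j → faceM m e j + faceL m l e j =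
          if j ≤ m + l then m + l - 1 else m + l := by
        intro e j he hj
        simp only [faceM, faceL]
        split_ifs <;> omega
      have kk : ∀ e j, e ≠ 2 → faceK k m l e j = if j ≤ m + l then k else k - 1 := by
        intro e j he
        simp [faceK, he]
      rw [ml e j (by unfold Adm at h1; omega) hj.1, ml e' i (by unfold Adm at h2; omega) hi.1, kk e j he, kk e' i he']
      by_cases c1 : j ≤ m + l
      · have c2 : i ≤ m + l := by omega
        have c3 : j - 1 ≤ m + l - 1 := by omega
        have c4 : i ≤ m + l - 1 := by omega
        simp only [c1, c2, c3, c4, if_true]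
        rw [ins_ins (k + j - 1) (k + i - 1) _ _ _ (by omega)]
        rw [show k + (j - 1) - 1 = k + j - 1 - 1 by omega]
      · by_cases c2 : i ≤ m + l
        · have c3 : ¬ j - 1 ≤ m + l - 1 := by omega
          simp only [c1, c2, c3, if_true, if_false]
          rw [ins_ins (k + i - 1) _ _ _ _ (by omega)]
          rw [show j - 1 - (m + l - 1) - 1 = j - (m + l) - 1 by omega,
            show k - 1 + i - 1 = k + i - 1 - 1 by omega]
        · have c3 : ¬ j - 1 ≤ m + l := by omega
          simp only [c1, c2, c3, if_false]
          rw [ins_ins (j - (m + l) - 1) (i - (m + l) - 1) _ _ _ (by omega)]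
          rw [show j - 1 - (m + l) - 1 = j - (m + l) - 1 - 1 by omega]

lemma face_l (c : Cell Y (n + 1)) (e i : ℕ) (h : Adm (n + 1) c.m e i) :
    (face e i c).l = faceL c.m c.l e i := by
  obtain ⟨hm, hk, -⟩ := face_spec c e i h
  have h1 := (face e i c).dim_eq
  have h2 := c.dim_eq
  rw [hm, hk] at h1
  unfold Adm at h
  unfold faceM faceK at h1
  unfold faceL
  split_ifs at * <;> omega

lemma face_face_std (c : Cell Y (n + 2)) (e j e' i a b a' b' : ℕ)
    (h1 : Adm (n + 2) c.m e j) (h2 : Adm (n + 1) (faceM c.m e j) e' i)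
    (h : partner (n + 2) c.m ((e, j), (e', i)) = ((a, b), (a', b')))
    (hs : Std ((e, j), (e', i))) :
    face a' b' (face a b c) = face e' i (face e j c) := by
  obtain ⟨g1, g2, -, -, g5⟩ := partner_spec n c.k c.m c.l c.dim_eq _ _ _ _ _ _ _ _ h1 h2 h
  obtain ⟨r1, r2, r3⟩ := face_spec c e j h1
  obtain ⟨s1, s2, s3⟩ := face_spec c a b g1
  have r4 := face_l c e j h1
  have s4 := face_l c a b g1
  obtain ⟨t1, t2, t3⟩ := face_spec (face e j c) e' i (by rw [r1]; exact h2)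
  obtain ⟨u1, u2, u3⟩ := face_spec (face a b c) a' b' (by rw [s1]; exact g2)
  refine ext_aux ?_ ?_ ?_
  · rw [u1, t1, s1, r1, g5]
  · rw [u2, t2, s1, r1, s2, r2, s4, r4]
    exact (std_shape n c.k c.m c.l c.dim_eq _ _ _ _ _ _ _ _ h1 h2 h hs).1
  · rw [u3, t3, s1, r1, s2, r2, s4, r4, s3, r3]
    ext x
    simp only [ContinuousMap.comp_apply]
    congr 1
    refine coord_ext fun t ht => ?_
    have key : ∀ (e j e' i : ℕ), Adm (n + 2) c.m e j →
        coord (faceMap (n + 1) c.k c.m c.l e j (faceMap n (faceK c.k c.m c.l e j) (faceM c.m e j)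
          (faceL c.m c.l e j) e' i x)) t =
        faceVal c.k c.m c.l e j (faceVal (faceK c.k c.m c.l e j) (faceM c.m e j)
          (faceL c.m c.l e j) e' i (coord x)) t := by
      intro e j e' i hA
      rw [coord_faceMap _ _ _ _ _ _ _ _ ht]
      have hd := c.dim_eq
      have hc := fun s hs => coord_faceMap n (faceK c.k c.m c.l e j) (faceM c.m e j)
          (faceL c.m c.l e j) e' i s x hs
      have hA' : e = 2 → 1 ≤ j ∧ j ≤ c.m := by unfold Adm at hA; omega
      have hA'' : 1 ≤ j ∧ j ≤ n + 2 := by unfold Adm at hA; omega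
      by_cases he : e = 2
      · have := hA' he
        subst he
        rw [faceVal_spec, faceVal_spec]
        unfold specN
        split_ifs
        · exact hc _ (by omega)
        · rfl
        · rw [hc _ (by omega)]
        · rw [hc _ (by omega)]
        · exact hc _ (by omega)
      · rw [faceVal_ins _ _ _ _ _ _ he, faceVal_ins _ _ _ _ _ _ he]
        unfold insN
        have hp : (if j ≤ c.m + c.l then c.k + j - 1 else j - (c.m + c.l) - 1) < n + 2 := by
          split_ifs <;> omega
        generalize (if j ≤ c.m + c.l then c.k + j - 1 else j - (c.m + c.l) - 1) = p at *
        split_ifs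
        all_goals first
          | rfl
          | exact hc _ (by omega)
    rw [key _ _ _ _ g1, key _ _ _ _ h1]
    exact congrFun (std_val n c.k c.m c.l c.dim_eq _ _ _ _ _ _ _ _ h1 h2 h hs (coord x)) t

lemma face_face (c : Cell Y (n + 2)) (e j e' i a b a' b' : ℕ)
    (h1 : Adm (n + 2) c.m e j) (h2 : Adm (n + 1) (faceM c.m e j) e' i)
    (h : partner (n + 2) c.m ((e, j), (e', i)) = ((a, b), (a', b'))) :
    face a' b' (face a b c) = face e' i (face e j c) ∧
    Odd (sgnExp (n + 2) a b + sgnExp (n + 1) a' b' +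
      (sgnExp (n + 2) e j + sgnExp (n + 1) e' i)) := by
  obtain ⟨g1, g2, g3, -, -⟩ := partner_spec n c.k c.m c.l c.dim_eq _ _ _ _ _ _ _ _ h1 h2 h
  by_cases hs : Std ((e, j), (e', i))
  · exact ⟨face_face_std c _ _ _ _ _ _ _ _ h1 h2 h hs,
      (std_shape n c.k c.m c.l c.dim_eq _ _ _ _ _ _ _ _ h1 h2 h hs).2⟩
  · have hs' := partner_std (n + 2) c.m _ hs
    rw [h] at hs'
    refine ⟨(face_face_std c _ _ _ _ _ _ _ _ g1 g2 g3 hs').symm, ?_⟩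
    rw [add_comm]
    exact (std_shape n c.k c.m c.l c.dim_eq _ _ _ _ _ _ _ _ g1 g2 g3 hs').2

variable (R : Type u) [CommRing R]

/-- The boundary of a cell of dimension `N = n + 1`:
`∑_{i=1}^{N} (-1)^i (d^0_i - d^1_i) + ∑_{i=2}^{m} (-1)^((i-1)N) d^2_i`. -/
def boundary (c : Cell Y (n + 1)) : Cell Y n →₀ R :=
  ∑ i ∈ Finset.Icc 1 (n + 1),
      (Finsupp.single (d0 i c) ((-1) ^ i) - Finsupp.single (d1 i c) ((-1) ^ i))
    + ∑ i ∈ Finset.Icc 2 c.m, Finsupp.single (d2 i c) ((-1) ^ ((i - 1) * (n + 1)))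

/-- The differential on the free module on all cells. -/
def chainD (Y : Type u) [TopologicalSpace Y] (n : ℕ) :
    (Cell Y (n + 1) →₀ R) →ₗ[R] (Cell Y n →₀ R) :=
  Finsupp.linearCombination R (boundary R)

/-- The set of all faces. -/
def adms (n m : ℕ) : Finset (ℕ × ℕ) :=
  (Finset.range 3 ×ˢ Finset.range (n + 1)).filter fun q => Adm n m q.1 q.2

lemma mem_adms {n m e i : ℕ} (hm : m ≤ n) : (e, i) ∈ adms n m ↔ Adm n m e i := by
  rw [adms, Finset.mem_filter, Finset.mem_product, Finset.mem_range, Finset.mem_range]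
  unfold Adm
  dsimp only
  omega

lemma boundary_eq (c : Cell Y (n + 1)) :
    boundary R c = ∑ q ∈ adms (n + 1) c.m,
      Finsupp.single (face q.1 q.2 c) ((-1 : R) ^ sgnExp (n + 1) q.1 q.2) := by
  have hd := c.dim_eq
  rw [adms, Finset.sum_filter, Finset.sum_product]
  simp only [Finset.sum_range_succ _ 2, Finset.sum_range_succ _ 1, Finset.sum_range_one]
  have f0 : ∀ i, face 0 i c = d0 i c := fun i => rfl
  have f1 : ∀ i, face 1 i c = d1 i c := fun i => rfl
  have f2 : ∀ i, face 2 i c = d2 i c := fun i => rfl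
  have k0 : ∑ i ∈ Finset.range (n + 1 + 1), (if Adm (n + 1) c.m 0 i then
      Finsupp.single (face 0 i c) ((-1 : R) ^ sgnExp (n + 1) 0 i) else 0) =
      ∑ i ∈ Finset.Icc 1 (n + 1), Finsupp.single (d0 i c) ((-1 : R) ^ i) := by
    rw [← Finset.sum_filter]
    refine Finset.sum_congr ?_ fun i _ => by simp [sgnExp, f0]
    ext i; simp [Adm]; try omega
  have k1 : ∑ i ∈ Finset.range (n + 1 + 1), (if Adm (n + 1) c.m 1 i then
      Finsupp.single (face 1 i c) ((-1 : R) ^ sgnExp (n + 1) 1 i) else 0) =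
      ∑ i ∈ Finset.Icc 1 (n + 1), - Finsupp.single (d1 i c) ((-1 : R) ^ i) -
      (if c.m = 0 then 0 else Finsupp.single (d2 1 c) 1) := by
    have : Finset.Icc 1 (n + 1) = insert 1 (Finset.Icc 2 (n + 1)) := by ext; simp; omega
    rw [this, Finset.sum_insert (by simp), ← Finset.sum_filter]
    by_cases hm : c.m = 0
    · have : (Finset.range (n + 1 + 1)).filter (fun i => Adm (n + 1) c.m 1 i) =
        insert 1 (Finset.Icc 2 (n + 1)) := by
        ext i; simp [Adm, hm]; try omega
      rw [this, Finset.sum_insert (by simp)]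
      simp [hm, f1, sgnExp, pow_succ]
    · have : (Finset.range (n + 1 + 1)).filter (fun i => Adm (n + 1) c.m 1 i) =
        (Finset.Icc 2 (n + 1)) := by
        ext i; simp [Adm, hm]; omega
      rw [this]
      have h1 : d1 1 c = d2 1 c := by simp [d1, Nat.pos_of_ne_zero hm]
      simp [hm, f1, sgnExp, pow_succ, h1]
  have k2 : ∑ i ∈ Finset.range (n + 1 + 1), (if Adm (n + 1) c.m 2 i then
      Finsupp.single (face 2 i c) ((-1 : R) ^ sgnExp (n + 1) 2 i) else 0) =
      ∑ i ∈ Finset.Icc 2 c.m, Finsupp.single (d2 i c) ((-1 : R) ^ ((i - 1) * (n + 1))) +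
      (if c.m = 0 then 0 else Finsupp.single (d2 1 c) 1) := by
    rw [← Finset.sum_filter]
    have : (Finset.range (n + 1 + 1)).filter (fun i => Adm (n + 1) c.m 2 i) =
        Finset.Icc 1 c.m := by
      ext i; simp [Adm]; omega
    rw [this]
    by_cases hm : c.m = 0
    · simp [hm]
    · have : Finset.Icc 1 c.m = insert 1 (Finset.Icc 2 c.m) := by ext; simp; omega
      rw [this, Finset.sum_insert (by simp), add_comm]
      simp [hm, f2, sgnExp]
  rw [k0, k1, k2, boundary, Finset.sum_sub_distrib, Finset.sum_neg_distrib]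
  abel

lemma chainD_single (c : Cell Y (n + 1)) (r : R) :
    chainD R Y n (Finsupp.single c r) = r • boundary R c := by
  simp [chainD]

lemma chainD_chainD (Y : Type u) [TopologicalSpace Y] (n : ℕ) :
    chainD R Y n ∘ₗ chainD R Y (n + 1) = 0 := by
  refine Finsupp.lhom_ext fun c r => ?_
  have hd := c.dim_eq
  simp only [LinearMap.comp_apply, chainD_single, LinearMap.zero_apply, map_smul]
  rw [boundary_eq, map_sum]
  simp only [chainD_single, boundary_eq, Finset.smul_sum]
  rw [Finset.sum_sigma']
  simp only [← Finset.smul_sum]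
  convert smul_zero r
  have hmem : ∀ q : (_ : ℕ × ℕ) × (ℕ × ℕ),
      q ∈ (adms (n + 1 + 1) c.m).sigma (fun q => adms (n + 1) (face q.1 q.2 c).m) ↔
      Adm (n + 2) c.m q.1.1 q.1.2 ∧ Adm (n + 1) (faceM c.m q.1.1 q.1.2) q.2.1 q.2.2 := by
    rintro ⟨⟨e, j⟩, e', i⟩
    have hd' := (face e j c).dim_eq
    rw [Finset.mem_sigma, mem_adms (by omega)]
    refine and_congr_right fun h => ?_
    rw [mem_adms (by simp only; omega), (face_spec c e j h).1]
  refine Finset.sum_involution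
    (fun q _ => ⟨(partner (n + 2) c.m (q.1, q.2)).1, (partner (n + 2) c.m (q.1, q.2)).2⟩)
    ?_ ?_ ?_ ?_
  · rintro ⟨⟨e, j⟩, e', i⟩ hq
    obtain ⟨h1, h2⟩ := (hmem _).1 hq
    obtain ⟨⟨⟨a, b⟩, a', b'⟩, hp⟩ : ∃ p, p = partner (n + 2) c.m ((e, j), (e', i)) := ⟨_, rfl⟩
    obtain ⟨g1, g2⟩ := face_face c e j e' i a b a' b' h1 h2 hp.symm
    simp only [← hp, g1, Finsupp.smul_single, smul_eq_mul, ← Finsupp.single_add, ← pow_add]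
    rw [Finsupp.single_eq_zero]
    have : (-1 : R) ^ _ = -1 := g2.neg_one_pow
    rw [pow_add] at this
    have e1 := neg_one_pow_eq_or R (sgnExp (n + 2) e j + sgnExp (n + 1) e' i)
    have e2 := neg_one_pow_eq_or R (sgnExp (n + 2) a b + sgnExp (n + 1) a' b')
    change (-1 : R) ^ (sgnExp (n + 2) e j + sgnExp (n + 1) e' i) +
      (-1 : R) ^ (sgnExp (n + 2) a b + sgnExp (n + 1) a' b') = 0
    rcases e1 with e1 | e1 <;> rw [e1] at this ⊢
    · rw [mul_one] at this; rw [this]; ring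
    · rw [mul_neg, mul_one, neg_inj] at this; rw [this]; ring
  · rintro ⟨⟨e, j⟩, e', i⟩ hq _ heq
    obtain ⟨h1, h2⟩ := (hmem _).1 hq
    obtain ⟨⟨⟨a, b⟩, a', b'⟩, hp⟩ : ∃ p, p = partner (n + 2) c.m ((e, j), (e', i)) := ⟨_, rfl⟩
    obtain ⟨-, -, -, g4, -⟩ :=
      partner_spec n c.k c.m c.l c.dim_eq _ _ _ _ _ _ _ _ h1 h2 hp.symm
    simp only [← hp, Sigma.mk.injEq, Prod.mk.injEq] at heq
    rcases g4 with g | g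
    · exact g heq.1.1
    · exact g heq.1.2
  · rintro ⟨⟨e, j⟩, e', i⟩ hq
    obtain ⟨h1, h2⟩ := (hmem _).1 hq
    obtain ⟨⟨⟨a, b⟩, a', b'⟩, hp⟩ : ∃ p, p = partner (n + 2) c.m ((e, j), (e', i)) := ⟨_, rfl⟩
    obtain ⟨g1, g2, -, -, -⟩ :=
      partner_spec n c.k c.m c.l c.dim_eq _ _ _ _ _ _ _ _ h1 h2 hp.symm
    simp only [← hp]
    exact (hmem _).2 ⟨g1, g2⟩
  · rintro ⟨⟨e, j⟩, e', i⟩ hq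
    obtain ⟨h1, h2⟩ := (hmem _).1 hq
    obtain ⟨⟨⟨a, b⟩, a', b'⟩, hp⟩ : ∃ p, p = partner (n + 2) c.m ((e, j), (e', i)) := ⟨_, rfl⟩
    obtain ⟨-, -, g3, -, -⟩ :=
      partner_spec n c.k c.m c.l c.dim_eq _ _ _ _ _ _ _ _ h1 h2 hp.symm
    simp only [← hp, g3]

end Cell

end

noncomputable section

namespace Cell
variable {Y Z : Type u} [TopologicalSpace Y] [TopologicalSpace Z] {n : ℕ}
variable (R : Type u) [CommRing R]

/-- A cell `I^k × F_m × I^l → Y` is degenerate if it does not depend on one of the coordinates of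
`I^k` or of `I^l`, that is, if it factors through a projection which forgets that coordinate. -/
def IsDegenerate (c : Cell Y n) : Prop :=
  ∃ p : Fin n, (p.1 < c.k ∨ c.k + c.m ≤ p.1) ∧
    ∀ x y : Fin n → unitInterval, (∀ j, j ≠ p → x j = y j) → c.map x = c.map y

/-- The cell does not depend on its `i`-th direction, a direction of `I^l` or of `I^k`. -/
def DegAt (c : Cell Y n) (i : ℕ) : Prop :=
  c.m < i ∧ i ≤ n ∧ ∀ x y : Fin n → unitInterval,
    (∀ t < n, t ≠ c.pos i → coord x t = coord y t) → c.map x = c.map y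

lemma isDegenerate_iff (c : Cell Y n) : c.IsDegenerate ↔ ∃ i, c.DegAt i := by
  have hd := c.dim_eq
  constructor
  · rintro ⟨p, hp, h⟩
    have hpn := p.2
    refine ⟨if p.1 < c.k then c.m + c.l + p.1 + 1 else p.1 - c.k + 1, ?_, ?_, ?_⟩
    · split_ifs <;> omega
    · split_ifs <;> omega
    · intro x y hxy
      refine h x y fun j hj => ?_
      have := hxy j.1 j.2 ?_
      · simpa [coord] using this
      · intro hj'
        apply hj
        ext
        rw [hj']
        unfold pos
        split_ifs <;> omega
  · rintro ⟨i, h1, h2, h3⟩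
    have hp : c.pos i < n := by unfold pos; split_ifs <;> omega
    refine ⟨⟨c.pos i, hp⟩, ?_, fun x y hxy => h3 x y fun t ht htp => ?_⟩
    · simp only [pos]; split_ifs <;> omega
    · simp only [coord, ht, dif_pos]
      exact hxy _ (by simpa [Fin.ext_iff] using htp)

lemma DegAt.face {c : Cell Y (n + 1)} {i e j : ℕ} (h : c.DegAt i) (hA : Adm (n + 1) c.m e j)
    (hij : j ≠ i) :
    (face e j c).DegAt (if e = 2 then i - j else if j < i then i - 1 else i) := by
  obtain ⟨h1, h2, h3⟩ := h
  obtain ⟨r1, r2, r3⟩ := face_spec c e j hA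
  have r4 := face_l c e j hA
  have hd := c.dim_eq
  have hd' := (Cell.face e j c).dim_eq
  have hA1 : 1 ≤ j ∧ j ≤ n + 1 ∧ (e = 2 → j ≤ c.m) ∧ (e = 0 ∨ e = 1 ∨ e = 2) := by
    unfold Adm at hA; omega
  clear hA
  refine ⟨?_, ?_, fun x y hxy => ?_⟩
  · rw [r1]; unfold faceM; split_ifs <;> omega
  · split_ifs <;> omega
  · rw [r3]
    simp only [ContinuousMap.comp_apply]
    refine h3 _ _ fun t ht htp => ?_
    rw [coord_faceMap _ _ _ _ _ _ _ _ ht, coord_faceMap _ _ _ _ _ _ _ _ ht]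
    unfold pos at hxy htp
    rw [r1, r2, r4] at hxy
    by_cases he : e = 2
    · subst he
      rw [faceVal_spec, faceVal_spec]
      have hp : (if (i - j) ≤ faceM c.m 2 j + faceL c.m c.l 2 j then faceK c.k c.m c.l 2 j + (i - j) - 1
          else (i - j) - (faceM c.m 2 j + faceL c.m c.l 2 j) - 1) =
          (if i ≤ c.m + c.l then c.k + i - 1 - 1 else i - (c.m + c.l) - 1) := by
        simp only [faceM, faceL, faceK]; simp; split_ifs <;> omega
      simp only [if_true] at hxy
      rw [hp] at hxy
      unfold specN
      split_ifs with g1 g2 g3 g4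
      · exact hxy _ (by omega) (by split_ifs at * <;> omega)
      · rfl
      · rw [hxy _ (by omega) (by split_ifs at * <;> omega)]
      · rw [hxy _ (by omega) (by split_ifs at * <;> omega)]
      · exact hxy _ (by omega) (by split_ifs at * <;> omega)
    · rw [faceVal_ins _ _ _ _ _ _ he, faceVal_ins _ _ _ _ _ _ he]
      simp only [he, if_false] at hxy
      have ml : faceM c.m e j + faceL c.m c.l e j =
          if j ≤ c.m + c.l then c.m + c.l - 1 else c.m + c.l := by
        simp only [faceM, faceL]
        split_ifs <;> omega
      have kk : faceK c.k c.m c.l e j = if j ≤ c.m + c.l then c.k else c.k - 1 := by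
        simp [faceK, he]
      rw [ml, kk] at hxy
      unfold insN
      split_ifs with g1 g2 g3
      all_goals first
        | rfl
        | exact hxy _ (by split_ifs at * <;> omega) (by split_ifs at * <;> omega)

lemma DegAt.face_eq {c : Cell Y (n + 1)} {i : ℕ} (h : c.DegAt i) : Cell.face 0 i c = Cell.face 1 i c := by
  obtain ⟨h1, h2, h3⟩ := h
  have a0 : Adm (n + 1) c.m 0 i := by unfold Adm; omega
  have a1 : Adm (n + 1) c.m 1 i := by unfold Adm; omega
  obtain ⟨r1, r2, r3⟩ := face_spec c 0 i a0
  obtain ⟨s1, s2, s3⟩ := face_spec c 1 i a1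
  have hi : ¬ i ≤ c.m := by omega
  refine ext_aux ?_ ?_ ?_
  · rw [r1, s1]; simp [faceM, hi]
  · rw [r2, s2]; simp [faceK]
  · rw [r3, s3]
    ext x
    simp only [ContinuousMap.comp_apply]
    refine h3 _ _ fun t ht htp => ?_
    rw [coord_faceMap _ _ _ _ _ _ _ _ ht, coord_faceMap _ _ _ _ _ _ _ _ ht,
      faceVal_ins _ _ _ _ _ _ (by decide), faceVal_ins _ _ _ _ _ _ (by decide)]
    unfold insN
    unfold pos at htp
    simp [htp]

/-- The submodule of the chains that is spanned by the degenerate cells. -/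
def degenerateChains (Y : Type u) [TopologicalSpace Y] (n : ℕ) : Submodule R (Cell Y n →₀ R) :=
  Submodule.span R {x | ∃ c : Cell Y n, c.IsDegenerate ∧ x = Finsupp.single c 1}

lemma single_mem_degenerateChains {c : Cell Y n} (h : c.IsDegenerate) (r : R) :
    Finsupp.single c r ∈ degenerateChains R Y n := by
  have : Finsupp.single c r = r • Finsupp.single c (1 : R) := by simp
  rw [this]
  exact Submodule.smul_mem _ _ (Submodule.subset_span ⟨c, h, rfl⟩)

lemma chainD_degenerate (Y : Type u) [TopologicalSpace Y] (n : ℕ) :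
    degenerateChains R Y (n + 1) ≤ (degenerateChains R Y n).comap (chainD R Y n) := by
  refine Submodule.span_le.2 ?_
  rintro _ ⟨c, hc, rfl⟩
  obtain ⟨i, hi⟩ := (isDegenerate_iff c).1 hc
  have hd := c.dim_eq
  rw [SetLike.mem_coe, Submodule.mem_comap, chainD_single, one_smul, boundary_eq]
  obtain ⟨h1, h2, -⟩ := id hi
  have m0 : (0, i) ∈ adms (n + 1) c.m := by rw [mem_adms (by omega)]; unfold Adm; omega
  have m1 : (1, i) ∈ (adms (n + 1) c.m).erase (0, i) := by
    rw [Finset.mem_erase, mem_adms (by omega)]; unfold Adm; refine ⟨by simp, ?_⟩; omega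
  rw [← Finset.add_sum_erase _ _ m0, ← Finset.add_sum_erase _ _ m1, ← add_assoc]
  refine Submodule.add_mem _ ?_ (Submodule.sum_mem _ ?_)
  · simp only [← hi.face_eq, ← Finsupp.single_add]
    simp [sgnExp, pow_succ]
  · rintro ⟨e, j⟩ hq
    rw [Finset.mem_erase, Finset.mem_erase, mem_adms (by omega)] at hq
    obtain ⟨q1, q2, q3⟩ := hq
    refine single_mem_degenerateChains R ((isDegenerate_iff _).2 ⟨_, hi.face q3 ?_⟩) _
    rintro rfl
    unfold Adm at q3
    simp at q1 q2
    omega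

/-- The cell obtained by composing with a continuous map `Y → Z`. -/
def postcomp (g : C(Y, Z)) (c : Cell Y n) : Cell Z n := ⟨c.k, c.m, c.l, c.dim_eq, g.comp c.map⟩

lemma postcomp_ofShape (g : C(Y, Z)) (k m l : ℕ) (f : C(Fin n → unitInterval, Y)) :
    (ofShape k m l f).postcomp g = ofShape k m l (g.comp f) := by
  unfold ofShape
  split_ifs <;> rfl

lemma postcomp_d0 (g : C(Y, Z)) (i : ℕ) (c : Cell Y (n + 1)) :
    (d0 i c).postcomp g = d0 i (c.postcomp g) := by
  unfold d0
  simp only [apply_ite (postcomp g), postcomp_ofShape]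
  rfl

lemma postcomp_d2 (g : C(Y, Z)) (i : ℕ) (c : Cell Y (n + 1)) :
    (d2 i c).postcomp g = d2 i (c.postcomp g) := by
  unfold d2
  simp only [postcomp_ofShape]
  rfl

lemma postcomp_d1 (g : C(Y, Z)) (i : ℕ) (c : Cell Y (n + 1)) :
    (d1 i c).postcomp g = d1 i (c.postcomp g) := by
  unfold d1
  simp only [apply_ite (postcomp g), postcomp_ofShape, postcomp_d2]
  rfl

/-- The map on chains induced by a continuous map. -/
def chainMap (g : C(Y, Z)) (n : ℕ) : (Cell Y n →₀ R) →ₗ[R] (Cell Z n →₀ R) :=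
  Finsupp.lmapDomain R R (postcomp g)

lemma chainMap_chainD (g : C(Y, Z)) (n : ℕ) :
    chainMap R g n ∘ₗ chainD R Y n = chainD R Z n ∘ₗ chainMap R g (n + 1) := by
  refine Finsupp.lhom_ext fun c r => ?_
  have hs : ∀ (k : ℕ) (c : Cell Y k) (r : R),
      chainMap R g k (Finsupp.single c r) = Finsupp.single (c.postcomp g) r := fun k c r => by
    rw [chainMap, Finsupp.lmapDomain_apply, Finsupp.mapDomain_single]
  rw [LinearMap.comp_apply, LinearMap.comp_apply, hs, chainD_single, chainD_single, map_smul]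
  congr 1
  simp only [boundary, map_add, map_sum, map_sub, hs, postcomp_d0, postcomp_d1, postcomp_d2]
  rfl

lemma chainMap_degenerate (g : C(Y, Z)) (n : ℕ) :
    degenerateChains R Y n ≤ (degenerateChains R Z n).comap (chainMap R g n) := by
  refine Submodule.span_le.2 ?_
  rintro _ ⟨c, ⟨p, hp, h⟩, rfl⟩
  rw [SetLike.mem_coe, Submodule.mem_comap, chainMap, Finsupp.lmapDomain_apply,
    Finsupp.mapDomain_single]
  have : (c.postcomp g).IsDegenerate := ⟨p, hp, fun x y hxy => congrArg g (h x y hxy)⟩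
  exact single_mem_degenerateChains R this 1

end Cell

open Cell

variable (R : Type u) [CommRing R]

/-- The normalized chains: all chains modulo the degenerate ones. -/
abbrev NormalizedChains (Y : Type u) [TopologicalSpace Y] (n : ℕ) : Type u :=
  (Cell Y n →₀ R) ⧸ degenerateChains R Y n

/-- The differential on normalized chains. -/
def normalizedD (Y : Type u) [TopologicalSpace Y] (n : ℕ) :
    NormalizedChains R Y (n + 1) →ₗ[R] NormalizedChains R Y n :=
  Submodule.mapQ _ _ (chainD R Y n) (chainD_degenerate R Y n)

lemma normalizedD_comp (Y : Type u) [TopologicalSpace Y] (n : ℕ) :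
    normalizedD R Y n ∘ₗ normalizedD R Y (n + 1) = 0 := by
  refine Submodule.linearMap_qext _ (LinearMap.ext fun x => ?_)
  have := LinearMap.congr_fun (chainD_chainD R Y n) x
  simp only [LinearMap.comp_apply, LinearMap.zero_apply] at this
  simp [normalizedD, this]

/-- The normalized chain complex of the singular freehedral set of `Y`, with coefficients in `R`. -/
def normalizedComplex (Y : TopCat.{u}) : ChainComplex (ModuleCat.{u} R) ℕ :=
  ChainComplex.of (fun n => ModuleCat.of R (NormalizedChains R Y n))
    (fun n => ModuleCat.ofHom (normalizedD R Y n))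
    (fun n => by rw [← ModuleCat.ofHom_comp, normalizedD_comp]; rfl)

lemma normalizedComplex_d (Y : TopCat.{u}) (n : ℕ) :
    (normalizedComplex R Y).d (n + 1) n = ModuleCat.ofHom (normalizedD R Y n) :=
  ChainComplex.of_d (fun n => ModuleCat.of R (NormalizedChains R Y n))
    (fun n => ModuleCat.ofHom (normalizedD R Y n)) n

/-- The map on normalized chains induced by a continuous map. -/
def normalizedMap {Y Z : TopCat.{u}} (g : Y ⟶ Z) (n : ℕ) :
    NormalizedChains R Y n →ₗ[R] NormalizedChains R Z n :=
  Submodule.mapQ _ _ (chainMap R g.hom n) (chainMap_degenerate R g.hom n)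

/-- The normalized chain complex as a functor of the space. -/
def normalizedComplexFunctor : TopCat.{u} ⥤ ChainComplex (ModuleCat.{u} R) ℕ where
  obj Y := normalizedComplex R Y
  map {Y Z} g := ChainComplex.ofHom
    (fun n => ModuleCat.ofHom (normalizedMap R g n)) (fun n => by
      rw [normalizedComplex_d, normalizedComplex_d]
      change ModuleCat.ofHom (normalizedD R Z n ∘ₗ normalizedMap R g (n + 1)) =
        ModuleCat.ofHom (normalizedMap R g n ∘ₗ normalizedD R Y n)
      congr 1
      refine Submodule.linearMap_qext _ (LinearMap.ext fun x => ?_)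
      have := LinearMap.congr_fun (chainMap_chainD R g.hom n) x
      simp only [LinearMap.comp_apply] at this
      simp [normalizedMap, normalizedD, this])
  map_id Y := by
    ext n x
    obtain ⟨x, rfl⟩ := Submodule.Quotient.mk_surjective _ x
    change Submodule.Quotient.mk (Finsupp.mapDomain (postcomp (ContinuousMap.id Y)) x) = _
    have : (postcomp (ContinuousMap.id Y) : Cell Y n → Cell Y n) = id := rfl
    rw [this, Finsupp.mapDomain_id]
    rfl
  map_comp {X Y Z} f g := by
    ext n x
    obtain ⟨x, rfl⟩ := Submodule.Quotient.mk_surjective _ x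
    change Submodule.Quotient.mk (Finsupp.mapDomain (postcomp (g.hom.comp f.hom)) x) =
      Submodule.Quotient.mk (Finsupp.mapDomain (postcomp g.hom)
        (Finsupp.mapDomain (postcomp f.hom) x))
    rw [← Finsupp.mapDomain_comp]
    rfl

end

noncomputable section

variable {R : Type u} [CommRing R]

section Cohomology

/-- The `R`-valued cochains of degree `n` on a chain complex of `R`-modules. -/
abbrev Cochain (K : ChainComplex (ModuleCat.{u} R) ℕ) (n : ℕ) : Type u :=
  K.X n ⟶ ModuleCat.of R R

/-- The coboundary `φ ↦ φ ∘ d`. -/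
def coboundary (K : ChainComplex (ModuleCat.{u} R) ℕ) (n : ℕ) :
    Cochain K n →ₗ[R] Cochain K (n + 1) :=
  Linear.leftComp R (ModuleCat.of R R) (K.d (n + 1) n)

/-- The cocycles of degree `n`. -/
def cocycles (K : ChainComplex (ModuleCat.{u} R) ℕ) (n : ℕ) : Submodule R (Cochain K n) :=
  LinearMap.ker (coboundary K n)

/-- The coboundaries of degree `n`. -/
def coboundaries (K : ChainComplex (ModuleCat.{u} R) ℕ) : (n : ℕ) → Submodule R (Cochain K n)
  | 0 => ⊥
  | n + 1 => LinearMap.range (coboundary K n)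

/-- The cohomology of the dual cochain complex: cocycles modulo coboundaries. -/
abbrev Cohomology (K : ChainComplex (ModuleCat.{u} R) ℕ) (n : ℕ) : Type u :=
  cocycles K n ⧸ (coboundaries K n).submoduleOf (cocycles K n)

variable {K L : ChainComplex (ModuleCat.{u} R) ℕ}

/-- The pull-back of cochains along a chain map. -/
def cochainMap (f : K ⟶ L) (n : ℕ) : Cochain L n →ₗ[R] Cochain K n :=
  Linear.leftComp R (ModuleCat.of R R) (f.f n)

lemma cochainMap_coboundary (f : K ⟶ L) (n : ℕ) (x : Cochain L n) :
    coboundary K n (cochainMap f n x) = cochainMap f (n + 1) (coboundary L n x) := by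
  simp [coboundary, cochainMap]

lemma cochainMap_cocycles (f : K ⟶ L) (n : ℕ) :
    cocycles L n ≤ (cocycles K n).comap (cochainMap f n) := by
  intro x hx
  have hx : coboundary L n x = 0 := hx
  change coboundary K n (cochainMap f n x) = 0
  rw [cochainMap_coboundary, hx, map_zero]

lemma cochainMap_coboundaries (f : K ⟶ L) (n : ℕ) :
    coboundaries L n ≤ (coboundaries K n).comap (cochainMap f n) := by
  cases n with
  | zero => exact bot_le
  | succ n =>
    rintro _ ⟨y, rfl⟩
    exact ⟨cochainMap f n y, cochainMap_coboundary f n y⟩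

/-- The map induced by a chain map in cohomology. -/
def cohomologyMap (f : K ⟶ L) (n : ℕ) : Cohomology L n →ₗ[R] Cohomology K n :=
  Submodule.mapQ _ _ ((cochainMap f n).restrict (cochainMap_cocycles f n))
    (fun x hx => cochainMap_coboundaries f n hx)

/-- A family of bilinear products of cochains, of degree `p` and `q` into degree `r = p + q`. -/
abbrev CochainProduct (K : ChainComplex (ModuleCat.{u} R) ℕ) : Type u :=
  ∀ p q r : ℕ, p + q = r → (Cochain K p →ₗ[R] Cochain K q →ₗ[R] Cochain K r)

/-- The Leibniz rule `δ (x y) = (δ x) y + (-1)^p x (δ y)`, for `x` of degree `p`. -/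
def IsLeibniz (mul : CochainProduct K) : Prop :=
  ∀ (p q r : ℕ) (h : p + q = r) (x : Cochain K p) (y : Cochain K q),
    coboundary K r (mul p q r h x y) =
      mul (p + 1) q (r + 1) (by omega) (coboundary K p x) y +
        (-1 : R) ^ p • mul p (q + 1) (r + 1) (by omega) x (coboundary K q y)

lemma IsLeibniz.mul_mem_cocycles {mul : CochainProduct K} (hmul : IsLeibniz mul) {p q r : ℕ}
    (h : p + q = r) {x : Cochain K p} {y : Cochain K q} (hx : x ∈ cocycles K p)
    (hy : y ∈ cocycles K q) : mul p q r h x y ∈ cocycles K r := by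
  have hx : coboundary K p x = 0 := hx
  have hy : coboundary K q y = 0 := hy
  change coboundary K r _ = 0
  rw [hmul, hx, hy]
  simp

lemma coboundary_mem (n : ℕ) (x : Cochain K n) : coboundary K n x ∈ coboundaries K (n + 1) :=
  ⟨x, rfl⟩

lemma IsLeibniz.left_mem {mul : CochainProduct K} (hmul : IsLeibniz mul) {p q r : ℕ}
    (h : p + q = r) {x : Cochain K p} {y : Cochain K q} (hx : x ∈ coboundaries K p)
    (hy : y ∈ cocycles K q) : mul p q r h x y ∈ coboundaries K r := by
  have hy : coboundary K q y = 0 := hy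
  cases p with
  | zero =>
    have hx : x = 0 := hx
    simp [hx]
  | succ p =>
    obtain ⟨z, rfl⟩ := hx
    obtain rfl : r = (p + q) + 1 := by omega
    have := hmul p q (p + q) rfl z y
    rw [hy, map_zero, smul_zero, add_zero] at this
    rw [← this]
    exact coboundary_mem _ _

lemma IsLeibniz.right_mem {mul : CochainProduct K} (hmul : IsLeibniz mul) {p q r : ℕ}
    (h : p + q = r) {x : Cochain K p} {y : Cochain K q} (hx : x ∈ cocycles K p)
    (hy : y ∈ coboundaries K q) : mul p q r h x y ∈ coboundaries K r := by
  have hx : coboundary K p x = 0 := hx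
  cases q with
  | zero =>
    have hy : y = 0 := hy
    simp [hy]
  | succ q =>
    obtain ⟨z, rfl⟩ := hy
    obtain rfl : r = (p + q) + 1 := by omega
    have := hmul p q (p + q) rfl x z
    rw [hx, map_zero, LinearMap.zero_apply, zero_add] at this
    have h2 : mul p (q + 1) (p + q + 1) h x (coboundary K q z) =
        coboundary K (p + q) ((-1 : R) ^ p • mul p q (p + q) rfl x z) := by
      rw [map_smul, this, smul_smul, ← mul_pow]
      simp
    rw [h2]
    exact coboundary_mem _ _

/-- The product of cohomology classes: `[x] ⬝ [y] = [x ⬝ y]` for cocycles `x`, `y`. -/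
def cohomologyMul (mul : CochainProduct K) (hmul : IsLeibniz mul) {p q r : ℕ} (h : p + q = r) :
    Cohomology K p → Cohomology K q → Cohomology K r :=
  Quotient.map₂ (fun x y => ⟨mul p q r h x.1 y.1, hmul.mul_mem_cocycles h x.2 y.2⟩) (by
    intro x x' hx y y' hy
    have hx : x.1 - x'.1 ∈ coboundaries K p := 
      (Submodule.Quotient.eq ((coboundaries K p).submoduleOf (cocycles K p))).1 (Quotient.sound hx)
    have hy : y.1 - y'.1 ∈ coboundaries K q := 
      (Submodule.Quotient.eq ((coboundaries K q).submoduleOf (cocycles K q))).1 (Quotient.sound hy)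
    refine Quotient.exact ((Submodule.Quotient.eq
      ((coboundaries K r).submoduleOf (cocycles K r))).2 ?_)
    change mul p q r h x.1 y.1 - mul p q r h x'.1 y'.1 ∈ coboundaries K r
    have : mul p q r h x.1 y.1 - mul p q r h x'.1 y'.1 =
        mul p q r h (x.1 - x'.1) y.1 + mul p q r h x'.1 (y.1 - y'.1) := by
      simp
    rw [this]
    exact Submodule.add_mem _ (hmul.left_mem h hx y.2) (hmul.right_mem h x'.2 hy))

end Cohomology

section Simplicial

open Simplicial

variable (X : SSet.{u})

variable {X} in
/-- The value of a simplicial cochain on a simplex. -/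
def simplexValue {n : ℕ} (σ : X _⦋n⦌) : Cochain (X.chainComplex (ModuleCat.of R R)) n →ₗ[R] R where
  toFun φ := (X.ιChainComplex σ ≫ φ).hom (1 : R)
  map_add' φ ψ := by simp
  map_smul' a φ := by simp

/-- The simplicial cochain with given values on the simplices. -/
def cochainOfValues {n : ℕ} (v : X _⦋n⦌ → R) : Cochain (X.chainComplex (ModuleCat.of R R)) n :=
  (X.isColimitChainComplexXCofan (ModuleCat.of R R) n).desc
    (Limits.Cofan.mk _ fun σ => ModuleCat.ofHom (LinearMap.toSpanSingleton R R (v σ)))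

lemma simplexValue_cochainOfValues {n : ℕ} (v : X _⦋n⦌ → R) (σ : X _⦋n⦌) :
    simplexValue σ (cochainOfValues X v) = v σ := by
  have := (X.isColimitChainComplexXCofan (ModuleCat.of R R) n).fac
    (Limits.Cofan.mk _ fun σ => ModuleCat.ofHom (LinearMap.toSpanSingleton R R (v σ))) ⟨σ⟩
  have h2 : X.ιChainComplex σ ≫ cochainOfValues X v =
    ModuleCat.ofHom (LinearMap.toSpanSingleton R R (v σ)) := this
  change (X.ιChainComplex σ ≫ cochainOfValues X v).hom (1 : R) = _
  rw [h2]
  simp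

lemma simplexValue_ext {n : ℕ} {φ ψ : Cochain (X.chainComplex (ModuleCat.of R R)) n}
    (h : ∀ σ : X _⦋n⦌, simplexValue σ φ = simplexValue σ ψ) : φ = ψ := by
  refine SSet.chainComplex_hom_ext fun σ => ?_
  ext
  exact h σ

/-- The cup product of simplicial cochains (dual to the Alexander-Whitney diagonal): the value of
`φ ψ` on an `n`-simplex is the value of `φ` on its front `p`-face times the value of `ψ` on its back
`q`-face. -/
def alexanderWhitney : CochainProduct (X.chainComplex (ModuleCat.of R R)) := fun p q r h =>
  LinearMap.mk₂ R
    (fun φ ψ => cochainOfValues X fun σ =>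
      simplexValue (X.map (SimplexCategory.subinterval 0 p (by omega)).op σ) φ *
        simplexValue (X.map (SimplexCategory.subinterval p q (by omega)).op σ) ψ)
    (fun _ _ _ => simplexValue_ext X fun σ => by
      simp only [simplexValue_cochainOfValues, map_add]; ring)
    (fun _ _ _ => simplexValue_ext X fun σ => by
      simp only [simplexValue_cochainOfValues, map_smul, smul_eq_mul]; ring)
    (fun _ _ _ => simplexValue_ext X fun σ => by
      simp only [simplexValue_cochainOfValues, map_add]; ring)
    (fun _ _ _ => simplexValue_ext X fun σ => by
      simp only [simplexValue_cochainOfValues, map_smul, smul_eq_mul]; ring)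

/-- The unit cochain, with value `1` on each vertex. -/
def simplicialOne : Cochain (X.chainComplex (ModuleCat.of R R)) 0 := cochainOfValues X fun _ => 1

end Simplicial

/-- The singular chain complex with coefficients in `R`. -/
abbrev singularComplexFunctor (R : Type u) [CommRing R] :
    TopCat.{u} ⥤ ChainComplex (ModuleCat.{u} R) ℕ :=
  (AlgebraicTopology.singularChainComplexFunctor (ModuleCat.{u} R)).obj (ModuleCat.of R R)

/-- The cup product of singular cochains. -/
def singularCup (Y : TopCat.{u}) : CochainProduct ((singularComplexFunctor R).obj Y) :=
  alexanderWhitney (TopCat.toSSet.obj Y)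

end

noncomputable section

/-- The cells of all dimensions. -/
abbrev AnyCell (Y : Type u) [TopologicalSpace Y] : Type u := Σ n : ℕ, Cell Y n

namespace AnyCell
variable {Y : Type u} [TopologicalSpace Y]

/-- `d^0_i`, for `1 ≤ i ≤ n` on cells of dimension `n` (other cells are left unchanged). -/
def d0 (i : ℕ) : AnyCell Y → AnyCell Y
  | ⟨0, c⟩ => ⟨0, c⟩
  | ⟨n + 1, c⟩ => if 1 ≤ i ∧ i ≤ n + 1 then ⟨n, c.d0 i⟩ else ⟨n + 1, c⟩

/-- `d^1_i`, for `1 ≤ i ≤ n` on cells of dimension `n` (other cells are left unchanged). -/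
def d1 (i : ℕ) : AnyCell Y → AnyCell Y
  | ⟨0, c⟩ => ⟨0, c⟩
  | ⟨n + 1, c⟩ => if 1 ≤ i ∧ i ≤ n + 1 then ⟨n, c.d1 i⟩ else ⟨n + 1, c⟩

/-- `d^2_i`, for `1 ≤ i ≤ m` on maps `I^k × F_m × I^l → Y` (other cells are left unchanged). -/
def d2 (i : ℕ) : AnyCell Y → AnyCell Y
  | ⟨0, c⟩ => ⟨0, c⟩
  | ⟨n + 1, c⟩ => if 1 ≤ i ∧ i ≤ c.m then ⟨n, c.d2 i⟩ else ⟨n + 1, c⟩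

/-- The composite `op j_p ∘ ⋯ ∘ op j_1`, where `j_p < ⋯ < j_1` are the elements of `s`: the operator
with the largest index is applied first. -/
def iterate (op : ℕ → AnyCell Y → AnyCell Y) (s : Finset ℕ) (c : AnyCell Y) : AnyCell Y :=
  s.sort.foldr op c

/-- The composite `d^2_{b_r - b_{r-1}} ∘ ⋯ ∘ d^2_{b_2 - b_1} ∘ d^2_{b_1 - b}` for the list
`b_1, …, b_r`. -/
def iterateD2 : ℕ → List ℕ → AnyCell Y → AnyCell Y
  | _, [], c => c
  | b, b' :: bs, c => iterateD2 b' bs (d2 (b' - b) c)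

/-- `Cell.DegAt` for cells of all dimensions. -/
def DegAt (c : AnyCell Y) (i : ℕ) : Prop := c.2.DegAt i

lemma DegAt.d0 {c : AnyCell Y} {i j : ℕ} (h : c.DegAt i) (hij : j ≠ i) :
    ∃ i', (c.d0 j).DegAt i' ∧ (i < j → i' = i) ∧ (j < i → i' = i ∨ i' = i - 1) := by
  obtain ⟨_ | n, c⟩ := c
  · exact ⟨i, h, fun _ => rfl, fun _ => Or.inl rfl⟩
  · simp only [AnyCell.d0]
    split_ifs with hj
    · have hA : Cell.Adm (n + 1) c.m 0 j := by unfold Cell.Adm; omega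
      have := Cell.DegAt.face h hA hij
      refine ⟨_, this, ?_, ?_⟩ <;> simp <;> omega
    · exact ⟨i, h, fun _ => rfl, fun _ => Or.inl rfl⟩

lemma DegAt.d2_valid {c : AnyCell Y} {i j : ℕ} (h : c.DegAt i) (h1 : 1 ≤ j) (h2 : j ≤ c.2.m) :
    (c.d2 j).DegAt (i - j) ∧ (c.d2 j).2.m = c.2.m - j := by
  obtain ⟨_ | n, c⟩ := c
  · have := c.dim_eq
    simp only at h2
    omega
  · simp only at h2
    have hval : AnyCell.d2 j (⟨n + 1, c⟩ : AnyCell Y) = ⟨n, c.d2 j⟩ := if_pos ⟨h1, h2⟩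
    rw [hval]
    have hA : Cell.Adm (n + 1) c.m 2 j := by unfold Cell.Adm; omega
    have h' := h.1
    simp only at h'
    have := Cell.DegAt.face h hA (by omega)
    rw [if_pos rfl] at this
    refine ⟨this, ?_⟩
    change (Cell.face 2 j c).m = c.m - j
    simpa [Cell.faceM] using (Cell.face_spec c 2 j hA).1

lemma DegAt.d2 {c : AnyCell Y} {i : ℕ} (h : c.DegAt i) (j : ℕ) :
    ∃ i', (c.d2 j).DegAt i' := by
  by_cases hj : 1 ≤ j ∧ j ≤ c.2.m
  · exact ⟨_, (h.d2_valid hj.1 hj.2).1⟩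
  · obtain ⟨_ | n, c⟩ := c
    · exact ⟨i, h⟩
    · simp only at hj
      simp only [AnyCell.d2, hj, if_false]
      exact ⟨i, h⟩

lemma DegAt.d1 {c : AnyCell Y} {i j : ℕ} (h : c.DegAt i) (hij : j ≠ i) :
    ∃ i', (c.d1 j).DegAt i' ∧ (i < j → i' = i) ∧ (j < i → i' = i ∨ i' = i - 1) := by
  obtain ⟨_ | n, c⟩ := c
  · exact ⟨i, h, fun _ => rfl, fun _ => Or.inl rfl⟩
  · simp only [AnyCell.d1]
    split_ifs with hj
    · by_cases hm : j = 1 ∧ 0 < c.m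
      · have hA : Cell.Adm (n + 1) c.m 2 1 := by unfold Cell.Adm; omega
        have h' := h.1
        simp only at h'
        have := Cell.DegAt.face h hA (by omega)
        refine ⟨i - 1, ?_, by omega, fun _ => Or.inr rfl⟩
        have he : c.d1 j = Cell.face 2 1 c := by simp [Cell.d1, hm, Cell.face]
        rw [if_pos rfl] at this
        rw [he]
        exact this
      · have hA : Cell.Adm (n + 1) c.m 1 j := by unfold Cell.Adm; omega
        have := Cell.DegAt.face h hA hij
        refine ⟨_, this, ?_, ?_⟩ <;> simp <;> omega
    · exact ⟨i, h, fun _ => rfl, fun _ => Or.inl rfl⟩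

lemma foldr_degAt (op : ℕ → AnyCell Y → AnyCell Y)
    (hop : ∀ (c : AnyCell Y) (i j : ℕ), c.DegAt i → j ≠ i →
      ∃ i', (op j c).DegAt i' ∧ (i < j → i' = i) ∧ (j < i → i' = i ∨ i' = i - 1))
    (c : AnyCell Y) (i : ℕ) (h : c.DegAt i) (js : List ℕ) (hs : js.Pairwise (· < ·))
    (hi : i ∉ js) :
    ∃ i', (js.foldr op c).DegAt i' ∧ ((∀ x ∈ js, i < x) → i' = i) ∧
      ∀ j, (∀ x ∈ js, j < x) → j < i → j < i' := by
  induction js with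
  | nil => exact ⟨i, h, fun _ => rfl, fun j _ hj => hj⟩
  | cons j js ih =>
    rw [List.pairwise_cons] at hs
    simp only [List.mem_cons, not_or] at hi
    obtain ⟨i', h1, h2, h3⟩ := ih hs.2 hi.2
    have hji : j ≠ i' ∧ (i < j → i' = i) ∧ (j < i → j < i') := by
      refine ⟨?_, fun hij => h2 fun x hx => hij.trans (hs.1 x hx), fun hij => h3 j hs.1 hij⟩
      rcases Nat.lt_or_gt_of_ne hi.1 with hij | hij
      · have := h2 fun x hx => hij.trans (hs.1 x hx)
        omega
      · have := h3 j hs.1 hij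
        omega
    obtain ⟨i'', g1, g2, g3⟩ := hop _ i' j h1 hji.1
    refine ⟨i'', g1, fun hx => ?_, fun j' hj' hj'i => ?_⟩
    · have := hx j (by simp)
      have := hji.2.1 this
      rw [g2 (by omega), this]
    · have := hj' j (by simp)
      by_cases hij : i < j
      · have := hji.2.1 hij
        rw [g2 (by omega)]
        omega
      · have := hji.2.2 (by omega)
        have := g3 this
        omega

lemma iterate_degAt (op : ℕ → AnyCell Y → AnyCell Y)
    (hop : ∀ (c : AnyCell Y) (i j : ℕ), c.DegAt i → j ≠ i →
      ∃ i', (op j c).DegAt i' ∧ (i < j → i' = i) ∧ (j < i → i' = i ∨ i' = i - 1))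
    (c : AnyCell Y) (i : ℕ) (h : c.DegAt i) (s : Finset ℕ) (hi : i ∉ s) :
    ∃ i', (iterate op s c).DegAt i' := by
  obtain ⟨i', h', -⟩ := foldr_degAt op hop c i h s.sort s.sortedLT_sort.pairwise (by simpa using hi)
  exact ⟨i', h'⟩

lemma iterateD2_degAt (M : ℕ) (bs : List ℕ) (b : ℕ) (hs : (b :: bs).Pairwise (· < ·))
    (hM : ∀ x ∈ bs, x < M) (c : AnyCell Y) (hc : c.2.m + b = M) (i : ℕ) (h : c.DegAt i) :
    (iterateD2 b bs c).DegAt (i + b - (bs.getLastD b)) := by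
  induction bs generalizing b c i with
  | nil => simpa [iterateD2] using h
  | cons b' bs ih =>
    rw [List.pairwise_cons] at hs
    have h1 := hs.1 b' (by simp)
    have h2 := hM b' (by simp)
    have hv : b' - b ≤ c.2.m := by omega
    obtain ⟨g1, g2⟩ := h.d2_valid (j := b' - b) (by omega) hv
    have hlt := h.1
    have := ih b' hs.2 (fun x hx => hM x (by simp [hx])) (d2 (b' - b) c) (by omega) _ g1
    have e : i - (b' - b) + b' = i + b := by omega
    rw [e] at this
    have e2 : (b' :: bs).getLastD b = bs.getLastD b' := List.getLastD_cons
    rw [e2]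
    exact this

end AnyCell

/-- The sign of the unshuffle `(K, L)`, for disjoint `K` and `L`: the parity of the number of pairs
`(a, b)` with `a ∈ K`, `b ∈ L` and `b < a`. -/
def unshuffleSign (K L : Finset ℕ) : ℤ :=
  (-1) ^ ((K ×ˢ L).filter fun q => q.2 < q.1).card

namespace Cell
variable {Y : Type u} [TopologicalSpace Y] {n : ℕ}

/-- The cubical part of the diagonal of a cell of dimension `n`: the sum over all decompositions of
`{1, …, n}` into disjoint subsets `K = {i_q < ⋯ < i_1}` and `L = {j_p < ⋯ < j_1}` of
`sgn (K, L) d^0_(j_p) ⋯ d^0_(j_1) ⊗ d^1_(i_q) ⋯ d^1_(i_1)`. -/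
def serreDiagonal (c : Cell Y n) : (AnyCell Y × AnyCell Y) →₀ ℤ :=
  ∑ L ∈ (Finset.Icc 1 n).powerset,
    Finsupp.single
      (AnyCell.iterate AnyCell.d0 L ⟨n, c⟩,
        AnyCell.iterate AnyCell.d1 (Finset.Icc 1 n \ L) ⟨n, c⟩)
      (unshuffleSign (Finset.Icc 1 n \ L) L)

/-- The `r` smallest elements `b_1 < ⋯ < b_r` of `L ∩ {1, …, m}`. For the special part of the
diagonal they are `b_s = j_(s) + 1`, where `j_(s) = j_1 + ⋯ + j_s`. -/
def initialPart (m : ℕ) (L : Finset ℕ) (r : ℕ) : List ℕ :=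
  ((L.filter (· ≤ m)).sort).take r

/-- The number `j_(r) = j_1 + ⋯ + j_r`, which is `b_r - 1`, and `0` if `r = 0`. -/
def partialSum (m : ℕ) (L : Finset ℕ) (r : ℕ) : ℕ :=
  (initialPart m L r).getLastD 1 - 1

/-- The left factor `d^0_(j_p) ⋯ d^0_(j_(r+1)) d^2_(j_r) ⋯ d^2_(j_1)` of a term of the special part
of the diagonal: here `b_s = j_(s) + 1` for `s ≤ r` are the `r` smallest elements of `L`, and
`j_(r+1) > ⋯ > j_p` are the numbers `b - j_(r)` for the other elements `b` of `L`. -/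
def leftFactor (c : Cell Y n) (L : Finset ℕ) (r : ℕ) : AnyCell Y :=
  AnyCell.iterate AnyCell.d0
    ((L.filter (partialSum c.m L r + 1 < ·)).image (· - partialSum c.m L r))
    (AnyCell.iterateD2 1 (initialPart c.m L r) ⟨n, c⟩)

/-- The right factor `d^2_t d^1_(i_(q-1)) ⋯ d^1_(i_1)` of a term of the special part of the diagonal:
`i_(q-1) < ⋯ < i_1` are the elements of `{2, …, n}` that are not in `L`. -/
def rightFactor (c : Cell Y n) (L : Finset ℕ) (t : ℕ) : AnyCell Y :=
  AnyCell.d2 t (AnyCell.iterate AnyCell.d1 (Finset.Icc 2 n \ L) ⟨n, c⟩)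

/-- The special part of the diagonal of a cell `I^k × F_m × I^l → Y` of dimension `n`: the sum, over
all `L ⊆ {2, …, n}` (with `p` elements, complement `K` in `{1, …, n}` with `q = n - p` elements, and
`a` elements in `{2, …, m}`) and over all `0 ≤ r < t ≤ a + 1` with `(r, t) ≠ (0, 1)`, of
`(-1)^((j_(r) + r) q + (p + 1)(t + 1)) sgn (K, L)` times
`d^0_(j_p) ⋯ d^0_(j_(r+1)) d^2_(j_r) ⋯ d^2_(j_1) ⊗ d^2_t d^1_(i_(q-1)) ⋯ d^1_(i_1)`.
The terms with `(r, t) = (0, 1)` occur in the cubical part. -/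
def specialDiagonal (c : Cell Y n) : (AnyCell Y × AnyCell Y) →₀ ℤ :=
  ∑ L ∈ (Finset.Icc 2 n).powerset,
    ∑ r ∈ Finset.range ((L.filter (· ≤ c.m)).card + 1),
      ∑ t ∈ (Finset.Icc (r + 1) ((L.filter (· ≤ c.m)).card + 1)).filter
          (fun t => ¬ (r = 0 ∧ t = 1)),
        Finsupp.single (c.leftFactor L r, c.rightFactor L t)
          ((-1) ^ ((partialSum c.m L r + r) * (n - L.card) + (L.card + 1) * (t + 1)) *
            unshuffleSign (Finset.Icc 1 n \ L) L)

/-- The diagonal of a cell, as a formal combination of pairs (tensors) of cells. -/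
def diagonal (c : Cell Y n) : (AnyCell Y × AnyCell Y) →₀ ℤ :=
  c.serreDiagonal + c.specialDiagonal

lemma leftFactor_degAt (c : Cell Y n) (L : Finset ℕ) (r i : ℕ) (hL : L ⊆ Finset.Icc 2 n)
    (h : c.DegAt i) (hi : i ∉ L) : ∃ i', (c.leftFactor L r).DegAt i' := by
  have hsub : ∀ x ∈ initialPart c.m L r, x ∈ L ∧ x ≤ c.m := fun x hx => by
    have := List.mem_of_mem_take hx
    simpa using this
  have hlast : (initialPart c.m L r).getLastD 1 = 1 ∨
      (initialPart c.m L r).getLastD 1 ∈ L ∧ (initialPart c.m L r).getLastD 1 ≤ c.m := by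
    rcases hq : initialPart c.m L r with _ | ⟨a, l⟩
    · simp
    · right
      have := hsub ((a :: l).getLast (by simp)) (by rw [hq]; exact List.getLast_mem _)
      simpa [List.getLastD_eq_getLast?, List.getLast?_eq_getLast_of_ne_nil] using this
  have hone : ∀ x ∈ L, 2 ≤ x := fun x hx => (Finset.mem_Icc.1 (hL hx)).1
  have hge : 1 ≤ (initialPart c.m L r).getLastD 1 := by
    rcases hlast with h' | h'
    · omega
    · have := hone _ h'.1; omega
  have key := AnyCell.iterateD2_degAt (c.m + 1) (initialPart c.m L r) 1 (by
      rw [List.pairwise_cons]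
      refine ⟨fun x hx => hone x (hsub x hx).1, ?_⟩
      exact (Finset.sortedLT_sort _).pairwise.sublist (List.take_sublist _ _))
    (fun x hx => Nat.lt_succ_of_le (hsub x hx).2) ⟨n, c⟩ rfl i h
  refine AnyCell.iterate_degAt _ (fun c i j h hij => h.d0 hij) _ _ key _ ?_
  have h1 := h.1
  intro hmem
  simp only [Finset.mem_image, Finset.mem_filter] at hmem
  obtain ⟨x, ⟨hx, hx'⟩, hxe⟩ := hmem
  unfold partialSum at hx' hxe
  have : x = i := by omega
  exact hi (this ▸ hx)

lemma rightFactor_degAt (c : Cell Y n) (L : Finset ℕ) (t i : ℕ)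
    (h : c.DegAt i) (hi : i ∈ L) : ∃ i', (c.rightFactor L t).DegAt i' := by
  obtain ⟨i', h'⟩ := AnyCell.iterate_degAt AnyCell.d1 (fun c i j h hij => h.d1 hij) ⟨n, c⟩ i h
    (Finset.Icc 2 n \ L) (by simp [hi])
  exact h'.d2 t

end Cell

variable {R : Type u} [CommRing R]

/-- The value of a normalized cochain of degree `p` on a cell; zero on cells of dimension `≠ p`. -/
def cellValue {Y : TopCat.{u}} {p : ℕ} (c : AnyCell Y) :
    Cochain (normalizedComplex R Y) p →ₗ[R] R where
  toFun x := if h : c.1 = p then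
      x.hom (Submodule.Quotient.mk (Finsupp.single (h ▸ c.2) 1) : NormalizedChains R Y p) else 0
  map_add' x y := by
    split_ifs
    · rfl
    · simp
  map_smul' a x := by
    split_ifs
    · rfl
    · simp

lemma cellValue_deg {Y : TopCat.{u}} {p i : ℕ} (c : AnyCell Y) (hc : c.DegAt i)
    (x : Cochain (normalizedComplex R Y) p) : cellValue c x = 0 := by
  obtain ⟨n, c⟩ := c
  change (if h : n = p then
      x.hom (Submodule.Quotient.mk (Finsupp.single (h ▸ c) 1) : NormalizedChains R Y p) else 0) = 0
  split_ifs with h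
  · subst h
    have hc : c.IsDegenerate := (Cell.isDegenerate_iff c).2 ⟨i, hc⟩
    have h0 := (Submodule.Quotient.mk_eq_zero (Cell.degenerateChains R Y n)).2
      (Cell.single_mem_degenerateChains R hc 1)
    simp only
    rw [h0]
    exact map_zero _
  · rfl

/-- The value `(x ⊗ y)(Δ c)`. -/
def cupValue {Y : TopCat.{u}} {p q n : ℕ} (x : Cochain (normalizedComplex R Y) p)
    (y : Cochain (normalizedComplex R Y) q) (c : Cell Y n) : R :=
  Finsupp.linearCombination ℤ (fun s : AnyCell Y × AnyCell Y => cellValue s.1 x * cellValue s.2 y)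
    c.diagonal

lemma cupValue_deg {Y : TopCat.{u}} {p q n : ℕ} (x : Cochain (normalizedComplex R Y) p)
    (y : Cochain (normalizedComplex R Y) q) (c : Cell Y n) (hc : c.IsDegenerate) :
    cupValue x y c = 0 := by
  obtain ⟨i, hi⟩ := (Cell.isDegenerate_iff c).1 hc
  have hl : ∀ s : AnyCell Y × AnyCell Y, ((∃ i', s.1.DegAt i') ∨ ∃ i', s.2.DegAt i') →
      cellValue s.1 x * cellValue s.2 y = 0 := by
    rintro s (⟨i', h⟩ | ⟨i', h⟩)
    · rw [cellValue_deg _ h, zero_mul]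
    · rw [cellValue_deg _ h, mul_zero]
  unfold cupValue Cell.diagonal Cell.serreDiagonal Cell.specialDiagonal
  simp only [map_add, map_sum, Finsupp.linearCombination_single]
  rw [Finset.sum_eq_zero, zero_add, Finset.sum_eq_zero]
  · intro L hL
    rw [Finset.mem_powerset] at hL
    refine Finset.sum_eq_zero fun r _ => Finset.sum_eq_zero fun t _ => ?_
    rw [hl (c.leftFactor L r, c.rightFactor L t), smul_zero]
    by_cases h : i ∈ L
    · exact Or.inr (c.rightFactor_degAt L t i hi h)
    · exact Or.inl (c.leftFactor_degAt L r i hL hi h)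
  · intro L hL
    rw [hl (_, _), smul_zero]
    by_cases h : i ∈ L
    · exact Or.inr (AnyCell.iterate_degAt _ (fun c i j h hij => h.d1 hij) ⟨n, c⟩ i hi _ (by simp [h]))
    · exact Or.inl (AnyCell.iterate_degAt _ (fun c i j h hij => h.d0 hij) ⟨n, c⟩ i hi _ h)

/-- The normalized cochain with prescribed values on cells. -/
def cochainOfCells {Y : TopCat.{u}} {n : ℕ} (v : Cell Y n → R)
    (hv : ∀ c : Cell Y n, c.IsDegenerate → v c = 0) : Cochain (normalizedComplex R Y) n :=
  ModuleCat.ofHom (Submodule.liftQ (Cell.degenerateChains R Y n) (Finsupp.linearCombination R v) (by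
    refine Submodule.span_le.2 ?_
    rintro _ ⟨c, hc, rfl⟩
    simp [hv c hc]))

lemma cellValue_cochainOfCells {Y : TopCat.{u}} {n : ℕ} (v : Cell Y n → R)
    (hv : ∀ c : Cell Y n, c.IsDegenerate → v c = 0) (c : Cell Y n) :
    cellValue ⟨n, c⟩ (cochainOfCells v hv) = v c := by
  change (if h : n = n then _ else 0) = _
  rw [dif_pos rfl]
  change Finsupp.linearCombination R v (Finsupp.single c 1) = v c
  simp

lemma cellValue_ext {Y : TopCat.{u}} {n : ℕ} {x y : Cochain (normalizedComplex R Y) n}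
    (h : ∀ c : Cell Y n, cellValue ⟨n, c⟩ x = cellValue ⟨n, c⟩ y) : x = y := by
  refine ModuleCat.hom_ext (Submodule.linearMap_qext _ (Finsupp.lhom_ext' fun c => ?_))
  refine LinearMap.ext_ring ?_
  have := h c
  change (if h : n = n then _ else 0) = (if h : n = n then _ else 0) at this
  rwa [dif_pos rfl, dif_pos rfl] at this

/-- The product of normalized cochains that is dual to the diagonal: `(x y)(c) = (x ⊗ y)(Δ c)`. -/
def freehedralCup (Y : TopCat.{u}) : CochainProduct (normalizedComplex R Y) := fun p q r _ =>
  LinearMap.mk₂ R (fun x y => cochainOfCells (fun c : Cell Y r => cupValue x y c)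
      (fun c hc => cupValue_deg x y c hc))
    (fun x x' y => cellValue_ext fun c => by
      rw [map_add]
      simp only [cellValue_cochainOfCells, cupValue, Finsupp.linearCombination_apply, map_add,
        add_mul, smul_add]
      exact Finsupp.sum_add)
    (fun a x y => cellValue_ext fun c => by
      rw [map_smul]
      simp only [cellValue_cochainOfCells, cupValue, Finsupp.linearCombination_apply, map_smul,
        smul_eq_mul, Finsupp.sum, Finset.mul_sum]
      exact Finset.sum_congr rfl fun s _ => by rw [mul_assoc, mul_smul_comm])
    (fun x y y' => cellValue_ext fun c => by
      rw [map_add]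
      simp only [cellValue_cochainOfCells, cupValue, Finsupp.linearCombination_apply, map_add,
        mul_add, smul_add]
      exact Finsupp.sum_add)
    (fun a x y => cellValue_ext fun c => by
      rw [map_smul]
      simp only [cellValue_cochainOfCells, cupValue, Finsupp.linearCombination_apply, map_smul,
        smul_eq_mul, Finsupp.sum, Finset.mul_sum]
      exact Finset.sum_congr rfl fun s _ => by rw [mul_left_comm, mul_smul_comm])

/-- The unit cochain, with value `1` on each cell of dimension `0`. -/
def freehedralOne (Y : TopCat.{u}) : Cochain (normalizedComplex R Y) 0 :=
  cochainOfCells (fun _ => 1) (by rintro c ⟨p, -⟩; exact p.elim0)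

end

end Freehedral

set_option linter.unusedSimpArgs false
namespace Freehedral
noncomputable section

/-- The letters of the words that describe the faces of `I^k × F_m × I^l`: the coordinate is kept
(`k`), equal to one (`e`) or to zero (`z`); the base letter is kept (`b`) or a point (`p`). -/
inductive Letter | k | e | z | b | p
  deriving DecidableEq

namespace Word
open Letter

variable {R : Type*} [CommRing R]

/-- The dimension of a word: the number of kept letters. -/
def deg : List Letter → ℕ
  | [] => 0
  | k :: w => deg w + 1
  | b :: w => deg w + 1
  | _ :: w => deg w

/-- A function on words, as a function of what follows the first letter. -/
def after (a : Letter) (X : List Letter → R) : List Letter → R := fun w => X (a :: w)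

/-- The twist by the parity of the dimension. -/
def twist (X : List Letter → R) : List Letter → R := fun w => (-1) ^ deg w * X w

/-- The sum over the words in which the base is moved to a later kept letter, or to the first `z`. -/
def move : List Letter → (List Letter → R) → R
  | [], _ => 0
  | k :: w, X => X (b :: w) + move w (after k X)
  | e :: w, X => move w (after e X)
  | z :: w, X => X (p :: w)
  | _ :: _, _ => 0

/-- The moves of the base as an operator on functions on words. -/
def mv (X : List Letter → R) : List Letter → R := fun w => move w X

/-- The coboundary of a function on words. -/
def delta : List Letter → (List Letter → R) → R
  | [], _ => 0
  | k :: w, X => X (e :: w) - X (z :: w) - delta w (after k X)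
  | b :: w, X => move w (after z X) - X (p :: w) - delta w (after b X)
  | e :: w, X => delta w (after e X)
  | z :: w, X => delta w (after z X)
  | p :: w, X => delta w (after p X)

mutual
/-- The product of two functions on words, dual to the freehedral diagonal. -/
def cup : List Letter → (List Letter → R) → (List Letter → R) → R
  | [], X, Y => X [] * Y []
  | k :: w, X, Y => cup w (after k X) (after e Y) + cup w (twist (after z X)) (after k Y)
  | e :: w, X, Y => cup w (after e X) (after e Y)
  | z :: w, X, Y => cup w (after z X) (after z Y)
  | p :: w, X, Y => cup w (after p X) (after p Y)
  | b :: w, X, Y => cup w (twist (after p X)) (after b Y) +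
      cup w (after b X) (mv (after z Y)) + cupMove w (after z X) (after z Y)
/-- The part of the product in which the bases of both factors are moved. -/
def cupMove : List Letter → (List Letter → R) → (List Letter → R) → R
  | k :: w, X, Y => cup w (twist (after b X)) (mv (after k Y)) -
      cupMove w (after k X) (after e Y) - cupMove w (twist (after z X)) (after k Y)
  | e :: w, X, Y => cupMove w (after e X) (after e Y)
  | _, _, _ => 0
end

/-- There is no base letter. -/
def Plain (w : List Letter) : Prop := ∀ a ∈ w, a ≠ b ∧ a ≠ p

/-- There is at most one base letter. -/
def AtMostOneBase : List Letter → Prop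
  | [] => True
  | b :: w => Plain w
  | p :: w => Plain w
  | _ :: w => AtMostOneBase w

lemma plain_cons {a : Letter} {w : List Letter} : Plain (a :: w) ↔ (a ≠ b ∧ a ≠ p) ∧ Plain w := by
  simp [Plain]

lemma Plain.atMostOneBase {w : List Letter} (h : Plain w) : AtMostOneBase w := by
  induction w with
  | nil => trivial
  | cons a w ih =>
    rw [plain_cons] at h
    cases a <;> simp_all [AtMostOneBase]

section linear

lemma after_add (a : Letter) (X X' : List Letter → R) : after a (X + X') = after a X + after a X' := rfl
lemma after_smul (a : Letter) (c : R) (X : List Letter → R) : after a (c • X) = c • after a X := rfl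
lemma twist_add (X X' : List Letter → R) : twist (X + X') = twist X + twist X' := by
  funext w; simp [twist, mul_add]
lemma twist_smul (c : R) (X : List Letter → R) : twist (c • X) = c • twist X := by
  funext w; simp [twist]; ring
lemma twist_twist (X : List Letter → R) : twist (twist X) = X := by
  funext w; simp [twist, ← mul_assoc, ← mul_pow]
lemma after_twist_k (X : List Letter → R) : after k (twist X) = (-1 : R) • twist (after k X) := by
  funext w; simp [after, twist, deg, pow_succ]
lemma after_twist_b (X : List Letter → R) : after b (twist X) = (-1 : R) • twist (after b X) := by
  funext w; simp [after, twist, deg, pow_succ]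
lemma after_twist_e (X : List Letter → R) : after e (twist X) = twist (after e X) := rfl
lemma after_twist_z (X : List Letter → R) : after z (twist X) = twist (after z X) := rfl
lemma after_twist_p (X : List Letter → R) : after p (twist X) = twist (after p X) := rfl

lemma move_add (w : List Letter) (X X' : List Letter → R) :
    move w (X + X') = move w X + move w X' := by
  induction w generalizing X X' with
  | nil => simp [move]
  | cons a w ih => cases a <;> simp [move, after_add, ih]; ring

lemma move_smul (w : List Letter) (c : R) (X : List Letter → R) :
    move w (c • X) = c * move w X := by
  induction w generalizing X with
  | nil => simp [move]
  | cons a w ih => cases a <;> simp [move, after_smul, ih]; ring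

lemma move_fun_add (X X' : List Letter → R) :
    mv (X + X') = mv X + mv X' :=
  funext fun v => move_add v X X'

lemma move_fun_smul (c : R) (X : List Letter → R) :
    mv (c • X) = c • mv X :=
  funext fun v => move_smul v c X

lemma delta_add (w : List Letter) (X X' : List Letter → R) :
    delta w (X + X') = delta w X + delta w X' := by
  induction w generalizing X X' with
  | nil => simp [delta]
  | cons a w ih => cases a <;> simp [delta, after_add, ih, move_add] <;> ring

lemma delta_smul (w : List Letter) (c : R) (X : List Letter → R) :
    delta w (c • X) = c * delta w X := by
  induction w generalizing X with
  | nil => simp [delta]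
  | cons a w ih => cases a <;> simp [delta, after_smul, ih, move_smul] <;> ring

lemma cup_add_left (w : List Letter) : ∀ (X X' Y : List Letter → R),
    cup w (X + X') Y = cup w X Y + cup w X' Y ∧
    cupMove w (X + X') Y = cupMove w X Y + cupMove w X' Y := by
  induction w with
  | nil => intro X X' Y; simp [cup, cupMove, add_mul]
  | cons a w ih =>
    intro X X' Y
    cases a <;> simp [cup, cupMove, after_add, twist_add, (ih _ _ _).1, (ih _ _ _).2] <;>
      (try constructor) <;> ring

lemma cup_add_right (w : List Letter) : ∀ (X Y Y' : List Letter → R),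
    cup w X (Y + Y') = cup w X Y + cup w X Y' ∧
    cupMove w X (Y + Y') = cupMove w X Y + cupMove w X Y' := by
  induction w with
  | nil => intro X X' Y; simp [cup, cupMove, mul_add]
  | cons a w ih =>
    intro X X' Y
    cases a <;> simp [cup, cupMove, after_add, move_fun_add, (ih _ _ _).1, (ih _ _ _).2] <;>
      (try constructor) <;> ring

lemma cup_smul_left (w : List Letter) : ∀ (c : R) (X Y : List Letter → R),
    cup w (c • X) Y = c * cup w X Y ∧ cupMove w (c • X) Y = c * cupMove w X Y := by
  induction w with
  | nil => intro c X Y; simp [cup, cupMove, mul_assoc]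
  | cons a w ih =>
    intro c X Y
    cases a <;> simp [cup, cupMove, after_smul, twist_smul, (ih _ _ _).1, (ih _ _ _).2] <;>
      (try constructor) <;> ring

lemma cup_smul_right (w : List Letter) : ∀ (c : R) (X Y : List Letter → R),
    cup w X (c • Y) = c * cup w X Y ∧ cupMove w X (c • Y) = c * cupMove w X Y := by
  induction w with
  | nil => intro c X Y; simp [cup, cupMove]; ring
  | cons a w ih =>
    intro c X Y
    cases a <;> simp [cup, cupMove, after_smul, move_fun_smul, (ih _ _ _).1, (ih _ _ _).2] <;>
      (try constructor) <;> ring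

end linear

/-- The coboundary as an operator on functions on words. -/
def coB (X : List Letter → R) : List Letter → R := fun w => delta w X

lemma after_k_coB (X : List Letter → R) :
    after k (coB X) = after e X + (-1 : R) • after z X + (-1 : R) • coB (after k X) := by
  funext w; simp [after, coB, delta]; ring
lemma after_b_coB (X : List Letter → R) :
    after b (coB X) = mv (after z X) + (-1 : R) • after p X + (-1 : R) • coB (after b X) := by
  funext w; simp [after, coB, mv, delta]; ring
lemma after_e_coB (X : List Letter → R) : after e (coB X) = coB (after e X) := rfl
lemma after_z_coB (X : List Letter → R) : after z (coB X) = coB (after z X) := rfl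
lemma after_p_coB (X : List Letter → R) : after p (coB X) = coB (after p X) := rfl

lemma mv_add (X X' : List Letter → R) : mv (X + X') = mv X + mv X' := move_fun_add X X'
lemma mv_smul (c : R) (X : List Letter → R) : mv (c • X) = c • mv X := move_fun_smul c X
lemma after_k_mv (X : List Letter → R) : after k (mv X) = after b X + mv (after k X) := rfl
lemma after_e_mv (X : List Letter → R) : after e (mv X) = mv (after e X) := rfl
lemma after_z_mv (X : List Letter → R) : after z (mv X) = after p X := rfl

lemma mv_twist (X : List Letter → R) : mv (twist X) = twist (mv X) := by
  funext w
  change move w (twist X) = (-1) ^ deg w * move w X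
  induction w generalizing X with
  | nil => simp [move]
  | cons a w ih =>
    cases a <;>
      simp only [move, deg, after_twist_k, after_twist_e, move_smul, ih, pow_succ] <;>
      simp [twist, deg, pow_succ, mul_add]

lemma coB_twist (X : List Letter → R) : coB (twist X) = (-1 : R) • twist (coB X) := by
  funext w
  change delta w (twist X) = (-1) * ((-1) ^ deg w * delta w X)
  have hm := fun (X : List Letter → R) (w : List Letter) => congrFun (mv_twist X) w
  simp only [mv, twist] at hm
  induction w generalizing X with
  | nil => simp [delta]
  | cons a w ih =>
    cases a <;>
      simp only [delta, deg, after_twist_k, after_twist_b, after_twist_e, after_twist_z,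
        after_twist_p, delta_smul, ih, pow_succ]
    · simp [twist, deg]; ring
    · change move w (twist (after z X)) - _ - _ = _
      have := hm (after z X) w
      change move w (twist (after z X)) = _ at this
      rw [this]
      simp [twist, deg]; ring

/-- Moving the base commutes with the coboundary. -/
lemma move_coB (w : List Letter) (hw : Plain w) (X : List Letter → R) :
    move w (coB X) = delta w (mv X) := by
  induction w generalizing X with
  | nil => rfl
  | cons a w ih =>
    rw [plain_cons] at hw
    cases a
    · simp only [move, delta, after_k_coB, after_k_mv, move_add, move_smul, delta_add, ih hw.2]
      simp [mv, move, coB, delta]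
      ring
    · simp only [move, delta, after_e_coB, after_e_mv, ih hw.2]
    · simp [move, delta, after_z_mv, coB]
    · simp at hw
    · simp at hw

lemma delta_cup_k (w : List Letter) (X Y : List Letter → R) :
    delta w (after k (fun v => cup v X Y)) = delta w (fun v => cup v (after k X) (after e Y)) +
      delta w (fun v => cup v (twist (after z X)) (after k Y)) := by
  rw [← delta_add]; rfl

lemma delta_cup_b (w : List Letter) (X Y : List Letter → R) :
    delta w (after b (fun v => cup v X Y)) = delta w (fun v => cup v (twist (after p X)) (after b Y)) +
      delta w (fun v => cup v (after b X) (mv (after z Y))) +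
      delta w (fun v => cupMove v (after z X) (after z Y)) := by
  rw [← delta_add, ← delta_add]; rfl

lemma delta_cupMove_k (w : List Letter) (X Y : List Letter → R) :
    delta w (after k (fun v => cupMove v X Y)) =
      delta w (fun v => cup v (twist (after b X)) (mv (after k Y))) -
      delta w (fun v => cupMove v (after k X) (after e Y)) -
      delta w (fun v => cupMove v (twist (after z X)) (after k Y)) := by
  have h : after k (fun v => cupMove v X Y) =
    (fun v => cup v (twist (after b X)) (mv (after k Y))) +
    (-1 : R) • (fun v => cupMove v (after k X) (after e Y)) +
    (-1 : R) • (fun v => cupMove v (twist (after z X)) (after k Y)) := by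
    funext v; simp [after, cupMove]; ring
  rw [h, delta_add, delta_add, delta_smul, delta_smul]
  ring

lemma move_cup_k (w : List Letter) (X Y : List Letter → R) :
    move w (after k (fun v => cup v X Y)) = move w (fun v => cup v (after k X) (after e Y)) +
      move w (fun v => cup v (twist (after z X)) (after k Y)) := by
  rw [← move_add]; rfl

lemma cup_congr_plain (w : List Letter) (hw : Plain w) {X X' Y Y' : List Letter → R}
    (hX : ∀ v, Plain v → X v = X' v) (hY : ∀ v, Plain v → Y v = Y' v) :
    cup w X Y = cup w X' Y' := by
  induction w generalizing X X' Y Y' with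
  | nil => simp [cup, hX [] hw, hY [] hw]
  | cons a w ih =>
    rw [plain_cons] at hw
    cases a <;> simp at hw
    · simp only [cup]
      rw [ih hw (X := after k X) (X' := after k X') (Y' := after e Y'),
        ih hw (X := twist (after z X)) (X' := twist (after z X')) (Y' := after k Y')]
      all_goals intro v hv; simp only [after, twist]
      · exact congrArg _ (hX _ (plain_cons.2 ⟨by simp, hv⟩))
      · exact hY _ (plain_cons.2 ⟨by simp, hv⟩)
      · exact hX _ (plain_cons.2 ⟨by simp, hv⟩)
      · exact hY _ (plain_cons.2 ⟨by simp, hv⟩)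
    · exact ih hw (fun v hv => hX _ (plain_cons.2 ⟨by simp, hv⟩))
        (fun v hv => hY _ (plain_cons.2 ⟨by simp, hv⟩))
    · exact ih hw (fun v hv => hX _ (plain_cons.2 ⟨by simp, hv⟩))
        (fun v hv => hY _ (plain_cons.2 ⟨by simp, hv⟩))

lemma cup_coB_mv (w : List Letter) (hw : Plain w) (X Y : List Letter → R) :
    cup w X (coB (mv Y)) = cup w X (mv (coB Y)) :=
  cup_congr_plain w hw (fun _ _ => rfl) (fun v hv => (move_coB v hv Y).symm)

/-- The Leibniz rule for functions on words, and the homotopy that is given by `cupMove`. -/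
theorem cup_leibniz_aux (w : List Letter) : ∀ (X Y : List Letter → R),
    (AtMostOneBase w →
      delta w (fun v => cup v X Y) = cup w (coB X) Y + cup w (twist X) (coB Y)) ∧
    (Plain w → cupMove w (coB X) Y + cupMove w (twist X) (coB Y) + delta w (fun v => cupMove v X Y)
      = move w (fun v => cup v X Y) - cup w (mv X) (mv Y)) := by
  induction w with
  | nil => intro X Y; simp [delta, cup, cupMove, move, mv, coB]
  | cons a w ih =>
    intro X Y
    have al := fun (X X' Y : List Letter → R) => (cup_add_left w X X' Y).1
    have al' := fun (X X' Y : List Letter → R) => (cup_add_left w X X' Y).2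
    have ar := fun (X X' Y : List Letter → R) => (cup_add_right w X X' Y).1
    have ar' := fun (X X' Y : List Letter → R) => (cup_add_right w X X' Y).2
    have sl := fun (c : R) (X Y : List Letter → R) => (cup_smul_left w c X Y).1
    have sl' := fun (c : R) (X Y : List Letter → R) => (cup_smul_left w c X Y).2
    have sr := fun (c : R) (X Y : List Letter → R) => (cup_smul_right w c X Y).1
    have sr' := fun (c : R) (X Y : List Letter → R) => (cup_smul_right w c X Y).2
    cases a
    · refine ⟨fun h => ?_, fun h => ?_⟩
      · simp only [delta, delta_cup_k, (ih _ _).1 h]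
        simp only [cup, after_k_coB, after_e_coB, after_z_coB, after_twist_k, after_twist_e,
          after_twist_z, al, ar, sl, sr, coB_twist, twist_twist]
        ring
      · rw [plain_cons] at h
        simp only [delta, delta_cupMove_k, move, move_cup_k, (ih _ _).1 h.2.atMostOneBase]
        have h1 := (ih (after k X) (after e Y)).2 h.2
        have h2 := (ih (twist (after z X)) (after k Y)).2 h.2
        simp only [cup, cupMove, after_k_coB, after_b_coB, after_e_coB, after_z_coB, after_twist_k,
          after_twist_e, after_twist_b, after_k_mv, after_e_mv, after_z_mv, twist_add, twist_smul,
          after_twist_z, al, ar, sl, sr, al', ar', sl', sr', coB_twist, twist_twist, mv_add, mv_smul, mv_twist, cup_coB_mv w h.2] at h1 h2 ⊢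
        linear_combination h1 + h2
    · refine ⟨fun h => ?_, fun h => ?_⟩
      · exact (ih _ _).1 h
      · rw [plain_cons] at h
        exact (ih _ _).2 h.2
    · refine ⟨fun h => ?_, fun h => ?_⟩
      · exact (ih _ _).1 h
      · have hz : after z (fun v => cupMove v X Y) = (0 : R) • fun _ => 0 := by
          funext v; simp [after, cupMove]
        rw [delta, hz, delta_smul]
        simp [cupMove, move, cup, after_z_mv]
    · refine ⟨fun h => ?_, fun h => ?_⟩
      · change Plain w at h
        have h2 := (ih (after z X) (after z Y)).2 h
        simp only [delta, delta_cup_b, (ih _ _).1 h.atMostOneBase]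
        simp only [cup, after_b_coB, after_e_coB, after_p_coB, after_z_coB, after_twist_b, after_twist_p,
          after_twist_z, al, ar, sl, sr, coB_twist, twist_twist, twist_add, twist_smul, mv_add, mv_smul, mv_twist, cup_coB_mv w h] at h2 ⊢
        have hz : move w (after z (fun v => cup v X Y)) =
          move w (fun v => cup v (after z X) (after z Y)) := rfl
        linear_combination hz - h2
      · simp [plain_cons] at h
    · refine ⟨fun h => ?_, fun h => ?_⟩
      · exact (ih _ _).1 (Plain.atMostOneBase h)
      · simp [plain_cons] at h

end Word
end
end Freehedral

namespace Freehedral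
noncomputable section
namespace Word
open Letter

/-- The dimension of the part of the word before the base. -/
def kdim : List Letter → ℕ
  | [] => 0
  | k :: w => kdim w + 1
  | e :: w => kdim w
  | z :: w => kdim w
  | _ :: _ => 0

/-- The number of kept letters before the first `z`. -/
def headDeg : List Letter → ℕ
  | k :: w => headDeg w + 1
  | e :: w => headDeg w
  | _ => 0

/-- The number of kept letters after the first `z`. -/
def tailDeg : List Letter → ℕ
  | [] => 0
  | z :: w => deg w
  | _ :: w => tailDeg w

/-- The dimension of the freehedral part of a word. -/
def mdim : List Letter → ℕ
  | [] => 0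
  | b :: w => headDeg w + 1
  | p :: _ => 0
  | _ :: w => mdim w

/-- The dimension of the part of a word after the freehedral part. -/
def ldim : List Letter → ℕ
  | [] => 0
  | b :: w => tailDeg w
  | p :: w => deg w
  | _ :: w => ldim w

/-- The position of the base. -/
def base : List Letter → ℕ
  | [] => 0
  | b :: _ => 0
  | p :: _ => 0
  | _ :: w => base w + 1

/-- The coordinate that belongs to a letter, and the remaining coordinates. -/
def value (a : Letter) (t : ℕ → unitInterval) : unitInterval :=
  if a = k ∨ a = b then t 0 else if a = e then 1 else 0

/-- The coordinates that remain after a letter. -/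
def rest (a : Letter) (t : ℕ → unitInterval) : ℕ → unitInterval :=
  if a = k ∨ a = b then fun j => t (j + 1) else t

/-- The coordinates of the positions of a word. -/
def raw : List Letter → (ℕ → unitInterval) → ℕ → unitInterval
  | [], _, _ => 0
  | a :: _, t, 0 => value a t
  | a :: w, t, j + 1 => raw w (rest a t) j

/-- The rescaling of the coordinates by the subdivision of the freehedron, for a base that has been
moved from position `k` to position `β`. -/
def place (k β j : ℕ) (x : unitInterval) : unitInterval :=
  if j < k then x else if j = k ∧ k < β then 1 else if j < β then upperHalf x
  else if j = β ∧ k < β then lowerHalf x else x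

/-- The coordinates of the inclusion of the face of `I^k × F_m × I^l` that is given by a word. -/
def wordVal (k m : ℕ) (w : List Letter) (t : ℕ → unitInterval) (j : ℕ) : unitInterval :=
  if j < k + m then place k (base w) j (raw w t j) else place k (base w) (j + 1) (raw w t (j + 1))

lemma continuous_raw {T : Type*} [TopologicalSpace T] (w : List Letter) (t : T → ℕ → unitInterval)
    (ht : ∀ j, Continuous fun x => t x j) (j : ℕ) : Continuous fun x => raw w (t x) j := by
  induction w generalizing t j with
  | nil => exact continuous_const
  | cons a w ih =>
    cases j with
    | zero =>
      simp only [raw, value]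
      split_ifs
      · exact ht 0
      · exact continuous_const
      · exact continuous_const
    | succ j =>
      refine ih _ (fun j => ?_) j
      simp only [rest]
      split_ifs
      · exact ht _
      · exact ht _

lemma continuous_place (k β j : ℕ) : Continuous (place k β j) := by
  unfold place
  split_ifs
  · exact continuous_id
  · exact continuous_const
  · exact continuous_upperHalf
  · exact continuous_lowerHalf
  · exact continuous_id

/-- The inclusion of the face of `I^k × F_m × I^l` that is given by a word. -/
def wordMap (n k m n' : ℕ) (w : List Letter) : C(Fin n' → unitInterval, Fin n → unitInterval) where
  toFun x j := wordVal k m w (coord x) j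
  continuous_toFun := by
    refine continuous_pi fun j => ?_
    unfold wordVal
    split_ifs
    all_goals exact (continuous_place _ _ _).comp (continuous_raw w _ continuous_coord _)

variable {Y : Type u} [TopologicalSpace Y]

/-- The face of a cell that is given by a word. -/
def realize {n : ℕ} (c : Cell Y n) (w : List Letter) : AnyCell Y :=
  ⟨kdim w + mdim w + ldim w, kdim w, mdim w, ldim w, rfl, c.map.comp (wordMap n c.k c.m _ w)⟩

lemma anyCell_ext {c c' : AnyCell Y} (hk : c.2.k = c'.2.k) (hm : c.2.m = c'.2.m)
    (hl : c.2.l = c'.2.l)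
    (h : ∀ t : ℕ → unitInterval, c.2.map (fun j => t j) = c'.2.map (fun j => t j)) : c = c' := by
  obtain ⟨n, k, m, l, hd, f⟩ := c
  obtain ⟨n', k', m', l', hd', f'⟩ := c'
  simp only at hk hm hl h
  subst hk hm hl hd hd'
  congr 2
  ext x
  have := h (coord x)
  have e : (fun j : Fin (k + m + l) => coord x j) = x := by funext j; simp [coord]
  rwa [e] at this

lemma coord_restrict {n : ℕ} (t : ℕ → unitInterval) (j : ℕ) (hj : j < n) :
    coord (fun j : Fin n => t j) j = t j := by
  simp [coord, hj]

/-- The letters `k`, `e`, `z`. -/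
def IsPlain (a : Letter) : Prop := a = k ∨ a = e ∨ a = z

/-- Words of `l` plain letters. -/
def PlainWord : ℕ → List Letter → Prop
  | 0, w => w = []
  | _ + 1, [] => False
  | l + 1, a :: w => IsPlain a ∧ PlainWord l w

/-- Words of `m` plain letters, followed by `z` and `l` plain letters. -/
def TailWord : ℕ → ℕ → List Letter → Prop
  | _, _, [] => False
  | 0, l, a :: w => a = z ∧ PlainWord l w
  | m + 1, l, a :: w => IsPlain a ∧ TailWord m l w

/-- Words which arise from those of `TailWord m l` if one chooses a base. -/
def MovedWord : ℕ → ℕ → List Letter → Prop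
  | _, _, [] => False
  | 0, l, a :: w => a = p ∧ PlainWord l w
  | m + 1, l, a :: w => (IsPlain a ∧ MovedWord m l w) ∨ ((a = b ∨ a = p) ∧ TailWord m l w)

/-- Words of the faces of `I^k × F_m × I^l`. -/
def FaceWord : ℕ → ℕ → ℕ → List Letter → Prop
  | _, _, _, [] => False
  | 0, 0, l, a :: w => a = p ∧ PlainWord l w
  | 0, m + 1, l, a :: w => ((a = b ∨ a = p) ∧ TailWord m l w) ∨ (a = z ∧ MovedWord m l w)
  | κ + 1, m, l, a :: w => IsPlain a ∧ FaceWord κ m l w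

/-- The word of `I^k × F_m × I^l` itself. -/
def top (k m l : ℕ) : List Letter :=
  List.replicate k Letter.k ++ (match m with
    | 0 => p :: List.replicate l Letter.k
    | m + 1 => b :: (List.replicate m Letter.k ++ z :: List.replicate l Letter.k))

/-- `a` may be inserted at position `π` into the words of `FaceWord k m l`. -/
def Insertable (k m π : ℕ) (a : Letter) : Prop := a = e ∨ a = z ∧ (π ≤ k ∨ k + m < π)

lemma PlainWord.length {l : ℕ} {w : List Letter} (h : PlainWord l w) : w.length = l := by
  induction l generalizing w with
  | zero => simp [show w = [] from h]
  | succ l ih => cases w with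
    | nil => exact h.elim
    | cons a w => simp [ih h.2]

lemma TailWord.length {m l : ℕ} {w : List Letter} (h : TailWord m l w) : w.length = m + 1 + l := by
  induction m generalizing w with
  | zero => cases w with
    | nil => exact h.elim
    | cons a w => simp [h.2.length]; omega
  | succ q ih => cases w with
    | nil => exact h.elim
    | cons a w => simp [ih h.2]; omega

lemma MovedWord.length {m l : ℕ} {w : List Letter} (h : MovedWord m l w) :
    w.length = m + 1 + l := by
  induction m generalizing w with
  | zero => cases w with
    | nil => exact h.elim
    | cons a w => simp [h.2.length]; omega
  | succ q ih => cases w with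
    | nil => exact h.elim
    | cons a w =>
      rcases h with h | h
      · simp [ih h.2]; omega
      · simp [h.2.length]; omega

lemma FaceWord.length {k m l : ℕ} {w : List Letter} (h : FaceWord k m l w) :
    w.length = k + m + 1 + l := by
  induction k generalizing w with
  | zero =>
    cases w with
    | nil => cases m <;> exact h.elim
    | cons a w =>
      cases m with
      | zero => simp [h.2.length]; omega
      | succ m =>
        rcases h with h | h
        · simp [h.2.length]; omega
        · simp [h.2.length]; omega
  | succ q ih => cases w with
    | nil => exact h.elim
    | cons a w => simp [ih h.2]; omega

lemma raw_insertIdx (π : ℕ) (a : Letter) (ha : a = e ∨ a = z) (w : List Letter) (hπ : π ≤ w.length)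
    (t : ℕ → unitInterval) :
    raw (w.insertIdx π a) t = Cell.insN π (if a = e then 1 else 0) (raw w t) := by
  induction π generalizing w t with
  | zero =>
    funext j
    rw [List.insertIdx_zero]
    cases j with
    | zero => rcases ha with rfl | rfl <;> simp [raw, Cell.insN, value]
    | succ j => rcases ha with rfl | rfl <;> simp [raw, Cell.insN, rest]
  | succ π ih =>
    cases w with
    | nil => simp at hπ
    | cons c w =>
      funext j
      rw [List.insertIdx_succ_cons]
      cases j with
      | zero => simp [raw, Cell.insN]
      | succ j =>
        simp only [raw]
        rw [ih w (by simpa using hπ)]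
        unfold Cell.insN
        rcases lt_trichotomy j π with h | h | h
        · simp [h, raw]
        · simp [h]
        · have h1 : ¬ j < π := by omega
          have h2 : j ≠ π := by omega
          simp only [h1, h2, if_false, Nat.succ_lt_succ_iff, Nat.add_right_cancel_iff]
          obtain ⟨j, rfl⟩ := Nat.exists_eq_succ_of_ne_zero (show j ≠ 0 by omega)
          rfl

lemma base_insertIdx (π : ℕ) (a : Letter) (ha : a = e ∨ a = z) (w : List Letter)
    (hπ : π ≤ w.length) :
    base (w.insertIdx π a) = if π ≤ base w then base w + 1 else base w := by
  induction π generalizing w with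
  | zero => rcases ha with rfl | rfl <;> simp [base]
  | succ π ih =>
    cases w with
    | nil => simp at hπ
    | cons c w =>
      rw [List.insertIdx_succ_cons]
      cases c <;> simp [base, ih w (by simpa using hπ)] <;> split_ifs <;> rfl

lemma deg_insertIdx (π : ℕ) (a : Letter) (ha : a = e ∨ a = z) (w : List Letter) :
    deg (w.insertIdx π a) = deg w := by
  induction π generalizing w with
  | zero => rcases ha with rfl | rfl <;> simp [deg]
  | succ π ih =>
    cases w with
    | nil => simp
    | cons c w => rw [List.insertIdx_succ_cons]; cases c <;> simp [deg, ih w]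

lemma TailWord.deg_insertIdx {m l : ℕ} {w : List Letter} (h : TailWord m l w) {π : ℕ} {a : Letter}
    (ha : a = e ∨ a = z ∧ m < π) :
    headDeg (w.insertIdx π a) = headDeg w ∧ tailDeg (w.insertIdx π a) = tailDeg w := by
  have ha' : a = e ∨ a = z := ha.imp_right And.left
  induction m generalizing w π with
  | zero =>
    cases w with
    | nil => exact h.elim
    | cons c w =>
      obtain ⟨rfl, h⟩ := h
      cases π with
      | zero =>
        obtain rfl : a = e := by simpa using ha
        simp [headDeg, tailDeg]
      | succ π =>
        rw [List.insertIdx_succ_cons]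
        simp [headDeg, tailDeg, Word.deg_insertIdx π a ha']
  | succ m ih =>
    cases w with
    | nil => exact h.elim
    | cons c w =>
      obtain ⟨hc, h⟩ := h
      cases π with
      | zero =>
        obtain rfl : a = e := by simpa using ha
        simp [headDeg, tailDeg]
      | succ π =>
        rw [List.insertIdx_succ_cons]
        have := ih h (π := π) (by simpa using ha)
        rcases hc with rfl | rfl | rfl
        · simp [headDeg, tailDeg, this.1, this.2]
        · simp [headDeg, tailDeg, this.1, this.2]
        · simp [headDeg, tailDeg, Word.deg_insertIdx π a ha']

lemma MovedWord.dims_insertIdx {m l : ℕ} {w : List Letter} (h : MovedWord m l w) {π : ℕ}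
    {a : Letter} (ha : a = e ∨ a = z ∧ (π = 0 ∨ m < π)) :
    kdim (w.insertIdx π a) = kdim w ∧ mdim (w.insertIdx π a) = mdim w ∧
      ldim (w.insertIdx π a) = ldim w := by
  have ha' : a = e ∨ a = z := ha.imp_right And.left
  induction m generalizing w π with
  | zero =>
    cases w with
    | nil => exact h.elim
    | cons c w =>
      obtain ⟨rfl, h⟩ := h
      cases π with
      | zero => rcases ha' with rfl | rfl <;> simp [kdim, mdim, ldim]
      | succ π =>
        rw [List.insertIdx_succ_cons]
        simp [kdim, mdim, ldim, Word.deg_insertIdx π a ha']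
  | succ m ih =>
    cases w with
    | nil => exact h.elim
    | cons c w =>
      cases π with
      | zero => rcases ha' with rfl | rfl <;> simp [kdim, mdim, ldim]
      | succ π =>
        rw [List.insertIdx_succ_cons]
        rcases h with ⟨hc, h⟩ | ⟨hc, h⟩
        · have := ih h (π := π) (by
            rcases ha with h | h
            · exact Or.inl h
            · exact Or.inr ⟨h.1, Or.inr (by omega)⟩)
          rcases hc with rfl | rfl | rfl <;> simp [kdim, mdim, ldim, this]
        · have := h.deg_insertIdx (π := π) (a := a) (by simpa using ha)
          rcases hc with rfl | rfl <;> simp [kdim, mdim, ldim, this, Word.deg_insertIdx π a ha']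

lemma FaceWord.dims_insertIdx {κ m l : ℕ} {w : List Letter} (h : FaceWord κ m l w) {π : ℕ}
    {a : Letter} (ha : Insertable κ m π a) :
    kdim (w.insertIdx π a) = kdim w ∧ mdim (w.insertIdx π a) = mdim w ∧
      ldim (w.insertIdx π a) = ldim w := by
  have ha' : a = e ∨ a = z := ha.imp_right And.left
  unfold Insertable at ha
  induction κ generalizing w π with
  | zero =>
    cases w with
    | nil => cases m <;> exact h.elim
    | cons c w =>
      cases π with
      | zero => rcases ha' with rfl | rfl <;> simp [kdim, mdim, ldim]
      | succ π =>
        rw [List.insertIdx_succ_cons]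
        cases m with
        | zero => obtain ⟨rfl, h⟩ := h; simp [kdim, mdim, ldim, Word.deg_insertIdx π a ha']
        | succ m =>
          rcases h with ⟨hc, h⟩ | ⟨hc, h⟩
          · have := h.deg_insertIdx (π := π) (a := a) (by simpa using ha)
            rcases hc with rfl | rfl <;> simp [kdim, mdim, ldim, this, Word.deg_insertIdx π a ha']
          · have := h.dims_insertIdx (π := π) (a := a) (by
              rcases ha with h | h
              · exact Or.inl h
              · exact Or.inr ⟨h.1, by omega⟩)
            subst hc
            simp [kdim, mdim, ldim, this]
  | succ κ ih =>
    cases w with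
    | nil => exact h.elim
    | cons c w =>
      obtain ⟨hc, h⟩ := h
      cases π with
      | zero => rcases ha' with rfl | rfl <;> simp [kdim, mdim, ldim]
      | succ π =>
        rw [List.insertIdx_succ_cons]
        have := ih h (π := π) (by
          rcases ha with h | h
          · exact Or.inl h
          · exact Or.inr ⟨h.1, by omega⟩)
        rcases hc with rfl | rfl | rfl <;> simp [kdim, mdim, ldim, this]

end Word
end
end Freehedral

namespace Freehedral
noncomputable section
namespace Word
open Letter
variable {Y : Type u} [TopologicalSpace Y]

lemma MovedWord.base_le {m l : ℕ} {w : List Letter} (h : MovedWord m l w) : base w ≤ m := by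
  induction m generalizing w with
  | zero => cases w with
    | nil => exact h.elim
    | cons a w => obtain ⟨rfl, h⟩ := h; simp [base]
  | succ m ih => cases w with
    | nil => exact h.elim
    | cons a w =>
      rcases h with ⟨h', h⟩ | ⟨rfl | rfl, h⟩
      · have := ih h
        rcases h' with rfl | rfl | rfl <;> simp [base, this]
      · simp [base]
      · simp [base]

lemma TailWord.raw_end {m l : ℕ} {w : List Letter} (h : TailWord m l w) (t : ℕ → unitInterval) :
    raw w t m = 0 := by
  induction m generalizing w t with
  | zero => cases w with
    | nil => exact h.elim
    | cons a w => obtain ⟨rfl, h⟩ := h; simp [raw, value]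
  | succ m ih => cases w with
    | nil => exact h.elim
    | cons a w => exact ih h.2 _

lemma MovedWord.raw_end {m l : ℕ} {w : List Letter} (h : MovedWord m l w)
    (t : ℕ → unitInterval) : raw w t m = 0 := by
  induction m generalizing w t with
  | zero => cases w with
    | nil => exact h.elim
    | cons a w => obtain ⟨rfl, h⟩ := h; simp [raw, value]
  | succ m ih => cases w with
    | nil => exact h.elim
    | cons a w => exact h.elim (fun h => ih h.2 _) fun h => h.2.raw_end _

/-- The coordinates of a face of `I^κ × F_m × I^l`. -/
lemma FaceWord.spec {κ m l : ℕ} {w : List Letter} (h : FaceWord κ m l w) (t : ℕ → unitInterval) :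
    κ ≤ base w ∧ base w ≤ κ + m ∧ raw w t (κ + m) = 0 ∧ (κ < base w → raw w t κ = 0) := by
  induction κ generalizing w t with
  | zero =>
    cases w with
    | nil => cases m <;> exact h.elim
    | cons a w =>
      cases m with
      | zero => obtain ⟨rfl, h⟩ := h; simp [base, raw, value]
      | succ m =>
        rcases h with ⟨h', h⟩ | ⟨rfl, h⟩
        · rw [show 0 + (m + 1) = m + 1 by omega]
          rcases h' with rfl | rfl <;> simp [base, raw, h.raw_end]
        · rw [show 0 + (m + 1) = m + 1 by omega]
          simp [base, raw, value, h.base_le, h.raw_end]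
  | succ κ ih =>
    cases w with
    | nil => exact h.elim
    | cons a w =>
      obtain ⟨h', h⟩ := h
      have := ih h (rest a t)
      rw [show κ + 1 + m = κ + m + 1 by omega]
      rcases h' with rfl | rfl | rfl <;> simp only [base, raw] <;>
        exact ⟨by omega, by omega, this.2.2.1, fun h => this.2.2.2 (by omega)⟩

/-- The position at which a letter is inserted into the words of a face. -/
def insPos (κ m l d i : ℕ) : ℕ :=
  if d = 2 then κ else if i ≤ m then (if d = 0 then κ + m else κ + i - 1)
  else if i ≤ m + l then κ + i else i - (m + l) - 1

/-- The letter that is inserted into the words of a face. -/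
def insLetter (d : ℕ) : Letter := if d = 1 then e else z

lemma insertable {n κ m l d i : ℕ} (hd : κ + m + l = n + 1) (hA : Cell.Adm (n + 1) m d i) :
    Insertable (Cell.faceK κ m l d i) (Cell.faceM m d i) (insPos κ m l d i) (insLetter d) ∧
    insPos κ m l d i ≤ n + 1 := by
  unfold Cell.Adm at hA
  unfold Insertable insLetter insPos Cell.faceK Cell.faceM
  rcases hA with ⟨rfl, h⟩ | ⟨rfl, h⟩ | ⟨rfl, h⟩
  · simp; split_ifs <;> omega
  · simp; split_ifs <;> omega
  · simp; omega

/-- `wordVal` for an arbitrary base and arbitrary coordinates of the positions. -/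
def placeAll (κ m β : ℕ) (r : ℕ → unitInterval) (j : ℕ) : unitInterval :=
  if j < κ + m then place κ β j (r j) else place κ β (j + 1) (r (j + 1))

lemma placeAll_low {κ m β π : ℕ} (ε : unitInterval) (r : ℕ → unitInterval) (h : π < κ)
    (hβ : κ - 1 ≤ β) (j : ℕ) :
    placeAll κ m (β + 1) (Cell.insN π ε r) j = Cell.insN π ε (placeAll (κ - 1) m β r) j := by
  obtain ⟨κ, rfl⟩ := Nat.exists_eq_add_of_lt h
  unfold placeAll Cell.insN place
  rcases lt_trichotomy j π with hj | hj | hj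
  · grind
  · grind
  · obtain ⟨j, rfl⟩ := Nat.exists_eq_succ_of_ne_zero (show j ≠ 0 by omega)
    grind

lemma placeAll_high {κ m β π : ℕ} (ε : unitInterval) (r : ℕ → unitInterval) (h : κ + m < π)
    (hβ : β ≤ κ + m) (j : ℕ) :
    placeAll κ m β (Cell.insN π ε r) j = Cell.insN (π - 1) ε (placeAll κ m β r) j := by
  unfold placeAll Cell.insN place
  rcases lt_trichotomy (j + 1) π with hj | hj | hj
  · grind
  · grind
  · obtain ⟨j, rfl⟩ := Nat.exists_eq_succ_of_ne_zero (show j ≠ 0 by omega)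
    grind

lemma placeAll_one {κ m β π : ℕ} (r : ℕ → unitInterval) (h : κ < π) (h' : π < κ + m)
    (j : ℕ) :
    placeAll κ m (if π ≤ β then β + 1 else β) (Cell.insN π 1 r) j =
      Cell.insN π 1 (placeAll κ (m - 1) β r) j := by
  have u1 := Cell.upperHalf_one
  obtain ⟨m, rfl⟩ := Nat.exists_eq_succ_of_ne_zero (show m ≠ 0 by omega)
  unfold placeAll Cell.insN place
  by_cases hβ : π ≤ β
  all_goals
    simp only [hβ, if_true, if_false, Nat.succ_eq_add_one, Nat.add_sub_cancel]
    rcases lt_trichotomy j π with hj | hj | hj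
    · grind (splits := 20)
    · grind (splits := 20)
    · obtain ⟨j, rfl⟩ := Nat.exists_eq_succ_of_ne_zero (show j ≠ 0 by omega)
      have h1 : ¬ j + 1 < π := by omega
      have h2 : j + 1 ≠ π := by omega
      have h3 : ¬ j + 1 + 1 < π := by omega
      have h4 : j + 1 + 1 ≠ π := by omega
      simp only [Nat.succ_eq_add_one, h1, h2, h3, h4, if_false, Nat.add_sub_cancel]
      grind (splits := 20)

lemma placeAll_zero {κ m β π : ℕ} (r : ℕ → unitInterval) (h : κ ≤ π) (h' : π < κ + m)
    (hβ : κ ≤ β) (hβ' : β ≤ π) (hr : r π = 0) (j : ℕ) :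
    placeAll κ m β (Cell.insN (κ + m) 0 r) j =
      Cell.insN π 0 (placeAll κ (π - κ) β r) j := by
  have l0 := Cell.lowerHalf_zero
  obtain ⟨q, rfl⟩ := Nat.exists_eq_add_of_le h
  have e : κ + (κ + q - κ) = κ + q := by omega
  unfold placeAll Cell.insN place
  rw [e]
  have h1 : j < κ + m ∨ κ + m ≤ j := lt_or_ge _ _
  rcases lt_trichotomy j (κ + q) with hj | hj | hj
  · have h2 : j < κ + m := by omega
    simp only [hj, h2, if_true]
  · subst hj
    simp only [h', if_true, lt_irrefl, if_false, hr]
    grind (splits := 20)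
  · obtain ⟨j, rfl⟩ := Nat.exists_eq_succ_of_ne_zero (show j ≠ 0 by omega)
    have h1 : ¬ j + 1 < κ := by omega
    have h2 : ¬ j + 1 = κ := by omega
    have h3 : ¬ j + 1 < β := by omega
    have h4 : ¬ j + 1 = β := by omega
    have h5 : ¬ j + 1 + 1 < κ := by omega
    have h6 : ¬ j + 1 + 1 = κ := by omega
    have h7 : ¬ j + 1 + 1 < β := by omega
    have h8 : ¬ j + 1 + 1 = β := by omega
    have h9 : ¬ j + 1 < κ + q := by omega
    have h10 : ¬ j + 1 = κ + q := by omega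
    have h11 : ¬ j < κ + q := by omega
    simp only [Nat.succ_eq_add_one, h1, h2, h3, h4, h5, h6, h7, h8, h9, h10, h11, if_false,
      Nat.add_sub_cancel, false_and]
    split_ifs <;> first | rfl | (exfalso; omega)

lemma placeAll_two {κ m β i : ℕ} (r : ℕ → unitInterval) (h : 1 ≤ i) (h' : i ≤ m)
    (hβ : κ + i - 1 ≤ β) (hβ' : β < κ + m) (hr : κ + i - 1 < β → r (κ + i - 1) = 0) (j : ℕ) :
    placeAll κ m (β + 1) (Cell.insN κ 0 r) j =
      Cell.specN κ i (i < m) (placeAll (κ + i - 1) (m - i) β r) j := by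
  have u0 := Cell.upperHalf_zero
  obtain ⟨i, rfl⟩ := Nat.exists_eq_succ_of_ne_zero (show i ≠ 0 by omega)
  obtain ⟨q, rfl⟩ := Nat.exists_eq_add_of_le h'
  simp only [Nat.succ_eq_add_one, ← add_assoc, Nat.add_sub_cancel, Nat.add_sub_cancel_left] at *
  unfold placeAll Cell.insN place Cell.specN
  rcases lt_trichotomy j κ with hj | hj | hj
  · grind (splits := 20)
  · grind (splits := 20)
  · obtain ⟨j, rfl⟩ := Nat.exists_eq_succ_of_ne_zero (show j ≠ 0 by omega)
    have h1 : ¬ j + 1 < κ := by omega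
    have h2 : ¬ j + 1 = κ := by omega
    have h3 : ¬ j + 1 + 1 < κ := by omega
    have h4 : ¬ j + 1 + 1 = κ := by omega
    simp only [Nat.succ_eq_add_one, h1, h2, h3, h4, if_false, Nat.add_sub_cancel, false_and]
    rcases lt_trichotomy (j + 1) (κ + i + 1) with hj | hj | hj
    · grind (splits := 20)
    · grind (splits := 20)
    · have h5 : ¬ j < κ + i := by omega
      have h6 : ¬ j = κ + i := by omega
      have h7 : ¬ j + 1 < κ + i := by omega
      have h8 : ¬ j + 1 = κ + i := by omega
      have h9 : ¬ j + 1 < κ + i + 1 := by omega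
      have h10 : ¬ j + 1 = κ + i + 1 := by omega
      simp only [h5, h6, h7, h8, h9, h10, if_false, false_and]
      grind (splits := 20)
lemma wordVal_insertIdx {n κ m l d i : ℕ} (hd : κ + m + l = n + 1) (hA : Cell.Adm (n + 1) m d i)
    {w : List Letter} (hw : FaceWord (Cell.faceK κ m l d i) (Cell.faceM m d i)
      (Cell.faceL m l d i) w) (t : ℕ → unitInterval) (j : ℕ) :
    wordVal κ m (w.insertIdx (insPos κ m l d i) (insLetter d)) t j =
      Cell.faceVal κ m l d i (wordVal (Cell.faceK κ m l d i) (Cell.faceM m d i) w t) j := by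
  obtain ⟨hi, hle⟩ := insertable hd hA
  obtain ⟨h1, h2, h3, h4⟩ := hw.spec t
  have hlen := hw.length
  have ha : insLetter d = e ∨ insLetter d = z := by unfold insLetter; split_ifs <;> simp
  have hlen' : insPos κ m l d i ≤ w.length := by
    have : Cell.faceK κ m l d i + Cell.faceM m d i + Cell.faceL m l d i = n := by
      unfold Cell.Adm at hA
      unfold Cell.faceK Cell.faceM Cell.faceL
      rcases hA with ⟨rfl, h⟩ | ⟨rfl, h⟩ | ⟨rfl, h⟩
      · simp; split_ifs <;> omega
      · simp; split_ifs <;> omega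
      · simp; omega
    omega
  change placeAll _ _ _ _ _ = Cell.faceVal κ m l d i (placeAll _ _ _ _) j
  rw [base_insertIdx _ _ ha _ hlen', raw_insertIdx _ _ ha _ hlen']
  generalize raw w t = r at *
  generalize base w = β at *
  clear hlen hlen' hw ha
  unfold Cell.Adm at hA
  rw [← or_assoc] at hA
  rcases hA with hA | ⟨rfl, h⟩
  · have hd2 : d ≠ 2 := by omega
    have hε : (if insLetter d = e then 1 else 0 : unitInterval) = if d = 0 then 0 else 1 := by
      rcases hA with ⟨rfl, -⟩ | ⟨rfl, -⟩ <;> simp [insLetter]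
    rw [Cell.faceVal_ins _ _ _ _ _ _ hd2, hε]
    by_cases c1 : m + l < i
    · have e1 : Cell.faceK κ m l d i = κ - 1 := by simp [Cell.faceK, hd2, c1]
      have e2 : Cell.faceM m d i = m := by unfold Cell.faceM; split_ifs <;> omega
      have e3 : insPos κ m l d i = i - (m + l) - 1 := by unfold insPos; split_ifs <;> omega
      rw [e1] at h1 h2 h3 h4 ⊢
      rw [e2, e3, if_neg (show ¬ i ≤ m + l by omega)]
      have hb : (if i - (m + l) - 1 ≤ β then β + 1 else β) = β + 1 := if_pos (by omega)
      rw [hb]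
      exact placeAll_low _ r (by omega) h1 j
    · have e1 : Cell.faceK κ m l d i = κ := by simp [Cell.faceK, hd2]; omega
      rw [e1] at h1 h2 h3 h4 ⊢
      rw [if_pos (show i ≤ m + l by omega)]
      by_cases c2 : m < i
      · have e2 : Cell.faceM m d i = m := by unfold Cell.faceM; split_ifs <;> omega
        have e3 : insPos κ m l d i = κ + i := by unfold insPos; split_ifs <;> omega
        rw [e2] at h2 h3 ⊢
        rw [e3, if_neg (show ¬ κ + i ≤ β by omega)]
        exact placeAll_high _ r (by omega) h2 j
      · rcases hA with ⟨rfl, h⟩ | ⟨rfl, h⟩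
        · have e2 : Cell.faceM m 0 i = i - 1 := by simp [Cell.faceM]; omega
          have e3 : insPos κ m l 0 i = κ + m := by simp [insPos]; omega
          rw [e2] at h2 h3 ⊢
          rw [e3, if_neg (show ¬ κ + m ≤ β by omega), if_pos rfl]
          have := placeAll_zero r (π := κ + i - 1) (κ := κ) (m := m) (β := β) (by omega) (by omega) h1
            (by omega) (by rwa [show κ + i - 1 = κ + (i - 1) by omega]) j
          rwa [show κ + i - 1 - κ = i - 1 by omega] at this
        · have e2 : Cell.faceM m 1 i = m - 1 := by simp [Cell.faceM]; omega
          have e3 : insPos κ m l 1 i = κ + i - 1 := by simp [insPos]; omega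
          rw [e2, e3, if_neg one_ne_zero]
          exact placeAll_one r (by omega) (by omega) j
  · have e1 : Cell.faceK κ m l 2 i = κ + i - 1 := by simp [Cell.faceK]
    have e2 : Cell.faceM m 2 i = m - i := by simp [Cell.faceM]
    have e3 : insPos κ m l 2 i = κ := by simp [insPos]
    rw [e1] at h1 h2 h3 h4 ⊢
    rw [e2] at h2 h3 ⊢
    rw [e3, if_pos (show κ ≤ β by omega), Cell.faceVal_spec]
    have hl : (if insLetter 2 = e then 1 else 0 : unitInterval) = 0 := by simp [insLetter]
    rw [hl]
    exact placeAll_two r h.1 h.2 h1 (by omega) h4 j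

lemma faceVal_congr {n κ m l d i : ℕ} (hd : κ + m + l = n + 1) (hA : Cell.Adm (n + 1) m d i)
    {x y : ℕ → unitInterval} (h : ∀ j < n, x j = y j) {j : ℕ} (hj : j < n + 1) :
    Cell.faceVal κ m l d i x j = Cell.faceVal κ m l d i y j := by
  unfold Cell.Adm at hA
  have hp : (if i ≤ m + l then κ + i - 1 else i - (m + l) - 1) < n + 1 := by split_ifs <;> omega
  unfold Cell.faceVal
  generalize (if i ≤ m + l then κ + i - 1 else i - (m + l) - 1) = q at *
  split_ifs
  all_goals first
    | rfl
    | exact h _ (by omega)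
    | rw [h _ (by omega)]

lemma realize_face {n : ℕ} (c : Cell Y (n + 1)) {d i : ℕ} (hA : Cell.Adm (n + 1) c.m d i)
    {w : List Letter} (hw : FaceWord (Cell.faceK c.k c.m c.l d i) (Cell.faceM c.m d i)
      (Cell.faceL c.m c.l d i) w) :
    realize (Cell.face d i c) w =
      realize c (w.insertIdx (insPos c.k c.m c.l d i) (insLetter d)) := by
  obtain ⟨r1, r2, r3⟩ := Cell.face_spec c d i hA
  obtain ⟨hi, -⟩ := insertable c.dim_eq hA
  obtain ⟨d1, d2, d3⟩ := hw.dims_insertIdx hi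
  refine anyCell_ext d1.symm d2.symm d3.symm fun t => ?_
  simp only [realize, ContinuousMap.comp_apply, r3]
  refine congrArg c.map (Cell.coord_ext fun j hj => ?_)
  refine (Cell.coord_faceMap _ _ _ _ _ _ _ _ hj).trans ?_
  have h1 : ∀ (N κ' m' n' : ℕ) (w : List Letter) (x : Fin n' → unitInterval), ∀ j < N,
      coord (wordMap N κ' m' n' w x) j = wordVal κ' m' w (coord x) j := by
    intro N κ' m' n' w x j hj
    simp [coord, wordMap, hj]
  refine Eq.trans ?_ (h1 _ _ _ _ _ _ _ hj).symm
  rw [wordVal_insertIdx c.dim_eq hA hw]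
  refine faceVal_congr c.dim_eq hA (fun j hj => ?_) hj
  rw [h1 _ _ _ _ _ _ _ hj, r1, r2, d1, d2, d3]

end Word
end
end Freehedral

namespace Freehedral
noncomputable section
namespace Word
open Letter
variable {R : Type*} [CommRing R]

section congr
variable {X X' Y Y' : List Letter → R} {κ m l : ℕ} {a : Letter} {w : List Letter}

lemma isPlain_k : IsPlain k := Or.inl rfl
lemma isPlain_e : IsPlain e := Or.inr (Or.inl rfl)
lemma isPlain_z : IsPlain z := Or.inr (Or.inr rfl)

lemma PlainWord.cons (ha : IsPlain a) (hw : PlainWord l w) : PlainWord (l + 1) (a :: w) := ⟨ha, hw⟩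
lemma TailWord.zero (hw : PlainWord l w) : TailWord 0 l (z :: w) := ⟨rfl, hw⟩
lemma TailWord.cons (ha : IsPlain a) (hw : TailWord m l w) : TailWord (m + 1) l (a :: w) := ⟨ha, hw⟩
lemma MovedWord.zero (hw : PlainWord l w) : MovedWord 0 l (p :: w) := ⟨rfl, hw⟩
lemma MovedWord.cons (ha : IsPlain a) (hw : MovedWord m l w) : MovedWord (m + 1) l (a :: w) :=
  Or.inl ⟨ha, hw⟩
lemma MovedWord.base_kept (hw : TailWord m l w) : MovedWord (m + 1) l (b :: w) :=
  Or.inr ⟨Or.inl rfl, hw⟩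
lemma MovedWord.base_point (hw : TailWord m l w) : MovedWord (m + 1) l (p :: w) :=
  Or.inr ⟨Or.inr rfl, hw⟩
lemma FaceWord.zero (hw : PlainWord l w) : FaceWord 0 0 l (p :: w) := ⟨rfl, hw⟩
lemma FaceWord.cons (ha : IsPlain a) (hw : FaceWord κ m l w) : FaceWord (κ + 1) m l (a :: w) :=
  ⟨ha, hw⟩
lemma FaceWord.base_kept (hw : TailWord m l w) : FaceWord 0 (m + 1) l (b :: w) :=
  Or.inl ⟨Or.inl rfl, hw⟩
lemma FaceWord.base_point (hw : TailWord m l w) : FaceWord 0 (m + 1) l (p :: w) :=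
  Or.inl ⟨Or.inr rfl, hw⟩
lemma FaceWord.moved (hw : MovedWord m l w) : FaceWord 0 (m + 1) l (z :: w) :=
  Or.inr ⟨rfl, hw⟩

lemma plainWord_replicate (l : ℕ) : PlainWord l (List.replicate l k) := by
  induction l with
  | zero => rfl
  | succ l ih => exact .cons isPlain_k ih

lemma tailWord_replicate (m l : ℕ) :
    TailWord m l (List.replicate m k ++ z :: List.replicate l k) := by
  induction m with
  | zero => exact .zero (plainWord_replicate l)
  | succ m ih => exact .cons isPlain_k ih

lemma faceWord_top (κ m l : ℕ) : FaceWord κ m l (top κ m l) := by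
  induction κ with
  | zero => cases m with
    | zero => exact .zero (plainWord_replicate l)
    | succ m => exact .base_kept (tailWord_replicate m l)
  | succ κ ih => exact .cons isPlain_k ih

lemma after_congr (h : X (a :: w) = X' (a :: w)) : after a X w = after a X' w := h

lemma twist_congr (h : X w = X' w) : twist X w = twist X' w := by
  unfold twist; rw [h]

lemma delta_congr_plain (hw : PlainWord l w)
    (h : ∀ v, PlainWord l v → X v = X' v) : delta w X = delta w X' := by
  induction l generalizing w X X' with
  | zero => cases w with
    | nil => rfl
    | cons a w => simp [PlainWord] at hw
  | succ l ih => cases w with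
    | nil => exact hw.elim
    | cons a w =>
      obtain ⟨ha, hw⟩ := hw
      rcases ha with rfl | rfl | rfl <;> simp only [delta]
      · rw [h _ (PlainWord.cons isPlain_e hw), h _ (PlainWord.cons isPlain_z hw), ih hw fun v hv => after_congr (h _ (PlainWord.cons isPlain_k hv))]
      · exact ih hw fun v hv => after_congr (h _ (PlainWord.cons isPlain_e hv))
      · exact ih hw fun v hv => after_congr (h _ (PlainWord.cons isPlain_z hv))

lemma delta_congr_tail (hw : TailWord m l w)
    (h : ∀ v, TailWord m l v → X v = X' v) : delta w X = delta w X' := by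
  induction m generalizing w X X' with
  | zero => cases w with
    | nil => exact hw.elim
    | cons a w =>
      obtain ⟨rfl, hw⟩ := hw
      simp only [delta]
      exact delta_congr_plain hw fun v hv => after_congr (h _ (TailWord.zero hv))
  | succ m ih => cases w with
    | nil => exact hw.elim
    | cons a w =>
      obtain ⟨ha, hw⟩ := hw
      rcases ha with rfl | rfl | rfl <;> simp only [delta]
      · rw [h _ (TailWord.cons isPlain_e hw), h _ (TailWord.cons isPlain_z hw), ih hw fun v hv => after_congr (h _ (TailWord.cons isPlain_k hv))]
      · exact ih hw fun v hv => after_congr (h _ (TailWord.cons isPlain_e hv))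
      · exact ih hw fun v hv => after_congr (h _ (TailWord.cons isPlain_z hv))

lemma move_congr (hw : TailWord m l w)
    (h : ∀ v, MovedWord m l v → X v = X' v) : move w X = move w X' := by
  induction m generalizing w X X' with
  | zero => cases w with
    | nil => exact hw.elim
    | cons a w =>
      obtain ⟨rfl, hw⟩ := hw
      exact h _ (MovedWord.zero hw)
  | succ m ih => cases w with
    | nil => exact hw.elim
    | cons a w =>
      obtain ⟨ha, hw⟩ := hw
      rcases ha with rfl | rfl | rfl <;> simp only [move]
      · rw [h _ (MovedWord.base_kept hw), ih hw fun v hv => after_congr (h _ (MovedWord.cons isPlain_k hv))]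
      · exact ih hw fun v hv => after_congr (h _ (MovedWord.cons isPlain_e hv))
      · exact h _ (MovedWord.base_point hw)

lemma delta_congr_moved (hw : MovedWord m l w)
    (h : ∀ v, MovedWord m l v → X v = X' v) : delta w X = delta w X' := by
  induction m generalizing w X X' with
  | zero => cases w with
    | nil => exact hw.elim
    | cons a w =>
      obtain ⟨rfl, hw⟩ := hw
      simp only [delta]
      exact delta_congr_plain hw fun v hv => after_congr (h _ (MovedWord.zero hv))
  | succ m ih => cases w with
    | nil => exact hw.elim
    | cons a w =>
      rcases hw with ⟨ha, hw⟩ | ⟨ha, hw⟩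
      · rcases ha with rfl | rfl | rfl <;> simp only [delta]
        · rw [h _ (MovedWord.cons isPlain_e hw), h _ (MovedWord.cons isPlain_z hw),
            ih hw fun v hv => after_congr (h _ (MovedWord.cons isPlain_k hv))]
        · exact ih hw fun v hv => after_congr (h _ (MovedWord.cons isPlain_e hv))
        · exact ih hw fun v hv => after_congr (h _ (MovedWord.cons isPlain_z hv))
      · rcases ha with rfl | rfl <;> simp only [delta]
        · rw [h _ (MovedWord.base_point hw),
            delta_congr_tail hw fun v hv => after_congr (h _ (MovedWord.base_kept hv)),
            move_congr hw fun v hv => after_congr (h _ (MovedWord.cons isPlain_z hv))]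
        · exact delta_congr_tail hw fun v hv => after_congr (h _ (MovedWord.base_point hv))

/-- The coboundary depends on the values on the words of faces only. -/
lemma delta_congr (hw : FaceWord κ m l w)
    (h : ∀ v, FaceWord κ m l v → X v = X' v) : delta w X = delta w X' := by
  induction κ generalizing w X X' with
  | zero => cases w with
    | nil => cases m <;> exact hw.elim
    | cons a w =>
      cases m with
      | zero =>
        obtain ⟨rfl, hw⟩ := hw
        simp only [delta]
        exact delta_congr_plain hw fun v hv => after_congr (h _ (FaceWord.zero hv))
      | succ m =>
        rcases hw with ⟨ha, hw⟩ | ⟨rfl, hw⟩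
        · rcases ha with rfl | rfl <;> simp only [delta]
          · rw [h _ (FaceWord.base_point hw),
              delta_congr_tail hw fun v hv => after_congr (h _ (FaceWord.base_kept hv)),
              move_congr hw fun v hv => after_congr (h _ (FaceWord.moved hv))]
          · exact delta_congr_tail hw fun v hv => after_congr (h _ (FaceWord.base_point hv))
        · simp only [delta]
          exact delta_congr_moved hw fun v hv => after_congr (h _ (FaceWord.moved hv))
  | succ κ ih => cases w with
    | nil => exact hw.elim
    | cons a w =>
      obtain ⟨ha, hw⟩ := hw
      rcases ha with rfl | rfl | rfl <;> simp only [delta]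
      · rw [h _ (FaceWord.cons isPlain_e hw), h _ (FaceWord.cons isPlain_z hw), ih hw fun v hv => after_congr (h _ (FaceWord.cons isPlain_k hv))]
      · exact ih hw fun v hv => after_congr (h _ (FaceWord.cons isPlain_e hv))
      · exact ih hw fun v hv => after_congr (h _ (FaceWord.cons isPlain_z hv))

lemma cup_congr_plainWord (hw : PlainWord l w)
    (h : ∀ v, PlainWord l v → X v = X' v) (h' : ∀ v, PlainWord l v → Y v = Y' v) :
    cup w X Y = cup w X' Y' := by
  induction l generalizing w X X' Y Y' with
  | zero => cases w with
    | nil => simp [cup, h [] hw, h' [] hw]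
    | cons a w => simp [PlainWord] at hw
  | succ l ih => cases w with
    | nil => exact hw.elim
    | cons a w =>
      obtain ⟨ha, hw⟩ := hw
      have g : ∀ a, IsPlain a → ∀ v, PlainWord l v → after a X v = after a X' v :=
        fun a ha v hv => h _ (PlainWord.cons ha hv)
      have g' : ∀ a, IsPlain a → ∀ v, PlainWord l v → after a Y v = after a Y' v :=
        fun a ha v hv => h' _ (PlainWord.cons ha hv)
      rcases ha with rfl | rfl | rfl <;> simp only [cup]
      · rw [ih hw (g _ isPlain_k) (g' _ isPlain_e),
          ih hw (fun v hv => twist_congr (g _ isPlain_z v hv)) (g' _ isPlain_k)]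
      · exact ih hw (g _ isPlain_e) (g' _ isPlain_e)
      · exact ih hw (g _ isPlain_z) (g' _ isPlain_z)

lemma cup_congr_tail (hw : TailWord m l w)
    (h : ∀ v, TailWord m l v → X v = X' v) (h' : ∀ v, TailWord m l v → Y v = Y' v) :
    cup w X Y = cup w X' Y' := by
  induction m generalizing w X X' Y Y' with
  | zero => cases w with
    | nil => exact hw.elim
    | cons a w =>
      obtain ⟨rfl, hw⟩ := hw
      simp only [cup]
      exact cup_congr_plainWord hw (fun v hv => after_congr (h _ (TailWord.zero hv))) (fun v hv => after_congr (h' _ (TailWord.zero hv)))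
  | succ m ih => cases w with
    | nil => exact hw.elim
    | cons a w =>
      obtain ⟨ha, hw⟩ := hw
      have g : ∀ a, IsPlain a → ∀ v, TailWord m l v → after a X v = after a X' v :=
        fun a ha v hv => h _ (TailWord.cons ha hv)
      have g' : ∀ a, IsPlain a → ∀ v, TailWord m l v → after a Y v = after a Y' v :=
        fun a ha v hv => h' _ (TailWord.cons ha hv)
      rcases ha with rfl | rfl | rfl <;> simp only [cup]
      · rw [ih hw (g _ isPlain_k) (g' _ isPlain_e),
          ih hw (fun v hv => twist_congr (g _ isPlain_z v hv)) (g' _ isPlain_k)]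
      · exact ih hw (g _ isPlain_e) (g' _ isPlain_e)
      · exact ih hw (g _ isPlain_z) (g' _ isPlain_z)

lemma cupMove_congr (hw : TailWord m l w)
    (h : ∀ v, MovedWord m l v → X v = X' v) (h' : ∀ v, MovedWord m l v → Y v = Y' v) :
    cupMove w X Y = cupMove w X' Y' := by
  induction m generalizing w X X' Y Y' with
  | zero => cases w with
    | nil => exact hw.elim
    | cons a w =>
      obtain ⟨rfl, hw⟩ := hw
      simp [cupMove]
  | succ m ih => cases w with
    | nil => exact hw.elim
    | cons a w =>
      obtain ⟨ha, hw⟩ := hw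
      have g : ∀ a, IsPlain a → ∀ v, MovedWord m l v → after a X v = after a X' v :=
        fun a ha v hv => h _ (MovedWord.cons ha hv)
      have g' : ∀ a, IsPlain a → ∀ v, MovedWord m l v → after a Y v = after a Y' v :=
        fun a ha v hv => h' _ (MovedWord.cons ha hv)
      rcases ha with rfl | rfl | rfl <;> simp only [cupMove]
      · rw [ih hw (g _ isPlain_k) (g' _ isPlain_e),
          ih hw (fun v hv => twist_congr (g _ isPlain_z v hv)) (g' _ isPlain_k),
          cup_congr_tail hw
            (fun v hv => twist_congr (after_congr (h _ (MovedWord.base_kept hv))))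
            (Y := mv (after k Y)) (Y' := mv (after k Y')) (fun v hv => move_congr hv (g' _ isPlain_k))]
      · exact ih hw (g _ isPlain_e) (g' _ isPlain_e)

lemma cup_congr_base (hw : TailWord m l w)
    (h : ∀ v, FaceWord 0 (m + 1) l v → X v = X' v) (h' : ∀ v, FaceWord 0 (m + 1) l v → Y v = Y' v) :
    cup (b :: w) X Y = cup (b :: w) X' Y' := by
  have g : ∀ v, MovedWord m l v → after z X v = after z X' v := fun v hv => after_congr (h _ (FaceWord.moved hv))
  have g' : ∀ v, MovedWord m l v → after z Y v = after z Y' v := fun v hv => after_congr (h' _ (FaceWord.moved hv))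
  simp only [cup]
  rw [cupMove_congr hw g g', cup_congr_tail hw (X := twist (after p X)) (Y := after b Y)
      (fun v hv => twist_congr (after_congr (h _ (FaceWord.base_point hv))))
      (fun v hv => after_congr (h' _ (FaceWord.base_kept hv))),
    cup_congr_tail hw (X := after b X) (Y := mv (after z Y))
      (fun v hv => after_congr (h _ (FaceWord.base_kept hv))) (fun v hv => move_congr hv g')]
  rfl

/-- The product on the word of `I^κ × F_m × I^l` depends on the values on words of faces only. -/
lemma cup_congr (h : ∀ v, FaceWord κ m l v → X v = X' v)
    (h' : ∀ v, FaceWord κ m l v → Y v = Y' v) : cup (top κ m l) X Y = cup (top κ m l) X' Y' := by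
  induction κ generalizing X X' Y Y' with
  | zero =>
    cases m with
    | zero =>
      change cup (p :: _) X Y = cup (p :: _) X' Y'
      simp only [cup]
      exact cup_congr_plainWord (plainWord_replicate l) (fun v hv => after_congr (h _ (FaceWord.zero hv)))
        fun v hv => after_congr (h' _ (FaceWord.zero hv))
    | succ m => exact cup_congr_base (tailWord_replicate m l) h h'
  | succ κ ih =>
    change cup (k :: top κ m l) X Y = cup (k :: top κ m l) X' Y'
    simp only [cup]
    rw [ih (X := after k X) (X' := after k X') (Y := after e Y) (Y' := after e Y')
        (fun v hv => after_congr (h _ (.cons isPlain_k hv)))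
        (fun v hv => after_congr (h' _ (.cons isPlain_e hv))),
      ih (X := twist (after z X)) (X' := twist (after z X')) (Y := after k Y) (Y' := after k Y')
        (fun v hv => twist_congr (h (z :: v) (.cons isPlain_z hv)))
        (fun v hv => after_congr (h' _ (.cons isPlain_k hv)))]

end congr

section insertion
variable (X Y : List Letter → R)

/-- Functions on words after the insertion of a letter. -/
def ins (π : ℕ) (a : Letter) (X : List Letter → R) : List Letter → R := fun w => X (w.insertIdx π a)

lemma after_ins (π : ℕ) (a c : Letter) : after c (ins (π + 1) a X) = ins π a (after c X) := by
  funext w; simp [after, ins]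

lemma ins_zero (a : Letter) : ins 0 a X = after a X := by
  funext w; simp [after, ins]

lemma twist_ins (π : ℕ) (a : Letter) (ha : a = e ∨ a = z) : twist (ins π a X) = ins π a (twist X) := by
  funext w; simp [twist, ins, deg_insertIdx π a ha]

lemma delta_ins_plain {l : ℕ} {w : List Letter} (hw : PlainWord l w) {π : ℕ} {a : Letter}
    (ha : a = e ∨ a = z) : delta w (ins π a X) = delta (w.insertIdx π a) X := by
  induction l generalizing w X π with
  | zero => cases w with
    | nil => cases π <;> rcases ha with rfl | rfl <;> simp [delta]
    | cons a w => simp [PlainWord] at hw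
  | succ l ih => cases w with
    | nil => exact hw.elim
    | cons c w =>
      cases π with
      | zero => rw [ins_zero]; rcases ha with rfl | rfl <;> simp [delta]
      | succ π =>
        obtain ⟨hc, hw⟩ := hw
        rw [List.insertIdx_succ_cons]
        rcases hc with rfl | rfl | rfl <;> simp only [delta, after_ins, ih _ hw]
        simp [ins]

lemma delta_ins_tail {m l : ℕ} {w : List Letter} (hw : TailWord m l w) {π : ℕ} {a : Letter}
    (ha : a = e ∨ a = z) : delta w (ins π a X) = delta (w.insertIdx π a) X := by
  induction m generalizing w X π with
  | zero => cases w with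
    | nil => exact hw.elim
    | cons c w =>
      cases π with
      | zero => rw [ins_zero]; rcases ha with rfl | rfl <;> simp [delta]
      | succ π =>
        obtain ⟨rfl, hw⟩ := hw
        rw [List.insertIdx_succ_cons]
        simp only [delta, after_ins, delta_ins_plain _ hw ha]
  | succ l ih => cases w with
    | nil => exact hw.elim
    | cons c w =>
      cases π with
      | zero => rw [ins_zero]; rcases ha with rfl | rfl <;> simp [delta]
      | succ π =>
        obtain ⟨hc, hw⟩ := hw
        rw [List.insertIdx_succ_cons]
        rcases hc with rfl | rfl | rfl <;> simp only [delta, after_ins, ih _ hw]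
        simp [ins]

lemma move_ins {m l : ℕ} {w : List Letter} (hw : TailWord m l w) {π : ℕ} {a : Letter}
    (ha : a = e ∨ a = z ∧ m < π) : move w (ins π a X) = move (w.insertIdx π a) X := by
  induction m generalizing w X π with
  | zero => cases w with
    | nil => exact hw.elim
    | cons c w =>
      cases π with
      | zero =>
        obtain rfl : a = e := by simpa using ha
        rw [ins_zero]; simp [move]
      | succ π =>
        obtain ⟨rfl, hw⟩ := hw
        rw [List.insertIdx_succ_cons]
        simp [move, ins]
  | succ m ih => cases w with
    | nil => exact hw.elim
    | cons c w =>
      cases π with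
      | zero =>
        obtain rfl : a = e := by simpa using ha
        rw [ins_zero]; simp [move]
      | succ π =>
        obtain ⟨hc, hw⟩ := hw
        rw [List.insertIdx_succ_cons]
        have ha' : a = e ∨ a = z ∧ m < π := by simpa using ha
        rcases hc with rfl | rfl | rfl <;> simp only [move, after_ins, ih _ hw ha']
        · simp [ins]
        · simp [ins]

lemma delta_ins_moved {m l : ℕ} {w : List Letter} (hw : MovedWord m l w) {π : ℕ} {a : Letter}
    (ha : a = e ∨ a = z ∧ (π = 0 ∨ m < π)) : delta w (ins π a X) = delta (w.insertIdx π a) X := by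
  have ha' : a = e ∨ a = z := ha.imp_right And.left
  cases π with
  | zero => rw [ins_zero]; rcases ha' with rfl | rfl <;> simp [delta]
  | succ π =>
    induction m generalizing w X π with
    | zero => cases w with
      | nil => exact hw.elim
      | cons c w =>
        obtain ⟨rfl, hw⟩ := hw
        rw [List.insertIdx_succ_cons]
        simp only [delta, after_ins, delta_ins_plain _ hw ha']
    | succ m ih => cases w with
      | nil => exact hw.elim
      | cons c w =>
        have ha2 : a = e ∨ a = z ∧ m < π := by simpa using ha
        rw [List.insertIdx_succ_cons]
        rcases hw with ⟨hc, hw⟩ | ⟨hc, hw⟩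
        · have key : ∀ X : List Letter → R, delta w (ins π a X) = delta (w.insertIdx π a) X := by
            intro X
            cases π with
            | zero => rw [ins_zero]; rcases ha' with rfl | rfl <;> simp [delta]
            | succ π => exact ih X hw _ (ha2.imp_right fun h => ⟨h.1, Or.inr h.2⟩)
          rcases hc with rfl | rfl | rfl <;> simp only [delta, after_ins, key]
          simp [ins]
        · rcases hc with rfl | rfl <;>
            simp only [delta, after_ins, delta_ins_tail _ hw ha', move_ins _ hw ha2]
          simp [ins]

/-- The coboundary commutes with the insertion of a letter. -/
lemma delta_ins {κ m l : ℕ} {w : List Letter} (hw : FaceWord κ m l w) {π : ℕ} {a : Letter}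
    (ha : Insertable κ m π a) : delta w (ins π a X) = delta (w.insertIdx π a) X := by
  have ha' : a = e ∨ a = z := ha.imp_right And.left
  cases π with
  | zero => rw [ins_zero]; rcases ha' with rfl | rfl <;> simp [delta]
  | succ π =>
    unfold Insertable at ha
    induction κ generalizing w X π with
    | zero => cases w with
      | nil => cases m <;> exact hw.elim
      | cons c w =>
        rw [List.insertIdx_succ_cons]
        cases m with
        | zero =>
          obtain ⟨rfl, hw⟩ := hw
          simp only [delta, after_ins, delta_ins_plain _ hw ha']
        | succ m =>
          have ha2 : a = e ∨ a = z ∧ m < π := ha.imp_right fun h => ⟨h.1, by omega⟩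
          rcases hw with ⟨hc, hw⟩ | ⟨rfl, hw⟩
          · rcases hc with rfl | rfl <;>
              simp only [delta, after_ins, delta_ins_tail _ hw ha', move_ins _ hw ha2]
            simp [ins]
          · simp only [delta, after_ins]
            exact delta_ins_moved _ hw (ha2.imp_right fun h => ⟨h.1, Or.inr h.2⟩)
    | succ κ ih => cases w with
      | nil => exact hw.elim
      | cons c w =>
        obtain ⟨hc, hw⟩ := hw
        rw [List.insertIdx_succ_cons]
        have key : ∀ X : List Letter → R, delta w (ins π a X) = delta (w.insertIdx π a) X := by
          intro X
          cases π with
          | zero => rw [ins_zero]; rcases ha' with rfl | rfl <;> simp [delta]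
          | succ π => exact ih X hw _ (ha.imp_right fun h => ⟨h.1, by omega⟩)
        rcases hc with rfl | rfl | rfl <;> simp only [delta, after_ins, key]
        simp [ins]

lemma cup_cons_ez {a : Letter} (ha : a = e ∨ a = z) (w : List Letter) :
    cup (a :: w) X Y = cup w (after a X) (after a Y) := by
  rcases ha with rfl | rfl <;> rfl

lemma cup_ins_plain {l : ℕ} {w : List Letter} (hw : PlainWord l w) {π : ℕ} {a : Letter}
    (ha : a = e ∨ a = z) (hπ : π ≤ l) :
    cup w (ins π a X) (ins π a Y) = cup (w.insertIdx π a) X Y := by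
  induction l generalizing w X Y π with
  | zero =>
    obtain rfl : π = 0 := by omega
    rw [ins_zero, ins_zero, List.insertIdx_zero, cup_cons_ez _ _ ha]
  | succ l ih => cases w with
    | nil => exact hw.elim
    | cons c w =>
      cases π with
      | zero => rw [ins_zero, ins_zero, List.insertIdx_zero, cup_cons_ez _ _ ha]
      | succ π =>
        obtain ⟨hc, hw⟩ := hw
        rw [List.insertIdx_succ_cons]
        rcases hc with rfl | rfl | rfl <;>
          simp only [cup, after_ins, twist_ins _ _ _ ha, ih _ _ hw (show π ≤ l by omega)]

lemma cup_ins_tail {m l : ℕ} {w : List Letter} (hw : TailWord m l w) {π : ℕ} {a : Letter}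
    (ha : a = e ∨ a = z) (hπ : π ≤ m + 1 + l) :
    cup w (ins π a X) (ins π a Y) = cup (w.insertIdx π a) X Y := by
  induction m generalizing w X Y π with
  | zero => cases w with
    | nil => exact hw.elim
    | cons c w =>
      cases π with
      | zero => rw [ins_zero, ins_zero, List.insertIdx_zero, cup_cons_ez _ _ ha]
      | succ π =>
        obtain ⟨rfl, hw⟩ := hw
        rw [List.insertIdx_succ_cons]
        simp only [cup, after_ins, cup_ins_plain _ _ hw ha (show π ≤ l by omega)]
  | succ m ih => cases w with
    | nil => exact hw.elim
    | cons c w =>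
      cases π with
      | zero => rw [ins_zero, ins_zero, List.insertIdx_zero, cup_cons_ez _ _ ha]
      | succ π =>
        obtain ⟨hc, hw⟩ := hw
        rw [List.insertIdx_succ_cons]
        rcases hc with rfl | rfl | rfl <;>
          simp only [cup, after_ins, twist_ins _ _ _ ha, ih _ _ hw (show π ≤ m + 1 + l by omega)]

lemma cup_ins_mv {m l : ℕ} {w : List Letter} (hw : TailWord m l w) {π : ℕ} {a : Letter}
    (ha : a = e ∨ a = z ∧ m < π) (hπ : π ≤ m + 1 + l) :
    cup w (ins π a X) (mv (ins π a Y)) = cup (w.insertIdx π a) X (mv Y) := by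
  rw [← cup_ins_tail _ _ hw (ha.imp_right And.left) hπ]
  exact cup_congr_tail hw (fun _ _ => rfl) fun v hv => move_ins _ hv ha

lemma cupMove_ins {m l : ℕ} {w : List Letter} (hw : TailWord m l w) {π : ℕ} {a : Letter}
    (ha : a = e ∨ a = z ∧ m < π) (hπ : π ≤ m + 1 + l) :
    cupMove w (ins π a X) (ins π a Y) = cupMove (w.insertIdx π a) X Y := by
  have ha' : a = e ∨ a = z := ha.imp_right And.left
  induction m generalizing w X Y π with
  | zero => cases w with
    | nil => exact hw.elim
    | cons c w =>
      cases π with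
      | zero =>
        obtain rfl : a = e := by simpa using ha
        rw [ins_zero, ins_zero]; simp [cupMove]
      | succ π =>
        obtain ⟨rfl, hw⟩ := hw
        simp [cupMove]
  | succ m ih => cases w with
    | nil => exact hw.elim
    | cons c w =>
      cases π with
      | zero =>
        obtain rfl : a = e := by simpa using ha
        rw [ins_zero, ins_zero]; simp [cupMove]
      | succ π =>
        obtain ⟨hc, hw⟩ := hw
        have ha2 : a = e ∨ a = z ∧ m < π := by simpa using ha
        rw [List.insertIdx_succ_cons]
        rcases hc with rfl | rfl | rfl <;>
          simp only [cupMove, after_ins, twist_ins _ _ _ ha', ih _ _ hw ha2 (show π ≤ m + 1 + l by omega),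
            cup_ins_mv _ _ hw ha2 (show π ≤ m + 1 + l by omega)]

/-- The product commutes with the insertion of a letter. -/
lemma cup_ins {κ m l : ℕ} {π : ℕ} {a : Letter}
    (ha : Insertable κ m π a) (hπ : π ≤ κ + m + 1 + l) :
    cup (top κ m l) (ins π a X) (ins π a Y) = cup ((top κ m l).insertIdx π a) X Y := by
  have ha' : a = e ∨ a = z := ha.imp_right And.left
  cases π with
  | zero => rw [ins_zero, ins_zero, List.insertIdx_zero, cup_cons_ez _ _ ha']
  | succ π =>
    unfold Insertable at ha
    induction κ generalizing X Y π with
    | zero =>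
      cases m with
      | zero =>
        change cup (p :: _) _ _ = cup (List.insertIdx (p :: _) _ _) _ _
        rw [List.insertIdx_succ_cons]
        simp only [cup, after_ins]
        exact cup_ins_plain _ _ (plainWord_replicate l) ha' (by omega)
      | succ m =>
        change cup (b :: _) _ _ = cup (List.insertIdx (b :: _) _ _) _ _
        rw [List.insertIdx_succ_cons]
        have ha2 : a = e ∨ a = z ∧ m < π := ha.imp_right fun h => ⟨h.1, by omega⟩
        simp only [cup, after_ins, twist_ins _ _ _ ha',
          cup_ins_tail _ _ (tailWord_replicate m l) ha' (show π ≤ m + 1 + l by omega),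
          cup_ins_mv _ _ (tailWord_replicate m l) ha2 (show π ≤ m + 1 + l by omega),
          cupMove_ins _ _ (tailWord_replicate m l) ha2 (show π ≤ m + 1 + l by omega)]
    | succ κ ih =>
      change cup (k :: top κ m l) _ _ = cup (List.insertIdx (k :: top κ m l) _ _) _ _
      rw [List.insertIdx_succ_cons]
      have key : ∀ X Y : List Letter → R, cup (top κ m l) (ins π a X) (ins π a Y) =
          cup ((top κ m l).insertIdx π a) X Y := by
        intro X Y
        cases π with
        | zero => rw [ins_zero, ins_zero, List.insertIdx_zero, cup_cons_ez _ _ ha']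
        | succ π => exact ih X Y (π := π) (ha.imp_right fun h => ⟨h.1, by omega⟩) (by omega)
      simp only [cup, after_ins, twist_ins _ _ _ ha', key]

end insertion

end Word
end
end Freehedral

namespace Freehedral
noncomputable section
namespace Word
open Letter
section top
variable {R : Type*} [CommRing R]

/-- The part of the word of `I^k × F_m × I^l` after the coordinates of `I^k`. -/
def core (m l : ℕ) : List Letter :=
  match m with
  | 0 => p :: List.replicate l k
  | m + 1 => b :: (List.replicate m k ++ z :: List.replicate l k)

lemma top_eq (κ m l : ℕ) : top κ m l = List.replicate κ k ++ core m l := by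
  cases m <;> rfl

omit [CommRing R] in
lemma insertIdx_append_right (A B : List Letter) (π : ℕ) (a : Letter) :
    (A ++ B).insertIdx (A.length + π) a = A ++ B.insertIdx π a := by
  induction A with
  | nil => simp
  | cons c A ih => simp [Nat.succ_add, Nat.add_right_comm _ 1, ih]

lemma insertIdx_replicate_append (n π : ℕ) (B : List Letter) (a : Letter) :
    (List.replicate n k ++ B).insertIdx (n + π) a = List.replicate n k ++ B.insertIdx π a := by
  simpa using insertIdx_append_right (List.replicate n k) B π a

lemma insertIdx_replicate_append_low (j n : ℕ) (B : List Letter) (a : Letter) :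
    (List.replicate (j + n) k ++ B).insertIdx j a =
      List.replicate j k ++ a :: (List.replicate n k ++ B) := by
  rw [List.replicate_add, List.append_assoc]
  simpa using insertIdx_replicate_append j 0 (List.replicate n k ++ B) a

lemma delta_replicate_append (n : ℕ) (w : List Letter) (X : List Letter → R) :
    delta (List.replicate n k ++ w) X =
      ∑ j ∈ Finset.range n, (-1) ^ j *
        (X (List.replicate j k ++ e :: (List.replicate (n - 1 - j) k ++ w)) -
          X (List.replicate j k ++ z :: (List.replicate (n - 1 - j) k ++ w))) +
      (-1) ^ n * delta w (fun v => X (List.replicate n k ++ v)) := by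
  induction n generalizing X with
  | zero => simp
  | succ n ih =>
    rw [List.replicate_succ, List.cons_append, delta, ih, Finset.sum_range_succ']
    have h : ∀ j, n + 1 - 1 - (j + 1) = n - 1 - j := fun j => by omega
    simp only [h, after, pow_succ, mul_add, List.replicate_succ, List.cons_append]
    simp only [pow_zero, List.replicate_zero, List.nil_append, Nat.sub_zero, one_mul,
      Nat.add_sub_cancel, mul_neg, mul_one, neg_mul, Finset.sum_neg_distrib]
    ring

lemma move_replicate_append (m l : ℕ) (X : List Letter → R) :
    move (List.replicate m k ++ z :: List.replicate l k) X =
      ∑ j ∈ Finset.range (m + 1), X (top j (m - j) l) := by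
  induction m generalizing X with
  | zero => simp [move, top]
  | succ m ih =>
    rw [List.replicate_succ, List.cons_append, move, ih, Finset.sum_range_succ' _ (m + 1), add_comm]
    congr 1
    refine Finset.sum_congr rfl fun j _ => ?_
    rw [show m + 1 - (j + 1) = m - j by omega]
    rfl

lemma mul_add_mul_eq {a a' c x y : R} (ha : a = -c) (ha' : a' = c) :
    a * x + a' * y = c * (y - x) := by
  rw [ha, ha']; ring

lemma sum_adms_zero (n : ℕ) (F : ℕ × ℕ → R) :
    ∑ q ∈ Cell.adms n 0, F q = ∑ j ∈ Finset.range n, (F (0, j + 1) + F (1, j + 1)) := by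
  have : Cell.adms n 0 = ((Finset.range n).image fun j => (0, j + 1)) ∪
      ((Finset.range n).image fun j => (1, j + 1)) := by
    ext ⟨d, i⟩
    rw [Cell.mem_adms (by omega)]
    simp only [Cell.Adm, Finset.mem_union, Finset.mem_image, Finset.mem_range, Prod.mk.injEq]
    constructor
    · rintro (h | h | h)
      · exact Or.inl ⟨i - 1, by omega⟩
      · exact Or.inr ⟨i - 1, by omega⟩
      · exact absurd h.2 (by omega)
    · rintro (⟨j, h, rfl, rfl⟩ | ⟨j, h, rfl, rfl⟩)
      · exact Or.inl ⟨rfl, by omega⟩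
      · exact Or.inr (Or.inl ⟨rfl, by omega, by omega, fun _ => trivial⟩)
  rw [this, Finset.sum_union, Finset.sum_image, Finset.sum_image, Finset.sum_add_distrib]
  · intro x _ y _ h; simpa using h
  · intro x _ y _ h; simpa using h
  · rw [Finset.disjoint_left]
    rintro ⟨d, i⟩ h1 h2
    simp at h1 h2
    omega

lemma sum_adms_succ {n m : ℕ} (hm : m ≤ n) (F : ℕ × ℕ → R) :
    ∑ q ∈ Cell.adms (n + 1) (m + 1), F q = F (0, 1) +
      ∑ j ∈ Finset.range n, (F (0, j + 2) + F (1, j + 2)) +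
      ∑ j ∈ Finset.range (m + 1), F (2, j + 1) := by
  have : Cell.adms (n + 1) (m + 1) = insert (0, 1) (((Finset.range n).image fun j => (0, j + 2)) ∪
      (((Finset.range n).image fun j => (1, j + 2)) ∪
      ((Finset.range (m + 1)).image fun j => (2, j + 1)))) := by
    ext ⟨d, i⟩
    rw [Cell.mem_adms (by omega)]
    simp only [Cell.Adm, Finset.mem_insert, Finset.mem_union, Finset.mem_image, Finset.mem_range,
      Prod.mk.injEq]
    constructor
    · rintro (h | h | h)
      · by_cases hi : i = 1
        · exact Or.inl (by omega)
        · exact Or.inr (Or.inl ⟨i - 2, by omega⟩)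
      · exact Or.inr (Or.inr (Or.inl ⟨i - 2, by omega⟩))
      · exact Or.inr (Or.inr (Or.inr ⟨i - 1, by omega⟩))
    · rintro (h | ⟨j, h⟩ | ⟨j, h⟩ | ⟨j, h⟩) <;> omega
  rw [this, Finset.sum_insert, Finset.sum_union, Finset.sum_union, Finset.sum_image,
    Finset.sum_image, Finset.sum_image, Finset.sum_add_distrib]
  · ring
  · intro x _ y _ h; simpa using h
  · intro x _ y _ h; simpa using h
  · intro x _ y _ h; simpa using h
  · rw [Finset.disjoint_left]
    rintro ⟨d, i⟩ h1 h2
    simp at h1 h2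
    omega
  · rw [Finset.disjoint_left]
    rintro ⟨d, i⟩ h1 h2
    simp at h1 h2
    omega
  · simp

lemma neg_one_pow_congr {a b : ℕ} (h : (a : ZMod 2) = b) : (-1 : R) ^ a = (-1) ^ b := by
  rw [ZMod.natCast_eq_natCast_iff] at h
  rcases Nat.even_or_odd a with ha | ha
  · have hb : Even b := by rw [Nat.even_iff] at *; exact h ▸ ha
    rw [ha.neg_one_pow, hb.neg_one_pow]
  · have hb : Odd b := by rw [Nat.odd_iff] at *; exact h ▸ ha
    rw [ha.neg_one_pow, hb.neg_one_pow]

lemma neg_one_pow_congr_neg {a b : ℕ} (h : (a : ZMod 2) = b + 1) : (-1 : R) ^ a = - (-1) ^ b := by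
  rw [neg_one_pow_congr (b := b + 1) (by push_cast; exact h), pow_succ]; ring

/-- The term of the coboundary that belongs to a face. -/
def faceTerm (κ m l : ℕ) (X : List Letter → R) (q : ℕ × ℕ) : R :=
  (-1) ^ (Cell.sgnExp (κ + m + l) q.1 q.2 + κ * (m + l) + Cell.faceK κ m l q.1 q.2 *
      (Cell.faceM m q.1 q.2 + Cell.faceL m l q.1 q.2)) *
    X ((top (Cell.faceK κ m l q.1 q.2) (Cell.faceM m q.1 q.2) (Cell.faceL m l q.1 q.2)).insertIdx
      (insPos κ m l q.1 q.2) (insLetter q.1))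

lemma faceTerm_low (κ m l j : ℕ) (hj : j < κ) (X : List Letter → R) :
    faceTerm κ m l X (0, m + l + j + 1) + faceTerm κ m l X (1, m + l + j + 1) =
      (-1) ^ j * (X (List.replicate j k ++ e :: (List.replicate (κ - 1 - j) k ++ core m l)) -
          X (List.replicate j k ++ z :: (List.replicate (κ - 1 - j) k ++ core m l))) := by
  obtain ⟨r, rfl⟩ := Nat.exists_eq_add_of_lt hj
  have h1 : ¬ m + l + j + 1 ≤ m + l := by omega
  have h2 : ¬ m + l + j + 1 ≤ m := by omega
  have h3 : m + l + j + 1 - (m + l) - 1 = j := by omega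
  have h4 : j + r + 1 - 1 - j = r := by omega
  simp only [faceTerm, Cell.faceK, Cell.faceM, Cell.faceL, insPos, insLetter, Cell.sgnExp, h1, h2,
    h3, h4, top_eq, Nat.add_sub_cancel, Nat.add_sub_cancel_left, if_false, if_true, zero_ne_one, one_ne_zero, reduceCtorEq,
    OfNat.zero_ne_ofNat, OfNat.one_ne_ofNat, insertIdx_replicate_append_low]
  refine mul_add_mul_eq (neg_one_pow_congr_neg ?_) (neg_one_pow_congr ?_)
  · push_cast; ring_nf; reduce_mod_char
  · push_cast; ring_nf; reduce_mod_char

lemma faceTerm_high (κ m l j : ℕ) (hj : j < l) (A : List Letter)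
    (hA : ∀ l, core m l = A ++ List.replicate l k) (hAl : A.length = m + 1) (X : List Letter → R) :
    faceTerm κ m l X (0, m + j + 1) + faceTerm κ m l X (1, m + j + 1) =
      (-1) ^ (κ + m + j) *
        (X (List.replicate κ k ++ (A ++ (List.replicate j k ++ e :: List.replicate (l - 1 - j) k))) -
        X (List.replicate κ k ++ (A ++ (List.replicate j k ++ z :: List.replicate (l - 1 - j) k)))) := by
  obtain ⟨r, rfl⟩ := Nat.exists_eq_add_of_lt hj
  have h1 : m + j + 1 ≤ m + (j + r + 1) := by omega
  have h2 : ¬ m + j + 1 ≤ m := by omega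
  have h3 : κ + (m + j + 1) = κ + (A.length + j) := by omega
  have h4 : j + r + 1 - 1 - j = r := by omega
  have h5 := fun a => insertIdx_replicate_append_low j r [] a
  simp only [List.append_nil] at h5
  simp only [faceTerm, Cell.faceK, Cell.faceM, Cell.faceL, insPos, insLetter, Cell.sgnExp, h1, h2,
    h3, h4, top_eq, Nat.add_sub_cancel, Nat.add_sub_cancel_left, if_false, if_true, zero_ne_one, one_ne_zero, reduceCtorEq,
    OfNat.zero_ne_ofNat, OfNat.one_ne_ofNat, insertIdx_replicate_append, hA, insertIdx_append_right,
    h5]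
  refine mul_add_mul_eq (neg_one_pow_congr_neg ?_) (neg_one_pow_congr ?_)
  · push_cast; ring_nf; reduce_mod_char
  · push_cast; ring_nf; reduce_mod_char

lemma faceTerm_mid (κ m l j : ℕ) (hj : j < m) (X : List Letter → R) :
    faceTerm κ (m + 1) l X (0, j + 2) + faceTerm κ (m + 1) l X (1, j + 2) =
      (-1) ^ (κ + j + 1) *
        (X (List.replicate κ k ++ b :: (List.replicate j k ++ e :: (List.replicate (m - 1 - j) k ++ z :: List.replicate l k))) -
        X (List.replicate κ k ++ b :: (List.replicate j k ++ z :: (List.replicate (m - 1 - j) k ++ z :: List.replicate l k)))) := by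
  obtain ⟨r, rfl⟩ := Nat.exists_eq_add_of_lt hj
  have h1 : j + 2 ≤ j + r + 1 + 1 + l := by omega
  have h2 : j + 2 ≤ j + r + 1 + 1 := by omega
  have h3 : κ + (j + 2) - 1 = κ + (j + 1) := by omega
  have h4 : j + r + 1 - 1 - j = r := by omega
  have h5 : j + 2 - 1 = j + 1 := by omega
  have h6 : j + r + 1 + 1 - (j + 2) = r := by omega
  have h7 : (List.replicate j k ++ z :: List.replicate (l + r) k).insertIdx (j + r + 1) z =
      List.replicate j k ++ z :: (List.replicate r k ++ z :: List.replicate l k) := by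
    rw [add_assoc, insertIdx_replicate_append, List.insertIdx_succ_cons, add_comm l r]
    have := insertIdx_replicate_append_low r l [] z
    simp only [List.append_nil] at this
    rw [this]
  simp only [faceTerm, Cell.faceK, Cell.faceM, Cell.faceL, insPos, insLetter, Cell.sgnExp, h1, h2,
    h3, h4, h5, h6, top_eq, Nat.add_sub_cancel, Nat.add_sub_cancel_left, if_false, if_true, zero_ne_one, one_ne_zero,
    reduceCtorEq, OfNat.zero_ne_ofNat, OfNat.one_ne_ofNat, insertIdx_replicate_append, core,
    List.insertIdx_succ_cons, h7, insertIdx_replicate_append_low]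
  refine mul_add_mul_eq (neg_one_pow_congr_neg ?_) (neg_one_pow_congr ?_)
  · push_cast; ring_nf; reduce_mod_char
  · push_cast; ring_nf; reduce_mod_char

lemma faceTerm_first (κ m l : ℕ) (X : List Letter → R) :
    faceTerm κ (m + 1) l X (0, 1) = - ((-1) ^ κ *
      X (List.replicate κ k ++ p :: (List.replicate m k ++ z :: List.replicate l k))) := by
  have h1 : 1 ≤ m + 1 + l := by omega
  have h2 : 1 ≤ m + 1 := by omega
  have h := insertIdx_replicate_append_low m l [] z
  simp only [List.append_nil, add_comm m l] at h
  simp only [faceTerm, Cell.faceK, Cell.faceM, Cell.faceL, insPos, insLetter, Cell.sgnExp, h1, h2,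
    top_eq, Nat.add_sub_cancel, Nat.add_sub_cancel_left, if_false, if_true, zero_ne_one, one_ne_zero,
    reduceCtorEq, OfNat.zero_ne_ofNat, OfNat.one_ne_ofNat, insertIdx_replicate_append, core,
    List.insertIdx_succ_cons, Nat.sub_self, h]
  rw [neg_one_pow_congr_neg (b := κ)]
  · ring
  · push_cast; ring_nf; reduce_mod_char

lemma faceTerm_special (κ m l j : ℕ) (hj : j < m + 1) (X : List Letter → R) :
    faceTerm κ (m + 1) l X (2, j + 1) = (-1) ^ κ *
      X (List.replicate κ k ++ z :: top j (m - j) l) := by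
  obtain ⟨r, rfl⟩ := Nat.exists_eq_add_of_le (Nat.le_of_lt_succ hj)
  have h1 : j + r - j = r := by omega
  have h2 : j + r + 1 - (j + 1) = r := by omega
  have h3 : κ + (j + 1) - 1 = κ + j := by omega
  simp only [faceTerm, Cell.faceK, Cell.faceM, Cell.faceL, insPos, insLetter, Cell.sgnExp, h1, h2,
    h3, top_eq, Nat.add_sub_cancel, Nat.add_sub_cancel_left, if_false, if_true, zero_ne_one, one_ne_zero,
    reduceCtorEq, OfNat.ofNat_ne_zero, OfNat.ofNat_ne_one, insertIdx_replicate_append_low]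
  congr 1
  have hj2 : ∀ x : ZMod 2, x + x ^ 2 = 0 := by decide
  refine neg_one_pow_congr ?_
  push_cast; ring_nf; reduce_mod_char; rw [hj2, zero_add]

/-- The coboundary on the word of `I^κ × F_m × I^l` is the sum over the faces. -/
lemma delta_top (κ m l : ℕ) (X : List Letter → R) :
    delta (top κ m l) X = ∑ q ∈ Cell.adms (κ + m + l) m, faceTerm κ m l X q := by
  rw [top_eq, delta_replicate_append]
  cases m with
  | zero =>
    have hs := delta_replicate_append l [] (after p fun v => X (List.replicate κ k ++ v))
    simp only [delta, mul_zero, add_zero, List.append_nil] at hs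
    simp only [core, delta]
    rw [hs, sum_adms_zero, show κ + 0 + l = l + κ by omega, Finset.sum_range_add, add_comm]
    congr 1
    · rw [Finset.mul_sum]
      refine Finset.sum_congr rfl fun j hj => ?_
      have := faceTerm_high κ 0 l j (Finset.mem_range.1 hj) [p] (fun _ => rfl) rfl X
      simp only [zero_add, add_zero] at this
      rw [this, pow_add]
      simp [after]; ring
    · refine Finset.sum_congr rfl fun j hj => ?_
      have := faceTerm_low κ 0 l j (Finset.mem_range.1 hj) X
      simp only [zero_add] at this
      exact this.symm
  | succ m =>
    have hs := fun X : List Letter → R => delta_replicate_append l [] X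
    simp only [delta, mul_zero, add_zero, List.append_nil] at hs
    rw [show κ + (m + 1) + l = (m + l + κ) + 1 by omega, sum_adms_succ (by omega),
      Finset.sum_range_add, Finset.sum_range_add]
    simp only [core, delta]
    rw [delta_replicate_append, move_replicate_append]
    simp only [delta, hs]
    have f1 := fun j hj => faceTerm_low κ (m + 1) l j hj X
    have f2 := fun j hj => faceTerm_high κ (m + 1) l j hj
      (b :: (List.replicate m k ++ [z])) (fun _ => by simp [core]) (by simp) X
    have t1 : ∀ j, m + 1 + l + j + 1 = m + l + j + 2 := fun j => by omega
    have t2 : ∀ j, m + 1 + j + 1 = m + j + 2 := fun j => by omega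
    simp only [t1] at f1
    simp only [t2] at f2
    have e1 : ∑ j ∈ Finset.range κ, (faceTerm κ (m + 1) l X (0, m + l + j + 2) +
        faceTerm κ (m + 1) l X (1, m + l + j + 2)) = _ :=
      Finset.sum_congr rfl fun j hj => f1 j (Finset.mem_range.1 hj)
    have e2 : ∑ j ∈ Finset.range l, (faceTerm κ (m + 1) l X (0, m + j + 2) +
        faceTerm κ (m + 1) l X (1, m + j + 2)) = _ :=
      Finset.sum_congr rfl fun j hj => f2 j (Finset.mem_range.1 hj)
    have e3 : ∑ j ∈ Finset.range m, (faceTerm κ (m + 1) l X (0, j + 2) +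
        faceTerm κ (m + 1) l X (1, j + 2)) = _ :=
      Finset.sum_congr rfl fun j hj => faceTerm_mid κ m l j (Finset.mem_range.1 hj) X
    have e4 : ∑ j ∈ Finset.range (m + 1), faceTerm κ (m + 1) l X (2, j + 1) = _ :=
      Finset.sum_congr rfl fun j hj => faceTerm_special κ m l j (Finset.mem_range.1 hj) X
    rw [e1, e2, e3, e4, faceTerm_first]
    simp only [after, core, pow_add, Finset.mul_sum, mul_sub, mul_add, Finset.sum_add_distrib, Finset.sum_sub_distrib,
      Finset.sum_neg_distrib, List.cons_append, List.append_assoc, mul_assoc, pow_one,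
      List.nil_append]
    simp only [mul_neg, neg_mul, one_mul, mul_one, Finset.sum_neg_distrib]
    ring

end top

section faces

/-- `w` is a word of a proper face. -/
def Proper (κ m l : ℕ) (w : List Letter) : Prop :=
  ∃ d i v, Cell.Adm (κ + m + l) m d i ∧
    FaceWord (Cell.faceK κ m l d i) (Cell.faceM m d i) (Cell.faceL m l d i) v ∧
    w = v.insertIdx (insPos κ m l d i) (insLetter d)

lemma PlainWord.eq_or_insertIdx {l : ℕ} {w : List Letter} (h : PlainWord l w) :
    w = List.replicate l k ∨ ∃ r d j v, l = r + 1 ∧ d ≤ 1 ∧ j ≤ r ∧ PlainWord r v ∧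
      w = v.insertIdx j (insLetter d) := by
  induction l generalizing w with
  | zero => exact Or.inl h
  | succ l ih => cases w with
    | nil => exact h.elim
    | cons a w =>
      obtain ⟨ha, h⟩ := h
      rcases ha with rfl | rfl | rfl
      · rcases ih h with rfl | ⟨r, d, j, v, rfl, hd, hj, hv, rfl⟩
        · exact Or.inl rfl
        · exact Or.inr ⟨r + 1, d, j + 1, k :: v, rfl, hd, by omega, .cons isPlain_k hv, rfl⟩
      · exact Or.inr ⟨l, 1, 0, w, rfl, le_rfl, by omega, h, rfl⟩
      · exact Or.inr ⟨l, 0, 0, w, rfl, by omega, by omega, h, rfl⟩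

lemma TailWord.eq_insertIdx {m l : ℕ} {w : List Letter} (h : TailWord m l w) :
    ∃ v, PlainWord (m + l) v ∧ w = v.insertIdx m z := by
  induction m generalizing w with
  | zero => cases w with
    | nil => exact h.elim
    | cons a w => obtain ⟨rfl, h⟩ := h; exact ⟨w, by simpa using h, rfl⟩
  | succ m ih => cases w with
    | nil => exact h.elim
    | cons a w =>
      obtain ⟨ha, h⟩ := h
      obtain ⟨v, hv, rfl⟩ := ih h
      refine ⟨a :: v, ?_, rfl⟩
      rw [Nat.add_right_comm]
      exact .cons ha hv

lemma TailWord.eq_or_insertIdx {m l : ℕ} {w : List Letter} (h : TailWord m l w) :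
    w = List.replicate m k ++ z :: List.replicate l k ∨
    (∃ r j v, m = r + 1 ∧ j ≤ r ∧ TailWord r l v ∧ w = v.insertIdx j e) ∨
    (∃ j r v, m = j + r + 1 ∧ TailWord j (r + l) v ∧ w = v.insertIdx m z) ∨
    (∃ r d j v, l = r + 1 ∧ d ≤ 1 ∧ j ≤ r ∧ TailWord m r v ∧
      w = v.insertIdx (m + 1 + j) (insLetter d)) := by
  induction m generalizing w with
  | zero => cases w with
    | nil => exact h.elim
    | cons a w =>
      obtain ⟨rfl, h⟩ := h
      rcases h.eq_or_insertIdx with rfl | ⟨r, d, j, v, rfl, hd, hj, hv, rfl⟩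
      · exact Or.inl rfl
      · refine Or.inr (Or.inr (Or.inr ⟨r, d, j, z :: v, rfl, hd, hj, .zero hv, ?_⟩))
        rw [zero_add, add_comm 1 j]; rfl
  | succ m ih => cases w with
    | nil => exact h.elim
    | cons a w =>
      obtain ⟨ha, h⟩ := h
      rcases ha with rfl | rfl | rfl
      · rcases ih h with rfl | ⟨r, j, v, rfl, hj, hv, rfl⟩ | ⟨j, r, v, rfl, hv, rfl⟩ |
          ⟨r, d, j, v, rfl, hd, hj, hv, rfl⟩
        · exact Or.inl rfl
        · exact Or.inr (Or.inl ⟨r + 1, j + 1, k :: v, rfl, by omega, .cons isPlain_k hv, rfl⟩)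
        · exact Or.inr (Or.inr (Or.inl ⟨j + 1, r, k :: v, by omega, .cons isPlain_k hv, rfl⟩))
        · refine Or.inr (Or.inr (Or.inr ⟨r, d, j, k :: v, rfl, hd, hj, .cons isPlain_k hv, ?_⟩))
          rw [show m + 1 + 1 + j = m + 1 + j + 1 by omega]; rfl
      · exact Or.inr (Or.inl ⟨m, 0, w, rfl, by omega, h, rfl⟩)
      · obtain ⟨v, hv, rfl⟩ := h.eq_insertIdx
        exact Or.inr (Or.inr (Or.inl ⟨0, m, z :: v, by omega, .zero hv, rfl⟩))

lemma MovedWord.faceWord {m l : ℕ} {w : List Letter} (h : MovedWord m l w) :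
    ∃ i r, m = i + r ∧ FaceWord i r l w := by
  induction m generalizing w with
  | zero => cases w with
    | nil => exact h.elim
    | cons a w => obtain ⟨rfl, h⟩ := h; exact ⟨0, 0, rfl, .zero h⟩
  | succ m ih => cases w with
    | nil => exact h.elim
    | cons a w =>
      rcases h with ⟨ha, h⟩ | ⟨ha, h⟩
      · obtain ⟨i, r, rfl, h'⟩ := ih h
        exact ⟨i + 1, r, by omega, .cons ha h'⟩
      · exact ⟨0, m + 1, by omega, Or.inl ⟨ha, h⟩⟩

lemma FaceWord.eq_top_or_proper {κ m l : ℕ} {w : List Letter} (h : FaceWord κ m l w) :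
    w = top κ m l ∨ Proper κ m l w := by
  induction κ generalizing w with
  | zero => cases w with
    | nil => cases m <;> exact h.elim
    | cons a w =>
      cases m with
      | zero =>
        obtain ⟨rfl, h⟩ := h
        rcases h.eq_or_insertIdx with rfl | ⟨r, d, j, v, rfl, hd, hj, hv, rfl⟩
        · exact Or.inl rfl
        · refine Or.inr ⟨d, j + 1, p :: v, ?_, ?_, ?_⟩
          · unfold Cell.Adm; omega
          · have h1 : d ≠ 2 := by omega
            have h2 : j ≤ r := hj
            have e1 : Cell.faceK 0 0 (r + 1) d (j + 1) = 0 := by unfold Cell.faceK; split_ifs <;> omega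
            have e2 : Cell.faceM 0 d (j + 1) = 0 := by unfold Cell.faceM; split_ifs <;> omega
            have e3 : Cell.faceL 0 (r + 1) d (j + 1) = r := by unfold Cell.faceL; split_ifs <;> omega
            rw [e1, e2, e3]
            exact .zero hv
          · have e : insPos 0 0 (r + 1) d (j + 1) = j + 1 := by unfold insPos; split_ifs <;> omega
            rw [e]; rfl
      | succ m =>
        rcases h with ⟨ha, h⟩ | ⟨rfl, h⟩
        · rcases ha with rfl | rfl
          · rcases h.eq_or_insertIdx with rfl | ⟨r, j, v, rfl, hj, hv, rfl⟩ |
              ⟨j, r, v, rfl, hv, rfl⟩ | ⟨r, d, j, v, rfl, hd, hj, hv, rfl⟩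
            · exact Or.inl rfl
            · refine Or.inr ⟨1, j + 2, b :: v, ?_, ?_, ?_⟩
              · unfold Cell.Adm; omega
              · have e1 : Cell.faceK 0 (r + 1 + 1) l 1 (j + 2) = 0 := by simp [Cell.faceK]
                have e2 : Cell.faceM (r + 1 + 1) 1 (j + 2) = r + 1 := by simp [Cell.faceM]; omega
                have e3 : Cell.faceL (r + 1 + 1) l 1 (j + 2) = l := by simp [Cell.faceL]; omega
                rw [e1, e2, e3]
                exact .base_kept hv
              · have e : insPos 0 (r + 1 + 1) l 1 (j + 2) = j + 1 := by simp [insPos]; omega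
                rw [e]; rfl
            · refine Or.inr ⟨0, j + 2, b :: v, ?_, ?_, ?_⟩
              · unfold Cell.Adm; omega
              · have e1 : Cell.faceK 0 (j + r + 1 + 1) l 0 (j + 2) = 0 := by simp [Cell.faceK]
                have e2 : Cell.faceM (j + r + 1 + 1) 0 (j + 2) = j + 1 := by simp [Cell.faceM]
                have e3 : Cell.faceL (j + r + 1 + 1) l 0 (j + 2) = r + l := by simp [Cell.faceL]; omega
                rw [e1, e2, e3]
                exact .base_kept hv
              · have e : insPos 0 (j + r + 1 + 1) l 0 (j + 2) = j + r + 1 + 1 := by simp [insPos]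
                rw [e]; rfl
            · refine Or.inr ⟨d, m + j + 2, b :: v, ?_, ?_, ?_⟩
              · unfold Cell.Adm; omega
              · have e1 : Cell.faceK 0 (m + 1) (r + 1) d (m + j + 2) = 0 := by unfold Cell.faceK; split_ifs <;> omega
                have e2 : Cell.faceM (m + 1) d (m + j + 2) = m + 1 := by unfold Cell.faceM; split_ifs <;> omega
                have e3 : Cell.faceL (m + 1) (r + 1) d (m + j + 2) = r := by unfold Cell.faceL; split_ifs <;> omega
                rw [e1, e2, e3]
                exact .base_kept hv
              · have e : insPos 0 (m + 1) (r + 1) d (m + j + 2) = m + 1 + j + 1 := by unfold insPos; split_ifs <;> omega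
                rw [e]; rfl
          · obtain ⟨v, hv, rfl⟩ := h.eq_insertIdx
            refine Or.inr ⟨0, 1, p :: v, ?_, ?_, ?_⟩
            · unfold Cell.Adm; omega
            · have e1 : Cell.faceK 0 (m + 1) l 0 1 = 0 := by simp [Cell.faceK]
              have e2 : Cell.faceM (m + 1) 0 1 = 0 := by simp [Cell.faceM]
              have e3 : Cell.faceL (m + 1) l 0 1 = m + l := by simp [Cell.faceL]; omega
              rw [e1, e2, e3]
              exact .zero hv
            · have e : insPos 0 (m + 1) l 0 1 = m + 1 := by simp [insPos]
              rw [e]; rfl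
        · obtain ⟨i, r, rfl, h'⟩ := h.faceWord
          refine Or.inr ⟨2, i + 1, w, ?_, ?_, ?_⟩
          · unfold Cell.Adm; omega
          · have e1 : Cell.faceK 0 (i + r + 1) l 2 (i + 1) = i := by simp [Cell.faceK]
            have e2 : Cell.faceM (i + r + 1) 2 (i + 1) = r := by simp [Cell.faceM]
            have e3 : Cell.faceL (i + r + 1) l 2 (i + 1) = l := by simp [Cell.faceL]
            rw [e1, e2, e3]
            exact h'
          · simp [insPos, insLetter]
  | succ κ ih => cases w with
    | nil => exact h.elim
    | cons a w =>
      obtain ⟨ha, h⟩ := h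
      have low : ∀ d, d ≤ 1 → Proper (κ + 1) m l (insLetter d :: w) := by
        intro d hd
        refine ⟨d, m + l + 1, w, ?_, ?_, ?_⟩
        · unfold Cell.Adm; omega
        · have e1 : Cell.faceK (κ + 1) m l d (m + l + 1) = κ := by unfold Cell.faceK; split_ifs <;> omega
          have e2 : Cell.faceM m d (m + l + 1) = m := by unfold Cell.faceM; split_ifs <;> omega
          have e3 : Cell.faceL m l d (m + l + 1) = l := by unfold Cell.faceL; split_ifs <;> omega
          rw [e1, e2, e3]
          exact h
        · have e : insPos (κ + 1) m l d (m + l + 1) = 0 := by unfold insPos; split_ifs <;> omega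
          rw [e]; rfl
      rcases ha with rfl | rfl | rfl
      · rcases ih h with rfl | ⟨d, i, v, hA, hv, rfl⟩
        · exact Or.inl rfl
        · unfold Cell.Adm at hA
          refine Or.inr ⟨d, if d ≠ 2 ∧ m + l < i then i + 1 else i, k :: v, ?_, ?_, ?_⟩
          · unfold Cell.Adm; split_ifs <;> omega
          · have e1 : Cell.faceK (κ + 1) m l d (if d ≠ 2 ∧ m + l < i then i + 1 else i) =
                Cell.faceK κ m l d i + 1 := by
              unfold Cell.faceK; split_ifs <;> omega
            have e2 : Cell.faceM m d (if d ≠ 2 ∧ m + l < i then i + 1 else i) =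
                Cell.faceM m d i := by
              unfold Cell.faceM; split_ifs <;> omega
            have e3 : Cell.faceL m l d (if d ≠ 2 ∧ m + l < i then i + 1 else i) =
                Cell.faceL m l d i := by
              unfold Cell.faceL; split_ifs <;> omega
            rw [e1, e2, e3]
            exact .cons isPlain_k hv
          · have e : insPos (κ + 1) m l d (if d ≠ 2 ∧ m + l < i then i + 1 else i) =
                insPos κ m l d i + 1 := by
              unfold insPos; split_ifs <;> omega
            rw [e]; rfl
      · exact Or.inr (low 1 le_rfl)
      · exact Or.inr (low 0 (by omega))

end faces

end Word
end
end Freehedral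

namespace Freehedral
noncomputable section
namespace Word
open Letter
variable {Y : Type u} [TopologicalSpace Y]

lemma deg_replicate (l : ℕ) : deg (List.replicate l k) = l := by
  induction l with
  | zero => rfl
  | succ l ih => simp [List.replicate_succ, deg, ih]

lemma headDeg_replicate (m l : ℕ) :
    headDeg (List.replicate m k ++ z :: List.replicate l k) = m := by
  induction m with
  | zero => rfl
  | succ m ih => simp [List.replicate_succ, headDeg, ih]

lemma tailDeg_replicate (m l : ℕ) :
    tailDeg (List.replicate m k ++ z :: List.replicate l k) = l := by
  induction m with
  | zero => simp [tailDeg, deg_replicate]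
  | succ m ih => simp [List.replicate_succ, tailDeg, ih]

lemma top_dims (κ m l : ℕ) :
    kdim (top κ m l) = κ ∧ mdim (top κ m l) = m ∧ ldim (top κ m l) = l ∧ base (top κ m l) = κ := by
  induction κ with
  | zero => cases m <;>
      simp [top, kdim, mdim, ldim, base, deg_replicate, headDeg_replicate, tailDeg_replicate]
  | succ κ ih =>
    change kdim (k :: top κ m l) = _ ∧ mdim (k :: top κ m l) = _ ∧ ldim (k :: top κ m l) = _ ∧
      base (k :: top κ m l) = _
    simp [kdim, mdim, ldim, base, ih]

lemma raw_replicate_append (n : ℕ) (w : List Letter) (t : ℕ → unitInterval) (j : ℕ) :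
    raw (List.replicate n k ++ w) t j =
      if j < n then t j else raw w (fun i => t (i + n)) (j - n) := by
  induction n generalizing t j with
  | zero => simp
  | succ n ih =>
    cases j with
    | zero => simp [List.replicate_succ, raw, value]
    | succ j =>
      simp only [List.replicate_succ, List.cons_append, raw, ih, rest, true_or, if_true,
        Nat.succ_lt_succ_iff, Nat.add_sub_add_right]
      rfl

lemma TailWord.deg_eq {m l : ℕ} {w : List Letter} (h : TailWord m l w) :
    deg w = headDeg w + tailDeg w := by
  induction m generalizing w with
  | zero => cases w with
    | nil => exact h.elim
    | cons a w => obtain ⟨rfl, h⟩ := h; simp [deg, headDeg, tailDeg]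
  | succ m ih => cases w with
    | nil => exact h.elim
    | cons a w =>
      obtain ⟨ha, h⟩ := h
      have := ih h
      rcases ha with rfl | rfl | rfl <;> simp [deg, headDeg, tailDeg] <;> omega

lemma MovedWord.deg_eq {m l : ℕ} {w : List Letter} (h : MovedWord m l w) :
    deg w = kdim w + mdim w + ldim w := by
  induction m generalizing w with
  | zero => cases w with
    | nil => exact h.elim
    | cons a w => obtain ⟨rfl, h⟩ := h; simp [deg, kdim, mdim, ldim]
  | succ m ih => cases w with
    | nil => exact h.elim
    | cons a w =>
      rcases h with ⟨ha, h⟩ | ⟨rfl | rfl, h⟩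
      · have := ih h
        rcases ha with rfl | rfl | rfl <;> simp [deg, kdim, mdim, ldim] <;> omega
      · have := h.deg_eq
        simp [deg, kdim, mdim, ldim]; omega
      · simp [deg, kdim, mdim, ldim]

lemma FaceWord.deg_eq {κ m l : ℕ} {w : List Letter} (h : FaceWord κ m l w) :
    deg w = kdim w + mdim w + ldim w := by
  induction κ generalizing w with
  | zero => cases w with
    | nil => cases m <;> exact h.elim
    | cons a w =>
      cases m with
      | zero => obtain ⟨rfl, h⟩ := h; simp [deg, kdim, mdim, ldim]
      | succ m =>
        rcases h with ⟨rfl | rfl, h⟩ | ⟨rfl, h⟩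
        · have := h.deg_eq
          simp [deg, kdim, mdim, ldim]; omega
        · simp [deg, kdim, mdim, ldim]
        · have := h.deg_eq
          simp [deg, kdim, mdim, ldim]; omega
  | succ κ ih => cases w with
    | nil => exact h.elim
    | cons a w =>
      obtain ⟨ha, h⟩ := h
      have := ih h
      rcases ha with rfl | rfl | rfl <;> simp [deg, kdim, mdim, ldim] <;> omega

lemma wordVal_top (κ m l : ℕ) (t : ℕ → unitInterval) {j : ℕ} (hj : j < κ + m + l) :
    wordVal κ m (top κ m l) t j = t j := by
  have hp : ∀ j x, place κ κ j x = x := fun j x => by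
    unfold place
    simp
    omega
  unfold wordVal
  rw [(top_dims κ m l).2.2.2, hp, hp, top_eq]
  simp only [raw_replicate_append]
  cases m with
  | zero =>
    split_ifs with h1 h2 h3
    · rfl
    · omega
    · omega
    · rw [core]
      obtain ⟨i, rfl⟩ := Nat.exists_eq_add_of_le (show κ ≤ j by omega)
      rw [show κ + i + 1 - κ = i + 1 by omega]
      have := raw_replicate_append l [] (fun i => t (i + κ)) i
      simp only [List.append_nil] at this
      simp only [raw, rest, reduceCtorEq, or_false, if_false, this]
      rw [if_pos (by omega), add_comm]
  | succ m =>
    have hr : ∀ i t, raw (core (m + 1) l) t i = if i ≤ m then t i else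
        raw (z :: List.replicate l k) (fun i => t (i + m + 1)) (i - m - 1) := by
      intro i t
      rw [core]
      cases i with
      | zero => simp [raw, value]
      | succ i =>
        simp only [raw, rest, or_true, if_true, raw_replicate_append, Nat.succ_le_iff]
        split_ifs
        · rfl
        · rw [show i + 1 - m - 1 = i - m by omega]
    split_ifs with h1 h2 h3
    · rfl
    · rw [hr, if_pos (by omega), Nat.sub_add_cancel (by omega)]
    · omega
    · rw [hr, if_neg (by omega)]
      obtain ⟨i, rfl⟩ := Nat.exists_eq_add_of_le (show κ + (m + 1) ≤ j by omega)
      rw [show κ + (m + 1) + i + 1 - κ - m - 1 = i + 1 by omega]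
      have := raw_replicate_append l [] (fun i => t (i + m + 1 + κ)) i
      simp only [List.append_nil] at this
      simp only [raw, rest, reduceCtorEq, or_false, if_false, this]
      rw [if_pos (by omega)]
      congr 1
      omega

lemma realize_top {n : ℕ} (c : Cell Y n) : realize c (top c.k c.m c.l) = ⟨n, c⟩ := by
  obtain ⟨h1, h2, h3, -⟩ := top_dims c.k c.m c.l
  have hd := c.dim_eq
  refine anyCell_ext h1 h2 h3 fun t => ?_
  simp only [realize, ContinuousMap.comp_apply]
  refine congrArg c.map (funext fun j => ?_)
  change wordVal c.k c.m (top c.k c.m c.l) (coord _) j = t j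
  rw [wordVal_top _ _ _ _ (by omega), coord_restrict _ _ (by omega)]

lemma face_shape {n : ℕ} (c : Cell Y (n + 1)) {d i : ℕ} (hA : Cell.Adm (n + 1) c.m d i) :
    (Cell.face d i c).k = Cell.faceK c.k c.m c.l d i ∧
    (Cell.face d i c).m = Cell.faceM c.m d i ∧ (Cell.face d i c).l = Cell.faceL c.m c.l d i := by
  obtain ⟨h1, h2, -⟩ := Cell.face_spec c d i hA
  refine ⟨h2, h1, ?_⟩
  have h3 := (Cell.face d i c).dim_eq
  have h4 := c.dim_eq
  rw [h1, h2] at h3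
  unfold Cell.Adm at hA
  rcases hA with ⟨rfl, h⟩ | ⟨rfl, h⟩ | ⟨rfl, h⟩
  · simp [Cell.faceK, Cell.faceM, Cell.faceL] at *; split_ifs at * <;> omega
  · simp [Cell.faceK, Cell.faceM, Cell.faceL] at *; split_ifs at * <;> omega
  · simp [Cell.faceK, Cell.faceM, Cell.faceL] at *; omega

variable {R : Type*} [CommRing R]

/-- The coboundary of a function on cells. -/
def cob (g : AnyCell Y → R) : AnyCell Y → R
  | ⟨0, _⟩ => 0
  | ⟨n + 1, c⟩ => ∑ q ∈ Cell.adms (n + 1) c.m,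
      (-1) ^ Cell.sgnExp (n + 1) q.1 q.2 * g ⟨n, Cell.face q.1 q.2 c⟩

/-- The function on words that is induced by a function on cells and a cell. -/
def wordFn (g : AnyCell Y → R) {n : ℕ} (c : Cell Y n) : List Letter → R := fun w =>
  (-1) ^ (kdim w * (mdim w + ldim w)) * g (realize c w)

lemma wordFn_top (g : AnyCell Y → R) {n : ℕ} (c : Cell Y n) :
    wordFn g c (top c.k c.m c.l) = (-1) ^ (c.k * (c.m + c.l)) * g ⟨n, c⟩ := by
  obtain ⟨h1, h2, h3, -⟩ := top_dims c.k c.m c.l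
  unfold wordFn
  rw [h1, h2, h3, realize_top]

lemma wordFn_face (g : AnyCell Y → R) {n : ℕ} (c : Cell Y (n + 1)) {d i : ℕ}
    (hA : Cell.Adm (n + 1) c.m d i) {w : List Letter}
    (hw : FaceWord (Cell.face d i c).k (Cell.face d i c).m (Cell.face d i c).l w) :
    wordFn g (Cell.face d i c) w =
      ins (insPos c.k c.m c.l d i) (insLetter d) (wordFn g c) w := by
  obtain ⟨s1, s2, s3⟩ := face_shape c hA
  rw [s1, s2, s3] at hw
  obtain ⟨d1, d2, d3⟩ := hw.dims_insertIdx (insertable c.dim_eq hA).1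
  unfold ins wordFn
  rw [d1, d2, d3, realize_face c hA hw]

/-- If the values of `X` on the words of the faces are those of a function on cells, then so is the
value of the coboundary of `X`. -/
lemma delta_top_eq (G : AnyCell Y → R) {n : ℕ} (c : Cell Y n) (X : List Letter → R)
    (hX : ∀ (n' : ℕ) (c' : Cell Y (n' + 1)) (d i : ℕ), n = n' + 1 → HEq c c' →
      Cell.Adm (n' + 1) c'.m d i →
      ins (insPos c'.k c'.m c'.l d i) (insLetter d) X
        (top (Cell.face d i c').k (Cell.face d i c').m (Cell.face d i c').l) =
      (-1) ^ ((Cell.face d i c').k * ((Cell.face d i c').m + (Cell.face d i c').l)) *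
        G ⟨n', Cell.face d i c'⟩) :
    delta (top c.k c.m c.l) X = (-1) ^ (c.k * (c.m + c.l)) * cob G ⟨n, c⟩ := by
  rw [delta_top, c.dim_eq]
  have hd := c.dim_eq
  cases n with
  | zero =>
    have : c.m = 0 := by omega
    simp [cob, this, sum_adms_zero]
  | succ n =>
    rw [cob, Finset.mul_sum]
    refine Finset.sum_congr rfl fun q hq => ?_
    have hA := (Cell.mem_adms (show c.m ≤ n + 1 by omega)).1 hq
    have h := hX n c q.1 q.2 rfl HEq.rfl hA
    obtain ⟨s1, s2, s3⟩ := face_shape c hA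
    rw [s1, s2, s3] at h
    unfold ins at h
    rw [faceTerm, h, c.dim_eq, pow_add, pow_add]
    set a := Cell.faceK c.k c.m c.l q.1 q.2 * (Cell.faceM c.m q.1 q.2 + Cell.faceL c.m c.l q.1 q.2)
    have h2 : ((-1 : R) ^ a) * (-1) ^ a = 1 := by rw [← mul_pow]; simp
    linear_combination (((-1 : R) ^ Cell.sgnExp (n + 1) q.1 q.2) * (-1) ^ (c.k * (c.m + c.l)) *
      G ⟨n, Cell.face q.1 q.2 c⟩) * h2

/-- The coboundary of words is the coboundary of cells. -/
lemma delta_wordFn (g : AnyCell Y → R) {n : ℕ} (c : Cell Y n) {w : List Letter}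
    (hw : FaceWord c.k c.m c.l w) : delta w (wordFn g c) = wordFn (cob g) c w := by
  induction n generalizing w with
  | zero =>
    rcases hw.eq_top_or_proper with rfl | ⟨d, i, v, hA, -⟩
    · rw [wordFn_top]
      refine delta_top_eq g c _ fun n' c' d i h _ _ => ?_
      omega
    · have := c.dim_eq
      unfold Cell.Adm at hA
      omega
  | succ n ih =>
    rcases hw.eq_top_or_proper with rfl | ⟨d, i, v, hA, hv, rfl⟩
    · rw [wordFn_top]
      refine delta_top_eq g c _ fun n' c' d i h hc hA => ?_
      obtain rfl : n = n' := by omega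
      obtain rfl := eq_of_heq hc
      rw [← wordFn_face g c hA (faceWord_top _ _ _), wordFn_top]
    · rw [c.dim_eq] at hA
      obtain ⟨s1, s2, s3⟩ := face_shape c hA
      rw [← delta_ins _ hv (insertable c.dim_eq hA).1]
      rw [← s1, ← s2, ← s3] at hv
      rw [← delta_congr hv fun v hv => wordFn_face g c hA hv, ih _ hv, wordFn_face _ c hA hv]
      rfl

/-- The product of functions on cells. -/
def cellCup (g h : AnyCell Y → R) (c : AnyCell Y) : R :=
  (-1) ^ (c.2.k * (c.2.m + c.2.l)) * cup (top c.2.k c.2.m c.2.l) (wordFn g c.2) (wordFn h c.2)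

lemma delta_cup (g h : AnyCell Y → R) {n : ℕ} (c : Cell Y n) :
    delta (top c.k c.m c.l) (fun v => cup v (wordFn g c) (wordFn h c)) =
      (-1) ^ (c.k * (c.m + c.l)) * cob (cellCup g h) ⟨n, c⟩ := by
  refine delta_top_eq _ c _ fun n' c' d i hn hc hA => ?_
  subst hn
  obtain rfl := eq_of_heq hc
  obtain ⟨s1, s2, s3⟩ := face_shape c hA
  obtain ⟨h1, h2⟩ := insertable c.dim_eq hA
  have hd := (Cell.face d i c).dim_eq
  unfold cellCup
  simp only
  rw [← mul_assoc, ← mul_pow]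
  simp only [mul_neg, mul_one, neg_neg, one_pow, one_mul]
  rw [cup_congr (fun v hv => wordFn_face g c hA hv) (fun v hv => wordFn_face h c hA hv),
    cup_ins _ _ (by rwa [s1, s2]) (by omega)]
  rfl

lemma Plain.replicate_append {w : List Letter} (h : Plain w) (n : ℕ) :
    Plain (List.replicate n k ++ w) := by
  induction n with
  | zero => exact h
  | succ n ih => rw [List.replicate_succ, List.cons_append, plain_cons]; exact ⟨by simp, ih⟩

lemma atMostOneBase_top (κ m l : ℕ) : AtMostOneBase (top κ m l) := by
  have h0 : Plain ([] : List Letter) := by simp [Plain]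
  have h1 : Plain (List.replicate l k) := by simpa using h0.replicate_append l
  induction κ with
  | zero => cases m with
    | zero => exact h1
    | succ m => exact (plain_cons.2 ⟨by simp, h1⟩ : Plain (z :: _)).replicate_append m
  | succ κ ih => exact ih

/-- The Leibniz rule for functions on cells. -/
lemma cob_cellCup (g h : AnyCell Y → R) (c : AnyCell Y) :
    cob (cellCup g h) c = cellCup (cob g) h c +
      cellCup (fun c => (-1) ^ c.1 * g c) (cob h) c := by
  obtain ⟨n, c⟩ := c
  have h1 := delta_cup g h c
  rw [(cup_leibniz_aux (top c.k c.m c.l) _ _).1 (atMostOneBase_top _ _ _),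
    cup_congr (X := coB (wordFn g c)) (X' := wordFn (cob g) c) (Y' := wordFn h c)
      (fun v hv => delta_wordFn g c hv) (fun _ _ => rfl),
    cup_congr (X := twist (wordFn g c)) (X' := wordFn (fun c => (-1) ^ c.1 * g c) c)
      (Y := coB (wordFn h c)) (Y' := wordFn (cob h) c) (fun v hv => ?_)
      (fun v hv => delta_wordFn h c hv)] at h1
  · have h2 : ((-1 : R) ^ (c.k * (c.m + c.l))) * (-1) ^ (c.k * (c.m + c.l)) = 1 := by
      rw [← mul_pow]; simp
    unfold cellCup
    simp only
    rw [← mul_add, h1, ← mul_assoc, h2, one_mul]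
    rfl
  · unfold twist wordFn
    rw [hv.deg_eq]
    simp only [realize]
    ring

end Word
end
end Freehedral

namespace Freehedral
noncomputable section
namespace Word
open Letter

/-- The list `f a, f (a + 1), …` of length `n`. -/
def block (f : ℕ → Letter) : ℕ → ℕ → List Letter
  | _, 0 => []
  | a, n + 1 => f a :: block f (a + 1) n

/-- The word of a face of `I^κ × F_m × I^l` with the letters `f` of the directions, and the letter
`τ` after those of `F_m`. -/
def word (κ m l : ℕ) (τ : Letter) (f : ℕ → Letter) : List Letter :=
  block f (m + l + 1) κ ++ (block f 1 m ++ τ :: block f (m + 1) l)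

lemma block_length (f : ℕ → Letter) (a n : ℕ) : (block f a n).length = n := by
  induction n generalizing a with
  | zero => rfl
  | succ n ih => simp [block, ih]

lemma block_add (f : ℕ → Letter) (a n n' : ℕ) :
    block f a (n + n') = block f a n ++ block f (a + n) n' := by
  induction n generalizing a with
  | zero => simp [block]
  | succ n ih =>
    rw [Nat.add_right_comm, block, ih, block, List.cons_append, Nat.add_right_comm a 1 n]
    rfl

lemma block_succ (f : ℕ → Letter) (a n : ℕ) : block f a (n + 1) = block f a n ++ [f (a + n)] := by
  rw [block_add]; rfl

lemma block_congr {f g : ℕ → Letter} {a a' n : ℕ} (h : ∀ i < n, f (a + i) = g (a' + i)) :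
    block f a n = block g a' n := by
  induction n generalizing a a' with
  | zero => rfl
  | succ n ih =>
    rw [block, block]
    congr 1
    · exact h 0 (by omega)
    · refine ih fun i hi => ?_
      have := h (i + 1) (by omega)
      rwa [show a + 1 + i = a + (i + 1) by omega, show a' + 1 + i = a' + (i + 1) by omega]

lemma word_congr {κ m l : ℕ} {τ : Letter} {f g : ℕ → Letter}
    (h : ∀ i, 1 ≤ i → i ≤ κ + m + l → f i = g i) : word κ m l τ f = word κ m l τ g := by
  unfold word
  rw [block_congr (g := g) (a' := m + l + 1) fun i hi => h _ (by omega) (by omega),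
    block_congr (n := m) (g := g) (a' := 1) fun i hi => h _ (by omega) (by omega),
    block_congr (n := l) (g := g) (a' := m + 1) fun i hi => h _ (by omega) (by omega)]

lemma insertIdx_block_append (f : ℕ → Letter) (a j r : ℕ) (c : Letter) (B : List Letter) :
    (block f a (j + r) ++ B).insertIdx j c = block f a j ++ c :: (block f (a + j) r ++ B) := by
  have := insertIdx_append_right (block f a j) (block f (a + j) r ++ B) 0 c
  rw [block_length] at this
  rw [block_add, List.append_assoc]
  exact this

lemma insertIdx_block_add (f : ℕ → Letter) (a n π : ℕ) (c : Letter) (B : List Letter) :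
    (block f a n ++ B).insertIdx (n + π) c = block f a n ++ B.insertIdx π c := by
  have := insertIdx_append_right (block f a n) B π c
  rwa [block_length] at this

/-- The letters after the insertion of a direction. -/
def insDir (x : ℕ) (a : Letter) (f : ℕ → Letter) (i : ℕ) : Letter :=
  if i < x then f i else if i = x then a else f (i - 1)

lemma block_insDir_low {f : ℕ → Letter} {x a n : ℕ} {c : Letter} (h : a + n ≤ x) :
    block (insDir x c f) a n = block f a n :=
  block_congr fun i hi => if_pos (by omega)

lemma block_insDir_high {f : ℕ → Letter} {x a n : ℕ} {c : Letter} (h : x ≤ a) :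
    block (insDir x c f) (a + 1) n = block f a n :=
  block_congr fun i hi => by
    unfold insDir
    rw [if_neg (by omega), if_neg (by omega)]
    congr 1
    omega

lemma block_insDir (f : ℕ → Letter) (a j r : ℕ) (c : Letter) :
    block (insDir (a + j) c f) a (j + r + 1) = block f a j ++ c :: block f (a + j) r := by
  rw [add_assoc, block_add, block_insDir_low le_rfl, block, block_insDir_high le_rfl]
  simp [insDir]

lemma insertIdx_word_k (κ m l j : ℕ) (hj : j ≤ κ) (τ c : Letter) (f : ℕ → Letter) :
    (word κ m l τ f).insertIdx j c = word (κ + 1) m l τ (insDir (m + l + 1 + j) c f) := by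
  obtain ⟨r, rfl⟩ := Nat.exists_eq_add_of_le hj
  unfold word
  rw [insertIdx_block_append, block_insDir, block_insDir_low (by omega), block_insDir_low (by omega)]
  simp

lemma insertIdx_word_l (κ m l j : ℕ) (hj : j ≤ l) (τ c : Letter) (f : ℕ → Letter) :
    (word κ m l τ f).insertIdx (κ + (m + (j + 1))) c =
      word κ m (l + 1) τ (insDir (m + 1 + j) c f) := by
  obtain ⟨r, rfl⟩ := Nat.exists_eq_add_of_le hj
  unfold word
  have := insertIdx_block_append f (m + 1) j r c []
  simp only [List.append_nil] at this
  rw [insertIdx_block_add, insertIdx_block_add, List.insertIdx_succ_cons, this, block_insDir,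
    ← add_assoc m, block_insDir_high (by omega), block_insDir_low (by omega)]
  simp only [add_assoc]

lemma insertIdx_word_m (κ m l j : ℕ) (hj : j ≤ m) (τ c : Letter) (f : ℕ → Letter) :
    (word κ m l τ f).insertIdx (κ + j) c = word κ (m + 1) l τ (insDir (1 + j) c f) := by
  obtain ⟨r, rfl⟩ := Nat.exists_eq_add_of_le hj
  unfold word
  rw [insertIdx_block_add, insertIdx_block_append, block_insDir,
    block_insDir_high (by omega), Nat.add_right_comm (j + r), block_insDir_high (by omega)]
  simp

lemma insertIdx_word_end (κ i l r : ℕ) (τ c : Letter) (f : ℕ → Letter) :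
    (word κ i (r + l) τ f).insertIdx (κ + (i + (r + 1))) c =
      word κ (i + r + 1) l c (insDir (i + 1) τ f) := by
  unfold word
  have := insertIdx_block_append f (i + 1) r l c []
  simp only [List.append_nil] at this
  rw [insertIdx_block_add, insertIdx_block_add, List.insertIdx_succ_cons, this,
    add_comm i 1, block_insDir, show i + r + 1 + l + 1 = i + (r + l) + 1 + 1 by omega,
    block_insDir_high (by omega), block_insDir_high (by omega)]
  simp [add_comm i, add_assoc, add_left_comm]

/-- The letters after the insertion of `z` that belongs to a face `d^2_i` of a cell of
dimension `n`. -/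
def insSpecial (n i : ℕ) (f : ℕ → Letter) (j : ℕ) : Letter :=
  if j = 1 then z else if j ≤ i then f (j + n - i - 1) else f (j - i)

lemma insertIdx_word_special (κ i m l : ℕ) (τ : Letter) (f : ℕ → Letter) :
    (word (κ + i) m l τ f).insertIdx κ z =
      word κ (m + i + 1) l τ (insSpecial (κ + m + l + i + 1) (i + 1) f) := by
  unfold word
  rw [insertIdx_block_append]
  congr 1
  · refine block_congr fun j hj => ?_
    unfold insSpecial
    rw [if_neg (by omega), if_neg (by omega)]
    congr 1; omega
  · rw [show m + i + 1 = i + m + 1 by omega, block, block_add, List.cons_append, List.append_assoc]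
    change z :: _ = z :: _
    congr 1
    congr 1
    · refine block_congr fun j hj => ?_
      unfold insSpecial
      rw [if_neg (by omega), if_pos (by omega)]
      congr 1; omega
    · congr 1
      · refine block_congr fun j hj => ?_
        unfold insSpecial
        rw [if_neg (by omega), if_neg (by omega)]
        congr 1; omega
      · congr 1
        refine block_congr fun j hj => ?_
        unfold insSpecial
        rw [if_neg (by omega), if_neg (by omega)]
        congr 1; omega

lemma plainWord_block {f : ℕ → Letter} {a n : ℕ} (h : ∀ i, a ≤ i → i < a + n → IsPlain (f i)) :
    PlainWord n (block f a n) := by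
  induction n generalizing a with
  | zero => rfl
  | succ n ih => exact .cons (h a le_rfl (by omega)) (ih fun i h1 h2 => h i (by omega) (by omega))

lemma tailWord_block {f : ℕ → Letter} {a n l : ℕ} {w : List Letter}
    (h : ∀ i, a ≤ i → i < a + n → IsPlain (f i)) (hw : PlainWord l w) :
    TailWord n l (block f a n ++ z :: w) := by
  induction n generalizing a with
  | zero => exact .zero hw
  | succ n ih => exact .cons (h a le_rfl (by omega)) (ih fun i h1 h2 => h i (by omega) (by omega))

lemma movedWord_block {f : ℕ → Letter} {a n l β : ℕ} {w : List Letter}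
    (h : ∀ i, a ≤ i → i < a + n → i ≠ β → IsPlain (f i)) (h1 : a ≤ β) (h2 : β < a + n)
    (hb : f β = b ∨ f β = p) (hw : PlainWord l w) :
    MovedWord n l (block f a n ++ z :: w) := by
  induction n generalizing a with
  | zero => omega
  | succ n ih =>
    by_cases hβ : β = a
    · subst hβ
      exact Or.inr ⟨hb, tailWord_block (fun i g1 g2 => h i (by omega) (by omega) (by omega)) hw⟩
    · exact .cons (h a le_rfl (by omega) (Ne.symm hβ))
        (ih (fun i h1 h2 => h i (by omega) (by omega)) (by omega) (by omega))

lemma movedWord_block_end {f : ℕ → Letter} {a n l : ℕ} {w : List Letter}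
    (h : ∀ i, a ≤ i → i < a + n → IsPlain (f i)) (hw : PlainWord l w) :
    MovedWord n l (block f a n ++ p :: w) := by
  induction n generalizing a with
  | zero => exact .zero hw
  | succ n ih => exact .cons (h a le_rfl (by omega)) (ih fun i h1 h2 => h i (by omega) (by omega))

lemma FaceWord.block_append {f : ℕ → Letter} {a n m l : ℕ} {w : List Letter}
    (h : ∀ i, a ≤ i → i < a + n → IsPlain (f i)) (hw : FaceWord 0 m l w) :
    FaceWord n m l (block f a n ++ w) := by
  induction n generalizing a with
  | zero => exact hw
  | succ n ih => exact .cons (h a le_rfl (by omega)) (ih fun i h1 h2 => h i (by omega) (by omega))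

lemma faceWord_word_zero {κ l : ℕ} {f : ℕ → Letter}
    (h : ∀ i, 1 ≤ i → i ≤ κ + l → IsPlain (f i)) : FaceWord κ 0 l (word κ 0 l p f) :=
  .block_append (fun i h1 h2 => h i (by omega) (by omega))
    (.zero (plainWord_block fun i h1 h2 => h i (by omega) (by omega)))

lemma faceWord_word_base {κ m l : ℕ} {f : ℕ → Letter}
    (h : ∀ i, 2 ≤ i → i ≤ κ + (m + 1) + l → IsPlain (f i)) (hb : f 1 = b ∨ f 1 = p) :
    FaceWord κ (m + 1) l (word κ (m + 1) l z f) :=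
  .block_append (fun i h1 h2 => h i (by omega) (by omega))
    (Or.inl ⟨hb, tailWord_block (fun i h1 h2 => h i (by omega) (by omega))
      (plainWord_block fun i h1 h2 => h i (by omega) (by omega))⟩)

lemma faceWord_word_moved {κ m l β : ℕ} {f : ℕ → Letter}
    (h : ∀ i, 2 ≤ i → i ≤ κ + (m + 1) + l → i ≠ β → IsPlain (f i)) (h1 : f 1 = z) (hβ : 2 ≤ β)
    (hβ' : β ≤ m + 1) (hb : f β = b ∨ f β = p) :
    FaceWord κ (m + 1) l (word κ (m + 1) l z f) := by
  refine .block_append (fun i h1 h2 => h i (by omega) (by omega) (by omega)) ?_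
  rw [block, h1]
  exact .moved (movedWord_block (fun i h1 h2 => h i (by omega) (by omega)) hβ (by omega) hb
      (plainWord_block fun i h1 h2 => h i (by omega) (by omega) (by omega)))

lemma faceWord_word_moved_end {κ m l : ℕ} {f : ℕ → Letter}
    (h : ∀ i, 2 ≤ i → i ≤ κ + (m + 1) + l → IsPlain (f i)) (h1 : f 1 = z) :
    FaceWord κ (m + 1) l (word κ (m + 1) l p f) := by
  refine .block_append (fun i h1 h2 => h i (by omega) (by omega)) ?_
  rw [block, h1]
  exact .moved (movedWord_block_end (fun i h1 h2 => h i (by omega) (by omega))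
      (plainWord_block fun i h1 h2 => h i (by omega) (by omega)))

variable {Y : Type u} [TopologicalSpace Y]

/-- The word of a face of a face `d^0_x` or `d^1_x` with `x` not in the freehedral part, or of a
face `d^1_x`. -/
lemma realize_face_word {n : ℕ} (c : Cell Y (n + 1)) {d x : ℕ} (hA : Cell.Adm (n + 1) c.m d x)
    (hd : d ≠ 2) (hx : d = 1 ∨ c.m < x) {τ : Letter} {f : ℕ → Letter}
    (hw : FaceWord (Cell.face d x c).k (Cell.face d x c).m (Cell.face d x c).l
      (word (Cell.face d x c).k (Cell.face d x c).m (Cell.face d x c).l τ f)) :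
    realize (Cell.face d x c)
      (word (Cell.face d x c).k (Cell.face d x c).m (Cell.face d x c).l τ f) =
      realize c (word c.k c.m c.l τ (insDir x (insLetter d) f)) := by
  obtain ⟨s1, s2, s3⟩ := face_shape c hA
  rw [s1, s2, s3] at hw ⊢
  rw [realize_face c hA hw]
  congr 1
  have hdim := c.dim_eq
  have h1 : d ≤ 1 ∧ 1 ≤ x ∧ x ≤ n + 1 ∧ (x = 1 → c.m = 0 ∨ d = 0) := by unfold Cell.Adm at hA; omega
  clear hw s1 s2 s3
  by_cases c1 : c.m + c.l < x
  · have e1 : Cell.faceK c.k c.m c.l d x = c.k - 1 := by unfold Cell.faceK; split_ifs <;> omega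
    have e2 : Cell.faceM c.m d x = c.m := by unfold Cell.faceM; split_ifs <;> omega
    have e3 : Cell.faceL c.m c.l d x = c.l := by unfold Cell.faceL; split_ifs <;> omega
    have e4 : insPos c.k c.m c.l d x = x - (c.m + c.l) - 1 := by unfold insPos; split_ifs <;> omega
    rw [e1, e2, e3, e4, insertIdx_word_k _ _ _ _ (by omega), Nat.sub_add_cancel (by omega)]
    congr 2
    omega
  · by_cases c2 : c.m < x
    · have e1 : Cell.faceK c.k c.m c.l d x = c.k := by unfold Cell.faceK; split_ifs <;> omega
      have e2 : Cell.faceM c.m d x = c.m := by unfold Cell.faceM; split_ifs <;> omega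
      have e3 : Cell.faceL c.m c.l d x = c.l - 1 := by unfold Cell.faceL; split_ifs <;> omega
      have e4 : insPos c.k c.m c.l d x = c.k + (c.m + ((x - c.m - 1) + 1)) := by
        unfold insPos; split_ifs <;> omega
      rw [e1, e2, e3, e4, insertIdx_word_l _ _ _ _ (by omega), Nat.sub_add_cancel (by omega)]
      congr 2
      omega
    · have e1 : Cell.faceK c.k c.m c.l d x = c.k := by unfold Cell.faceK; split_ifs <;> omega
      have e2 : Cell.faceM c.m d x = c.m - 1 := by unfold Cell.faceM; split_ifs <;> omega
      have e3 : Cell.faceL c.m c.l d x = c.l := by unfold Cell.faceL; split_ifs <;> omega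
      have e4 : insPos c.k c.m c.l d x = c.k + (x - 1) := by
        unfold insPos; split_ifs <;> omega
      rw [e1, e2, e3, e4, insertIdx_word_m _ _ _ _ (by omega), Nat.sub_add_cancel (by omega)]
      congr 2
      omega

lemma realize_d0_word {n : ℕ} (c : Cell Y (n + 1)) {x : ℕ} (hx : 1 ≤ x) (hx' : x ≤ c.m)
    {τ : Letter} {f : ℕ → Letter}
    (hw : FaceWord (Cell.face 0 x c).k (Cell.face 0 x c).m (Cell.face 0 x c).l
      (word (Cell.face 0 x c).k (Cell.face 0 x c).m (Cell.face 0 x c).l τ f)) :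
    realize (Cell.face 0 x c)
      (word (Cell.face 0 x c).k (Cell.face 0 x c).m (Cell.face 0 x c).l τ f) =
      realize c (word c.k c.m c.l z (insDir x τ f)) := by
  have hdim := c.dim_eq
  have hA : Cell.Adm (n + 1) c.m 0 x := by unfold Cell.Adm; omega
  obtain ⟨s1, s2, s3⟩ := face_shape c hA
  rw [s1, s2, s3] at hw ⊢
  rw [realize_face c hA hw]
  congr 1
  have e1 : Cell.faceK c.k c.m c.l 0 x = c.k := by simp [Cell.faceK]; try omega
  have e2 : Cell.faceM c.m 0 x = x - 1 := by simp [Cell.faceM, hx']; try omega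
  have e3 : Cell.faceL c.m c.l 0 x = (c.m - x) + c.l := by simp [Cell.faceL, hx']; try omega
  have e4 : insPos c.k c.m c.l 0 x = c.k + ((x - 1) + ((c.m - x) + 1)) := by
    simp [insPos, hx']; try omega
  rw [e1, e2, e3, e4, insertIdx_word_end, Nat.sub_add_cancel hx,
    show x - 1 + (c.m - x) + 1 = c.m by omega]
  rfl

lemma realize_d2_word {n : ℕ} (c : Cell Y (n + 1)) {x : ℕ} (hx : 1 ≤ x) (hx' : x ≤ c.m)
    {τ : Letter} {f : ℕ → Letter}
    (hw : FaceWord (Cell.face 2 x c).k (Cell.face 2 x c).m (Cell.face 2 x c).l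
      (word (Cell.face 2 x c).k (Cell.face 2 x c).m (Cell.face 2 x c).l τ f)) :
    realize (Cell.face 2 x c)
      (word (Cell.face 2 x c).k (Cell.face 2 x c).m (Cell.face 2 x c).l τ f) =
      realize c (word c.k c.m c.l τ (insSpecial (n + 1) x f)) := by
  have hdim := c.dim_eq
  have hA : Cell.Adm (n + 1) c.m 2 x := by unfold Cell.Adm; omega
  obtain ⟨s1, s2, s3⟩ := face_shape c hA
  rw [s1, s2, s3] at hw ⊢
  rw [realize_face c hA hw]
  congr 1
  have e1 : Cell.faceK c.k c.m c.l 2 x = c.k + (x - 1) := by simp [Cell.faceK]; try omega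
  have e2 : Cell.faceM c.m 2 x = c.m - x := by simp [Cell.faceM]; try omega
  have e3 : Cell.faceL c.m c.l 2 x = c.l := by simp [Cell.faceL]; try omega
  have e4 : insPos c.k c.m c.l 2 x = c.k := by simp [insPos]; try omega
  have e5 : insLetter 2 = z := rfl
  rw [e1, e2, e3, e4, e5, insertIdx_word_special, Nat.sub_add_cancel hx,
    show c.m - x + (x - 1) + 1 = c.m by omega,
    show c.k + (c.m - x) + c.l + (x - 1) + 1 = n + 1 by omega]

end Word
end
end Freehedral

namespace Freehedral
noncomputable section
namespace Word
open Letter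
variable {Y : Type u} [TopologicalSpace Y]

lemma block_const (a n : ℕ) : block (fun _ => k) a n = List.replicate n k := by
  induction n generalizing a with
  | zero => rfl
  | succ n ih => rw [block, ih]; rfl

/-- The letters of the left factors of the diagonal, if the base is not moved. -/
def leftLetter (m : ℕ) (L : Finset ℕ) (i : ℕ) : Letter :=
  if i = 1 ∧ 0 < m then (if 1 ∈ L then p else b) else if i ∈ L then z else k

/-- The letters of the right factors of the diagonal, if the base is not moved. -/
def rightLetter (m : ℕ) (K : Finset ℕ) (i : ℕ) : Letter :=
  if i = 1 ∧ 0 < m then b else if i ∈ K then e else k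

/-- The letter after those of the freehedral part, if the base is not moved. -/
def endLetter (m : ℕ) : Letter := if m = 0 then p else z

lemma word_eq_top {κ m l : ℕ} {f : ℕ → Letter}
    (h : ∀ i, 1 ≤ i → f i = if i = 1 ∧ 0 < m then b else k) :
    word κ m l (endLetter m) f = top κ m l := by
  cases m with
  | zero =>
    rw [word_congr (g := fun _ => k) fun i h1 _ => by rw [h i h1]; simp]
    unfold word
    simp only [block_const]
    rfl
  | succ m =>
    unfold word
    rw [block_congr (g := fun _ => k) (a' := 0) (n := κ) fun i _ => by
        rw [h _ (by omega), if_neg (by omega)],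
      block_congr (g := fun _ => k) (a' := 0) (n := l) fun i _ => by
        rw [h _ (by omega), if_neg (by omega)], block,
      block_congr (g := fun _ => k) (a' := 0) (n := m) fun i _ => by
        rw [h _ (by omega), if_neg (by omega)], h 1 le_rfl]
    simp only [block_const]
    rfl

lemma iterate_insert_max (op : ℕ → AnyCell Y → AnyCell Y) {L : Finset ℕ} {x : ℕ}
    (h : ∀ y ∈ L, y < x) (c : AnyCell Y) :
    AnyCell.iterate op (insert x L) c = AnyCell.iterate op L (op x c) := by
  have hs : (insert x L).sort = L.sort ++ [x] := by
    refine List.Perm.eq_of_pairwise (le := (· ≤ ·)) ?_ (Finset.pairwise_sort _ _) ?_ ?_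
    · intro a b _ _ h1 h2; exact le_antisymm h1 h2
    · rw [List.pairwise_append]
      refine ⟨Finset.pairwise_sort _ _, List.pairwise_singleton _ _, ?_⟩
      intro a ha b hb
      simp only [List.mem_singleton] at hb
      subst hb
      exact (h a (by simpa using ha)).le
    · refine (List.perm_ext_iff_of_nodup (Finset.sort_nodup _ _) ?_).2 fun a => by simp [or_comm]
      rw [List.nodup_append]
      refine ⟨Finset.sort_nodup _ _, by simp, ?_⟩
      intro a ha b hb
      simp only [List.mem_singleton] at hb
      have := h a (by simpa using ha)
      omega
  unfold AnyCell.iterate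
  rw [hs, List.foldr_append]
  rfl

lemma iterate_empty (op : ℕ → AnyCell Y → AnyCell Y) (c : AnyCell Y) :
    AnyCell.iterate op ∅ c = c := by
  simp [AnyCell.iterate]

lemma leftLetter_plain {m : ℕ} {L : Finset ℕ} {i : ℕ} (h : ¬ (i = 1 ∧ 0 < m)) :
    IsPlain (leftLetter m L i) := by
  unfold leftLetter IsPlain
  rw [if_neg h]
  split_ifs <;> simp

lemma rightLetter_plain {m : ℕ} {L : Finset ℕ} {i : ℕ} (h : ¬ (i = 1 ∧ 0 < m)) :
    IsPlain (rightLetter m L i) := by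
  unfold rightLetter IsPlain
  rw [if_neg h]
  split_ifs <;> simp

lemma faceWord_left (κ m l : ℕ) (L : Finset ℕ) :
    FaceWord κ m l (word κ m l (endLetter m) (leftLetter m L)) := by
  cases m with
  | zero => exact faceWord_word_zero fun i _ _ => leftLetter_plain (by omega)
  | succ m =>
    refine faceWord_word_base (fun i _ _ => leftLetter_plain (by omega)) ?_
    unfold leftLetter
    rw [if_pos (by omega)]
    split_ifs <;> simp

lemma faceWord_right (κ m l : ℕ) (L : Finset ℕ) :
    FaceWord κ m l (word κ m l (endLetter m) (rightLetter m L)) := by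
  cases m with
  | zero => exact faceWord_word_zero fun i _ _ => rightLetter_plain (by omega)
  | succ m =>
    refine faceWord_word_base (fun i _ _ => rightLetter_plain (by omega)) ?_
    unfold rightLetter
    rw [if_pos (by omega)]
    simp

/-- The faces `d^0_(j_p) ⋯ d^0_(j_1)`. -/
lemma iterate_d0 {n : ℕ} (c : Cell Y n) (L : Finset ℕ) (hL : ∀ x ∈ L, 1 ≤ x ∧ x ≤ n) :
    AnyCell.iterate AnyCell.d0 L ⟨n, c⟩ =
      realize c (word c.k c.m c.l (endLetter c.m) (leftLetter c.m L)) := by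
  induction L using Finset.induction_on_max generalizing n with
  | empty =>
    rw [iterate_empty, word_eq_top, realize_top]
    intro i hi
    simp [leftLetter]
  | insert x L hx ih =>
    rw [iterate_insert_max _ hx]
    have hxn := hL x (by simp)
    obtain ⟨n, rfl⟩ := Nat.exists_eq_succ_of_ne_zero (show n ≠ 0 by omega)
    have hd : AnyCell.d0 x (⟨n + 1, c⟩ : AnyCell Y) = ⟨n, Cell.face 0 x c⟩ := if_pos hxn
    rw [hd, ih _ fun y hy => ⟨(hL y (by simp [hy])).1, by have := hx y hy; omega⟩]
    have hA : Cell.Adm (n + 1) c.m 0 x := by unfold Cell.Adm; omega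
    have s := (face_shape c hA).2.1
    have hxL : x ∉ L := fun h => lt_irrefl _ (hx x h)
    have hxL' : ∀ i, x ≤ i → i ∉ L := fun i hi h => by have := hx i h; omega
    by_cases hm : c.m < x
    · rw [realize_face_word c hA (by omega) (Or.inr hm) (faceWord_left _ _ _ _)]
      have e : (Cell.face 0 x c).m = c.m := by rw [s]; simp [Cell.faceM]; omega
      rw [e]
      congr 1
      refine word_congr fun i h1 h2 => ?_
      unfold insDir leftLetter
      rcases lt_trichotomy i x with h | h | h
      · rw [if_pos h]
        have : i ≠ x := by omega
        by_cases h1x : 1 = x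
        · omega
        · simp [this, h1x]
      · subst h
        simp [insLetter]
        omega
      · have a1 := hxL' (i - 1) (by omega)
        have a2 := hxL' i (by omega)
        have h3 : ¬ (i - 1 = 1 ∧ 0 < c.m) := by omega
        have h4 : ¬ (i = 1 ∧ 0 < c.m) := by omega
        have h5 : ¬ i < x := by omega
        have h6 : ¬ i = x := by omega
        simp only [a1, a2, h3, h4, h5, h6, if_false, Finset.mem_insert, or_self]
    · rw [realize_d0_word c hxn.1 (by omega) (faceWord_left _ _ _ _)]
      have e : (Cell.face 0 x c).m = x - 1 := by rw [s]; simp [Cell.faceM]; omega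
      rw [e]
      have e' : endLetter c.m = z := by unfold endLetter; rw [if_neg (by omega)]
      rw [e']
      congr 1
      refine word_congr fun i h1 h2 => ?_
      unfold insDir leftLetter endLetter
      rcases lt_trichotomy i x with h | h | h
      · have h3 : (i = 1 ∧ 0 < x - 1) ↔ (i = 1 ∧ 0 < c.m) := by omega
        have : i ≠ x := by omega
        have h1x : 1 ≠ x := by omega
        simp only [h, h3, if_true, Finset.mem_insert, this, h1x, false_or]
      · subst h
        by_cases h1 : i = 1
        · subst h1
          simp
          omega
        · have h7 : i - 1 ≠ 0 := by omega
          simp [h1, h7]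
      · have a1 := hxL' (i - 1) (by omega)
        have a2 := hxL' i (by omega)
        have h3 : ¬ (i - 1 = 1 ∧ 0 < x - 1) := by omega
        have h4 : ¬ (i = 1 ∧ 0 < c.m) := by omega
        have h5 : ¬ i < x := by omega
        have h6 : ¬ i = x := by omega
        simp only [a1, a2, h3, h4, h5, h6, if_false, Finset.mem_insert, or_self]

/-- The faces `d^1_(i_q) ⋯ d^1_(i_1)`, if the direction `1` of the freehedral part is not used. -/
lemma iterate_d1 {n : ℕ} (c : Cell Y n) (K : Finset ℕ) (hK : ∀ x ∈ K, 1 ≤ x ∧ x ≤ n)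
    (h1 : 1 ∈ K → c.m = 0) :
    AnyCell.iterate AnyCell.d1 K ⟨n, c⟩ =
      realize c (word c.k c.m c.l (endLetter c.m) (rightLetter c.m K)) := by
  induction K using Finset.induction_on_max generalizing n with
  | empty =>
    rw [iterate_empty, word_eq_top, realize_top]
    intro i hi
    simp [rightLetter]
  | insert x K hx ih =>
    rw [iterate_insert_max _ hx]
    have hxn := hK x (by simp)
    obtain ⟨n, rfl⟩ := Nat.exists_eq_succ_of_ne_zero (show n ≠ 0 by omega)
    have hx1 : x = 1 → c.m = 0 := fun h => h1 (by simp [h])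
    have hA : Cell.Adm (n + 1) c.m 1 x := by unfold Cell.Adm; omega
    have hd : AnyCell.d1 x (⟨n + 1, c⟩ : AnyCell Y) = ⟨n, Cell.face 1 x c⟩ := if_pos hxn
    have s := (face_shape c hA).2.1
    have e : (Cell.face 1 x c).m = if x ≤ c.m then c.m - 1 else c.m := by
      rw [s]; simp [Cell.faceM]
    have em : (0 < (Cell.face 1 x c).m) ↔ 0 < c.m := by rw [e]; split_ifs <;> omega
    rw [hd, ih _ (fun y hy => ⟨(hK y (by simp [hy])).1, by have := hx y hy; omega⟩)
      (fun h => by have := h1 (by simp [h]); omega)]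
    have hxK' : ∀ i, x ≤ i → i ∉ K := fun i hi h => by have := hx i h; omega
    rw [realize_face_word c hA (by omega) (Or.inl rfl) (faceWord_right _ _ _ _)]
    have e' : endLetter (Cell.face 1 x c).m = endLetter c.m := by
      unfold endLetter
      split_ifs <;> first | rfl | omega
    rw [e']
    congr 1
    refine word_congr fun i h1 h2 => ?_
    unfold insDir rightLetter
    simp only [em]
    rcases lt_trichotomy i x with h | h | h
    · have : i ≠ x := by omega
      simp [h, this]
    · subst h
      have h4 : ¬ (i = 1 ∧ 0 < c.m) := by omega
      simp [insLetter, h4]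
    · have a1 := hxK' (i - 1) (by omega)
      have a2 := hxK' i (by omega)
      have h3 : ¬ (i - 1 = 1 ∧ 0 < c.m) := by omega
      have h4 : ¬ (i = 1 ∧ 0 < c.m) := by omega
      have h5 : ¬ i < x := by omega
      have h6 : ¬ i = x := by omega
      simp only [a1, a2, h3, h4, h5, h6, if_false, Finset.mem_insert, or_self]

/-- The letters of the right factors of the diagonal, if the base is moved to the direction `j`. -/
def rightMoved (m j : ℕ) (K : Finset ℕ) (i : ℕ) : Letter :=
  if i = 1 then z else if i = j ∧ j ≤ m then b else if i ∈ K then e else k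

/-- The letter after those of the freehedral part, if the base is moved to the direction `j`. -/
def endMoved (m j : ℕ) : Letter := if j ≤ m then z else p

lemma faceWord_rightMoved (κ m l j : ℕ) (K : Finset ℕ) (hj : 2 ≤ j) (hj' : j ≤ m + 1) :
    FaceWord κ m l (word κ m l (endMoved m j) (rightMoved m j K)) := by
  obtain ⟨m, rfl⟩ := Nat.exists_eq_succ_of_ne_zero (show m ≠ 0 by omega)
  have hp : ∀ i, 2 ≤ i → ¬ (i = j ∧ j ≤ m + 1) → IsPlain (rightMoved (m + 1) j K i) := by
    intro i hi hi'
    unfold rightMoved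
    rw [if_neg (by omega), if_neg hi']
    unfold IsPlain
    split_ifs <;> simp
  by_cases h : j ≤ m + 1
  · have e1 : endMoved (m + 1) j = z := if_pos h
    rw [Nat.succ_eq_add_one, e1]
    refine faceWord_word_moved (β := j) (fun i h1 _ h3 => hp i h1 (by omega)) ?_ hj h ?_
    · simp [rightMoved]
    · left
      unfold rightMoved
      rw [if_neg (by omega), if_pos (by omega)]
  · have e1 : endMoved (m + 1) j = p := if_neg h
    rw [Nat.succ_eq_add_one, e1]
    refine faceWord_word_moved_end (fun i h1 _ => hp i h1 (by omega)) ?_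
    simp [rightMoved]

/-- The number of elements of `{2, …, j}` that are not in `K`. -/
def rank (K : Finset ℕ) (j : ℕ) : ℕ := (Finset.Icc 2 j \ K).card

/-- The faces `d^2_t d^1_(i_(q-1)) ⋯ d^1_(i_1)`. -/
lemma d2_iterate_d1 {n : ℕ} (c : Cell Y n) (K : Finset ℕ) (hK : ∀ x ∈ K, 2 ≤ x ∧ x ≤ n) (j : ℕ)
    (hj : 2 ≤ j) (hj' : j ≤ c.m + 1) (hjK : j ≤ c.m → j ∉ K) :
    AnyCell.d2 (rank (K.filter (· ≤ c.m)) j) (AnyCell.iterate AnyCell.d1 K ⟨n, c⟩) =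
      realize c (word c.k c.m c.l (endMoved c.m j) (rightMoved c.m j K)) := by
  induction K using Finset.induction_on_max generalizing n j with
  | empty =>
    have hdim := c.dim_eq
    obtain ⟨n, rfl⟩ := Nat.exists_eq_succ_of_ne_zero (show n ≠ 0 by omega)
    have hr : rank ((∅ : Finset ℕ).filter (· ≤ c.m)) j = j - 1 := by simp [rank]
    rw [iterate_empty, hr]
    have hd : AnyCell.d2 (j - 1) (⟨n + 1, c⟩ : AnyCell Y) = ⟨n, Cell.face 2 (j - 1) c⟩ :=
      if_pos (by omega)
    have hA : Cell.Adm (n + 1) c.m 2 (j - 1) := by unfold Cell.Adm; omega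
    have s := (face_shape c hA).2.1
    have e : (Cell.face 2 (j - 1) c).m = c.m + 1 - j := by rw [s]; simp [Cell.faceM]; omega
    rw [hd, ← realize_top, ← word_eq_top (f := rightLetter (Cell.face 2 (j - 1) c).m ∅)
      (fun i _ => by simp [rightLetter]),
      realize_d2_word c (by omega) (by omega) (faceWord_right _ _ _ _), e]
    have e' : endLetter (c.m + 1 - j) = endMoved c.m j := by
      unfold endLetter endMoved; split_ifs <;> first | rfl | omega
    rw [e']
    congr 1
    refine word_congr fun i h1 h2 => ?_
    unfold insSpecial rightMoved rightLetter
    have e1 : i - (j - 1) = 1 ↔ i = j := by omega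
    have e2 : 0 < c.m + 1 - j ↔ j ≤ c.m := by omega
    by_cases hi1 : i = 1
    · simp [hi1]
    · by_cases hij : i ≤ j - 1
      · have e3 : ¬ (i + (n + 1) - (j - 1) - 1 = 1 ∧ 0 < c.m + 1 - j) := by omega
        have e4 : ¬ (i = j ∧ j ≤ c.m) := by omega
        simp only [hi1, hij, e3, e4, if_true, if_false, Finset.notMem_empty]
      · simp [hi1, hij, e1, e2]
  | insert x K hx ih =>
    rw [iterate_insert_max _ hx]
    have hxn := hK x (by simp)
    obtain ⟨n, rfl⟩ := Nat.exists_eq_succ_of_ne_zero (show n ≠ 0 by omega)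
    have hA : Cell.Adm (n + 1) c.m 1 x := by unfold Cell.Adm; omega
    have hd : AnyCell.d1 x (⟨n + 1, c⟩ : AnyCell Y) = ⟨n, Cell.face 1 x c⟩ := if_pos (by omega)
    have s := (face_shape c hA).2.1
    have hxK' : ∀ i, x ≤ i → i ∉ K := fun i hi h => by have := hx i h; omega
    rw [hd]
    have hK' : ∀ y ∈ K, 2 ≤ y ∧ y ≤ n := fun y hy =>
      ⟨(hK y (by simp [hy])).1, by have := hx y hy; omega⟩
    have em : (Cell.face 1 x c).m = if x ≤ c.m then c.m - 1 else c.m := by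
      rw [s]; simp [Cell.faceM]
    have hjx : j ≤ c.m → j ≠ x := fun h h' => hjK h (by simp [h'])
    set j' := if x < j ∧ x ≤ c.m then j - 1 else j with hj'_def
    have h2 : 2 ≤ j' ∧ j' ≤ (Cell.face 1 x c).m + 1 ∧ (j' ≤ (Cell.face 1 x c).m → j' ∉ K) := by
      rw [em, hj'_def]
      split_ifs with h1 h2 h2
      · exact ⟨by omega, by omega, fun _ => hxK' _ (by omega)⟩
      · omega
      · refine ⟨hj, by omega, fun _ => ?_⟩
        have := hjK (by omega)
        simp at this
        exact this.2
      · refine ⟨hj, hj', fun h => ?_⟩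
        have := hjK h
        simp at this
        exact this.2
    have := ih (Cell.face 1 x c) hK' j' h2.1 h2.2.1 h2.2.2
    have hrank : rank ((insert x K).filter (· ≤ c.m)) j =
        rank (K.filter (· ≤ (Cell.face 1 x c).m)) j' := by
      unfold rank
      rw [em, hj'_def]
      by_cases hxm : x ≤ c.m
      · have f1 : (insert x K).filter (· ≤ c.m) = insert x K := by
          refine Finset.filter_true_of_mem fun y hy => ?_
          rcases Finset.mem_insert.1 hy with rfl | hy
          · exact hxm
          · have := hx y hy; omega
        have f2 : K.filter (· ≤ c.m - 1) = K :=
          Finset.filter_true_of_mem fun y hy => by have := hx y hy; omega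
        simp only [hxm, and_true, if_true, f1, f2]
        split_ifs with h
        · have e1 : Finset.Icc 2 j \ insert x K =
              ((Finset.Icc 2 (j - 1) \ K).erase x) ∪ {j} := by
            ext y
            simp only [Finset.mem_sdiff, Finset.mem_Icc, Finset.mem_insert, Finset.mem_union,
              Finset.mem_erase, Finset.mem_singleton]
            have := hxK' j (by omega)
            constructor
            · rintro ⟨h1, h2⟩
              by_cases hy : y = j
              · exact Or.inr hy
              · exact Or.inl ⟨fun h => h2 (Or.inl h), by omega, fun h => h2 (Or.inr h)⟩
            · rintro (⟨h1, h2, h3⟩ | rfl)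
              · exact ⟨by omega, by tauto⟩
              · exact ⟨by omega, by rintro (h | h); · omega
                                    · exact this h⟩
          rw [e1, Finset.card_union_of_disjoint, Finset.card_erase_of_mem, Finset.card_singleton,
            Nat.sub_add_cancel]
          · refine Finset.card_pos.2 ⟨x, ?_⟩
            simp only [Finset.mem_sdiff, Finset.mem_Icc]
            exact ⟨by omega, hxK' x le_rfl⟩
          · simp only [Finset.mem_sdiff, Finset.mem_Icc]
            exact ⟨by omega, hxK' x le_rfl⟩
          · simp
            omega
        · congr 1
          ext y
          simp only [Finset.mem_sdiff, Finset.mem_Icc, Finset.mem_insert]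
          constructor
          · rintro ⟨h1, h2⟩; exact ⟨h1, fun h => h2 (Or.inr h)⟩
          · rintro ⟨h1, h2⟩
            refine ⟨h1, ?_⟩
            rintro (rfl | h')
            · have := hjx; omega
            · exact h2 h'
      · simp only [hxm, and_false, if_false]
        congr 2
        rw [Finset.filter_insert, if_neg hxm]
    rw [hrank, this, realize_face_word c hA (by omega) (Or.inl rfl)
      (faceWord_rightMoved _ _ _ _ _ h2.1 h2.2.1)]
    have c2 : j' ≤ (Cell.face 1 x c).m ↔ j ≤ c.m := by
      rw [em, hj'_def]; split_ifs <;> omega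
    have e' : endMoved (Cell.face 1 x c).m j' = endMoved c.m j := by
      unfold endMoved
      simp only [c2]
    rw [e']
    congr 1
    refine word_congr fun i h1 h2 => ?_
    unfold insDir rightMoved
    simp only [c2]
    rcases lt_trichotomy i x with h | h | h
    · have : i ≠ x := by omega
      have h3 : (i = j' ∧ j ≤ c.m) ↔ (i = j ∧ j ≤ c.m) := by
        rw [hj'_def]; split_ifs <;> omega
      simp [h, this, h3]
    · subst h
      have h3 : ¬ (i = j ∧ j ≤ c.m) := by omega
      have h4 : i ≠ 1 := by omega
      simp [insLetter, h3, h4]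
    · have a1 := hxK' (i - 1) (by omega)
      have a2 := hxK' i (by omega)
      have h3 : (i - 1 = j' ∧ j ≤ c.m) ↔ (i = j ∧ j ≤ c.m) := by
        rw [hj'_def]; split_ifs <;> omega
      have h4 : i ≠ 1 := by omega
      have h5 : ¬ i < x := by omega
      have h6 : ¬ i = x := by omega
      have h7 : i - 1 ≠ 1 := by omega
      simp only [a1, a2, h3, h4, h5, h6, h7, if_false, Finset.mem_insert, or_self]

end Word
end
end Freehedral

namespace Freehedral
noncomputable section
namespace Word
open Letter

/-- The letters of left factors. -/
def zk (S : Finset ℕ) (i : ℕ) : Letter := if i ∈ S then z else k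
/-- The letters of right factors. -/
def ke (S : Finset ℕ) (i : ℕ) : Letter := if i ∈ S then k else e
/-- The letters of left factors, with the base at `j`. -/
def zkb (S : Finset ℕ) (j i : ℕ) : Letter := if i = j then b else zk S i
/-- The letters of right factors, with the base at `j`. -/
def keb (S : Finset ℕ) (j i : ℕ) : Letter := if i = j then b else ke S i

/-- The number of pairs `(a, b)` with `a ∈ K`, `b ∈ L` and `b < a`. -/
def inv (K L : Finset ℕ) : ℕ := ((K ×ˢ L).filter fun q => q.2 < q.1).card

lemma inv_eq_sum (K L : Finset ℕ) : inv K L = ∑ x ∈ K, (L.filter (· < x)).card := by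
  unfold inv
  rw [Finset.card_filter, Finset.sum_product]
  refine Finset.sum_congr rfl fun x _ => ?_
  rw [Finset.card_filter]

lemma inv_eq_sum' (K L : Finset ℕ) : inv K L = ∑ y ∈ L, (K.filter (y < ·)).card := by
  unfold inv
  rw [Finset.card_filter, Finset.sum_product_right]
  refine Finset.sum_congr rfl fun x _ => ?_
  rw [Finset.card_filter]

lemma inv_union_left {K K' L : Finset ℕ} (h : Disjoint K K') :
    inv (K ∪ K') L = inv K L + inv K' L := by
  simp only [inv_eq_sum, Finset.sum_union h]

lemma inv_union_right {K L L' : Finset ℕ} (h : Disjoint L L') :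
    inv K (L ∪ L') = inv K L + inv K L' := by
  simp only [inv_eq_sum', Finset.sum_union h]

lemma inv_of_lt {K L : Finset ℕ} (h : ∀ x ∈ L, ∀ y ∈ K, x < y) : inv K L = K.card * L.card := by
  rw [inv_eq_sum, Finset.sum_congr rfl (g := fun _ => L.card) fun y hy => ?_]
  · simp
  · rw [Finset.filter_true_of_mem fun x hx => h x hx y hy]

lemma inv_of_le {K L : Finset ℕ} (h : ∀ x ∈ L, ∀ y ∈ K, y ≤ x) : inv K L = 0 := by
  rw [inv_eq_sum, Finset.sum_eq_zero fun y hy => ?_]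
  rw [Finset.filter_false_of_mem fun x hx => not_lt.2 (h x hx y hy)]
  rfl

lemma sum_powerset_union {M : Type*} [AddCommMonoid M] {A B : Finset ℕ} (h : Disjoint A B)
    (F : Finset ℕ → M) :
    ∑ S ∈ (A ∪ B).powerset, F S = ∑ S ∈ A.powerset, ∑ T ∈ B.powerset, F (S ∪ T) := by
  induction B using Finset.induction_on generalizing F with
  | empty => simp
  | insert x B hx ih =>
    rw [Finset.disjoint_insert_right] at h
    rw [Finset.union_insert, Finset.sum_powerset_insert (by simp [h.1, hx]), ih h.2, ih h.2,
      ← Finset.sum_add_distrib]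
    refine Finset.sum_congr rfl fun S _ => ?_
    rw [Finset.sum_powerset_insert hx]
    simp only [Finset.union_insert]

variable {R : Type*} [CommRing R]

/-- Functions on words after a fixed initial word. -/
def pre (u : List Letter) (X : List Letter → R) : List Letter → R := fun v => X (u ++ v)

/-- The `s`-th power of the twist. -/
def twistN (s : ℕ) (X : List Letter → R) : List Letter → R := fun w => (-1) ^ (s * deg w) * X w

omit [CommRing R] in
lemma after_pre (a : Letter) (u : List Letter) (X : List Letter → R) :
    after a (pre u X) = pre (u ++ [a]) X := by
  funext v; simp [after, pre]

lemma after_twistN_k (s : ℕ) (X : List Letter → R) :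
    after k (twistN s X) = ((-1) ^ s : R) • twistN s (after k X) := by
  funext v; simp [after, twistN, deg, mul_add, pow_add, mul_assoc, mul_left_comm]

lemma after_twistN_b (s : ℕ) (X : List Letter → R) :
    after b (twistN s X) = ((-1) ^ s : R) • twistN s (after b X) := by
  funext v; simp [after, twistN, deg, mul_add, pow_add, mul_assoc, mul_left_comm]

lemma after_twistN_z (s : ℕ) (X : List Letter → R) :
    after z (twistN s X) = twistN s (after z X) := rfl

lemma twist_twistN (s : ℕ) (X : List Letter → R) : twist (twistN s X) = twistN (s + 1) X := by
  funext v; simp [twist, twistN, add_mul, pow_add]; ring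

lemma twistN_zero (X : List Letter → R) : twistN 0 X = X := by
  funext v; simp [twistN]

lemma block_insert_zk {S : Finset ℕ} {a n N : ℕ} (h : a + n ≤ N) :
    block (zk (insert N S)) a n = block (zk S) a n :=
  block_congr fun i hi => by
    have : a + i ≠ N := by omega
    simp [zk, this]

lemma block_insert_ke {S : Finset ℕ} {a n N : ℕ} (h : a + n ≤ N) :
    block (ke (insert N S)) a n = block (ke S) a n :=
  block_congr fun i hi => by
    have : a + i ≠ N := by omega
    simp [ke, this]

lemma block_insert_zkb {S : Finset ℕ} {a n N j : ℕ} (h : a + n ≤ N) :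
    block (zkb (insert N S) j) a n = block (zkb S j) a n :=
  block_congr fun i hi => by
    have : a + i ≠ N := by omega
    simp [zkb, zk, this]

lemma block_insert_keb {S : Finset ℕ} {a n N j : ℕ} (h : a + n ≤ N) :
    block (keb (insert N S) j) a n = block (keb S j) a n :=
  block_congr fun i hi => by
    have : a + i ≠ N := by omega
    simp [keb, ke, this]

lemma inv_insert_left {A S : Finset ℕ} {N : ℕ} (hN : ∀ x ∈ A, x < N) (hS : S ⊆ A) :
    inv (insert N A \ S) S = inv (A \ S) S + S.card := by
  have hNS : N ∉ S := fun h => lt_irrefl _ (hN _ (hS h))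
  have hNA : N ∉ A := fun h => lt_irrefl _ (hN _ h)
  have : insert N A \ S = (A \ S) ∪ {N} := by
    rw [Finset.insert_sdiff_of_notMem _ hNS, Finset.union_comm]; rfl
  rw [this, inv_union_left (by simp [hNA]), inv_of_lt (K := {N})]
  · simp
  · intro x hx y hy
    rw [Finset.mem_singleton] at hy
    exact hy ▸ hN x (hS hx)

lemma inv_insert_right {A S : Finset ℕ} {N : ℕ} (hN : ∀ x ∈ A, x < N) (hS : S ⊆ A) :
    inv (insert N A \ insert N S) (insert N S) = inv (A \ S) S := by
  have hNS : N ∉ S := fun h => lt_irrefl _ (hN _ (hS h))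
  have hNA : N ∉ A := fun h => lt_irrefl _ (hN _ h)
  have : insert N A \ insert N S = A \ S := by
    ext x
    simp only [Finset.mem_sdiff, Finset.mem_insert]
    constructor
    · rintro ⟨h1 | h1, h2⟩
      · exact absurd (Or.inl h1) h2
      · exact ⟨h1, fun h => h2 (Or.inr h)⟩
    · rintro ⟨h1, h2⟩
      refine ⟨Or.inr h1, ?_⟩
      rintro (h | h)
      · exact hNA (h ▸ h1)
      · exact h2 h
  rw [this, Finset.insert_eq, Finset.union_comm, inv_union_right (by simp [hNS]),
    inv_of_le (L := {N})]
  · simp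
  · intro x hx y hy
    rw [Finset.mem_singleton] at hx
    exact hx ▸ (hN y (Finset.mem_sdiff.1 hy).1).le

lemma Ico_succ_insert (a n : ℕ) :
    Finset.Ico a (a + (n + 1)) = insert (a + n) (Finset.Ico a (a + n)) := by
  ext x; simp; omega

/-- The product on a word that begins with kept letters. -/
lemma cup_replicate_append (a n : ℕ) (w : List Letter) (X Y : List Letter → R) :
    cup (List.replicate n k ++ w) X Y =
      ∑ S ∈ (Finset.Ico a (a + n)).powerset, (-1) ^ inv (Finset.Ico a (a + n) \ S) S *
        cup w (twistN S.card (pre (block (zk S) a n) X)) (pre (block (ke S) a n) Y) := by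
  induction n generalizing w with
  | zero =>
    simp only [inv, block, add_zero, Finset.Ico_self, Finset.powerset_empty, Finset.sum_singleton]
    simp [twistN_zero]
    rfl
  | succ n ih =>
    have hN : ∀ x ∈ Finset.Ico a (a + n), x < a + n := fun x hx => (Finset.mem_Ico.1 hx).2
    rw [List.replicate_succ', List.append_assoc, ih, Ico_succ_insert,
      Finset.sum_powerset_insert (by simp), ← Finset.sum_add_distrib]
    refine Finset.sum_congr rfl fun S hS => ?_
    rw [Finset.mem_powerset] at hS
    have hNS : a + n ∉ S := fun h => lt_irrefl _ (hN _ (hS h))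
    rw [inv_insert_left hN hS, inv_insert_right hN hS, Finset.card_insert_of_notMem hNS]
    simp only [block_succ, block_insert_zk le_rfl, block_insert_ke le_rfl]
    rw [List.singleton_append, cup, after_twistN_k, after_twistN_z, twist_twistN,
      (cup_smul_left _ _ _ _).1]
    simp only [after_pre]
    have h1 : zk S (a + n) = k := if_neg hNS
    have h2 : zk (insert (a + n) S) (a + n) = z := if_pos (by simp)
    have h3 : ke S (a + n) = e := if_neg hNS
    have h4 : ke (insert (a + n) S) (a + n) = k := if_pos (by simp)
    rw [h1, h2, h3, h4, pow_add]
    ring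

lemma deg_block_zk (S : Finset ℕ) (a n : ℕ) :
    deg (block (zk S) a n) = (Finset.Ico a (a + n) \ S).card := by
  induction n with
  | zero => simp [block, deg]
  | succ n ih =>
    have hd : ∀ u v : List Letter, deg (u ++ v) = deg u + deg v := by
      intro u v
      induction u with
      | nil => simp [deg]
      | cons c u ih => cases c <;> simp [deg, ih] <;> omega
    rw [block_succ, hd, ih, Ico_succ_insert]
    by_cases h : a + n ∈ S
    · rw [Finset.insert_sdiff_of_mem _ h]
      simp [zk, h, deg]
    · rw [Finset.insert_sdiff_of_notMem _ h, Finset.card_insert_of_notMem (by simp)]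
      simp [zk, h, deg]

/-- Words of `m` letters, the letter `τ`, and `l` letters. -/
def tail (f : ℕ → Letter) (a m l : ℕ) (τ : Letter) : List Letter :=
  block f a m ++ τ :: block f (a + m) l

lemma Ico_add_eq_union (a m l : ℕ) :
    Finset.Ico a (a + (m + l)) = Finset.Ico a (a + m) ∪ Finset.Ico (a + m) (a + m + l) := by
  ext x; simp; omega

lemma disjoint_Ico_add (a m l : ℕ) :
    Disjoint (Finset.Ico a (a + m)) (Finset.Ico (a + m) (a + m + l)) := by
  rw [Finset.disjoint_left]
  intro x h1 h2
  simp at h1 h2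
  omega

section union
variable {a m l : ℕ} {S T : Finset ℕ} (hS : S ⊆ Finset.Ico a (a + m))
  (hT : T ⊆ Finset.Ico (a + m) (a + m + l))
include hS hT

omit hS in
lemma block_union_left (F : Finset ℕ → ℕ → Letter)
    (hF : ∀ S S' i, (i ∈ S ↔ i ∈ S') → F S i = F S' i) :
    block (F (S ∪ T)) a m = block (F S) a m :=
  block_congr fun i hi => hF _ _ _ (by
    have : a + i ∉ T := fun h => by have := Finset.mem_Ico.1 (hT h); omega
    simp [this])

omit hT in
lemma block_union_right (F : Finset ℕ → ℕ → Letter)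
    (hF : ∀ S S' i, (i ∈ S ↔ i ∈ S') → F S i = F S' i) :
    block (F (S ∪ T)) (a + m) l = block (F T) (a + m) l :=
  block_congr fun i hi => hF _ _ _ (by
    have : a + m + i ∉ S := fun h => by have := Finset.mem_Ico.1 (hS h); omega
    simp [this])

lemma sdiff_union_Ico : Finset.Ico a (a + (m + l)) \ (S ∪ T) =
    (Finset.Ico a (a + m) \ S) ∪ (Finset.Ico (a + m) (a + m + l) \ T) := by
  ext x
  have h1 := fun h : x ∈ S => Finset.mem_Ico.1 (hS h)
  have h2 := fun h : x ∈ T => Finset.mem_Ico.1 (hT h)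
  simp only [Finset.mem_sdiff, Finset.mem_union, Finset.mem_Ico]
  constructor
  · rintro ⟨h, h'⟩
    by_cases hx : x < a + m
    · exact Or.inl ⟨by omega, fun g => h' (Or.inl g)⟩
    · exact Or.inr ⟨by omega, fun g => h' (Or.inr g)⟩
  · rintro (⟨h, h'⟩ | ⟨h, h'⟩)
    · exact ⟨by omega, by rintro (g | g); · exact h' g
                          · have := h2 g; omega⟩
    · exact ⟨by omega, by rintro (g | g); · have := h1 g; omega
                          · exact h' g⟩

lemma inv_union_Ico : inv (Finset.Ico a (a + (m + l)) \ (S ∪ T)) (S ∪ T) =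
    inv (Finset.Ico a (a + m) \ S) S + inv (Finset.Ico (a + m) (a + m + l) \ T) T +
      S.card * (Finset.Ico (a + m) (a + m + l) \ T).card := by
  have hST : Disjoint S T := (disjoint_Ico_add a m l).mono hS hT
  rw [sdiff_union_Ico hS hT, inv_union_left
    ((disjoint_Ico_add a m l).mono Finset.sdiff_subset Finset.sdiff_subset),
    inv_union_right hST, inv_union_right hST, inv_of_le (K := Finset.Ico a (a + m) \ S) (L := T),
    inv_of_lt (K := Finset.Ico (a + m) (a + m + l) \ T) (L := S)]
  · ring
  · intro x hx y hy
    have := Finset.mem_Ico.1 (hS hx)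
    have := Finset.mem_Ico.1 (Finset.mem_sdiff.1 hy).1
    omega
  · intro x hx y hy
    have := Finset.mem_Ico.1 (hT hx)
    have := Finset.mem_Ico.1 (Finset.mem_sdiff.1 hy).1
    omega

end union

lemma zk_local (S S' : Finset ℕ) (i : ℕ) (h : i ∈ S ↔ i ∈ S') : zk S i = zk S' i := by
  unfold zk; simp only [h]
lemma ke_local (S S' : Finset ℕ) (i : ℕ) (h : i ∈ S ↔ i ∈ S') : ke S i = ke S' i := by
  unfold ke; simp only [h]
lemma zkb_local (j : ℕ) (S S' : Finset ℕ) (i : ℕ) (h : i ∈ S ↔ i ∈ S') :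
    zkb S j i = zkb S' j i := by
  unfold zkb; rw [zk_local S S' i h]
lemma keb_local (j : ℕ) (S S' : Finset ℕ) (i : ℕ) (h : i ∈ S ↔ i ∈ S') :
    keb S j i = keb S' j i := by
  unfold keb; rw [ke_local S S' i h]

lemma cup_replicate (a n : ℕ) (X Y : List Letter → R) :
    cup (List.replicate n k) X Y =
      ∑ S ∈ (Finset.Ico a (a + n)).powerset, (-1) ^ inv (Finset.Ico a (a + n) \ S) S *
        (X (block (zk S) a n) * Y (block (ke S) a n)) := by
  have := cup_replicate_append a n [] X Y
  simpa [cup, twistN, deg, pre] using this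

/-- The product on the word of `F_(m + 1) × I^l` without its first letter. -/
lemma cup_tail (a m l : ℕ) (X Y : List Letter → R) :
    cup (List.replicate m k ++ z :: List.replicate l k) X Y =
      ∑ S ∈ (Finset.Ico a (a + (m + l))).powerset,
        (-1) ^ inv (Finset.Ico a (a + (m + l)) \ S) S *
          (X (tail (zk S) a m l z) * Y (tail (ke S) a m l z)) := by
  rw [cup_replicate_append a, Ico_add_eq_union, sum_powerset_union (disjoint_Ico_add a m l)]
  refine Finset.sum_congr rfl fun S hS => ?_
  rw [cup, cup_replicate (a + m), Finset.mul_sum]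
  refine Finset.sum_congr rfl fun T hT => ?_
  rw [Finset.mem_powerset] at hS hT
  rw [← Ico_add_eq_union, inv_union_Ico hS hT]
  unfold tail
  rw [block_union_left hT _ zk_local, block_union_left hT _ ke_local,
    block_union_right hS _ zk_local, block_union_right hS _ ke_local]
  simp only [after, twistN, pre, deg, deg_block_zk, pow_add]
  ring

end Word
end
end Freehedral

namespace Freehedral
noncomputable section
namespace Word
open Letter
variable {R : Type*} [CommRing R]

/-- The moves of the base of a right factor, after a position `i`: the moves to the positions of
`S` that have been passed already, and the later ones. -/
def laterMoves (S : Finset ℕ) (i a n : ℕ) (Y : List Letter → R) : List Letter → R := fun v =>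
  ∑ j ∈ S.filter (i < ·), Y (block (keb S j) a n ++ v) + mv (pre (block (ke S) a n) Y) v

lemma after_e_laterMoves {S : Finset ℕ} {i a n : ℕ} (hS : a + n ∉ S) (Y : List Letter → R) :
    after e (laterMoves S i a n Y) = laterMoves S i a (n + 1) Y := by
  funext v
  have h1 : ke S (a + n) = e := if_neg hS
  change ∑ j ∈ S.filter (i < ·), Y (block (keb S j) a n ++ e :: v) +
      move (e :: v) (pre (block (ke S) a n) Y) =
    ∑ j ∈ S.filter (i < ·), Y (block (keb S j) a (n + 1) ++ v) +
      move v (pre (block (ke S) a (n + 1)) Y)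
  rw [block_succ (ke S), h1, move, after_pre]
  congr 1
  refine Finset.sum_congr rfl fun j hj => ?_
  have h2 : keb S j (a + n) = e := by
    unfold keb
    rw [if_neg, h1]
    rintro rfl
    exact hS (Finset.mem_filter.1 hj).1
  rw [block_succ, h2, List.append_assoc]
  rfl

lemma after_k_laterMoves {S : Finset ℕ} {i a n : ℕ} (hS : ∀ x ∈ S, x < a + n) (hi : i < a + n)
    (Y : List Letter → R) :
    after k (laterMoves S i a n Y) = laterMoves (insert (a + n) S) i a (n + 1) Y := by
  funext v
  have hN : a + n ∉ S := fun h => lt_irrefl _ (hS _ h)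
  have h1 : ke (insert (a + n) S) (a + n) = k := if_pos (by simp)
  change ∑ j ∈ S.filter (i < ·), Y (block (keb S j) a n ++ k :: v) +
      move (k :: v) (pre (block (ke S) a n) Y) =
    ∑ j ∈ (insert (a + n) S).filter (i < ·), Y (block (keb (insert (a + n) S) j) a (n + 1) ++ v) +
      move v (pre (block (ke (insert (a + n) S)) a (n + 1)) Y)
  rw [Finset.filter_insert, if_pos hi, Finset.sum_insert (by simp [hN])]
  have h2 : keb (insert (a + n) S) (a + n) (a + n) = b := if_pos rfl
  have h3 : block (keb (insert (a + n) S) (a + n)) a n = block (ke S) a n :=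
    block_congr fun i hi => by
      have : i ≠ n := by omega
      simp [keb, ke, this]
  rw [block_succ (keb _ (a + n)), h2, h3, block_succ (ke _), h1, block_insert_ke le_rfl, move]
  have h4 : ∀ j ∈ S.filter (i < ·), Y (block (keb (insert (a + n) S) j) a (n + 1) ++ v) =
      Y (block (keb S j) a n ++ k :: v) := fun j hj => by
    have h5 : keb (insert (a + n) S) j (a + n) = k := by
      unfold keb
      rw [if_neg, h1]
      rintro rfl
      exact hN (Finset.mem_filter.1 hj).1
    rw [block_succ, block_insert_keb le_rfl, h5, List.append_assoc]
    rfl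
  rw [Finset.sum_congr rfl h4, after_pre]
  simp only [pre, after, List.append_assoc, List.singleton_append]
  ring

lemma laterMoves_last {S : Finset ℕ} {a n : ℕ} (hS : ∀ x ∈ S, x < a + n) (Y : List Letter → R) :
    laterMoves (insert (a + n) S) (a + n) a (n + 1) Y =
      mv (after k (pre (block (ke S) a n) Y)) := by
  funext v
  have h1 : ke (insert (a + n) S) (a + n) = k := if_pos (by simp)
  unfold laterMoves
  rw [Finset.filter_false_of_mem, Finset.sum_empty, zero_add, after_pre, block_succ,
    block_insert_ke le_rfl, h1]
  intro x hx
  rcases Finset.mem_insert.1 hx with rfl | hx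
  · exact lt_irrefl _
  · have := hS x hx
    omega

/-- The exponent of the sign of a term in which the base of the left factor is moved to `i`. -/
def moveSign (A S : Finset ℕ) (i : ℕ) : ℕ :=
  inv (A \ S) S + ((A \ S).filter (· < i)).card

/-- The part of the product in which both bases are moved, on a word that begins with kept
letters. -/
lemma cupMove_replicate_append (a n : ℕ) (w : List Letter) (X Y : List Letter → R) :
    cupMove (List.replicate n k ++ w) X Y =
      ∑ S ∈ (Finset.Ico a (a + n)).powerset,
        ((-1) ^ (inv (Finset.Ico a (a + n) \ S) S + n) *
          cupMove w (twistN S.card (pre (block (zk S) a n) X)) (pre (block (ke S) a n) Y) +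
        ∑ i ∈ S, (-1) ^ moveSign (Finset.Ico a (a + n)) S i *
          cup w (twistN S.card (pre (block (zkb S i) a n) X)) (laterMoves S i a n Y)) := by
  induction n generalizing w with
  | zero =>
    simp only [inv, block, add_zero, Finset.Ico_self, Finset.powerset_empty, Finset.sum_singleton]
    simp [twistN_zero]
    rfl
  | succ n ih =>
    have hN : ∀ x ∈ Finset.Ico a (a + n), x < a + n := fun x hx => (Finset.mem_Ico.1 hx).2
    rw [List.replicate_succ', List.append_assoc, ih, Ico_succ_insert,
      Finset.sum_powerset_insert (by simp), ← Finset.sum_add_distrib]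
    refine Finset.sum_congr rfl fun S hS => ?_
    rw [Finset.mem_powerset] at hS
    have hSN : ∀ x ∈ S, x < a + n := fun x hx => hN x (hS hx)
    have hNS : a + n ∉ S := fun h => lt_irrefl _ (hSN _ h)
    have hcard := Finset.card_insert_of_notMem hNS
    have h1 : zk S (a + n) = k := if_neg hNS
    have h2 : zk (insert (a + n) S) (a + n) = z := if_pos (by simp)
    have h3 : ke S (a + n) = e := if_neg hNS
    have h4 : ke (insert (a + n) S) (a + n) = k := if_pos (by simp)
    have key : ∀ i ∈ S, (-1 : R) ^ moveSign (Finset.Ico a (a + n)) S i *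
        cup ([k] ++ w) (twistN S.card (pre (block (zkb S i) a n) X)) (laterMoves S i a n Y) =
        (-1) ^ moveSign (insert (a + n) (Finset.Ico a (a + n))) S i *
          cup w (twistN S.card (pre (block (zkb S i) a (n + 1)) X))
            (laterMoves S i a (n + 1) Y) +
        (-1) ^ moveSign (insert (a + n) (Finset.Ico a (a + n))) (insert (a + n) S) i *
          cup w (twistN (S.card + 1) (pre (block (zkb (insert (a + n) S) i) a (n + 1)) X))
            (laterMoves (insert (a + n) S) i a (n + 1) Y) := by
      intro i hi
      have hiN := hSN i hi
      have h5 : zkb S i (a + n) = k := by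
        unfold zkb; rw [if_neg (by omega), h1]
      have h6 : zkb (insert (a + n) S) i (a + n) = z := by
        unfold zkb; rw [if_neg (by omega), h2]
      have s1 : moveSign (insert (a + n) (Finset.Ico a (a + n))) S i =
          moveSign (Finset.Ico a (a + n)) S i + S.card := by
        unfold moveSign
        rw [inv_insert_left hN hS, Finset.insert_sdiff_of_notMem _ hNS, Finset.filter_insert,
          if_neg (by omega)]
        ring
      have s2 : moveSign (insert (a + n) (Finset.Ico a (a + n))) (insert (a + n) S) i =
          moveSign (Finset.Ico a (a + n)) S i := by
        unfold moveSign
        rw [inv_insert_right hN hS, Finset.insert_sdiff_of_mem _ (Finset.mem_insert_self _ _)]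
        congr 2
        ext x
        simp only [Finset.mem_filter, Finset.mem_sdiff, Finset.mem_Ico, Finset.mem_insert]
        constructor
        · rintro ⟨⟨h1, h2⟩, h3⟩; exact ⟨⟨h1, fun h => h2 (Or.inr h)⟩, h3⟩
        · rintro ⟨⟨h1, h2⟩, h3⟩
          exact ⟨⟨h1, by rintro (h | h); · omega
                         · exact h2 h⟩, h3⟩
      rw [List.singleton_append, cup, after_twistN_k, after_twistN_z, twist_twistN,
        (cup_smul_left _ _ _ _).1, after_e_laterMoves hNS, after_k_laterMoves hSN hiN, s1, s2]
      simp only [after_pre, block_succ, h5, h6, block_insert_zkb le_rfl]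
      rw [pow_add]
      ring
    rw [Finset.sum_congr rfl key, Finset.sum_add_distrib, Finset.sum_insert hNS]
    have s3 : moveSign (insert (a + n) (Finset.Ico a (a + n))) (insert (a + n) S) (a + n) =
        inv (Finset.Ico a (a + n) \ S) S + (Finset.Ico a (a + n) \ S).card := by
      unfold moveSign
      rw [inv_insert_right hN hS, Finset.insert_sdiff_of_mem _ (Finset.mem_insert_self _ _)]
      congr 2
      ext x
      simp only [Finset.mem_filter, Finset.mem_sdiff, Finset.mem_Ico, Finset.mem_insert]
      constructor
      · rintro ⟨⟨h1, h2⟩, h3⟩; exact ⟨h1, fun h => h2 (Or.inr h)⟩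
      · rintro ⟨h1, h2⟩
        exact ⟨⟨h1, by rintro (h | h); · omega
                       · exact h2 h⟩, h1.2⟩
    have h7 : block (zkb (insert (a + n) S) (a + n)) a (n + 1) = block (zk S) a n ++ [b] := by
      rw [block_succ]
      congr 1
      · refine block_congr fun i hi => ?_
        have : i ≠ n := by omega
        simp [zkb, zk, this]
      · simp [zkb]
    have hc : n = (Finset.Ico a (a + n) \ S).card + S.card := by
      rw [Finset.card_sdiff_add_card_eq_card hS]; simp
    have e1 : (-1 : R) ^ n = (-1) ^ (Finset.Ico a (a + n) \ S).card * (-1) ^ S.card := by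
      rw [← pow_add, ← hc]
    have e2 : ((-1 : R) ^ S.card) * (-1) ^ S.card = 1 := by rw [← mul_pow]; simp
    rw [laterMoves_last hSN, h7, s3, inv_insert_left hN hS, inv_insert_right hN hS, hcard,
      List.singleton_append, cupMove, after_twistN_k, after_twistN_b, after_twistN_z, twist_smul,
      twist_twistN, twist_twistN, (cup_smul_left _ _ _ _).1, (cup_smul_left _ _ _ _).2]
    simp only [block_succ, block_insert_zk le_rfl, block_insert_ke le_rfl, h1, h2, h3, h4,
      after_pre]
    simp only [pow_add, pow_one]
    rw [e1]
    linear_combination ((-1) ^ inv (Finset.Ico a (a + n) \ S) S *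
      (-1) ^ (Finset.Ico a (a + n) \ S).card *
      cup w (twistN (S.card + 1) (pre (block (zk S) a n ++ [b]) X))
        (mv (pre (block (ke S) a n ++ [k]) Y))) * e2

/-- The moves of the base over the first letters of a right word. -/
lemma move_block_append (S : Finset ℕ) (a m : ℕ) (v : List Letter) (Y : List Letter → R) :
    move (block (ke S) a m ++ v) Y =
      ∑ j ∈ S ∩ Finset.Ico a (a + m), Y (block (keb S j) a m ++ v) +
        move v (pre (block (ke S) a m) Y) := by
  induction m generalizing v with
  | zero =>
    simp [block]
    rfl
  | succ m ih =>
    have hN : a + m ∉ S ∩ Finset.Ico a (a + m) := by simp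
    have hj : ∀ j ∈ S ∩ Finset.Ico a (a + m), Y (block (keb S j) a m ++ ([ke S (a + m)] ++ v)) =
        Y (block (keb S j) a (m + 1) ++ v) := fun j hj => by
      have : keb S j (a + m) = ke S (a + m) := by
        unfold keb
        rw [if_neg]
        rintro rfl
        exact hN hj
      rw [block_succ, this, List.append_assoc]
    rw [block_succ, List.append_assoc, ih, Finset.sum_congr rfl hj, Ico_succ_insert]
    by_cases h : a + m ∈ S
    · have h1 : ke S (a + m) = k := if_pos h
      have h2 : block (keb S (a + m)) a (m + 1) = block (ke S) a m ++ [b] := by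
        rw [block_succ]
        congr 1
        · refine block_congr fun i hi => ?_
          have : i ≠ m := by omega
          simp [keb, this]
        · simp [keb]
      rw [Finset.inter_insert_of_mem h, Finset.sum_insert hN, h1, h2, List.singleton_append, move,
        after_pre]
      simp only [pre, List.append_assoc, List.singleton_append]
      ring
    · have h1 : ke S (a + m) = e := if_neg h
      rw [Finset.inter_insert_of_notMem h, h1, List.singleton_append, move, after_pre]

/-- The moves of the base on a right word. -/
lemma mv_tail (S : Finset ℕ) (a m l : ℕ) (Y : List Letter → R) :
    mv Y (tail (ke S) a m l z) =
      ∑ j ∈ S ∩ Finset.Ico a (a + m), Y (tail (keb S j) a m l z) + Y (tail (ke S) a m l p) := by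
  unfold mv tail
  rw [move_block_append, move]
  congr 1
  refine Finset.sum_congr rfl fun j hj => ?_
  have hj' := Finset.mem_Ico.1 (Finset.mem_inter.1 hj).2
  congr 3
  exact block_congr fun r hr => by unfold keb; rw [if_neg (by omega)]

lemma cupMove_z (w : List Letter) (X Y : List Letter → R) : cupMove (z :: w) X Y = 0 := by
  rw [cupMove] <;> simp

/-- The part of the product in which both bases are moved. -/
lemma cupMove_tail (a m l : ℕ) (X Y : List Letter → R) :
    cupMove (List.replicate m k ++ z :: List.replicate l k) X Y =
      ∑ S ∈ (Finset.Ico a (a + (m + l))).powerset, ∑ i ∈ S.filter (· < a + m),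
        (-1) ^ moveSign (Finset.Ico a (a + (m + l))) S i *
          (X (tail (zkb S i) a m l z) *
            (∑ j ∈ S.filter (fun j => i < j ∧ j < a + m), Y (tail (keb S j) a m l z) +
              Y (tail (ke S) a m l p))) := by
  rw [cupMove_replicate_append a, Ico_add_eq_union, sum_powerset_union (disjoint_Ico_add a m l)]
  refine Finset.sum_congr rfl fun S hS => ?_
  rw [Finset.mem_powerset] at hS
  rw [cupMove_z, mul_zero, zero_add, ← Ico_add_eq_union]
  have hf : ∀ T ∈ (Finset.Ico (a + m) (a + m + l)).powerset,
      (S ∪ T).filter (· < a + m) = S := fun T hT => by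
    rw [Finset.mem_powerset] at hT
    ext x
    have h1 := fun h : x ∈ S => Finset.mem_Ico.1 (hS h)
    have h2 := fun h : x ∈ T => Finset.mem_Ico.1 (hT h)
    simp only [Finset.mem_filter, Finset.mem_union]
    constructor
    · rintro ⟨h | h, h'⟩
      · exact h
      · have := h2 h; omega
    · intro h; exact ⟨Or.inl h, (h1 h).2⟩
  refine Eq.trans ?_ (Finset.sum_congr rfl fun T hT =>
    Finset.sum_congr (hf T hT).symm fun _ _ => rfl)
  rw [Finset.sum_comm]
  refine Finset.sum_congr rfl fun i hi => ?_
  have hi' := Finset.mem_Ico.1 (hS hi)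
  rw [cup, cup_replicate (a + m), Finset.mul_sum]
  refine Finset.sum_congr rfl fun T hT => ?_
  have hfT := hf T hT
  rw [Finset.mem_powerset] at hT
  have hf2 : (S ∪ T).filter (fun j => i < j ∧ j < a + m) = S.filter (i < ·) := by
    have h := congrArg (Finset.filter (i < ·)) hfT
    rw [Finset.filter_filter] at h
    rw [← h]
    exact Finset.filter_congr fun x _ => and_comm
  have hs : moveSign (Finset.Ico a (a + (m + l))) (S ∪ T) i =
      moveSign (Finset.Ico a (a + m)) S i + inv (Finset.Ico (a + m) (a + m + l) \ T) T +
        S.card * (Finset.Ico (a + m) (a + m + l) \ T).card := by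
    unfold moveSign
    rw [inv_union_Ico hS hT, sdiff_union_Ico hS hT, Finset.filter_union,
      Finset.filter_false_of_mem (s := Finset.Ico (a + m) (a + m + l) \ T), Finset.union_empty]
    · ring
    · intro x hx
      have := Finset.mem_Ico.1 (Finset.mem_sdiff.1 hx).1
      omega
  rw [hs, hf2]
  unfold tail laterMoves
  have hz : block (zkb (S ∪ T) i) (a + m) l = block (zk T) (a + m) l :=
    (block_union_right hS _ (zkb_local i)).trans (block_congr fun j hj => by
      unfold zkb; rw [if_neg (by omega)])
  have he : ∀ j ∈ S.filter (i < ·), Y (block (keb (S ∪ T) j) a m ++ z ::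
      block (keb (S ∪ T) j) (a + m) l) =
      Y (block (keb S j) a m ++ z :: block (ke T) (a + m) l) := fun j hj => by
    have hj' := Finset.mem_Ico.1 (hS (Finset.mem_filter.1 hj).1)
    rw [block_union_left hT _ (keb_local j), block_union_right hS _ (keb_local j)]
    congr 3
    exact block_congr fun r hr => by unfold keb; rw [if_neg (by omega)]
  rw [Finset.sum_congr rfl he, hz, block_union_left hT _ (zkb_local i),
    block_union_left hT _ ke_local, block_union_right hS _ ke_local]
  simp only [after, twistN, pre, deg, deg_block_zk, pow_add, mv, move]
  ring

end Word
end
end Freehedral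

namespace Freehedral
noncomputable section
namespace Word
open Letter
variable {Y : Type u} [TopologicalSpace Y]

/-- The letters of the left factors of the diagonal, if the base is moved to `j`, where the
directions are numbered from `o`. -/
def leftMoved (o j : ℕ) (L : Finset ℕ) (i : ℕ) : Letter :=
  if i + (o - 1) = j then b else if i = 1 ∨ i + (o - 1) ∈ L then z else k

lemma faceWord_leftMoved (κ m l o j : ℕ) (L : Finset ℕ) (hm : 0 < m) (ho : 1 ≤ o) (hj : o ≤ j)
    (hj' : j < m + o) : FaceWord κ m l (word κ m l z (leftMoved o j L)) := by
  obtain ⟨m, rfl⟩ := Nat.exists_eq_succ_of_ne_zero (show m ≠ 0 by omega)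
  have hp : ∀ i, i + (o - 1) ≠ j → IsPlain (leftMoved o j L i) := by
    intro i hi
    unfold leftMoved IsPlain
    rw [if_neg hi]
    split_ifs <;> simp
  by_cases h : o = j
  · subst h
    refine faceWord_word_base (fun i h1 _ => hp i (by omega)) (Or.inl ?_)
    unfold leftMoved
    rw [if_pos (by omega)]
  · refine faceWord_word_moved (β := j - (o - 1)) (fun i h1 _ h3 => hp i (by omega)) ?_ (by omega)
      (by omega) (Or.inl ?_)
    · unfold leftMoved
      rw [if_neg (by omega), if_pos (Or.inl rfl)]
    · unfold leftMoved
      rw [if_pos (by omega)]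

lemma le_getLastD {o : ℕ} {bs : List ℕ} (hs : (o :: bs).Pairwise (· < ·)) :
    ∀ x ∈ o :: bs, x ≤ bs.getLastD o := by
  induction bs generalizing o with
  | nil => simp
  | cons b' bs ih =>
    rw [List.pairwise_cons] at hs
    rw [List.getLastD_cons]
    intro x hx
    rcases List.mem_cons.1 hx with rfl | hx
    · exact (hs.1 b' (by simp)).le.trans (ih hs.2 b' (by simp))
    · exact ih hs.2 x hx

lemma getLastD_mem (o : ℕ) (bs : List ℕ) : bs.getLastD o ∈ o :: bs := by
  induction bs generalizing o with
  | nil => simp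
  | cons b' bs ih =>
    rw [List.getLastD_cons]
    exact List.mem_cons_of_mem _ (ih b')

/-- The faces `d^0_(j_p) ⋯ d^0_(j_(r+1)) d^2_(j_r) ⋯ d^2_(j_1)`. -/
lemma iterate_d0_iterateD2 {n : ℕ} (c : Cell Y n) (o : ℕ) (bs : List ℕ) (M : Finset ℕ) (ho : 1 ≤ o)
    (hs : (o :: bs).Pairwise (· < ·)) (hb : ∀ x ∈ bs, x < c.m + o) (hm : 0 < c.m)
    (hM : ∀ x ∈ M, bs.getLastD o < x ∧ x ≤ n + o - 1) :
    AnyCell.iterate AnyCell.d0 (M.image (· - (bs.getLastD o - 1)))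
        (AnyCell.iterateD2 o bs ⟨n, c⟩) =
      realize c (word c.k c.m c.l z (leftMoved o (bs.getLastD o) (bs.toFinset ∪ M))) := by
  induction bs generalizing n o with
  | nil =>
    simp only [List.getLastD_nil] at hM ⊢
    have hmem : ∀ i, 1 ≤ i → (i ∈ M.image (· - (o - 1)) ↔ i + (o - 1) ∈ M) := by
      intro i hi
      rw [Finset.mem_image]
      constructor
      · rintro ⟨x, hx, rfl⟩
        have := hM x hx
        rwa [Nat.sub_add_cancel (by omega)]
      · intro h
        exact ⟨_, h, by omega⟩
    change AnyCell.iterate AnyCell.d0 _ ⟨n, c⟩ = _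
    rw [iterate_d0]
    · have e : endLetter c.m = z := by unfold endLetter; rw [if_neg (by omega)]
      rw [e]
      congr 1
      refine word_congr fun i h1 h2 => ?_
      unfold leftLetter leftMoved
      have h3 : ¬ 1 ∈ M.image (· - (o - 1)) := by
        rw [hmem _ le_rfl]
        intro h
        have := hM _ h
        omega
      by_cases hi : i = 1
      · subst hi
        rw [if_pos (by omega), if_neg h3, if_pos (by omega)]
      · have h5 : ¬ (i = 1 ∧ 0 < c.m) := by omega
        have h6 : ¬ (i + (o - 1) = o) := by omega
        simp [h5, h6, hi, hmem i h1]
    · intro x hx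
      rw [Finset.mem_image] at hx
      obtain ⟨y, hy, rfl⟩ := hx
      have := hM y hy
      omega
  | cons b' bs ih =>
    rw [List.getLastD_cons] at hM ⊢
    have hs' := List.pairwise_cons.1 hs
    have hob := hs'.1 b' (by simp)
    have hbm := hb b' (by simp)
    have hdim := c.dim_eq
    obtain ⟨n, rfl⟩ := Nat.exists_eq_succ_of_ne_zero (show n ≠ 0 by omega)
    have hd : AnyCell.d2 (b' - o) (⟨n + 1, c⟩ : AnyCell Y) = ⟨n, Cell.face 2 (b' - o) c⟩ :=
      if_pos (by omega)
    have hA : Cell.Adm (n + 1) c.m 2 (b' - o) := by unfold Cell.Adm; omega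
    have s := (face_shape c hA).2.1
    have e : (Cell.face 2 (b' - o) c).m = c.m - (b' - o) := by rw [s]; simp [Cell.faceM]
    have hlast := le_getLastD hs'.2
    have hlb := hlast b' (by simp)
    have hlast' : bs.getLastD b' < c.m + o := hb _ (getLastD_mem _ _)
    rw [AnyCell.iterateD2, hd, ih (Cell.face 2 (b' - o) c) b' (by omega) hs'.2
        (fun x hx => by have := hb x (by simp [hx]); omega) (by omega)
        (fun x hx => by have := hM x hx; omega),
      realize_d2_word c (by omega) (by omega)
        (faceWord_leftMoved _ _ _ _ _ _ (by omega) (by omega) hlb (by omega))]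
    congr 1
    refine word_congr fun i h1 h2 => ?_
    unfold insSpecial
    by_cases hi1 : i = 1
    · subst hi1
      unfold leftMoved
      rw [if_pos rfl, if_neg (by omega), if_pos (Or.inl rfl)]
    · rw [if_neg hi1]
      have hbs := fun x (hx : x ∈ bs) => (List.pairwise_cons.1 hs'.2).1 x hx
      by_cases hi : i ≤ b' - o
      · rw [if_pos hi]
        unfold leftMoved
        have g1 : ¬ (i + (n + 1) - (b' - o) - 1 + (b' - 1) ∈ bs.toFinset ∪ M) := by
          rw [Finset.mem_union, List.mem_toFinset]
          rintro (h | h)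
          · have := hlast _ (List.mem_cons_of_mem _ h); omega
          · have := hM _ h; omega
        have g2 : ¬ (i + (o - 1) ∈ (b' :: bs).toFinset ∪ M) := by
          rw [Finset.mem_union, List.mem_toFinset, List.mem_cons]
          rintro ((h | h) | h)
          · omega
          · have := hbs _ h; omega
          · have := hM _ h; omega
        rw [if_neg (by omega), if_neg (by rintro (h | h); · omega
                                          · exact g1 h), if_neg (by omega),
          if_neg (by rintro (h | h); · omega
                     · exact g2 h)]
      · rw [if_neg hi]
        unfold leftMoved
        have g1 : i - (b' - o) + (b' - 1) = i + (o - 1) := by omega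
        have g2 : i - (b' - o) = 1 ↔ i + (o - 1) = b' := by omega
        rw [g1]
        simp [g2, hi1, or_assoc]

lemma sort_eq_append (A : Finset ℕ) (i : ℕ) :
    A.sort = (A.filter (· ≤ i)).sort ++ (A.filter (i < ·)).sort := by
  refine List.Perm.eq_of_pairwise (le := (· ≤ ·)) ?_ (Finset.pairwise_sort _ _) ?_ ?_
  · intro a b _ _ h1 h2; exact le_antisymm h1 h2
  · rw [List.pairwise_append]
    refine ⟨Finset.pairwise_sort _ _, Finset.pairwise_sort _ _, ?_⟩
    intro a ha b hb
    simp only [Finset.mem_sort, Finset.mem_filter] at ha hb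
    omega
  · refine (List.perm_ext_iff_of_nodup (Finset.sort_nodup _ _) ?_).2 fun a => ?_
    · rw [List.nodup_append]
      refine ⟨Finset.sort_nodup _ _, Finset.sort_nodup _ _, ?_⟩
      intro a ha b hb
      simp only [Finset.mem_sort, Finset.mem_filter] at ha hb
      omega
    · simp only [Finset.mem_sort, Finset.mem_filter, List.mem_append]
      constructor
      · intro h
        rcases le_or_gt a i with h' | h'
        · exact Or.inl ⟨h, h'⟩
        · exact Or.inr ⟨h, h'⟩
      · rintro (h | h) <;> exact h.1

lemma initialPart_card {m i : ℕ} (hi : i ≤ m) (L : Finset ℕ) :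
    Cell.initialPart m L (L.filter (· ≤ i)).card = (L.filter (· ≤ i)).sort := by
  unfold Cell.initialPart
  have h : (L.filter (· ≤ m)).filter (· ≤ i) = L.filter (· ≤ i) := by
    ext x
    simp only [Finset.mem_filter]
    constructor
    · rintro ⟨⟨h1, _⟩, h2⟩; exact ⟨h1, h2⟩
    · rintro ⟨h1, h2⟩; exact ⟨⟨h1, by omega⟩, h2⟩
  rw [sort_eq_append _ i, h]
  exact List.take_left' (Finset.length_sort _)

lemma pairwise_cons_sort {L : Finset ℕ} {i : ℕ} (hL : ∀ x ∈ L, 2 ≤ x) :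
    (1 :: (L.filter (· ≤ i)).sort).Pairwise (· < ·) := by
  rw [List.pairwise_cons]
  refine ⟨fun x hx => hL x ?_, (Finset.sortedLT_sort _).pairwise⟩
  simp only [Finset.mem_sort, Finset.mem_filter] at hx
  exact hx.1

lemma getLastD_sort {L : Finset ℕ} {i : ℕ} (hL : ∀ x ∈ L, 2 ≤ x) (hi : i ∈ insert 1 L) :
    ((L.filter (· ≤ i)).sort).getLastD 1 = i := by
  refine le_antisymm ?_ (le_getLastD (pairwise_cons_sort hL) i ?_)
  · have := getLastD_mem 1 ((L.filter (· ≤ i)).sort)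
    simp only [List.mem_cons, Finset.mem_sort, Finset.mem_filter] at this
    rcases this with h | h
    · rcases Finset.mem_insert.1 hi with hi | hi
      · omega
      · have := hL i hi; omega
    · exact h.2
  · simp only [List.mem_cons, Finset.mem_sort, Finset.mem_filter]
    rcases Finset.mem_insert.1 hi with hi | hi
    · exact Or.inl hi
    · exact Or.inr ⟨hi, le_rfl⟩

lemma partialSum_card {m i : ℕ} {L : Finset ℕ} (hL : ∀ x ∈ L, 2 ≤ x) (hi : i ∈ insert 1 L)
    (him : i ≤ m) : Cell.partialSum m L (L.filter (· ≤ i)).card = i - 1 := by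
  unfold Cell.partialSum
  rw [initialPart_card him, getLastD_sort hL hi]

/-- The left factors of the special part of the diagonal. -/
lemma leftFactor_card {n : ℕ} (c : Cell Y n) {L : Finset ℕ} {i : ℕ}
    (hL : ∀ x ∈ L, 2 ≤ x ∧ x ≤ n) (hi : i ∈ insert 1 L) (him : i ≤ c.m) :
    c.leftFactor L (L.filter (· ≤ i)).card =
      realize c (word c.k c.m c.l z (zkb (insert 1 L) i)) := by
  have h2 := fun x hx => (hL x hx).1
  have h1 : 1 ≤ i := by
    rcases Finset.mem_insert.1 hi with h | h
    · omega
    · have := h2 i h; omega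
  have key := iterate_d0_iterateD2 c 1 (L.filter (· ≤ i)).sort (L.filter (i < ·)) le_rfl
    (pairwise_cons_sort h2) (fun x hx => by
      simp only [Finset.mem_sort, Finset.mem_filter] at hx; omega) (by omega) (fun x hx => by
      rw [getLastD_sort h2 hi]
      rw [Finset.mem_filter] at hx
      have := hL x hx.1
      omega)
  rw [getLastD_sort h2 hi] at key
  unfold Cell.leftFactor
  rw [partialSum_card h2 hi him, initialPart_card him, Nat.sub_add_cancel h1, key]
  congr 1
  refine word_congr fun x _ _ => ?_
  unfold leftMoved zkb zk
  have : (x ∈ (L.filter (· ≤ i)).sort.toFinset ∪ L.filter (i < ·)) ↔ x ∈ L := by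
    simp only [Finset.mem_union, List.mem_toFinset, Finset.mem_sort, Finset.mem_filter]
    constructor
    · rintro (h | h) <;> exact h.1
    · intro h
      rcases le_or_gt x i with h' | h'
      · exact Or.inl ⟨h, h'⟩
      · exact Or.inr ⟨h, h'⟩
  simp only [Nat.sub_self, add_zero, this, Finset.mem_insert]

end Word
end
end Freehedral

namespace Freehedral
noncomputable section
namespace Word
open Letter
variable {R : Type*} [CommRing R]

/-- The left words of the product on a word `core (m + 1) l`, with the base moved to `i`. -/
def leftWord (m l : ℕ) (S : Finset ℕ) (i : ℕ) : List Letter :=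
  tail (zkb (insert 1 S) i) 1 (m + 1) l z

/-- The right words of the product on a word `core (m + 1) l`, with the base moved to `j`. -/
def rightWord (m l : ℕ) (S : Finset ℕ) (j : ℕ) : List Letter :=
  tail (rightMoved (m + 1) j (Finset.Ico 2 (2 + (m + l)) \ S)) 1 (m + 1) l (endMoved (m + 1) j)

lemma leftWord_one (m l : ℕ) (S : Finset ℕ) :
    leftWord m l S 1 = b :: tail (zk S) 2 m l z := by
  unfold leftWord tail
  rw [block, List.cons_append]
  congr 1
  have h : ∀ i, 2 ≤ i → zkb (insert 1 S) 1 i = zk S i := fun i hi => by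
    have : i ≠ 1 := by omega
    simp [zkb, zk, this]
  rw [block_congr (g := zk S) (a' := 2) fun i _ => h _ (by omega), add_comm 2 m,
    block_congr (n := l) (g := zk S) (a' := m + 2) fun i _ => by
      rw [h _ (by omega)]; congr 1; omega]

lemma leftWord_of_two_le (m l : ℕ) (S : Finset ℕ) {i : ℕ} (hi : 2 ≤ i) :
    leftWord m l S i = z :: tail (zkb S i) 2 m l z := by
  unfold leftWord tail
  rw [block, List.cons_append]
  have h1 : zkb (insert 1 S) i 1 = z := by
    unfold zkb zk; rw [if_neg (by omega), if_pos (by simp)]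
  rw [h1]
  congr 1
  have h : ∀ x, 2 ≤ x → zkb (insert 1 S) i x = zkb S i x := fun x hx => by
    have : x ≠ 1 := by omega
    simp [zkb, zk, this]
  rw [block_congr (g := zkb S i) (a' := 2) fun i _ => h _ (by omega), add_comm 2 m,
    block_congr (n := l) (g := zkb S i) (a' := m + 2) fun i _ => by
      rw [h _ (by omega)]; congr 1; omega]

lemma rightWord_of_le {m l : ℕ} {S : Finset ℕ} {j : ℕ} (hj : j ≤ m + 1) :
    rightWord m l S j = z :: tail (keb S j) 2 m l z := by
  unfold rightWord tail
  have h1 : endMoved (m + 1) j = z := if_pos hj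
  have h : ∀ x, 2 ≤ x → x < 2 + (m + l) →
      rightMoved (m + 1) j (Finset.Ico 2 (2 + (m + l)) \ S) x = keb S j x := fun x hx hx' => by
    have h1 : x ≠ 1 := by omega
    have h2 : x ∈ Finset.Ico 2 (2 + (m + l)) \ S ↔ x ∉ S := by
      simp only [Finset.mem_sdiff, Finset.mem_Ico]; tauto
    unfold rightMoved keb ke
    simp only [h1, h2, hj, if_false, and_true, ite_not]
  rw [block, List.cons_append, h1, block_congr (g := keb S j) (a' := 2) fun i _ => h _ (by omega)
    (by omega), add_comm 2 m, block_congr (n := l) (g := keb S j) (a' := m + 2) fun i _ => by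
      rw [h _ (by omega) (by omega)]; congr 1; omega]
  rfl

lemma rightWord_end (m l : ℕ) (S : Finset ℕ) :
    rightWord m l S (m + 2) = z :: tail (ke S) 2 m l p := by
  unfold rightWord tail
  have h1 : endMoved (m + 1) (m + 2) = p := if_neg (by omega)
  have h : ∀ x, 2 ≤ x → x < 2 + (m + l) →
      rightMoved (m + 1) (m + 2) (Finset.Ico 2 (2 + (m + l)) \ S) x = ke S x := fun x hx hx' => by
    have h1 : x ≠ 1 := by omega
    have h2 : x ∈ Finset.Ico 2 (2 + (m + l)) \ S ↔ x ∉ S := by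
      simp only [Finset.mem_sdiff, Finset.mem_Ico]; tauto
    have h3 : ¬ m + 2 ≤ m + 1 := by omega
    unfold rightMoved ke
    simp only [h1, h2, h3, if_false, and_false, ite_not]
  rw [block, List.cons_append, h1, block_congr (g := ke S) (a' := 2) fun i _ => h _ (by omega)
    (by omega), add_comm 2 m, block_congr (n := l) (g := ke S) (a' := m + 2) fun i _ => by
      rw [h _ (by omega) (by omega)]; congr 1; omega]
  rfl

lemma deg_append (u v : List Letter) : deg (u ++ v) = deg u + deg v := by
  induction u with
  | nil => simp [deg]
  | cons c u ih => cases c <;> simp [deg, ih] <;> omega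

lemma deg_tail_zk {a m l : ℕ} (S : Finset ℕ) :
    deg (tail (zk S) a m l z) = (Finset.Ico a (a + (m + l)) \ S).card := by
  unfold tail
  rw [deg_append, show deg (z :: block (zk S) (a + m) l) = deg (block (zk S) (a + m) l) from rfl,
    deg_block_zk, deg_block_zk, Ico_add_eq_union, Finset.union_sdiff_distrib,
    Finset.card_union_of_disjoint ((disjoint_Ico_add a m l).mono Finset.sdiff_subset
      Finset.sdiff_subset)]

lemma moveSign_one {A S : Finset ℕ} (h : ∀ x ∈ A, 2 ≤ x) : moveSign A S 1 = inv (A \ S) S := by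
  unfold moveSign
  rw [Finset.filter_false_of_mem]
  · rfl
  · intro x hx
    have := h x (Finset.mem_sdiff.1 hx).1
    omega

/-- The directions to which the base of a right factor can be moved, without those up to `i`. -/
def targets (m i : ℕ) (S : Finset ℕ) : Finset ℕ :=
  (insert (m + 1) (S.filter (· ≤ m))).filter (i < ·)

lemma sum_targets {M : Type*} [AddCommMonoid M] {m i : ℕ} (hi : i < m + 1) (S : Finset ℕ)
    (F : ℕ → M) :
    ∑ j ∈ targets m i S, F j = ∑ j ∈ S.filter (fun j => i < j ∧ j < m + 1), F j + F (m + 1) := by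
  unfold targets
  rw [Finset.filter_insert, if_pos hi, Finset.sum_insert (by simp), add_comm, Finset.filter_filter]
  congr 1
  refine Finset.sum_congr (Finset.filter_congr fun x _ => ?_) fun _ _ => rfl
  omega

/-- The product on a word `core (m + 1) l`. -/
lemma cup_core_succ (m l : ℕ) (X Y : List Letter → R) :
    cup (core (m + 1) l) X Y = ∑ S ∈ (Finset.Ico 2 (2 + (m + l))).powerset,
      ((-1) ^ (inv (Finset.Ico 2 (2 + (m + l)) \ S) S + (Finset.Ico 2 (2 + (m + l)) \ S).card) *
          (X (p :: tail (zk S) 2 m l z) * Y (b :: tail (ke S) 2 m l z)) +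
        ∑ i ∈ insert 1 (S.filter (· ≤ m + 1)), ∑ j ∈ targets (m + 1) i S,
          (-1) ^ moveSign (Finset.Ico 2 (2 + (m + l))) S i *
            (X (leftWord m l S i) * Y (rightWord m l S j))) := by
  have hA : ∀ x ∈ Finset.Ico 2 (2 + (m + l)), 2 ≤ x := fun x hx => (Finset.mem_Ico.1 hx).1
  change cup (b :: (List.replicate m k ++ z :: List.replicate l k)) X Y = _
  rw [cup, cup_tail 2, cup_tail 2, cupMove_tail 2, ← Finset.sum_add_distrib,
    ← Finset.sum_add_distrib]
  refine Finset.sum_congr rfl fun S hS => ?_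
  rw [Finset.mem_powerset] at hS
  have h1S : 1 ∉ S := fun h => by have := hA 1 (hS h); omega
  rw [Finset.sum_insert (by simp [h1S]), moveSign_one hA, add_assoc]
  congr 1
  · simp only [twist, after, deg_tail_zk, pow_add]; ring
  congr 1
  · rw [sum_targets (by omega), ← Finset.mul_sum, mv_tail, leftWord_one, rightWord_end,
      mul_add, mul_add]
    have : S.filter (fun j => 1 < j ∧ j < m + 1 + 1) = S ∩ Finset.Ico 2 (2 + m) := by
      ext x
      simp only [Finset.mem_filter, Finset.mem_inter, Finset.mem_Ico]
      have := fun h : x ∈ S => hA x (hS h)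
      constructor
      · rintro ⟨h1, h2⟩; exact ⟨h1, by omega⟩
      · rintro ⟨h1, h2⟩; exact ⟨h1, by omega⟩
    rw [this, Finset.mul_sum]
    congr 2
    refine Finset.sum_congr rfl fun j hj => ?_
    have := Finset.mem_Ico.1 (Finset.mem_inter.1 hj).2
    rw [rightWord_of_le (by omega)]
    rfl
  · have : S.filter (· < 2 + m) = S.filter (· ≤ m + 1) :=
      Finset.filter_congr fun x _ => by omega
    rw [this]
    refine Finset.sum_congr rfl fun i hi => ?_
    rw [Finset.mem_filter] at hi
    have hi2 := hA i (hS hi.1)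
    rw [sum_targets (by omega), leftWord_of_two_le m l S hi2, rightWord_end, mul_add, mul_add,
      Finset.mul_sum, Finset.mul_sum]
    have : S.filter (fun j => i < j ∧ j < 2 + m) = S.filter (fun j => i < j ∧ j < m + 1 + 1) :=
      Finset.filter_congr fun x _ => by omega
    rw [this]
    congr 1
    refine Finset.sum_congr rfl fun j hj => ?_
    rw [Finset.mem_filter] at hj
    rw [rightWord_of_le (by omega)]
    rfl

lemma kdim_block_append_plain {f : ℕ → Letter} {a n : ℕ} {v : List Letter}
    (h : ∀ i, a ≤ i → i < a + n → IsPlain (f i)) :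
    kdim (block f a n ++ v) = ((Finset.Ico a (a + n)).filter fun i => f i = k).card + kdim v := by
  induction n generalizing v with
  | zero => simp [block]
  | succ n ih =>
    rw [block_succ, List.append_assoc, ih fun i h1 h2 => h i h1 (by omega), Ico_succ_insert,
      Finset.filter_insert]
    rcases h (a + n) (by omega) (by omega) with h | h | h
    · rw [if_pos h, Finset.card_insert_of_notMem (by simp), h]
      simp [kdim]
      omega
    · simp [h, kdim]
    · simp [h, kdim]

lemma kdim_block_append_base {f : ℕ → Letter} {a n j : ℕ} {v : List Letter}
    (h : ∀ i, a ≤ i → i < j → IsPlain (f i)) (h1 : a ≤ j) (h2 : j < a + n) (hj : f j = b) :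
    kdim (block f a n ++ v) = ((Finset.Ico a j).filter fun i => f i = k).card := by
  obtain ⟨r, rfl⟩ := Nat.exists_eq_add_of_le h1
  obtain ⟨s, rfl⟩ := Nat.exists_eq_add_of_lt (show r < n by omega)
  rw [add_assoc r, block_add, List.append_assoc,
    kdim_block_append_plain h, block, hj]
  simp [kdim]

lemma deg_block (f : ℕ → Letter) (a n : ℕ) :
    deg (block f a n) = ((Finset.Ico a (a + n)).filter fun i => f i = k ∨ f i = b).card := by
  induction n with
  | zero => simp [block, deg]
  | succ n ih =>
    rw [block_succ, deg_append, ih, Ico_succ_insert, Finset.filter_insert]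
    cases h : f (a + n) <;> simp [h, deg]

lemma deg_tail (f : ℕ → Letter) (a m l : ℕ) {τ : Letter} (hτ : τ = z ∨ τ = p) :
    deg (tail f a m l τ) =
      ((Finset.Ico a (a + (m + l))).filter fun i => f i = k ∨ f i = b).card := by
  unfold tail
  have : deg (τ :: block f (a + m) l) = deg (block f (a + m) l) := by
    rcases hτ with rfl | rfl <;> rfl
  rw [deg_append, this, deg_block, deg_block, Ico_add_eq_union, Finset.filter_union,
    Finset.card_union_of_disjoint
      ((disjoint_Ico_add a m l).mono (Finset.filter_subset _ _) (Finset.filter_subset _ _))]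

end Word
end
end Freehedral

namespace Freehedral
noncomputable section
namespace Word
open Letter

lemma word_eq_append_tail (κ m l : ℕ) (τ : Letter) (f : ℕ → Letter) :
    word κ m l τ f = block f (m + l + 1) κ ++ tail f 1 m l τ := by
  unfold word tail
  rw [add_comm 1 m]

section words
variable {κ m l : ℕ} {S T : Finset ℕ}

lemma deg_tail_ke (hS : S ⊆ Finset.Ico 2 (2 + (m + l))) : deg (tail (ke S) 2 m l z) = S.card := by
  rw [deg_tail _ _ _ _ (Or.inl rfl)]
  congr 1
  ext x
  rw [Finset.mem_filter]
  unfold ke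
  by_cases h : x ∈ S
  · simp only [h, if_true, true_or, and_true, iff_true]
    exact hS h
  · simp [h]

lemma deg_leftWord (hS : S ⊆ Finset.Ico 2 (2 + (m + l))) {i : ℕ} (hi : i ∈ insert 1 S) :
    deg (leftWord m l S i) = (Finset.Ico 2 (2 + (m + l)) \ S).card + 1 := by
  unfold leftWord
  rw [deg_tail _ _ _ _ (Or.inl rfl), ← Finset.card_insert_of_notMem (a := i)]
  · congr 1
    ext x
    have h1 := fun h : x ∈ S => Finset.mem_Ico.1 (hS h)
    have h2 := fun h : i ∈ S => Finset.mem_Ico.1 (hS h)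
    rw [Finset.mem_insert] at hi
    simp only [Finset.mem_filter, Finset.mem_insert, Finset.mem_sdiff, Finset.mem_Ico, zkb, zk]
    by_cases hx : x = i
    · subst hx
      simp
      rcases hi with hi | hi
      · omega
      · have := h2 hi; omega
    · by_cases hx1 : x = 1
      · subst hx1; simp [hx]
      · by_cases hxS : x ∈ S
        · simp [hx, hx1, hxS]
        · simp [hx, hx1, hxS]; omega
  · rw [Finset.mem_sdiff, Finset.mem_Ico]
    rintro ⟨h1, h2⟩
    rcases Finset.mem_insert.1 hi with hi | hi
    · omega
    · exact h2 hi

lemma kdim_leftWord (hS : S ⊆ Finset.Ico 2 (2 + (m + l))) {i : ℕ} (hi : i ∈ insert 1 S)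
    (him : i ≤ m + 1) :
    kdim (leftWord m l S i) = ((Finset.Ico 2 (2 + (m + l)) \ S).filter (· < i)).card := by
  have h1i : 1 ≤ i := by
    rcases Finset.mem_insert.1 hi with hi | hi
    · omega
    · have := Finset.mem_Ico.1 (hS hi); omega
  unfold leftWord tail
  rw [kdim_block_append_base (j := i) _ h1i (by omega) (if_pos rfl)]
  · congr 1
    ext x
    simp only [Finset.mem_filter, Finset.mem_sdiff, Finset.mem_Ico]
    unfold zkb zk
    by_cases hx : x < i
    · have : x ≠ i := by omega
      by_cases hx1 : x = 1
      · subst hx1; simp [this]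
      · by_cases hxS : x ∈ S
        · simp [this, hx1, hxS]
        · simp [this, hx1, hxS]; omega
    · simp [hx]
  · intro x _ hx
    unfold zkb zk IsPlain
    rw [if_neg (by omega)]
    split_ifs <;> simp

lemma rightMoved_eq_k (hS : S ⊆ Finset.Ico 2 (2 + (m + l))) {j x : ℕ}
    (hj : j ∈ insert (m + 2) (S.filter (· ≤ m + 1))) (h1 : 1 ≤ x) (h2 : x < 2 + (m + l)) :
    (rightMoved (m + 1) j (Finset.Ico 2 (2 + (m + l)) \ S) x = k ∨
      rightMoved (m + 1) j (Finset.Ico 2 (2 + (m + l)) \ S) x = b) ↔ x ∈ S := by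
  have h3 := fun h : x ∈ S => Finset.mem_Ico.1 (hS h)
  rw [Finset.mem_insert, Finset.mem_filter] at hj
  unfold rightMoved
  by_cases hx1 : x = 1
  · subst hx1
    have : 1 ∉ S := fun h => by have := h3 h; omega
    simp [this]
  · by_cases hxj : x = j ∧ j ≤ m + 1
    · have hxS : x ∈ S := by
        rcases hj with hj | hj
        · omega
        · exact hxj.1 ▸ hj.1
      simp only [if_neg hx1, if_pos hxj, hxS]
      simp
    · have : x ∈ Finset.Ico 2 (2 + (m + l)) \ S ↔ x ∉ S := by
        rw [Finset.mem_sdiff, Finset.mem_Ico]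
        constructor
        · exact fun h => h.2
        · exact fun h => ⟨by omega, h⟩
      simp only [if_neg hx1, if_neg hxj, this]
      by_cases hxS : x ∈ S <;> simp [hxS]

lemma deg_rightWord (hS : S ⊆ Finset.Ico 2 (2 + (m + l))) {j : ℕ}
    (hj : j ∈ insert (m + 2) (S.filter (· ≤ m + 1))) : deg (rightWord m l S j) = S.card := by
  unfold rightWord
  rw [deg_tail]
  · congr 1
    ext x
    have h3 := fun h : x ∈ S => Finset.mem_Ico.1 (hS h)
    rw [Finset.mem_filter, Finset.mem_Ico]
    constructor
    · rintro ⟨h1, h2⟩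
      exact (rightMoved_eq_k hS hj h1.1 (by omega)).1 h2
    · intro h
      have := h3 h
      exact ⟨by omega, (rightMoved_eq_k hS hj (by omega) (by omega)).2 h⟩
  · unfold endMoved
    split_ifs <;> simp

lemma kdim_rightWord (hS : S ⊆ Finset.Ico 2 (2 + (m + l))) {j : ℕ}
    (hj : j ∈ insert (m + 2) (S.filter (· ≤ m + 1))) :
    kdim (rightWord m l S j) = (S.filter (· < j)).card := by
  have hS' := fun x (h : x ∈ S) => Finset.mem_Ico.1 (hS h)
  have hj2 : 2 ≤ j ∧ j ≤ m + 2 := by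
    rw [Finset.mem_insert, Finset.mem_filter] at hj
    rcases hj with hj | hj
    · omega
    · have := hS' _ hj.1; omega
  have hpl : ∀ x, 1 ≤ x → ¬ (x = j ∧ j ≤ m + 1) →
      IsPlain (rightMoved (m + 1) j (Finset.Ico 2 (2 + (m + l)) \ S) x) := by
    intro x _ hx
    unfold rightMoved IsPlain
    split_ifs <;> simp
  have hk : ∀ x, 1 ≤ x → x < 2 + (m + l) → ¬ (x = j ∧ j ≤ m + 1) →
      (rightMoved (m + 1) j (Finset.Ico 2 (2 + (m + l)) \ S) x = k ↔ x ∈ S) := by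
    intro x h1 h2 hx
    rw [← rightMoved_eq_k hS hj h1 h2]
    rcases hpl x h1 hx with h | h | h <;> simp [h]
  unfold rightWord tail
  by_cases hjm : j ≤ m + 1
  · rw [kdim_block_append_base (j := j) (fun x h1 h2 => hpl x h1 (by omega)) (by omega) (by omega)]
    · congr 1
      ext x
      simp only [Finset.mem_filter, Finset.mem_Ico]
      constructor
      · rintro ⟨h1, h2⟩
        exact ⟨(hk x h1.1 (by omega) (by omega)).1 h2, h1.2⟩
      · rintro ⟨h1, h2⟩
        have := hS' x h1
        exact ⟨by omega, (hk x (by omega) (by omega) (by omega)).2 h1⟩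
    · unfold rightMoved
      rw [if_neg (by omega), if_pos ⟨rfl, hjm⟩]
  · have he : endMoved (m + 1) j = p := if_neg hjm
    rw [kdim_block_append_plain (fun x h1 h2 => hpl x h1 (by omega)), he]
    simp only [kdim, add_zero]
    congr 1
    ext x
    simp only [Finset.mem_filter, Finset.mem_Ico]
    constructor
    · rintro ⟨h1, h2⟩
      exact ⟨(hk x h1.1 (by omega) (by omega)).1 h2, by omega⟩
    · rintro ⟨h1, h2⟩
      have := hS' x h1
      exact ⟨by omega, (hk x (by omega) (by omega) (by omega)).2 h1⟩

variable (hS : S ⊆ Finset.Ico 2 (2 + (m + l)))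
  (hT : T ⊆ Finset.Ico (m + l + 2) (m + l + 2 + κ))
include hS hT

omit hS hT in
lemma mem_sdiff_union_iff {x : ℕ} (h1 : 2 ≤ x) (h2 : x < m + l + 2 + κ) :
    x ∈ Finset.Icc 2 (m + l + 1 + κ) \ (S ∪ T) ↔ x ∉ S ∧ x ∉ T := by
  simp only [Finset.mem_sdiff, Finset.mem_Icc, Finset.mem_union]
  constructor
  · rintro ⟨_, h⟩; tauto
  · rintro ⟨h3, h4⟩; exact ⟨by omega, by tauto⟩

lemma word_left_first : word κ (m + 1) l z (leftLetter (m + 1) (insert 1 (S ∪ T))) =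
    block (zk T) (m + l + 2) κ ++ p :: tail (zk S) 2 m l z := by
  have hS' := fun x (h : x ∈ S) => Finset.mem_Ico.1 (hS h)
  have hT' := fun x (h : x ∈ T) => Finset.mem_Ico.1 (hT h)
  have h1 : ∀ x, 2 ≤ x → x < m + l + 2 → leftLetter (m + 1) (insert 1 (S ∪ T)) x = zk S x :=
    fun x h1 h2 => by
      have hx : x ∉ T := fun h => by have := hT' x h; omega
      have hx1 : x ≠ 1 := by omega
      simp [leftLetter, zk, hx, hx1]
  have h2 : ∀ x, m + l + 2 ≤ x → leftLetter (m + 1) (insert 1 (S ∪ T)) x = zk T x :=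
    fun x h2 => by
      have hx : x ∉ S := fun h => by have := hS' x h; omega
      have hx1 : x ≠ 1 := by omega
      simp [leftLetter, zk, hx, hx1]
  have h3 : leftLetter (m + 1) (insert 1 (S ∪ T)) 1 = p := by simp [leftLetter]
  rw [word_eq_append_tail]
  unfold tail
  rw [block_congr (n := κ) (g := zk T) (a' := m + l + 2) fun i _ => by
      rw [h2 _ (by omega)]; congr 1; omega, block, h3,
    block_congr (n := m) (g := zk S) (a' := 2) fun i _ => h1 _ (by omega) (by omega),
    block_congr (n := l) (g := zk S) (a' := 2 + m) fun i _ => by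
      rw [h1 _ (by omega) (by omega)]; congr 1; omega]
  rfl

lemma word_right_first :
    word κ (m + 1) l z (rightLetter (m + 1) (Finset.Icc 2 (m + l + 1 + κ) \ (S ∪ T))) =
      block (ke T) (m + l + 2) κ ++ b :: tail (ke S) 2 m l z := by
  have hS' := fun x (h : x ∈ S) => Finset.mem_Ico.1 (hS h)
  have hT' := fun x (h : x ∈ T) => Finset.mem_Ico.1 (hT h)
  set K := Finset.Icc 2 (m + l + 1 + κ) \ (S ∪ T) with hK
  have h1 : ∀ x, 2 ≤ x → x < m + l + 2 → rightLetter (m + 1) K x = ke S x :=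
    fun x h1 h2 => by
      have hx : x ∉ T := fun h => by have := hT' x h; omega
      have hx1 : x ≠ 1 := by omega
      have := mem_sdiff_union_iff (κ := κ) (m := m) (l := l) (S := S) (T := T) h1 (by omega)
      rw [← hK] at this
      unfold rightLetter ke
      simp [this, hx, hx1]
  have h2 : ∀ x, m + l + 2 ≤ x → x < m + l + 2 + κ → rightLetter (m + 1) K x = ke T x :=
    fun x h2 h3 => by
      have hx : x ∉ S := fun h => by have := hS' x h; omega
      have hx1 : x ≠ 1 := by omega
      have := mem_sdiff_union_iff (κ := κ) (m := m) (l := l) (S := S) (T := T) (x := x) (by omega) (by omega)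
      rw [← hK] at this
      unfold rightLetter ke
      simp [this, hx, hx1]
  have h3 : rightLetter (m + 1) K 1 = b := by simp [rightLetter]
  rw [word_eq_append_tail]
  unfold tail
  rw [block_congr (n := κ) (g := ke T) (a' := m + l + 2) fun i _ => by
      rw [h2 _ (by omega) (by omega)]; congr 1; omega, block, h3,
    block_congr (n := m) (g := ke S) (a' := 2) fun i _ => h1 _ (by omega) (by omega),
    block_congr (n := l) (g := ke S) (a' := 2 + m) fun i _ => by
      rw [h1 _ (by omega) (by omega)]; congr 1; omega]
  rfl

lemma word_left_moved {i : ℕ} (hi : i ≤ m + 1) :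
    word κ (m + 1) l z (zkb (insert 1 (S ∪ T)) i) =
      block (zk T) (m + l + 2) κ ++ leftWord m l S i := by
  have hS' := fun x (h : x ∈ S) => Finset.mem_Ico.1 (hS h)
  have hT' := fun x (h : x ∈ T) => Finset.mem_Ico.1 (hT h)
  have h1 : ∀ x, x < m + l + 2 → zkb (insert 1 (S ∪ T)) i x = zkb (insert 1 S) i x :=
    fun x h2 => by
      have hx : x ∉ T := fun h => by have := hT' x h; omega
      simp [zkb, zk, hx]
  have h2 : ∀ x, m + l + 2 ≤ x → zkb (insert 1 (S ∪ T)) i x = zk T x :=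
    fun x h2 => by
      have hx : x ∉ S := fun h => by have := hS' x h; omega
      have hx1 : x ≠ 1 := by omega
      have hxi : x ≠ i := by omega
      simp [zkb, zk, hx, hx1, hxi]
  rw [word_eq_append_tail]
  unfold leftWord tail
  rw [block_congr (n := κ) (g := zk T) (a' := m + l + 2) fun i _ => by
      rw [h2 _ (by omega)]; congr 1; omega,
    block_congr (n := m + 1) (g := zkb (insert 1 S) i) (a' := 1) fun i _ => h1 _ (by omega),
    block_congr (n := l) (g := zkb (insert 1 S) i) (a' := 1 + (m + 1)) fun i _ => h1 _ (by omega)]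

lemma word_right_moved {j : ℕ} :
    word κ (m + 1) l (endMoved (m + 1) j)
        (rightMoved (m + 1) j (Finset.Icc 2 (m + l + 1 + κ) \ (S ∪ T))) =
      block (ke T) (m + l + 2) κ ++ rightWord m l S j := by
  have hS' := fun x (h : x ∈ S) => Finset.mem_Ico.1 (hS h)
  have hT' := fun x (h : x ∈ T) => Finset.mem_Ico.1 (hT h)
  set K := Finset.Icc 2 (m + l + 1 + κ) \ (S ∪ T) with hK
  have h1 : ∀ x, 1 ≤ x → x < m + l + 2 → rightMoved (m + 1) j K x =
      rightMoved (m + 1) j (Finset.Ico 2 (2 + (m + l)) \ S) x :=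
    fun x h1 h2 => by
      by_cases hx1 : x = 1
      · simp [rightMoved, hx1]
      have hx : x ∉ T := fun h => by have := hT' x h; omega
      have := mem_sdiff_union_iff (κ := κ) (m := m) (l := l) (S := S) (T := T) (x := x) (by omega) (by omega)
      rw [← hK] at this
      have h4 : x ∈ Finset.Ico 2 (2 + (m + l)) \ S ↔ x ∉ S := by
        rw [Finset.mem_sdiff, Finset.mem_Ico]
        constructor
        · exact fun h => h.2
        · exact fun h => ⟨by omega, h⟩
      unfold rightMoved
      simp only [this, h4, hx, not_false_eq_true, and_true]
  have h2 : ∀ x, m + l + 2 ≤ x → x < m + l + 2 + κ → rightMoved (m + 1) j K x = ke T x :=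
    fun x h2 h3 => by
      have hx : x ∉ S := fun h => by have := hS' x h; omega
      have hx1 : x ≠ 1 := by omega
      have hxj : ¬ (x = j ∧ j ≤ m + 1) := by omega
      have := mem_sdiff_union_iff (κ := κ) (m := m) (l := l) (S := S) (T := T) (x := x) (by omega) (by omega)
      rw [← hK] at this
      unfold rightMoved ke
      simp only [this, hx, hx1, hxj, if_false, not_false_eq_true, true_and, ite_not]
  rw [word_eq_append_tail]
  unfold rightWord tail
  rw [block_congr (n := κ) (g := ke T) (a' := m + l + 2) fun i _ => by
      rw [h2 _ (by omega) (by omega)]; congr 1; omega,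
    block_congr (n := m + 1) (g := rightMoved (m + 1) j (Finset.Ico 2 (2 + (m + l)) \ S)) (a' := 1)
      fun i _ => h1 _ (by omega) (by omega),
    block_congr (n := l) (g := rightMoved (m + 1) j (Finset.Ico 2 (2 + (m + l)) \ S))
      (a' := 1 + (m + 1)) fun i _ => h1 _ (by omega) (by omega)]

end words

end Word
end
end Freehedral

namespace Freehedral
noncomputable section
namespace Word
open Letter
variable {R : Type*} [CommRing R] {Y : Type u} [TopologicalSpace Y]

lemma wordFn_eq (g : AnyCell Y → R) {n : ℕ} (c : Cell Y n) {w : List Letter}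
    (h : FaceWord c.k c.m c.l w) :
    wordFn g c w = (-1) ^ (kdim w * (deg w + 1)) * g (realize c w) := by
  unfold wordFn
  congr 1
  refine neg_one_pow_congr ?_
  rw [h.deg_eq]
  push_cast
  generalize (kdim w : ZMod 2) = x
  generalize (mdim w : ZMod 2) = y
  generalize (ldim w : ZMod 2) = t
  revert x y t
  decide

lemma kdim_block_zk {T : Finset ℕ} {a n : ℕ} (v : List Letter) :
    kdim (block (zk T) a n ++ v) = (Finset.Ico a (a + n) \ T).card + kdim v := by
  rw [kdim_block_append_plain]
  · congr 2
    ext x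
    rw [Finset.mem_filter, Finset.mem_sdiff]
    unfold zk
    by_cases h : x ∈ T <;> simp [h]
  · intro i _ _
    unfold zk IsPlain
    split_ifs <;> simp

lemma kdim_block_ke {T : Finset ℕ} {a n : ℕ} (hT : T ⊆ Finset.Ico a (a + n)) (v : List Letter) :
    kdim (block (ke T) a n ++ v) = T.card + kdim v := by
  rw [kdim_block_append_plain]
  · congr 2
    ext x
    rw [Finset.mem_filter]
    unfold ke
    by_cases h : x ∈ T
    · simp only [h, if_true, and_true, iff_true]
      exact hT h
    · simp [h]
  · intro i _ _
    unfold ke IsPlain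
    split_ifs <;> simp

lemma deg_block_ke {T : Finset ℕ} {a n : ℕ} (hT : T ⊆ Finset.Ico a (a + n)) :
    deg (block (ke T) a n) = T.card := by
  rw [deg_block]
  congr 1
  ext x
  rw [Finset.mem_filter]
  unfold ke
  by_cases h : x ∈ T
  · simp only [h, if_true, true_or, and_true, iff_true]
    exact hT h
  · simp [h]

/-- The terms of the product on the word of a cell, as products of values on faces. -/
lemma wordFn_mul_wordFn (g h : AnyCell Y → R) {n : ℕ} (c : Cell Y n) {a : ℕ} {T : Finset ℕ}
    (hT : T ⊆ Finset.Ico a (a + c.k)) {u v : List Letter}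
    (hu : FaceWord c.k c.m c.l (block (zk T) a c.k ++ u))
    (hv : FaceWord c.k c.m c.l (block (ke T) a c.k ++ v)) (huv : deg u + deg v = c.m + c.l) :
    (-1) ^ (c.k * (c.m + c.l)) * (twistN T.card (pre (block (zk T) a c.k) (wordFn g c)) u *
      pre (block (ke T) a c.k) (wordFn h c) v) =
    (-1) ^ ((Finset.Ico a (a + c.k) \ T).card * deg v +
        kdim u * ((Finset.Ico a (a + c.k) \ T).card + deg u + 1) +
        kdim v * (T.card + deg v + 1)) *
      (g (realize c (block (zk T) a c.k ++ u)) * h (realize c (block (ke T) a c.k ++ v))) := by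
  have hk : c.k = (Finset.Ico a (a + c.k) \ T).card + T.card := by
    rw [Finset.card_sdiff_add_card_eq_card hT]; simp
  unfold twistN pre
  rw [wordFn_eq g c hu, wordFn_eq h c hv]
  have := neg_one_pow_congr (R := R) (a := c.k * (c.m + c.l) + T.card * deg u +
      kdim (block (zk T) a c.k ++ u) * (deg (block (zk T) a c.k ++ u) + 1) +
      kdim (block (ke T) a c.k ++ v) * (deg (block (ke T) a c.k ++ v) + 1))
    (b := (Finset.Ico a (a + c.k) \ T).card * deg v +
        kdim u * ((Finset.Ico a (a + c.k) \ T).card + deg u + 1) +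
        kdim v * (T.card + deg v + 1)) (by
      rw [kdim_block_zk, kdim_block_ke hT, deg_append, deg_append, deg_block_zk, deg_block_ke hT,
        ← huv]
      have hk' := congrArg (Nat.cast : ℕ → ZMod 2) hk
      push_cast at hk' ⊢
      rw [hk']
      generalize ((Finset.Ico a (a + c.k) \ T).card : ZMod 2) = x
      generalize (T.card : ZMod 2) = y
      generalize (deg u : ZMod 2) = d
      generalize (deg v : ZMod 2) = d'
      generalize (kdim u : ZMod 2) = s
      generalize (kdim v : ZMod 2) = s'
      revert x y d d' s s'
      decide)
  rw [← this]
  simp only [pow_add]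
  ring

/-- The exponent of the sign of a term of the special part of the diagonal. -/
def specialExp (n : ℕ) (L : Finset ℕ) (i j : ℕ) : ℕ :=
  inv (Finset.Icc 1 n \ L) L + ((Finset.Icc 2 n \ L).filter (· < i)).card * (n - L.card) +
    (L.card + 1) * (L.filter (· < j)).card

end Word
end
end Freehedral

namespace Freehedral
noncomputable section
namespace Word
open Letter
variable {R : Type*} [CommRing R] {Y : Type u} [TopologicalSpace Y]

section sets
variable {κ m l : ℕ} {S T : Finset ℕ} (hS : S ⊆ Finset.Ico 2 (2 + (m + l)))
  (hT : T ⊆ Finset.Ico (m + l + 2) (m + l + 2 + κ))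
include hS hT

lemma Icc_sdiff_union : Finset.Icc 2 (m + l + 1 + κ) \ (S ∪ T) =
    (Finset.Ico 2 (2 + (m + l)) \ S) ∪ (Finset.Ico (m + l + 2) (m + l + 2 + κ) \ T) := by
  ext x
  have h1 := fun h : x ∈ S => Finset.mem_Ico.1 (hS h)
  have h2 := fun h : x ∈ T => Finset.mem_Ico.1 (hT h)
  simp only [Finset.mem_sdiff, Finset.mem_union, Finset.mem_Ico, Finset.mem_Icc]
  constructor
  · rintro ⟨h, h'⟩
    by_cases hx : x < m + l + 2
    · exact Or.inl ⟨by omega, fun g => h' (Or.inl g)⟩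
    · exact Or.inr ⟨by omega, fun g => h' (Or.inr g)⟩
  · rintro (⟨h, h'⟩ | ⟨h, h'⟩)
    · exact ⟨by omega, by rintro (g | g); · exact h' g
                          · have := h2 g; omega⟩
    · exact ⟨by omega, by rintro (g | g); · have := h1 g; omega
                          · exact h' g⟩

lemma inv_Icc_sdiff_union : inv (Finset.Icc 2 (m + l + 1 + κ) \ (S ∪ T)) (S ∪ T) =
    inv (Finset.Ico 2 (2 + (m + l)) \ S) S +
      inv (Finset.Ico (m + l + 2) (m + l + 2 + κ) \ T) T +
      (Finset.Ico (m + l + 2) (m + l + 2 + κ) \ T).card * S.card := by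
  have hd : Disjoint (Finset.Ico 2 (2 + (m + l))) (Finset.Ico (m + l + 2) (m + l + 2 + κ)) := by
    rw [Finset.disjoint_left]; intro x; simp; omega
  rw [Icc_sdiff_union hS hT, inv_union_left (hd.mono Finset.sdiff_subset Finset.sdiff_subset),
    inv_union_right (hd.mono hS hT), inv_union_right (hd.mono hS hT),
    inv_of_le (K := Finset.Ico 2 (2 + (m + l)) \ S) (L := T),
    inv_of_lt (K := Finset.Ico (m + l + 2) (m + l + 2 + κ) \ T) (L := S)]
  · ring
  · intro x hx y hy
    have := Finset.mem_Ico.1 (hS hx)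
    have := Finset.mem_Ico.1 (Finset.mem_sdiff.1 hy).1
    omega
  · intro x hx y hy
    have := Finset.mem_Ico.1 (hT hx)
    have := Finset.mem_Ico.1 (Finset.mem_sdiff.1 hy).1
    omega

omit hS in
lemma filter_union_le {i : ℕ} (hi : i ≤ m + l + 1) : (S ∪ T).filter (· ≤ i) = S.filter (· ≤ i) := by
  rw [Finset.filter_union, Finset.filter_false_of_mem (s := T), Finset.union_empty]
  intro x hx
  have := Finset.mem_Ico.1 (hT hx)
  omega

omit hS in
lemma filter_union_lt {i : ℕ} (hi : i ≤ m + l + 2) : (S ∪ T).filter (· < i) = S.filter (· < i) := by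
  rw [Finset.filter_union, Finset.filter_false_of_mem (s := T), Finset.union_empty]
  intro x hx
  have := Finset.mem_Ico.1 (hT hx)
  omega

lemma filter_sdiff_union_lt {i : ℕ} (hi : i ≤ m + l + 2) :
    (Finset.Icc 2 (m + l + 1 + κ) \ (S ∪ T)).filter (· < i) =
      (Finset.Ico 2 (2 + (m + l)) \ S).filter (· < i) := by
  rw [Icc_sdiff_union hS hT, Finset.filter_union, Finset.filter_false_of_mem
    (s := Finset.Ico (m + l + 2) (m + l + 2 + κ) \ T), Finset.union_empty]
  intro x hx
  have := Finset.mem_Ico.1 (Finset.mem_sdiff.1 hx).1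
  omega

lemma card_union_eq : (S ∪ T).card = S.card + T.card := by
  refine Finset.card_union_of_disjoint (Finset.disjoint_left.2 fun x h1 h2 => ?_)
  have := Finset.mem_Ico.1 (hS h1)
  have := Finset.mem_Ico.1 (hT h2)
  omega

end sets

lemma Icc_one_eq_insert {n : ℕ} (hn : 1 ≤ n) : Finset.Icc 1 n = insert 1 (Finset.Icc 2 n) := by
  ext x; simp; omega

lemma inv_Icc_one {n : ℕ} (hn : 1 ≤ n) {L : Finset ℕ} (hL : L ⊆ Finset.Icc 2 n) :
    inv (Finset.Icc 1 n \ L) L = inv (Finset.Icc 2 n \ L) L := by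
  have h1 : 1 ∉ L := fun h => by have := Finset.mem_Icc.1 (hL h); omega
  rw [Icc_one_eq_insert hn, Finset.insert_sdiff_of_notMem _ h1, Finset.insert_eq,
    inv_union_left (by simp), inv_of_le (K := {1}), zero_add]
  intro x hx y hy
  have := Finset.mem_Icc.1 (hL hx)
  rw [Finset.mem_singleton] at hy
  omega

lemma inv_insert_one {n : ℕ} {L : Finset ℕ} (hL : L ⊆ Finset.Icc 2 n) :
    inv (Finset.Icc 2 n \ L) (insert 1 L) =
      inv (Finset.Icc 2 n \ L) L + (Finset.Icc 2 n \ L).card := by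
  have h1 : 1 ∉ L := fun h => by have := Finset.mem_Icc.1 (hL h); omega
  rw [Finset.insert_eq, inv_union_right (by simpa using h1), inv_of_lt (L := {1}), add_comm]
  · simp
  · intro x hx y hy
    have := Finset.mem_Icc.1 (Finset.mem_sdiff.1 hy).1
    rw [Finset.mem_singleton] at hx
    omega

/-- The product of functions on cells, on cells with a freehedral part. -/
lemma cellCup_of_pos (g h : AnyCell Y → R) {n : ℕ} (c : Cell Y n) (hm : 0 < c.m) :
    cellCup g h ⟨n, c⟩ = ∑ L ∈ (Finset.Icc 2 n).powerset,
      ((-1) ^ inv (Finset.Icc 2 n \ L) (insert 1 L) *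
          (g (realize c (word c.k c.m c.l z (leftLetter c.m (insert 1 L)))) *
            h (realize c (word c.k c.m c.l z (rightLetter c.m (Finset.Icc 2 n \ L))))) +
        ∑ i ∈ insert 1 (L.filter (· ≤ c.m)), ∑ j ∈ targets c.m i L,
          (-1) ^ specialExp n L i j *
            (g (realize c (word c.k c.m c.l z (zkb (insert 1 L) i))) *
              h (realize c (word c.k c.m c.l (endMoved c.m j)
                (rightMoved c.m j (Finset.Icc 2 n \ L)))))) := by
  obtain ⟨m, hcm⟩ := Nat.exists_eq_succ_of_ne_zero hm.ne'
  have hdim := c.dim_eq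
  have hn : n = m + c.l + 1 + c.k := by omega
  have hD : Finset.Icc 2 n =
      Finset.Ico 2 (2 + (m + c.l)) ∪ Finset.Ico (m + c.l + 2) (m + c.l + 2 + c.k) := by
    ext x; simp; omega
  have hdis : Disjoint (Finset.Ico 2 (2 + (m + c.l)))
      (Finset.Ico (m + c.l + 2) (m + c.l + 2 + c.k)) := by
    rw [Finset.disjoint_left]; intro x; simp; omega
  have hez : endLetter c.m = z := if_neg (by omega)
  rw [hD, sum_powerset_union hdis, Finset.sum_comm, ← hD]
  unfold cellCup
  rw [top_eq, cup_replicate_append (m + c.l + 2), Finset.mul_sum]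
  refine Finset.sum_congr rfl fun T hT => ?_
  simp only [hcm]
  rw [Nat.succ_eq_add_one, cup_core_succ, Finset.mul_sum, Finset.mul_sum]
  refine Finset.sum_congr rfl fun S hS => ?_
  rw [Finset.mem_powerset] at hS hT
  have hdeg : (Finset.Ico 2 (2 + (m + c.l)) \ S).card + S.card = m + c.l := by
    rw [Finset.card_sdiff_add_card_eq_card hS]; simp
  have hdegT : (Finset.Ico (m + c.l + 2) (m + c.l + 2 + c.k) \ T).card + T.card = c.k := by
    rw [Finset.card_sdiff_add_card_eq_card hT]; simp
  have hLn : S ∪ T ⊆ Finset.Icc 2 n := by rw [hD]; exact Finset.union_subset_union hS hT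
  have key := fun u v => wordFn_mul_wordFn g h c hT (u := u) (v := v)
  rw [hcm, Nat.succ_eq_add_one] at key
  have hinv := inv_Icc_sdiff_union hS hT
  have hsd := Icc_sdiff_union hS hT
  rw [← hn] at hinv hsd
  generalize (-1 : R) ^ (c.k * (m + 1 + c.l)) = σ at key ⊢
  rw [mul_add, mul_add]
  congr 1
  · have w1 := word_left_first hS hT
    have w2 := word_right_first hS hT
    rw [← hn] at w2
    have f1 := faceWord_left c.k c.m c.l (insert 1 (S ∪ T))
    have f2 := faceWord_right c.k c.m c.l (Finset.Icc 2 n \ (S ∪ T))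
    rw [hez, hcm, Nat.succ_eq_add_one, w1] at f1
    rw [hez, hcm, Nat.succ_eq_add_one, w2] at f2
    have hd1 : deg (p :: tail (zk S) 2 m c.l z) = (Finset.Ico 2 (2 + (m + c.l)) \ S).card :=
      deg_tail_zk S
    have hd2 : deg (b :: tail (ke S) 2 m c.l z) = S.card + 1 :=
      congrArg (· + 1) (deg_tail_ke hS)
    have := key _ _ f1 f2 (by rw [hd1, hd2]; omega)
    rw [hd1, hd2] at this
    rw [w1, w2, inv_insert_one hLn, hinv, hsd,
      Finset.card_union_of_disjoint (hdis.mono Finset.sdiff_subset Finset.sdiff_subset)]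
    simp only [kdim, zero_mul, add_zero] at this
    simp only [pow_add, mul_add, mul_one] at this ⊢
    linear_combination ((-1) ^ inv (Finset.Ico (m + c.l + 2) (m + c.l + 2 + c.k) \ T) T *
      ((-1) ^ inv (Finset.Ico 2 (2 + (m + c.l)) \ S) S *
        (-1) ^ (Finset.Ico 2 (2 + (m + c.l)) \ S).card)) * this
  · have ht : ∀ i, targets (m + 1) i (S ∪ T) = targets (m + 1) i S := fun i => by
      unfold targets; rw [filter_union_le hT (by omega)]
    rw [filter_union_le hT (by omega), Finset.mul_sum, Finset.mul_sum]
    refine Finset.sum_congr rfl fun i hi => ?_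
    rw [ht, Finset.mul_sum, Finset.mul_sum]
    refine Finset.sum_congr rfl fun j hj => ?_
    have hi1 : i ∈ insert 1 S ∧ i ≤ m + 1 := by
      rw [Finset.mem_insert, Finset.mem_filter] at hi
      rw [Finset.mem_insert]
      rcases hi with hi | hi
      · exact ⟨Or.inl hi, by omega⟩
      · exact ⟨Or.inr hi.1, hi.2⟩
    have hj1 : j ∈ insert (m + 2) (S.filter (· ≤ m + 1)) := (Finset.mem_filter.1 hj).1
    have hj2 : 2 ≤ j ∧ j ≤ m + 2 := by
      rw [Finset.mem_insert, Finset.mem_filter] at hj1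
      rcases hj1 with hj1 | hj1
      · omega
      · have := Finset.mem_Ico.1 (hS hj1.1); omega
    have h1i : 1 ≤ i := by
      rcases Finset.mem_insert.1 hi1.1 with hi | hi
      · omega
      · have := Finset.mem_Ico.1 (hS hi); omega
    have w1 := word_left_moved hS hT hi1.2
    have w2 := word_right_moved hS hT (j := j)
    rw [← hn] at w2
    have f1 : FaceWord c.k (m + 1) c.l (word c.k (m + 1) c.l z (zkb (insert 1 (S ∪ T)) i)) := by
      have := faceWord_leftMoved c.k (m + 1) c.l 1 i (insert 1 (S ∪ T)) (by omega) le_rfl h1i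
        (by omega)
      rwa [word_congr (g := zkb (insert 1 (S ∪ T)) i) fun x _ _ => by
        unfold leftMoved zkb zk
        simp [or_assoc]] at this
    have f2 := faceWord_rightMoved c.k (m + 1) c.l j (Finset.Icc 2 n \ (S ∪ T)) hj2.1 (by omega)
    rw [w1] at f1
    rw [w2] at f2
    have := key _ _ f1 f2 (by rw [deg_leftWord hS hi1.1, deg_rightWord hS hj1]; omega)
    rw [deg_leftWord hS hi1.1, deg_rightWord hS hj1, kdim_leftWord hS hi1.1 hi1.2,
      kdim_rightWord hS hj1] at this
    rw [w1, w2]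
    have hc : n - (S ∪ T).card = (Finset.Ico 2 (2 + (m + c.l)) \ S).card +
        (Finset.Ico (m + c.l + 2) (m + c.l + 2 + c.k) \ T).card + 1 := by
      rw [card_union_eq hS hT]; omega
    have hfl := filter_sdiff_union_lt hS hT (i := i) (by omega)
    rw [← hn] at hfl
    have e := neg_one_pow_congr (R := R) (b := specialExp n (S ∪ T) i j)
      (a := inv (Finset.Ico (m + c.l + 2) (m + c.l + 2 + c.k) \ T) T +
        moveSign (Finset.Ico 2 (2 + (m + c.l))) S i +
        ((Finset.Ico (m + c.l + 2) (m + c.l + 2 + c.k) \ T).card * S.card +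
          ((Finset.Ico 2 (2 + (m + c.l)) \ S).filter (· < i)).card *
            ((Finset.Ico (m + c.l + 2) (m + c.l + 2 + c.k) \ T).card +
              ((Finset.Ico 2 (2 + (m + c.l)) \ S).card + 1) + 1) +
          (S.filter (· < j)).card * (T.card + S.card + 1))) (by
        unfold specialExp moveSign
        rw [hc, inv_Icc_one (by omega) hLn, card_union_eq hS hT, filter_union_lt hT (by omega),
          hinv, hfl]
        push_cast
        have h2 : (2 : ZMod 2) = 0 := by decide
        linear_combination
          (((Finset.Ico 2 (2 + (m + c.l)) \ S).filter (· < i)).card : ZMod 2) * h2)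
    rw [← e]
    simp only [pow_add] at this ⊢
    linear_combination ((-1) ^ inv (Finset.Ico (m + c.l + 2) (m + c.l + 2 + c.k) \ T) T *
      (-1) ^ moveSign (Finset.Ico 2 (2 + (m + c.l))) S i) * this

/-- The product of functions on cells, on cells without a freehedral part. -/
lemma cellCup_of_zero (g h : AnyCell Y → R) {n : ℕ} (c : Cell Y n) (hm : c.m = 0) :
    cellCup g h ⟨n, c⟩ = ∑ L ∈ (Finset.Icc 1 n).powerset,
      (-1) ^ inv (Finset.Icc 1 n \ L) L *
          (g (realize c (word c.k c.m c.l p (leftLetter c.m L))) *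
            h (realize c (word c.k c.m c.l p (rightLetter c.m (Finset.Icc 1 n \ L))))) := by
  have hdim := c.dim_eq
  have hn : n = c.l + c.k := by omega
  have hD : Finset.Icc 1 n =
      Finset.Ico 1 (1 + c.l) ∪ Finset.Ico (1 + c.l) (1 + c.l + c.k) := by
    ext x; simp; omega
  have hD' : Finset.Icc 1 n = Finset.Ico 1 (1 + (c.l + c.k)) := by
    ext x; simp; omega
  have hdis := disjoint_Ico_add 1 c.l c.k
  have hep : endLetter c.m = p := if_pos hm
  rw [hD, sum_powerset_union hdis, Finset.sum_comm, ← hD, hD']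
  unfold cellCup
  rw [top_eq, cup_replicate_append (1 + c.l), Finset.mul_sum]
  refine Finset.sum_congr rfl fun T hT => ?_
  have key := fun u v => wordFn_mul_wordFn g h c (Finset.mem_powerset.1 hT) (u := u) (v := v)
  have f1 := fun L => faceWord_left c.k c.m c.l L
  have f2 := fun L => faceWord_right c.k c.m c.l L
  simp only [hm, hep] at key f1 f2 ⊢
  change _ * (_ * cup (p :: List.replicate c.l k) _ _) = _
  rw [cup, cup_replicate 1, Finset.mul_sum, Finset.mul_sum]
  refine Finset.sum_congr rfl fun S hS => ?_
  rw [Finset.mem_powerset] at hS hT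
  have hS' := fun x (h : x ∈ S) => Finset.mem_Ico.1 (hS h)
  have hT' := fun x (h : x ∈ T) => Finset.mem_Ico.1 (hT h)
  have w1 : word c.k 0 c.l p (leftLetter 0 (S ∪ T)) =
      block (zk T) (1 + c.l) c.k ++ p :: block (zk S) 1 c.l := by
    have : leftLetter 0 (S ∪ T) = zk (S ∪ T) := by funext i; simp [leftLetter, zk]
    unfold word
    rw [this, zero_add, add_comm c.l 1, block_union_left hT _ zk_local, block_union_right hS _ zk_local]
    rfl
  have w2 : word c.k 0 c.l p (rightLetter 0 (Finset.Ico 1 (1 + (c.l + c.k)) \ (S ∪ T))) =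
      block (ke T) (1 + c.l) c.k ++ p :: block (ke S) 1 c.l := by
    rw [word_congr (g := ke (S ∪ T)) fun i h1 h2 => by
      have h3 : i ∈ Finset.Ico 1 (1 + (c.l + c.k)) \ (S ∪ T) ↔ i ∉ S ∪ T := by
        rw [Finset.mem_sdiff, Finset.mem_Ico]
        constructor
        · exact fun h => h.2
        · exact fun h => ⟨by omega, h⟩
      unfold rightLetter ke
      simp only [h3, lt_irrefl, and_false, if_false, ite_not]]
    unfold word
    rw [zero_add, add_comm c.l 1, block_union_left hT _ ke_local, block_union_right hS _ ke_local]
    rfl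
  have hdeg : (Finset.Ico 1 (1 + c.l) \ S).card + S.card = c.l := by
    rw [Finset.card_sdiff_add_card_eq_card hS]; simp
  have hd1 : deg (p :: block (zk S) 1 c.l) = (Finset.Ico 1 (1 + c.l) \ S).card :=
    deg_block_zk S 1 c.l
  have hd2 : deg (p :: block (ke S) 1 c.l) = S.card := deg_block_ke hS
  have := key _ _ (w1 ▸ f1 (S ∪ T)) (w2 ▸ f2 (Finset.Ico 1 (1 + (c.l + c.k)) \ (S ∪ T)))
    (by rw [hd1, hd2]; omega)
  rw [hd1, hd2] at this
  rw [w1, w2, inv_union_Ico hS hT]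
  simp only [kdim, zero_mul, add_zero] at this
  simp only [pow_add, mul_comm S.card, after] at this ⊢
  linear_combination ((-1) ^ inv (Finset.Ico (1 + c.l) (1 + c.l + c.k) \ T) T *
    (-1) ^ inv (Finset.Ico 1 (1 + c.l) \ S) S) * this

end Word
end
end Freehedral

namespace Freehedral
noncomputable section
namespace Word
open Letter

/-- The sum over the ranks of the elements of `E` that are larger than `i`. -/
lemma sum_filter_card {M : Type*} [AddCommMonoid M] (E : Finset ℕ) (i : ℕ) (G : ℕ → M) :
    ∑ j ∈ E.filter (i < ·), G (E.filter (· ≤ j)).card =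
      ∑ t ∈ Finset.Icc ((E.filter (· ≤ i)).card + 1) E.card, G t := by
  have hlt : ∀ a b, b ∈ E → a < b → (E.filter (· ≤ a)).card < (E.filter (· ≤ b)).card := by
    intro a b hb hab
    refine Finset.card_lt_card ⟨fun x hx => ?_, fun h => ?_⟩
    · rw [Finset.mem_filter] at hx ⊢
      exact ⟨hx.1, by omega⟩
    · have := h (Finset.mem_filter.2 ⟨hb, le_rfl⟩)
      rw [Finset.mem_filter] at this
      omega
  have hinj : Set.InjOn (fun j => (E.filter (· ≤ j)).card) (E.filter (i < ·) : Finset ℕ) := by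
    intro a ha b hb hab
    simp only [Finset.coe_filter, Set.mem_ofPred_eq] at ha hb
    by_contra hne
    rcases Nat.lt_or_gt_of_ne hne with h | h
    · exact absurd hab (hlt a b hb.1 h).ne
    · exact absurd hab (hlt b a ha.1 h).ne'
  rw [← Finset.sum_image (f := G) hinj]
  refine Finset.sum_congr (Finset.eq_of_subset_of_card_le ?_ ?_) fun _ _ => rfl
  · intro t ht
    rw [Finset.mem_image] at ht
    obtain ⟨j, hj, rfl⟩ := ht
    rw [Finset.mem_filter] at hj
    rw [Finset.mem_Icc]
    exact ⟨hlt i j hj.1 hj.2, Finset.card_le_card (Finset.filter_subset _ _)⟩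
  · rw [Finset.card_image_of_injOn hinj, Nat.card_Icc]
    have : (E.filter (· ≤ i)).card + (E.filter (i < ·)).card = E.card := by
      rw [← Finset.card_filter_add_card_filter_not (s := E) (· ≤ i)]
      congr 2
      exact Finset.filter_congr fun x _ => by omega
    omega

lemma sum_insert_one {M : Type*} [AddCommMonoid M] {m : ℕ} {L : Finset ℕ} (hL : ∀ x ∈ L, 2 ≤ x)
    (G : ℕ → M) :
    ∑ i ∈ insert 1 (L.filter (· ≤ m)), G (L.filter (· ≤ i)).card =
      ∑ r ∈ Finset.range ((L.filter (· ≤ m)).card + 1), G r := by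
  have h1 : ∀ E ⊆ L, E.filter (· ≤ 1) = ∅ := fun E hE =>
    Finset.filter_false_of_mem fun x hx => by have := hL x (hE hx); omega
  have h2 : (L.filter (· ≤ m)).filter (1 < ·) = L.filter (· ≤ m) :=
    Finset.filter_true_of_mem fun x hx => hL x (Finset.mem_filter.1 hx).1
  have h3 : ∀ i ∈ L.filter (· ≤ m), G (L.filter (· ≤ i)).card =
      G ((L.filter (· ≤ m)).filter (· ≤ i)).card := fun i hi => by
    rw [Finset.mem_filter] at hi
    rw [Finset.filter_filter]
    congr 2
    exact Finset.filter_congr fun x _ => by omega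
  rw [Finset.sum_insert, h1 L subset_rfl, Finset.sum_congr rfl h3]
  · have := sum_filter_card (L.filter (· ≤ m)) 1 G
    rw [h2, h1 _ (Finset.filter_subset _ _)] at this
    rw [this, Finset.sum_range_succ', add_comm, Finset.range_eq_Ico,
      Finset.sum_Ico_add' G 0 _ 1]
    rfl
  · rw [Finset.mem_filter]
    intro h
    have := hL 1 h.1
    omega

lemma rank_eq {n m j : ℕ} (hmn : m ≤ n) {L : Finset ℕ} (hL : ∀ x ∈ L, 2 ≤ x) (hj : j ≤ m + 1)
    (hj2 : 2 ≤ j) :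
    rank ((Finset.Icc 2 n \ L).filter (· ≤ m)) j =
      ((insert (m + 1) (L.filter (· ≤ m))).filter (· ≤ j)).card := by
  unfold rank
  congr 1
  ext x
  have := hL x
  simp only [Finset.mem_sdiff, Finset.mem_Icc, Finset.mem_filter, Finset.mem_insert]
  by_cases hx : x ∈ L
  · simp only [hx, true_and, not_true_eq_false, and_false, false_and, not_false_eq_true, and_true]
    have := this hx
    omega
  · simp only [hx, not_false_eq_true, and_true, false_and, or_false]
    omega

lemma card_filter_le_eq {m j : ℕ} {L : Finset ℕ}
    (hj : j ∈ insert (m + 1) (L.filter (· ≤ m))) :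
    ((insert (m + 1) (L.filter (· ≤ m))).filter (· ≤ j)).card = (L.filter (· < j)).card + 1 := by
  have hjm : j ≤ m + 1 := by
    rw [Finset.mem_insert, Finset.mem_filter] at hj
    omega
  have : (insert (m + 1) (L.filter (· ≤ m))).filter (· ≤ j) = insert j (L.filter (· < j)) := by
    ext x
    rw [Finset.mem_insert, Finset.mem_filter] at hj
    simp only [Finset.mem_insert, Finset.mem_filter]
    constructor
    · rintro ⟨h1 | h1, h2⟩
      · left; omega
      · rcases h2.lt_or_eq with h | h
        · exact Or.inr ⟨h1.1, h⟩
        · exact Or.inl h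
    · rintro (rfl | h)
      · exact ⟨hj, le_rfl⟩
      · exact ⟨Or.inr ⟨h.1, by omega⟩, by omega⟩
  rw [this, Finset.card_insert_of_notMem (by simp)]

lemma card_filter_add_card {n i : ℕ} {L : Finset ℕ} (hL : ∀ x ∈ L, 2 ≤ x) (hi : i ∈ insert 1 L)
    (hin : i ≤ n) :
    ((Finset.Icc 2 n \ L).filter (· < i)).card + (L.filter (· ≤ i)).card = i - 1 := by
  rw [← Finset.card_union_of_disjoint]
  · have : (Finset.Icc 2 n \ L).filter (· < i) ∪ L.filter (· ≤ i) = Finset.Icc 2 i := by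
      ext x
      simp only [Finset.mem_union, Finset.mem_filter, Finset.mem_sdiff, Finset.mem_Icc]
      constructor
      · rintro (h | h)
        · omega
        · have := hL x h.1; omega
      · intro h
        by_cases hx : x ∈ L
        · exact Or.inr ⟨hx, h.2⟩
        · refine Or.inl ⟨⟨by omega, hx⟩, ?_⟩
          rcases h.2.lt_or_eq with h' | rfl
          · exact h'
          · rcases Finset.mem_insert.1 hi with h' | h'
            · omega
            · exact absurd h' hx
    rw [this, Nat.card_Icc]
    omega
  · rw [Finset.disjoint_left]
    intro x h1 h2
    simp only [Finset.mem_filter, Finset.mem_sdiff] at h1 h2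
    exact h1.1.2 h2.1

variable {Y : Type u} [TopologicalSpace Y]

lemma iterate_insert_min (op : ℕ → AnyCell Y → AnyCell Y) {L : Finset ℕ} {x : ℕ}
    (h : ∀ y ∈ L, x < y) (c : AnyCell Y) :
    AnyCell.iterate op (insert x L) c = op x (AnyCell.iterate op L c) := by
  have h1 : (insert x L).filter (· ≤ x) = {x} := by
    ext y
    simp only [Finset.mem_filter, Finset.mem_insert, Finset.mem_singleton]
    constructor
    · rintro ⟨h1 | h1, h2⟩
      · exact h1
      · have := h y h1; omega
    · rintro rfl; exact ⟨Or.inl rfl, le_rfl⟩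
  have h2 : (insert x L).filter (x < ·) = L := by
    ext y
    simp only [Finset.mem_filter, Finset.mem_insert]
    constructor
    · rintro ⟨h1 | h1, h2⟩
      · omega
      · exact h1
    · intro h1; exact ⟨Or.inr h1, h y h1⟩
  unfold AnyCell.iterate
  rw [sort_eq_append _ x, h1, h2, Finset.sort_singleton]
  rfl

lemma d1_one {c : AnyCell Y} (h : 0 < c.2.m) : AnyCell.d1 1 c = AnyCell.d2 1 c := by
  obtain ⟨_ | n, c⟩ := c
  · rfl
  · simp only at h
    simp only [AnyCell.d1, AnyCell.d2]
    rw [if_pos (by omega), if_pos (by omega)]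
    simp [Cell.d1, h]

lemma mdim_block_append {f : ℕ → Letter} {a n : ℕ} {v : List Letter}
    (h : ∀ i, a ≤ i → i < a + n → IsPlain (f i)) : mdim (block f a n ++ v) = mdim v := by
  induction n generalizing a with
  | zero => rfl
  | succ n ih =>
    rw [block, List.cons_append]
    have := ih (a := a + 1) fun i h1 h2 => h i (by omega) (by omega)
    rcases h a le_rfl (by omega) with h | h | h <;> rw [h, mdim, this] <;> simp

lemma m_iterate_d1_pos {n : ℕ} (c : Cell Y n) (hm : 0 < c.m) (K : Finset ℕ)
    (hK : ∀ x ∈ K, 2 ≤ x ∧ x ≤ n) : 0 < (AnyCell.iterate AnyCell.d1 K ⟨n, c⟩).2.m := by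
  rw [iterate_d1 c K (fun x hx => by have := hK x hx; omega)
    (fun h => by have := hK 1 h; omega)]
  obtain ⟨m, hcm⟩ := Nat.exists_eq_succ_of_ne_zero hm.ne'
  change 0 < mdim _
  unfold word
  rw [mdim_block_append fun i h1 h2 => rightLetter_plain (by omega), hcm, block,
    show rightLetter m.succ K 1 = b by simp [rightLetter]]
  simp [mdim]

variable {R : Type*} [CommRing R]

/-- The product of functions on cells is dual to the diagonal. -/
lemma cellCup_eq_diagonal (g h : AnyCell Y → R) {n : ℕ} (c : Cell Y n) :
    cellCup g h ⟨n, c⟩ =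
      Finsupp.linearCombination ℤ (fun s : AnyCell Y × AnyCell Y => g s.1 * h s.2) c.diagonal := by
  have hsm : ∀ (a : ℕ) (x : R), ((-1 : ℤ) ^ a) • x = (-1) ^ a * x := fun a x => by
    rw [zsmul_eq_mul]; push_cast; rfl
  have hus : ∀ K L, unshuffleSign K L = (-1) ^ inv K L := fun _ _ => rfl
  unfold Cell.diagonal Cell.serreDiagonal Cell.specialDiagonal
  simp only [map_add, map_sum, Finsupp.linearCombination_single, hus, ← pow_add, hsm]
  have hL2 : ∀ L ∈ (Finset.Icc 2 n).powerset, ∀ x ∈ L, 2 ≤ x ∧ x ≤ n := fun L hL x hx =>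
    Finset.mem_Icc.1 (Finset.mem_powerset.1 hL hx)
  by_cases hm : c.m = 0
  · rw [cellCup_of_zero g h c hm]
    have : ∀ L ∈ (Finset.Icc 2 n).powerset, L.filter (· ≤ c.m) = ∅ := fun L hL =>
      Finset.filter_false_of_mem fun x hx => by have := hL2 L hL x hx; omega
    rw [Finset.sum_eq_zero (s := (Finset.Icc 2 n).powerset), add_zero]
    · refine Finset.sum_congr rfl fun L hL => ?_
      have hL := Finset.mem_powerset.1 hL
      rw [iterate_d0 c L fun x hx => Finset.mem_Icc.1 (hL hx),
        iterate_d1 c _ (fun x hx => Finset.mem_Icc.1 (Finset.mem_sdiff.1 hx).1) fun _ => hm,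
        show endLetter c.m = p from if_pos hm]
    · intro L hL
      rw [this L hL, Finset.card_empty]
      refine Finset.sum_eq_zero fun r hr => Finset.sum_eq_zero fun t ht => ?_
      simp only [Finset.mem_filter, Finset.mem_Icc, Finset.mem_range] at hr ht
      omega
  · have hm : 0 < c.m := Nat.pos_of_ne_zero hm
    have hdim := c.dim_eq
    have hez : endLetter c.m = z := if_neg (by omega)
    rw [cellCup_of_pos g h c hm, Icc_one_eq_insert (by omega),
      Finset.sum_powerset_insert (by simp), ← Finset.sum_add_distrib, ← Finset.sum_add_distrib]
    refine Finset.sum_congr rfl fun L hL => ?_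
    have hL' := hL2 L hL
    have hL'' := fun x hx => (hL' x hx).1
    have h1L : 1 ∉ L := fun h => by have := hL' 1 h; omega
    have hK : ∀ x ∈ Finset.Icc 2 n \ L, 2 ≤ x ∧ x ≤ n := fun x hx =>
      Finset.mem_Icc.1 (Finset.mem_sdiff.1 hx).1
    have hs1 : insert 1 (Finset.Icc 2 n) \ insert 1 L = Finset.Icc 2 n \ L := by
      ext x
      simp only [Finset.mem_sdiff, Finset.mem_insert, Finset.mem_Icc]
      constructor
      · rintro ⟨h1, h2⟩; exact ⟨by omega, fun h => h2 (Or.inr h)⟩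
      · rintro ⟨h1, h2⟩; exact ⟨Or.inr h1, by rintro (h | h); · omega
                                              · exact h2 h⟩
    have hs2 : insert 1 (Finset.Icc 2 n) \ L = insert 1 (Finset.Icc 2 n \ L) :=
      Finset.insert_sdiff_of_notMem _ h1L
    rw [hs1, add_comm (_ * _) (_ * _), add_assoc]
    congr 1
    · rw [iterate_d0 c (insert 1 L) fun x hx => by
          rcases Finset.mem_insert.1 hx with h | h
          · omega
          · have := hL' x h; omega,
        iterate_d1 c _ (fun x hx => by have := hK x hx; omega)
          (fun h => by have := hK 1 h; omega), hez]
    · set term : ℕ → ℕ → R := fun r t =>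
        (-1) ^ ((Cell.partialSum c.m L r + r) * (n - L.card) + (L.card + 1) * (t + 1) +
          inv (insert 1 (Finset.Icc 2 n) \ L) L) * (g (c.leftFactor L r) * h (c.rightFactor L t))
        with hterm
      have h01 : (-1) ^ inv (insert 1 (Finset.Icc 2 n) \ L) L *
          (g (AnyCell.iterate AnyCell.d0 L ⟨n, c⟩) *
            h (AnyCell.iterate AnyCell.d1 (insert 1 (Finset.Icc 2 n) \ L) ⟨n, c⟩)) = term 0 1 := by
        have e1 := leftFactor_card c hL' (i := 1) (by simp) hm
        have e0 : L.filter (· ≤ 1) = ∅ :=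
          Finset.filter_false_of_mem fun x hx => by have := hL' x hx; omega
        rw [e0, Finset.card_empty] at e1
        have e2 := partialSum_card (m := c.m) hL'' (i := 1) (by simp) hm
        rw [e0, Finset.card_empty] at e2
        rw [hterm]
        simp only [e1, e2]
        congr 1
        · refine neg_one_pow_congr ?_
          push_cast
          have h2 : (2 : ZMod 2) = 0 := by decide
          linear_combination (-(L.card + 1 : ZMod 2)) * h2
        · congr 2
          · rw [iterate_d0 c L fun x hx => by have := hL' x hx; omega, hez]
            congr 1
            refine word_congr fun x _ _ => ?_
            unfold leftLetter zkb zk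
            by_cases hx : x = 1
            · simp [hx, hm, h1L]
            · simp [hx]
          · rw [hs2, iterate_insert_min _ fun y hy => (hK y hy).1,
              d1_one (m_iterate_d1_pos c hm _ hK)]
            rfl
      rw [h01]
      have hsum : term 0 1 + ∑ r ∈ Finset.range ((L.filter (· ≤ c.m)).card + 1),
          ∑ t ∈ (Finset.Icc (r + 1) ((L.filter (· ≤ c.m)).card + 1)).filter
            (fun t => ¬ (r = 0 ∧ t = 1)), term r t =
          ∑ r ∈ Finset.range ((L.filter (· ≤ c.m)).card + 1),
            ∑ t ∈ Finset.Icc (r + 1) ((L.filter (· ≤ c.m)).card + 1), term r t := by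
        rw [Finset.sum_range_succ', Finset.sum_range_succ', ← add_assoc, add_comm (term 0 1),
          add_assoc]
        congr 1
        · refine Finset.sum_congr rfl fun r _ => Finset.sum_congr ?_ fun _ _ => rfl
          exact Finset.filter_true_of_mem fun t _ => by omega
        · have h1 : 1 ∈ Finset.Icc (0 + 1) ((L.filter (· ≤ c.m)).card + 1) := by simp
          rw [← Finset.add_sum_erase _ _ h1]
          congr 1
          refine Finset.sum_congr ?_ fun _ _ => rfl
          ext t
          rw [Finset.mem_filter, Finset.mem_erase, and_comm]
          simp
      rw [hsum, ← sum_insert_one (m := c.m) hL'']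
      refine Finset.sum_congr rfl fun i hi => ?_
      have hi1 : i ∈ insert 1 L ∧ i ≤ c.m := by
        rw [Finset.mem_insert, Finset.mem_filter] at hi
        rw [Finset.mem_insert]
        rcases hi with hi | hi
        · exact ⟨Or.inl hi, by omega⟩
        · exact ⟨Or.inr hi.1, hi.2⟩
      have hE : (insert (c.m + 1) (L.filter (· ≤ c.m))).card = (L.filter (· ≤ c.m)).card + 1 :=
        Finset.card_insert_of_notMem (by simp)
      have hEi : (insert (c.m + 1) (L.filter (· ≤ c.m))).filter (· ≤ i) = L.filter (· ≤ i) := by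
        rw [Finset.filter_insert, if_neg (by omega), Finset.filter_filter]
        exact Finset.filter_congr fun x _ => by omega
      have := sum_filter_card (insert (c.m + 1) (L.filter (· ≤ c.m))) i
        (term (L.filter (· ≤ i)).card)
      rw [hEi, hE] at this
      rw [← this]
      refine Finset.sum_congr rfl fun j hj => ?_
      have hj1 := (Finset.mem_filter.1 hj).1
      have hj2 : j = c.m + 1 ∨ j ∈ L ∧ j ≤ c.m := by
        simpa only [Finset.mem_insert, Finset.mem_filter] using hj1
      have hj3 : 2 ≤ j ∧ j ≤ c.m + 1 := by
        rcases hj2 with h | h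
        · omega
        · have := hL' j h.1; omega
      have hrank := rank_eq (n := n) (m := c.m) (j := j) (by omega) hL'' hj3.2 hj3.1
      have hright := d2_iterate_d1 c _ hK j hj3.1 hj3.2 (fun h hjK => by
        rcases hj2 with h' | h'
        · omega
        · exact (Finset.mem_sdiff.1 hjK).2 h'.1)
      rw [hterm]
      simp only
      rw [leftFactor_card c hL' hi1.1 hi1.2, partialSum_card hL'' hi1.1 hi1.2,
        ← hright, hrank, card_filter_le_eq hj1]
      congr 1
      refine neg_one_pow_congr ?_
      unfold specialExp
      rw [← card_filter_add_card (n := n) hL'' hi1.1 (by omega), Icc_one_eq_insert (by omega)]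
      push_cast
      have h2 : (2 : ZMod 2) = 0 := by decide
      linear_combination (-((L.filter (· ≤ i)).card * (n - L.card : ℕ) + L.card + 1 : ZMod 2)) * h2

end Word
end
end Freehedral

namespace Freehedral
noncomputable section
open Word
variable {R : Type u} [CommRing R]

lemma cellValue_of_ne {Y : TopCat.{u}} {p : ℕ} {c : AnyCell Y} (h : c.1 ≠ p)
    (x : Cochain (normalizedComplex R Y) p) : cellValue c x = 0 :=
  dif_neg h

/-- The class of a cell in the normalized chains. -/
def cellClass (R : Type u) [CommRing R] {Y : TopCat.{u}} {n : ℕ} (c : Cell Y n) :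
    NormalizedChains R Y n :=
  Submodule.Quotient.mk (Finsupp.single c 1)

lemma cellValue_eq {Y : TopCat.{u}} {n : ℕ} (c : Cell Y n)
    (x : Cochain (normalizedComplex R Y) n) :
    cellValue ⟨n, c⟩ x = x.hom (cellClass R c) :=
  dif_pos rfl

lemma normalizedD_cellClass {Y : TopCat.{u}} {n : ℕ} (c : Cell Y (n + 1)) :
    normalizedD R Y n (cellClass R c) = ∑ q ∈ Cell.adms (n + 1) c.m,
      ((-1 : R) ^ Cell.sgnExp (n + 1) q.1 q.2) • cellClass R (Cell.face q.1 q.2 c) := by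
  change Submodule.Quotient.mk (Cell.chainD R Y n (Finsupp.single c 1)) = _
  rw [Cell.chainD_single, one_smul, Cell.boundary_eq]
  change (Cell.degenerateChains R Y n).mkQ _ = _
  rw [map_sum]
  refine Finset.sum_congr rfl fun q _ => ?_
  unfold cellClass
  rw [← Submodule.Quotient.mk_smul, Finsupp.smul_single, smul_eq_mul, mul_one]
  rfl

lemma cellValue_coboundary {Y : TopCat.{u}} {p : ℕ} (c : AnyCell Y)
    (x : Cochain (normalizedComplex R Y) p) :
    cellValue c (coboundary _ p x) = cob (fun c => cellValue c x) c := by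
  obtain ⟨_ | n, c⟩ := c
  · exact cellValue_of_ne (by simp) _
  · by_cases h : n = p
    · subst h
      let φ : NormalizedChains R Y n →ₗ[R] R := x.hom
      have hφ : ∀ c : Cell Y n, cellValue ⟨n, c⟩ x = φ (cellClass R c) := fun c => cellValue_eq c x
      rw [cellValue_eq]
      change x.hom (((normalizedComplex R Y).d (n + 1) n).hom _) = _
      rw [normalizedComplex_d]
      change φ (normalizedD R Y n (cellClass R c)) = _
      rw [normalizedD_cellClass, map_sum]
      unfold cob
      simp only [map_smul, smul_eq_mul, hφ]
    · rw [cellValue_of_ne (by simpa using h)]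
      unfold cob
      simp only
      rw [Finset.sum_eq_zero]
      intro q _
      rw [cellValue_of_ne (by simpa using h), mul_zero]

lemma cellValue_freehedralCup {Y : TopCat.{u}} {p q r : ℕ} (h : p + q = r)
    (x : Cochain (normalizedComplex R Y) p) (y : Cochain (normalizedComplex R Y) q)
    (c : Cell Y r) :
    cellValue ⟨r, c⟩ (freehedralCup Y p q r h x y) =
      cellCup (fun c => cellValue c x) (fun c => cellValue c y) ⟨r, c⟩ := by
  rw [cellCup_eq_diagonal]
  exact cellValue_cochainOfCells _ (fun c hc => cupValue_deg x y c hc) c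

lemma cellCup_smul_left {Y : Type u} [TopologicalSpace Y] (s : R) (g h : AnyCell Y → R)
    (c : AnyCell Y) : cellCup (fun c => s * g c) h c = s * cellCup g h c := by
  have : wordFn (fun c => s * g c) c.2 = s • wordFn g c.2 := by
    funext w
    simp only [wordFn, Pi.smul_apply, smul_eq_mul]
    ring
  unfold cellCup
  rw [this, (cup_smul_left _ _ _ _).1]
  ring

lemma isLeibniz_freehedralCup (Y : TopCat.{u}) : IsLeibniz (freehedralCup (R := R) Y) := by
  intro p q r h x y
  refine cellValue_ext fun c => ?_
  rw [map_add, map_smul, cellValue_coboundary, cellValue_freehedralCup, cellValue_freehedralCup]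
  have h1 : cob (fun c => cellValue c (freehedralCup Y p q r h x y)) ⟨r + 1, c⟩ =
      cob (cellCup (fun c => cellValue c x) (fun c => cellValue c y)) ⟨r + 1, c⟩ := by
    unfold cob
    simp only [cellValue_freehedralCup]
  have h2 : (fun c : AnyCell Y => (-1 : R) ^ c.1 * cellValue c x) =
      fun c => (-1) ^ p * cellValue c x := by
    funext c
    by_cases hc : c.1 = p
    · rw [hc]
    · rw [cellValue_of_ne hc, mul_zero, mul_zero]
  simp only [cellValue_coboundary] at *
  rw [h1, cob_cellCup, h2, cellCup_smul_left, smul_eq_mul]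

end
end Freehedral

namespace Freehedral
noncomputable section
open Simplicial
variable {R : Type u} [CommRing R]

section AlexanderWhitney
variable (X : SSet.{u})

lemma simplexValue_coboundary {n : ℕ} (x : Cochain (X.chainComplex (ModuleCat.of R R)) n)
    (σ : X _⦋n + 1⦌) :
    simplexValue σ (coboundary _ n x) =
      ∑ i : Fin (n + 2), (-1) ^ i.1 * simplexValue (X.δ i σ) x := by
  change (X.ιChainComplex σ ≫ (X.chainComplex (ModuleCat.of R R)).d (n + 1) n ≫ x).hom (1 : R) = _
  rw [SSet.ιChainComplex_d_assoc, Preadditive.sum_comp, ModuleCat.hom_sum, LinearMap.sum_apply]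
  refine Finset.sum_congr rfl fun i _ => ?_
  rcases neg_one_pow_eq_or ℤ i.1 with h | h
  · have h' : (-1 : R) ^ i.1 = 1 := by simpa using congrArg (Int.cast : ℤ → R) h
    rw [h, h']
    simp [simplexValue]
  · have h' : (-1 : R) ^ i.1 = -1 := by simpa using congrArg (Int.cast : ℤ → R) h
    rw [h, h']
    simp [simplexValue]

variable {X}

/-- The face of a simplex with the vertices `j, …, j + l`. -/
def subsimplex {n : ℕ} (j l : ℕ) (h : j + l ≤ n) (σ : X _⦋n⦌) : X _⦋l⦌ :=
  X.map (SimplexCategory.subinterval j l h).op σ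

lemma subinterval_apply {n j l : ℕ} (h : j + l ≤ n) (i : Fin (l + 1)) :
    ((SimplexCategory.subinterval j l h).toOrderHom i).1 = i.1 + j := rfl

lemma δ_subsimplex {n j l : ℕ} (h : j + (l + 1) ≤ n + 1) (i : Fin (l + 2)) (i' : Fin (n + 2))
    (hi : i'.1 = i.1 + j) (σ : X _⦋n + 1⦌) :
    X.δ i (subsimplex j (l + 1) h σ) = subsimplex j l (by omega) (X.δ i' σ) := by
  change X.map _ (X.map _ σ) = X.map _ (X.map _ σ)
  rw [← Functor.map_comp_apply, ← Functor.map_comp_apply, ← op_comp, ← op_comp]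
  congr 2
  refine congrArg (fun g => X.map (Quiver.Hom.op g)) <| SimplexCategory.Hom.ext _ _ (OrderHom.ext _ _ (funext fun a => Fin.ext ?_))
  change ((i.succAbove a).1 + j) = (i'.succAbove ((SimplexCategory.subinterval j l _).toOrderHom a)).1
  unfold Fin.succAbove
  simp only [Fin.lt_def, Fin.val_castSucc, subinterval_apply, hi, add_lt_add_iff_right]
  split_ifs <;> simp [subinterval_apply]
  omega

lemma subsimplex_δ_of_lt {n j l : ℕ} (h : j + l ≤ n) (i : Fin (n + 2)) (hi : j + l < i.1)
    (σ : X _⦋n + 1⦌) :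
    subsimplex j l h (X.δ i σ) = subsimplex j l (by omega) σ := by
  change X.map _ (X.map _ σ) = X.map _ σ
  rw [← Functor.map_comp_apply, ← op_comp]
  congr 2
  refine congrArg (fun g => X.map (Quiver.Hom.op g)) <| SimplexCategory.Hom.ext _ _ (OrderHom.ext _ _ (funext fun a => Fin.ext ?_))
  change (i.succAbove ((SimplexCategory.subinterval j l _).toOrderHom a)).1 = a.1 + j
  unfold Fin.succAbove
  rw [if_pos]
  · rfl
  · rw [Fin.lt_def, Fin.val_castSucc, subinterval_apply]
    have := a.2
    simp at this
    omega

lemma subsimplex_δ_of_le {n j l : ℕ} (h : j + l ≤ n) (i : Fin (n + 2)) (hi : i.1 ≤ j)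
    (σ : X _⦋n + 1⦌) :
    subsimplex j l h (X.δ i σ) = subsimplex (j + 1) l (by omega) σ := by
  change X.map _ (X.map _ σ) = X.map _ σ
  rw [← Functor.map_comp_apply, ← op_comp]
  congr 2
  refine congrArg (fun g => X.map (Quiver.Hom.op g)) <| SimplexCategory.Hom.ext _ _ (OrderHom.ext _ _ (funext fun a => Fin.ext ?_))
  change (i.succAbove ((SimplexCategory.subinterval j l _).toOrderHom a)).1 = a.1 + (j + 1)
  unfold Fin.succAbove
  rw [if_neg]
  · rw [Fin.val_succ, subinterval_apply]; omega
  · rw [Fin.lt_def, Fin.val_castSucc, subinterval_apply]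
    omega

lemma simplexValue_alexanderWhitney {p q r : ℕ} (h : p + q = r)
    (x : Cochain (X.chainComplex (ModuleCat.of R R)) p)
    (y : Cochain (X.chainComplex (ModuleCat.of R R)) q) (σ : X _⦋r⦌) :
    simplexValue σ (alexanderWhitney X p q r h x y) =
      simplexValue (subsimplex 0 p (by omega) σ) x * simplexValue (subsimplex p q (by omega) σ) y :=
  simplexValue_cochainOfValues _ _ _

lemma isLeibniz_alexanderWhitney : IsLeibniz (R := R) (alexanderWhitney X) := by
  rintro p q r rfl x y
  refine simplexValue_ext X fun σ => ?_
  rw [map_add, map_smul, simplexValue_coboundary]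
  simp only [simplexValue_alexanderWhitney, simplexValue_coboundary, smul_eq_mul]
  have hc : p + 1 + (q + 1) = p + q + 2 := by omega
  rw [← Fin.sum_congr' _ hc, Fin.sum_univ_add, Fin.sum_univ_castSucc (n := p + 1),
    Fin.sum_univ_succ (n := q + 1), add_mul, mul_add, mul_add, Finset.sum_mul, Finset.mul_sum,
    Finset.mul_sum]
  have e1 : ∀ i : Fin (p + 1), X.δ (Fin.castSucc i) (subsimplex 0 (p + 1) (by omega) σ) =
      subsimplex 0 p (by omega) (X.δ (Fin.cast hc (Fin.castAdd (q + 1) i)) σ) := fun i =>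
    δ_subsimplex _ _ _ rfl σ
  have e2 : ∀ i : Fin (p + 1),
      subsimplex p q (by omega) (X.δ (Fin.cast hc (Fin.castAdd (q + 1) i)) σ) =
        subsimplex (p + 1) q (by omega) σ := fun i =>
    subsimplex_δ_of_le _ _ (by simp; omega) σ
  have e3 : ∀ i : Fin (q + 1), X.δ (Fin.succ i) (subsimplex p (q + 1) (by omega) σ) =
      subsimplex p q (by omega) (X.δ (Fin.cast hc (Fin.natAdd (p + 1) i)) σ) := fun i =>
    δ_subsimplex _ _ _ (by simp; omega) σ
  have e4 : ∀ i : Fin (q + 1),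
      subsimplex 0 p (by omega) (X.δ (Fin.cast hc (Fin.natAdd (p + 1) i)) σ) =
        subsimplex 0 p (by omega) σ := fun i =>
    subsimplex_δ_of_lt _ _ (by simp; omega) σ
  have e5 : X.δ (Fin.last (p + 1)) (subsimplex 0 (p + 1) (by omega) σ) =
      subsimplex 0 p (by omega) σ := by
    rw [δ_subsimplex _ _ ⟨p + 1, by omega⟩ (by simp) σ, subsimplex_δ_of_lt _ _ (by simp) σ]
  have e6 : X.δ 0 (subsimplex p (q + 1) (by omega) σ) = subsimplex (p + 1) q (by omega) σ := by
    rw [δ_subsimplex _ _ ⟨p, by omega⟩ (by simp) σ, subsimplex_δ_of_le _ _ (by simp) σ]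
  simp only [e1, e2, e3, e4, e5, e6, Fin.val_cast, Fin.val_castAdd, Fin.val_natAdd,
    Fin.val_castSucc, Fin.val_last, Fin.val_succ, Fin.val_zero]
  have s1 : ∀ i : Fin (q + 1), (-1 : R) ^ (p + 1 + i.1) = (-1) ^ p * (-1) ^ (i.1 + 1) := fun i => by
    rw [← pow_add]; congr 1; omega
  simp only [s1, mul_assoc]
  have s2 : (-1 : R) ^ (p + 1) = - (-1) ^ p := by rw [pow_succ]; ring
  simp only [s2, mul_left_comm ((simplexValue _) x)]
  ring

end AlexanderWhitney

end
end Freehedral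

namespace Freehedral
noncomputable section
open Simplicial
variable {R : Type u} [CommRing R]

section CubeToSimplex

/-- The product `x_0 ⋯ x_(j-1)`. -/
def headProd (x : ℕ → ℝ) (j : ℕ) : ℝ := ∏ i ∈ Finset.range j, x i

lemma headProd_congr {x y : ℕ → ℝ} {j : ℕ} (h : ∀ i < j, x i = y i) :
    headProd x j = headProd y j :=
  Finset.prod_congr rfl fun i hi => h i (Finset.mem_range.1 hi)

lemma headProd_eq_zero {x : ℕ → ℝ} {p j : ℕ} (h : x p = 0) (hp : p < j) : headProd x j = 0 :=
  Finset.prod_eq_zero (Finset.mem_range.2 hp) h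

/-- The barycentric coordinates of the image of a point of the cube in the simplex. -/
def cubeWeight {n : ℕ} (x : Fin n → unitInterval) (j : ℕ) : ℝ :=
  headProd (fun i => coord x i) j - headProd (fun i => coord x i) (j + 1)

lemma coord_of_le {n : ℕ} (x : Fin n → unitInterval) {j : ℕ} (h : n ≤ j) : coord x j = 0 :=
  dif_neg (by omega)

/-- The map from the cube to the simplex that collapses, for each `i`, the face `x_i = 0` onto the
face with the vertices `0, …, i`. -/
def cubeToSimplex (n : ℕ) : C(Fin n → unitInterval, stdSimplex ℝ (Fin (n + 1))) where
  toFun x := ⟨fun j => cubeWeight x j.1, by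
    constructor
    · intro j
      simp only [cubeWeight, headProd, Finset.prod_range_succ, sub_nonneg]
      refine mul_le_of_le_one_right (Finset.prod_nonneg fun i _ => (coord x i).2.1)
        (coord x j).2.2
    · rw [Fin.sum_univ_eq_sum_range (cubeWeight x)]
      unfold cubeWeight
      rw [Finset.sum_range_sub', headProd_eq_zero (p := n) (j := n + 1) (by simp [coord_of_le])
        (by omega)]
      simp [headProd]⟩
  continuous_toFun := by
    refine Continuous.subtype_mk (continuous_pi fun j => ?_) _
    have : ∀ j, Continuous fun x : Fin n → unitInterval => headProd (fun i => coord x i) j :=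
      fun j => continuous_finsetProd _ fun i _ => continuous_subtype_val.comp (continuous_coord i)
    exact (this _).sub (this _)

lemma cubeToSimplex_apply {n : ℕ} (x : Fin n → unitInterval) (j : Fin (n + 1)) :
    cubeToSimplex n x j = cubeWeight x j.1 := rfl

lemma map_succAbove_apply {n : ℕ} (i : Fin (n + 2)) (s : stdSimplex ℝ (Fin (n + 1))) :
    (stdSimplex.map i.succAbove s) i = 0 ∧
      ∀ a, (stdSimplex.map i.succAbove s) (i.succAbove a) = s a := by
  constructor
  · rw [stdSimplex.map_coe, FunOnFinite.linearMap_apply_apply]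
    refine Finset.sum_eq_zero fun a ha => ?_
    exact absurd (Finset.mem_filter.1 ha).2 (Fin.succAbove_ne i a)
  · intro a
    rw [stdSimplex.map_coe, FunOnFinite.linearMap_apply_apply]
    have : (Finset.univ.filter fun x => i.succAbove x = i.succAbove a) = {a} := by
      ext; simp
    rw [this, Finset.sum_singleton]

lemma eq_map_succAbove {n : ℕ} (i : Fin (n + 2)) (s : stdSimplex ℝ (Fin (n + 1)))
    (t : stdSimplex ℝ (Fin (n + 2))) (h0 : t i = 0) (h : ∀ a, t (i.succAbove a) = s a) :
    t = stdSimplex.map i.succAbove s := by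
  obtain ⟨g0, g⟩ := map_succAbove_apply i s
  refine DFunLike.ext _ _ fun j => ?_
  rcases Fin.eq_self_or_eq_succAbove i j with rfl | ⟨a, rfl⟩
  · rw [h0, g0]
  · rw [h, g]

lemma headProd_insert_one {n p : ℕ} (x : Fin n → unitInterval) (hp : p ≤ n) {j : ℕ}
    (hj : j ≤ n + 1) :
    headProd (fun i => coord (cubeFace n p 1 x) i) j =
      headProd (fun i => coord x i) (if j ≤ p then j else j - 1) := by
  induction j with
  | zero => simp [headProd]
  | succ j ih =>
    have ih := ih (by omega)
    rw [headProd, Finset.prod_range_succ, ← headProd, ih, Cell.coord_cubeFace _ _ _ _ _ (by omega)]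
    rcases lt_trichotomy j p with h | h | h
    · rw [if_pos h.le, if_pos h, if_pos (by omega), headProd, headProd, Finset.prod_range_succ]
    · subst h
      simp
    · rw [if_neg (by omega), if_neg (by omega), if_neg (by omega), if_neg (by omega)]
      obtain ⟨j, rfl⟩ := Nat.exists_eq_succ_of_ne_zero (show j ≠ 0 by omega)
      simp [headProd, Finset.prod_range_succ]

lemma cubeToSimplex_insert_one {n : ℕ} (p : Fin (n + 1)) (x : Fin n → unitInterval) :
    cubeToSimplex (n + 1) (cubeFace n p.1 1 x) =
      stdSimplex.map (Fin.castSucc p).succAbove (cubeToSimplex n x) := by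
  have hp := p.2
  refine eq_map_succAbove _ _ _ ?_ fun a => ?_
  · rw [cubeToSimplex_apply, Fin.val_castSucc, cubeWeight, headProd_insert_one _ (by omega) (by omega),
      headProd_insert_one _ (by omega) (by omega), if_pos le_rfl, if_neg (by omega)]
    exact sub_self _
  · have ha := a.2
    rw [cubeToSimplex_apply, cubeToSimplex_apply, cubeWeight, cubeWeight]
    by_cases h : a.1 < p.1
    · rw [Fin.succAbove_of_castSucc_lt _ _ (show a.1 < p.1 from h), Fin.val_castSucc,
        headProd_insert_one _ (by omega) (by omega), headProd_insert_one _ (by omega) (by omega),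
        if_pos (by omega), if_pos (by omega)]
    · rw [Fin.succAbove_of_le_castSucc _ _ (show p.1 ≤ a.1 by omega), Fin.val_succ,
        headProd_insert_one _ (by omega) (by omega)]
      by_cases ha' : a.1 < n
      · rw [headProd_insert_one _ (by omega) (by omega), if_neg (by omega), if_neg (by omega)]
        rfl
      · have : a.1 = n := by omega
        rw [headProd_eq_zero (p := n + 1) (j := a.1 + 1 + 1) (by simp [coord_of_le]) (by omega),
          headProd_eq_zero (p := n) (j := a.1 + 1) (by simp [coord_of_le]) (by omega),
          if_neg (by omega)]
        rfl

lemma headProd_insert_zero {n p : ℕ} (x : Fin n → unitInterval) (hp : p ≤ n) (j : ℕ) :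
    headProd (fun i => coord (cubeFace n p 0 x) i) j =
      if j ≤ p then headProd (fun i => coord x i) j else 0 := by
  split_ifs with h
  · refine headProd_congr fun i hi => ?_
    rw [Cell.coord_cubeFace _ _ _ _ _ (by omega), if_pos (by omega)]
  · refine headProd_eq_zero (p := p) ?_ (by omega)
    rw [Cell.coord_cubeFace _ _ _ _ _ (by omega), if_neg (by omega), if_pos rfl]
    rfl

lemma cubeToSimplex_insert_zero {n : ℕ} (x : Fin n → unitInterval) :
    cubeToSimplex (n + 1) (cubeFace n n 0 x) =
      stdSimplex.map (Fin.last (n + 1)).succAbove (cubeToSimplex n x) := by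
  refine eq_map_succAbove _ _ _ ?_ fun a => ?_
  · rw [cubeToSimplex_apply, cubeWeight, headProd_insert_zero _ le_rfl,
      headProd_insert_zero _ le_rfl]
    simp
  · have ha := a.2
    rw [Fin.succAbove_last_apply, cubeToSimplex_apply, cubeToSimplex_apply, cubeWeight, cubeWeight,
      headProd_insert_zero _ le_rfl, headProd_insert_zero _ le_rfl, Fin.val_castSucc,
      if_pos (by omega)]
    split_ifs
    · rfl
    · rw [headProd_eq_zero (p := n) (j := a.1 + 1) (by simp [coord_of_le]) (by omega)]

lemma cubeToSimplex_congr {n p : ℕ} (hp : p ≤ n) (x y : Fin n → unitInterval)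
    (h : ∀ i < p, coord x i = coord y i) :
    cubeToSimplex (n + 1) (cubeFace n p 0 x) = cubeToSimplex (n + 1) (cubeFace n p 0 y) := by
  refine DFunLike.ext _ _ fun j => ?_
  have := fun j (hj : j ≤ p) => headProd_congr (x := fun i => coord x i) (y := fun i => coord y i)
    (j := j) fun i hi => congrArg _ (h i (by omega))
  simp only [cubeToSimplex_apply, cubeWeight, headProd_insert_zero _ hp]
  congr 1
  · split_ifs with hj
    · exact this _ hj
    · rfl
  · split_ifs with hj
    · exact this _ hj
    · rfl

end CubeToSimplex

section SimplexCell
variable {Y : TopCat.{u}}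

/-- The cell `I^n → Δ^n → Y` of a singular simplex. -/
def simplexCell {n : ℕ} (σ : (TopCat.toSSet.obj Y) _⦋n⦌) : Cell Y n :=
  ⟨0, 0, n, by omega, (Y.toSSetObjEquiv _ σ).comp (cubeToSimplex n)⟩

lemma d1_simplexCell {n : ℕ} (σ : (TopCat.toSSet.obj Y) _⦋n + 1⦌) (p : Fin (n + 1)) :
    Cell.d1 (p.1 + 1) (simplexCell σ) =
      simplexCell ((TopCat.toSSet.obj Y).δ (Fin.castSucc p) σ) := by
  have hp := p.2
  have hA : Cell.Adm (n + 1) (simplexCell σ).m 1 (p.1 + 1) := by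
    unfold Cell.Adm; change _ ∨ _ ∧ _ ∧ _ ∧ (_ → 0 = 0) ∨ _; omega
  obtain ⟨r1, r2, r3⟩ := Cell.face_spec _ _ _ hA
  change Cell.face 1 (p.1 + 1) (simplexCell σ) = _
  refine Cell.ext_aux r1 ?_ ?_
  · rw [r2]; simp [Cell.faceK, simplexCell]
  · rw [r3]
    ext x
    have hm : p.1 + 1 ≤ 0 + (n + 1) := by omega
    simp only [simplexCell, Cell.faceMap, ContinuousMap.comp_apply, hm, if_true]
    rw [TopCat.toSSetObjEquiv_δ_apply]
    simp [cubeToSimplex_insert_one]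

lemma d0_simplexCell_last {n : ℕ} (σ : (TopCat.toSSet.obj Y) _⦋n + 1⦌) :
    Cell.d0 (n + 1) (simplexCell σ) =
      simplexCell ((TopCat.toSSet.obj Y).δ (Fin.last (n + 1)) σ) := by
  have hA : Cell.Adm (n + 1) (simplexCell σ).m 0 (n + 1) := by
    unfold Cell.Adm; omega
  obtain ⟨r1, r2, r3⟩ := Cell.face_spec _ _ _ hA
  change Cell.face 0 (n + 1) (simplexCell σ) = _
  refine Cell.ext_aux r1 ?_ ?_
  · rw [r2]; simp [Cell.faceK, simplexCell]
  · rw [r3]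
    ext x
    simp only [simplexCell, Cell.faceMap, ContinuousMap.comp_apply]
    rw [TopCat.toSSetObjEquiv_δ_apply]
    simp [cubeToSimplex_insert_zero]

lemma d0_simplexCell_degAt {n i : ℕ} (σ : (TopCat.toSSet.obj Y) _⦋n + 1⦌) (h1 : 1 ≤ i)
    (h2 : i ≤ n) : (Cell.d0 i (simplexCell σ)).DegAt i := by
  have hA : Cell.Adm (n + 1) (simplexCell σ).m 0 i := by
    unfold Cell.Adm; omega
  obtain ⟨r1, r2, r3⟩ := Cell.face_spec _ _ _ hA
  have r4 := Cell.face_l _ _ _ hA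
  change (Cell.face 0 i (simplexCell σ)).DegAt i
  refine ⟨?_, h2, fun x y hxy => ?_⟩
  · rw [r1]; change Cell.faceM 0 0 i < i; unfold Cell.faceM; split_ifs <;> omega
  · rw [r3]
    have hm : i ≤ 0 + (n + 1) := by omega
    simp only [simplexCell, Cell.faceMap, ContinuousMap.comp_apply, hm, if_true]
    refine congrArg _ (cubeToSimplex_congr (by omega) x y fun t ht => hxy t (by omega) ?_)
    have hd := (Cell.face 0 i (simplexCell σ)).dim_eq
    change t ≠ Cell.pos (Cell.face 0 i (simplexCell σ)) i
    unfold Cell.pos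
    have hk : (Cell.face 0 i (simplexCell σ)).k = 0 := by
      rw [r2]; simp [simplexCell, Cell.faceK]
    split_ifs <;> omega

lemma simplexCell_map {Z : TopCat.{u}} (g : Y ⟶ Z) {n : ℕ}
    (σ : (TopCat.toSSet.obj Y) _⦋n⦌) :
    simplexCell ((TopCat.toSSet.map g).app _ σ) = (simplexCell σ).postcomp g.hom := rfl

end SimplexCell

end
end Freehedral

namespace Freehedral
noncomputable section
open Simplicial
variable {R : Type u} [CommRing R]

lemma cellClass_eq_zero {Y : TopCat.{u}} {n : ℕ} {c : Cell Y n} (h : c.IsDegenerate) :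
    cellClass R c = 0 :=
  (Submodule.Quotient.mk_eq_zero _).2 (Cell.single_mem_degenerateChains R h 1)

lemma normalizedD_cellClass_eq {Y : TopCat.{u}} {n : ℕ} (c : Cell Y (n + 1)) :
    normalizedD R Y n (cellClass R c) =
      ∑ i ∈ Finset.Icc 1 (n + 1), (-1 : R) ^ i • (cellClass R (c.d0 i) - cellClass R (c.d1 i)) +
        ∑ i ∈ Finset.Icc 2 c.m, (-1 : R) ^ ((i - 1) * (n + 1)) • cellClass R (c.d2 i) := by
  change Submodule.Quotient.mk (Cell.chainD R Y n (Finsupp.single c 1)) = _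
  rw [Cell.chainD_single, one_smul, Cell.boundary]
  change (Cell.degenerateChains R Y n).mkQ _ = _
  have hs : ∀ (c : Cell Y n) (r : R), (Cell.degenerateChains R Y n).mkQ (Finsupp.single c r) =
      r • cellClass R c := fun c r => by
    unfold cellClass
    rw [← Submodule.Quotient.mk_smul, Finsupp.smul_single, smul_eq_mul, mul_one]
    rfl
  simp only [map_add, map_sum, map_sub, hs, smul_sub]

section SimplexToCell
variable {Y : TopCat.{u}}

lemma normalizedD_simplexCell {n : ℕ} (σ : (TopCat.toSSet.obj Y) _⦋n + 1⦌) :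
    normalizedD R Y n (cellClass R (simplexCell σ)) =
      ∑ i : Fin (n + 2), (-1 : R) ^ i.1 • cellClass R (simplexCell ((TopCat.toSSet.obj Y).δ i σ)) := by
  rw [normalizedD_cellClass_eq, show Finset.Icc 2 (simplexCell σ).m = ∅ from rfl,
    Finset.sum_empty, add_zero]
  simp only [smul_sub, Finset.sum_sub_distrib]
  rw [Finset.sum_Icc_succ_top (by omega), Finset.sum_eq_zero, zero_add, d0_simplexCell_last,
    Fin.sum_univ_castSucc]
  · have h1 : Finset.Icc 1 (n + 1) = (Finset.range (n + 1)).image (· + 1) := by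
      ext i
      simp only [Finset.mem_Icc, Finset.mem_image, Finset.mem_range]
      exact ⟨fun h => ⟨i - 1, by omega, by omega⟩, by rintro ⟨a, h, rfl⟩; omega⟩
    rw [h1, Finset.sum_image (fun a _ b _ h => Nat.succ_injective h), ← Fin.sum_univ_eq_sum_range
      (fun i => (-1 : R) ^ (i + 1) • cellClass R (Cell.d1 (i + 1) (simplexCell σ))), sub_eq_neg_add,
      ← Finset.sum_neg_distrib]
    congr 1
    refine Finset.sum_congr rfl fun p _ => ?_
    rw [d1_simplexCell, pow_succ, mul_neg_one, neg_smul, neg_neg]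
    rfl
  · intro i hi
    rw [Finset.mem_Icc] at hi
    rw [cellClass_eq_zero, smul_zero]
    exact (Cell.isDegenerate_iff _).2 ⟨_, d0_simplexCell_degAt σ hi.1 hi.2⟩

/-- The map to the normalized chains with value the class of a cell. -/
def cellMap (R : Type u) [CommRing R] {n : ℕ} (c : Cell Y n) :
    ModuleCat.of R R ⟶ (normalizedComplex R Y).X n :=
  ModuleCat.ofHom (LinearMap.toSpanSingleton R (NormalizedChains R Y n) (cellClass R c))

lemma cellMap_apply {n : ℕ} (c : Cell Y n) : (cellMap R c).hom (1 : R) = cellClass R c :=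
  one_smul R (cellClass R c)

/-- The map from singular chains to normalized chains in one degree. -/
def simplexToCellF (R : Type u) [CommRing R] (Y : TopCat.{u}) (n : ℕ) :
    ((TopCat.toSSet.obj Y).chainComplex (ModuleCat.of R R)).X n ⟶ (normalizedComplex R Y).X n :=
  ((TopCat.toSSet.obj Y).isColimitChainComplexXCofan (ModuleCat.of R R) n).desc
    (Limits.Cofan.mk _ fun σ => cellMap R (simplexCell σ))

lemma ι_simplexToCellF {n : ℕ} (σ : (TopCat.toSSet.obj Y) _⦋n⦌) :
    (TopCat.toSSet.obj Y).ιChainComplex σ ≫ simplexToCellF R Y n = cellMap R (simplexCell σ) :=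
  ((TopCat.toSSet.obj Y).isColimitChainComplexXCofan (ModuleCat.of R R) n).fac
    (Limits.Cofan.mk _ fun σ => cellMap R (simplexCell σ)) ⟨σ⟩

lemma ι_simplexToCellF_assoc {n : ℕ} (σ : (TopCat.toSSet.obj Y) _⦋n⦌) {Z : ModuleCat.{u} R}
    (h : (normalizedComplex R Y).X n ⟶ Z) :
    (TopCat.toSSet.obj Y).ιChainComplex σ ≫ simplexToCellF R Y n ≫ h =
      cellMap R (simplexCell σ) ≫ h := by
  rw [← ι_simplexToCellF, Category.assoc]

lemma simplexToCellF_comm (n : ℕ) :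
    simplexToCellF R Y (n + 1) ≫ (normalizedComplex R Y).d (n + 1) n =
      ((TopCat.toSSet.obj Y).chainComplex (ModuleCat.of R R)).d (n + 1) n ≫
        simplexToCellF R Y n := by
  refine SSet.chainComplex_hom_ext fun σ => ?_
  rw [ι_simplexToCellF_assoc, SSet.ιChainComplex_d_assoc, Preadditive.sum_comp]
  refine ModuleCat.hom_ext (LinearMap.ext_ring ?_)
  rw [ModuleCat.hom_sum, LinearMap.sum_apply, ModuleCat.hom_comp, LinearMap.comp_apply,
    cellMap_apply, normalizedComplex_d]
  refine (normalizedD_simplexCell σ).trans ?_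
  refine Finset.sum_congr rfl fun i _ => ?_
  rcases neg_one_pow_eq_or ℤ i.1 with h | h
  · have h' : (-1 : R) ^ i.1 = 1 := by simpa using congrArg (Int.cast : ℤ → R) h
    rw [h, h', one_smul, one_smul, ι_simplexToCellF, cellMap_apply]
  · have h' : (-1 : R) ^ i.1 = -1 := by simpa using congrArg (Int.cast : ℤ → R) h
    rw [h, h', neg_smul, neg_smul, one_smul, one_smul, Preadditive.neg_comp, ι_simplexToCellF,
      ModuleCat.hom_neg, LinearMap.neg_apply, cellMap_apply]
    rfl

end SimplexToCell

/-- The natural chain map from singular chains to normalized chains on cells. -/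
def simplexToCell (R : Type u) [CommRing R] :
    singularComplexFunctor R ⟶ normalizedComplexFunctor R where
  app Y :=
    { f := simplexToCellF R Y
      comm' := by
        rintro i j hij
        obtain rfl : j + 1 = i := hij
        exact simplexToCellF_comm j }
  naturality Y Z g := by
    refine HomologicalComplex.hom_ext _ _ fun n => SSet.chainComplex_hom_ext fun σ => ?_
    have h1 := SSet.ι_chainComplexMap_f_assoc (X := TopCat.toSSet.obj Y) (Y := TopCat.toSSet.obj Z)
      (f := TopCat.toSSet.map g) (R := ModuleCat.of R R) (x := σ) (h := simplexToCellF R Z n)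
    have h2 := ι_simplexToCellF_assoc (R := R) σ (((normalizedComplexFunctor R).map g).f n)
    rw [ι_simplexToCellF] at h1
    refine (h1.trans ?_).trans h2.symm
    refine ModuleCat.hom_ext (LinearMap.ext_ring ?_)
    change (1 : R) • cellClass R (simplexCell ((TopCat.toSSet.map g).app _ σ)) =
      normalizedMap R g n ((1 : R) • cellClass R (simplexCell σ))
    rw [one_smul, one_smul, simplexCell_map]
    change _ = Submodule.Quotient.mk (Finsupp.mapDomain _ (Finsupp.single (simplexCell σ) (1 : R)))
    rw [Finsupp.mapDomain_single]
    rfl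

lemma simplexValue_cochainMap {Y : TopCat.{u}} {n : ℕ} (σ : (TopCat.toSSet.obj Y) _⦋n⦌)
    (x : Cochain ((normalizedComplexFunctor R).obj Y) n) :
    simplexValue σ (cochainMap ((simplexToCell R).app Y) n x) = cellValue ⟨n, simplexCell σ⟩ x := by
  have h := ι_simplexToCellF_assoc (R := R) σ x
  refine Eq.trans ?_ (cellValue_eq _ _).symm
  refine (congrArg (fun f => f.hom (1 : R)) h).trans ?_
  change x.hom ((1 : R) • cellClass R (simplexCell σ)) = _
  rw [one_smul]
  rfl

lemma cochainMap_freehedralOne (Y : TopCat.{u}) :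
    cochainMap ((simplexToCell R).app Y) 0 (freehedralOne (R := R) Y) =
      simplicialOne (R := R) (TopCat.toSSet.obj Y) := by
  refine simplexValue_ext _ fun σ => ?_
  exact (simplexValue_cochainMap _ _).trans <| (cellValue_cochainOfCells _ _ _).trans (simplexValue_cochainOfValues (TopCat.toSSet.obj Y) (fun _ => (1 : R)) σ).symm

section Product
variable {Y : TopCat.{u}}

lemma iterate_empty (op : ℕ → AnyCell Y → AnyCell Y) (c : AnyCell Y) :
    AnyCell.iterate op ∅ c = c := by
  simp [AnyCell.iterate]

lemma subsimplex_self {n : ℕ} (h : 0 + n ≤ n) (σ : (TopCat.toSSet.obj Y) _⦋n⦌) :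
    subsimplex 0 n h σ = σ := by
  change (TopCat.toSSet.obj Y).map _ σ = σ
  have e : SimplexCategory.subinterval 0 n h = 𝟙 _ := rfl
  rw [e, op_id, Functor.map_id_apply]

lemma iterate_d1_simplexCell (p l : ℕ) {n : ℕ} (h : p + l = n) (σ : (TopCat.toSSet.obj Y) _⦋n⦌) :
    AnyCell.iterate AnyCell.d1 (Finset.Icc 1 p) ⟨n, simplexCell σ⟩ =
      ⟨l, simplexCell (subsimplex p l h.le σ)⟩ := by
  induction p generalizing n with
  | zero =>
    obtain rfl : l = n := by omega
    rw [subsimplex_self, Finset.Icc_eq_empty (by omega), iterate_empty]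
  | succ p ih =>
    obtain ⟨n, rfl⟩ : ∃ k, n = k + 1 := ⟨p + l, by omega⟩
    have hp : Finset.Icc 1 (p + 1) = insert (p + 1) (Finset.Icc 1 p) := by ext; simp; omega
    rw [hp, Word.iterate_insert_max _ (by simp)]
    have h1 : AnyCell.d1 (p + 1) (⟨n + 1, simplexCell σ⟩ : AnyCell Y) =
        ⟨n, Cell.d1 (p + 1) (simplexCell σ)⟩ := if_pos ⟨by omega, by omega⟩
    rw [h1, d1_simplexCell σ ⟨p, by omega⟩, ih (by omega)]
    rw [subsimplex_δ_of_le _ _ (by simp)]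

lemma iterate_d0_simplexCell (p q : ℕ) {n : ℕ} (h : p + q = n) (σ : (TopCat.toSSet.obj Y) _⦋n⦌) :
    AnyCell.iterate AnyCell.d0 (Finset.Icc (p + 1) n) ⟨n, simplexCell σ⟩ =
      ⟨p, simplexCell (subsimplex 0 p (by omega) σ)⟩ := by
  induction q generalizing n with
  | zero =>
    obtain rfl : p = n := by omega
    rw [subsimplex_self, Finset.Icc_eq_empty (by omega), iterate_empty]
  | succ q ih =>
    obtain ⟨n, rfl⟩ : ∃ k, n = k + 1 := ⟨p + q, by omega⟩
    have hp : Finset.Icc (p + 1) (n + 1) = insert (n + 1) (Finset.Icc (p + 1) n) := by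
      ext; simp; omega
    have h0 : AnyCell.d0 (n + 1) (⟨n + 1, simplexCell σ⟩ : AnyCell Y) =
        ⟨n, Cell.d0 (n + 1) (simplexCell σ)⟩ := if_pos ⟨by omega, le_rfl⟩
    rw [hp, Word.iterate_insert_max _ (by simp), h0, d0_simplexCell_last, ih (by omega),
      subsimplex_δ_of_lt _ _ (by simp; omega)]

lemma iterate_d0_simplexCell_degAt (L : Finset ℕ) {n : ℕ} (hL : L ⊆ Finset.Icc 1 n)
    (σ : (TopCat.toSSet.obj Y) _⦋n⦌) (hne : ∀ p, L ≠ Finset.Icc (p + 1) n) :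
    ∃ i, (AnyCell.iterate AnyCell.d0 L ⟨n, simplexCell σ⟩).DegAt i := by
  induction L using Finset.induction_on_max generalizing n with
  | empty => exact absurd (Finset.Icc_eq_empty (by omega)).symm (hne n)
  | insert x L hx ih =>
    rw [Finset.insert_subset_iff, Finset.mem_Icc] at hL
    obtain ⟨n, rfl⟩ : ∃ k, n = k + 1 := ⟨n - 1, by omega⟩
    have h0 : AnyCell.d0 x (⟨n + 1, simplexCell σ⟩ : AnyCell Y) =
        ⟨n, Cell.d0 x (simplexCell σ)⟩ := if_pos hL.1
    rw [Word.iterate_insert_max _ hx, h0]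
    by_cases hxn : x = n + 1
    · subst hxn
      rw [d0_simplexCell_last]
      refine ih (fun y hy => ?_) _ ?_
      · have := Finset.mem_Icc.1 (hL.2 hy)
        have := hx y hy
        rw [Finset.mem_Icc]; omega
      · rintro p rfl
        by_cases hp : p ≤ n
        · exact hne p (by ext; simp; omega)
        · rw [Finset.Icc_eq_empty (by omega)] at hne
          exact hne n (by simp)
    · exact AnyCell.iterate_degAt _ (fun c i j h hij => h.d0 hij)
        ⟨n, Cell.d0 x (simplexCell σ)⟩ x
        (d0_simplexCell_degAt σ hL.1.1 (by omega)) L (fun h => lt_irrefl _ (hx x h))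

lemma cellValue_simplexCell_mul {p q r : ℕ} (h : p + q = r)
    (x : Cochain (normalizedComplex R Y) p) (y : Cochain (normalizedComplex R Y) q)
    (σ : (TopCat.toSSet.obj Y) _⦋r⦌) :
    cellValue ⟨r, simplexCell σ⟩ (freehedralCup Y p q r h x y) =
      cellValue ⟨p, simplexCell (subsimplex 0 p (by omega) σ)⟩ x *
        cellValue ⟨q, simplexCell (subsimplex p q (by omega) σ)⟩ y := by
  refine (cellValue_cochainOfCells (cupValue x y) (cupValue_deg x y) _).trans ?_
  unfold cupValue Cell.diagonal Cell.serreDiagonal Cell.specialDiagonal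
  simp only [map_add, map_sum, Finsupp.linearCombination_single]
  have hsp : ∀ L ∈ (Finset.Icc 2 r).powerset, (L.filter (· ≤ (simplexCell σ).m)) = ∅ := by
    intro L hL
    refine Finset.filter_eq_empty_iff.2 fun z hz => ?_
    have := Finset.mem_Icc.1 (Finset.mem_powerset.1 hL hz)
    change ¬ z ≤ 0
    omega
  rw [add_eq_left.2 (Finset.sum_eq_zero fun L hL => ?_)]
  · rw [Finset.sum_eq_single_of_mem (Finset.Icc (p + 1) r) (by
      rw [Finset.mem_powerset]; exact Finset.Icc_subset_Icc (by omega) le_rfl)]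
    · have hK : Finset.Icc 1 r \ Finset.Icc (p + 1) r = Finset.Icc 1 p := by ext; simp; omega
      have hs : unshuffleSign (Finset.Icc 1 p) (Finset.Icc (p + 1) r) = 1 := by
        unfold unshuffleSign
        rw [Finset.filter_eq_empty_iff.2, Finset.card_empty, pow_zero]
        rintro ⟨a, b⟩ hab
        simp only [Finset.mem_product, Finset.mem_Icc] at hab
        simp only; omega
      rw [hK, hs, one_smul, iterate_d1_simplexCell p q h]
      rw [iterate_d0_simplexCell p q h]
    · intro L hL hne
      by_cases hp : ∃ p', L = Finset.Icc (p' + 1) r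
      · obtain ⟨p', rfl⟩ := hp
        obtain ⟨p'', hp'', he⟩ : ∃ p'' ≤ r, Finset.Icc (p' + 1) r = Finset.Icc (p'' + 1) r := by
          by_cases hp' : p' ≤ r
          · exact ⟨p', hp', rfl⟩
          · exact ⟨r, le_rfl, by rw [Finset.Icc_eq_empty (by omega), Finset.Icc_eq_empty (by omega)]⟩
        rw [he] at hne ⊢
        rw [iterate_d0_simplexCell p'' (r - p'') (by omega), cellValue_of_ne, zero_mul, smul_zero]
        intro hpp
        change p'' = p at hpp
        exact hne (by rw [hpp])
      · obtain ⟨i, hi⟩ := iterate_d0_simplexCell_degAt L (Finset.mem_powerset.1 hL) σ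
          (not_exists.1 hp)
        rw [cellValue_deg _ hi, zero_mul, smul_zero]
  · rw [hsp L hL, Finset.sum_eq_zero]
    intro t ht
    rw [Finset.card_empty, Finset.range_one, Finset.mem_singleton] at ht
    subst ht
    rw [Finset.sum_eq_zero]
    intro t ht
    rw [Finset.mem_filter, Finset.mem_Icc, Finset.card_empty] at ht
    omega

lemma cochainMap_freehedralCup {p q r : ℕ} (h : p + q = r)
    (x : Cochain ((normalizedComplexFunctor R).obj Y) p)
    (y : Cochain ((normalizedComplexFunctor R).obj Y) q) :
    cochainMap ((simplexToCell R).app Y) r (freehedralCup Y p q r h x y) =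
      singularCup Y p q r h (cochainMap ((simplexToCell R).app Y) p x)
        (cochainMap ((simplexToCell R).app Y) q y) := by
  refine simplexValue_ext _ fun σ => ?_
  refine (simplexValue_cochainMap σ _).trans ((cellValue_simplexCell_mul h x y σ).trans ?_)
  refine Eq.trans ?_ (simplexValue_alexanderWhitney h _ _ σ).symm
  exact congrArg₂ _ (simplexValue_cochainMap _ x).symm (simplexValue_cochainMap _ y).symm

lemma cohomologyMap_freehedralCup (hF : IsLeibniz (freehedralCup (R := R) Y))
    (hS : IsLeibniz (singularCup (R := R) Y)) {p q r : ℕ} (h : p + q = r)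
    (a : Cohomology ((normalizedComplexFunctor R).obj Y) p)
    (b : Cohomology ((normalizedComplexFunctor R).obj Y) q) :
    cohomologyMap ((simplexToCell R).app Y) r (cohomologyMul _ hF h a b) =
      cohomologyMul _ hS h (cohomologyMap ((simplexToCell R).app Y) p a)
        (cohomologyMap ((simplexToCell R).app Y) q b) := by
  induction a using Quotient.inductionOn
  induction b using Quotient.inductionOn
  rename_i a b
  refine congrArg (Submodule.Quotient.mk) (Subtype.ext ?_)
  exact cochainMap_freehedralCup h a.1 b.1

end Product

end
end Freehedral

namespace Freehedral
noncomputable section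
variable {R : Type u} [CommRing R]

section AcyclicModels
open Limits

/-- A functor is relatively projective if natural transformations out of it lift along every natural
transformation `f` along which they lift pointwise on the contractible spaces. -/
def RelProjective (F : TopCat.{u} ⥤ ModuleCat.{u} R) : Prop :=
  ∀ (A B : TopCat.{u} ⥤ ModuleCat.{u} R) (f : A ⟶ B) (φ : F ⟶ B),
    (∀ M : TopCat.{u}, (ContinuousMap.id M).Nullhomotopic →
      ∀ x : F.obj M, ∃ a : A.obj M, f.app M a = φ.app M x) → ∃ ψ : F ⟶ A, ψ ≫ f = φ

lemma RelProjective.biprod {F G : TopCat.{u} ⥤ ModuleCat.{u} R} (hF : RelProjective F)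
    (hG : RelProjective G) : RelProjective (F ⊞ G) := by
  intro A B f φ h
  obtain ⟨α, hα⟩ := hF A B f (biprod.inl ≫ φ) fun M hM x => h M hM ((biprod.inl : F ⟶ F ⊞ G).app M x)
  obtain ⟨β, hβ⟩ := hG A B f (biprod.inr ≫ φ) fun M hM x => h M hM ((biprod.inr : G ⟶ F ⊞ G).app M x)
  refine ⟨biprod.desc α β, ?_⟩
  apply biprod.hom_ext'
  · simpa using hα
  · simpa using hβ

/-- A complex of relatively projective functors which is exact on the contractible spaces has a
natural contraction. -/
lemma exists_contraction (K : ℕ → TopCat.{u} ⥤ ModuleCat.{u} R) (d : ∀ n, K (n + 1) ⟶ K n)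
    (hd : ∀ n, d (n + 1) ≫ d n = 0) (hK : ∀ n, RelProjective (K n))
    (h0 : ∀ M : TopCat.{u}, (ContinuousMap.id M).Nullhomotopic →
      ∀ x : (K 0).obj M, ∃ y : (K 1).obj M, (d 0).app M y = x)
    (h1 : ∀ M : TopCat.{u}, (ContinuousMap.id M).Nullhomotopic →
      ∀ (n : ℕ) (x : (K (n + 1)).obj M), (d n).app M x = 0 →
        ∃ y : (K (n + 2)).obj M, (d (n + 1)).app M y = x) :
    ∃ h : ∀ n, K n ⟶ K (n + 1), h 0 ≫ d 0 = 𝟙 _ ∧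
      ∀ n, d n ≫ h n + h (n + 1) ≫ d (n + 1) = 𝟙 _ := by
  have step : ∀ n (h : {h : K n ⟶ K (n + 1) // d n ≫ h ≫ d n = d n}),
      ∃ h' : {h : K (n + 1) ⟶ K (n + 2) // d (n + 1) ≫ h ≫ d (n + 1) = d (n + 1)},
        d n ≫ h.1 + h'.1 ≫ d (n + 1) = 𝟙 _ := by
    rintro n ⟨h, hh⟩
    have hz : (𝟙 _ - d n ≫ h) ≫ d n = 0 := by
      rw [Preadditive.sub_comp, Category.id_comp, Category.assoc, hh, sub_self]
    obtain ⟨h', e⟩ := hK (n + 1) (K (n + 2)) (K (n + 1)) (d (n + 1)) (𝟙 _ - d n ≫ h)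
      fun M hM x => h1 M hM n _ (LinearMap.congr_fun
        (congrArg ModuleCat.Hom.hom (NatTrans.congr_app hz M)) x)
    refine ⟨⟨h', ?_⟩, ?_⟩
    · rw [e, Preadditive.comp_sub, Category.comp_id, ← Category.assoc, hd, zero_comp, sub_zero]
    · rw [e, add_sub_cancel]
  obtain ⟨z, hz⟩ := hK 0 (K 1) (K 0) (d 0) (𝟙 _) fun M hM x => h0 M hM _
  choose nxt hnxt using step
  let h : ∀ n, {h : K n ⟶ K (n + 1) // d n ≫ h ≫ d n = d n} := fun n =>
    Nat.rec ⟨z, by rw [hz, Category.comp_id]⟩ (fun n h => nxt n h) n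
  exact ⟨fun n => (h n).1, hz, fun n => hnxt n (h n)⟩

variable {S F : TopCat.{u} ⥤ ChainComplex (ModuleCat.{u} R) ℕ}

/-- The functor of the chains of degree `n`. -/
abbrev chainsAt (S : TopCat.{u} ⥤ ChainComplex (ModuleCat.{u} R) ℕ) (n : ℕ) :
    TopCat.{u} ⥤ ModuleCat.{u} R :=
  S ⋙ HomologicalComplex.eval _ _ n

/-- The differential as a natural transformation. -/
abbrev chainsD (S : TopCat.{u} ⥤ ChainComplex (ModuleCat.{u} R) ℕ) (n : ℕ) :
    chainsAt S (n + 1) ⟶ chainsAt S n :=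
  Functor.whiskerLeft S (HomologicalComplex.dNatTrans _ _ (n + 1) n)

/-- A natural chain map in degree `n`. -/
abbrev chainsMap (Φ : S ⟶ F) (n : ℕ) : chainsAt S n ⟶ chainsAt F n :=
  Functor.whiskerRight Φ _

lemma chainsD_comp (S : TopCat.{u} ⥤ ChainComplex (ModuleCat.{u} R) ℕ) (n : ℕ) :
    chainsD S (n + 1) ≫ chainsD S n = 0 := by
  ext Y : 2
  exact (S.obj Y).d_comp_d _ _ _

lemma chainsMap_comm (Φ : S ⟶ F) (n : ℕ) :
    chainsMap Φ (n + 1) ≫ chainsD F n = chainsD S n ≫ chainsMap Φ n := by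
  ext Y : 2
  exact (Φ.app Y).comm _ _

/-- The functors in the mapping cone of a natural chain map. -/
def coneX (S F : TopCat.{u} ⥤ ChainComplex (ModuleCat.{u} R) ℕ) :
    ℕ → TopCat.{u} ⥤ ModuleCat.{u} R
  | 0 => chainsAt F 0
  | n + 1 => chainsAt F (n + 1) ⊞ chainsAt S n

/-- The differential of the mapping cone in positive degrees. -/
def coneStep (Φ : S ⟶ F) (n : ℕ) :
    chainsAt F (n + 2) ⊞ chainsAt S (n + 1) ⟶ chainsAt F (n + 1) ⊞ chainsAt S n :=
  biprod.lift (biprod.desc (chainsD F (n + 1)) (chainsMap Φ (n + 1)))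
    (biprod.desc 0 (-chainsD S n))

/-- The differential of the mapping cone of a natural chain map. -/
def coneD (Φ : S ⟶ F) : ∀ n, coneX S F (n + 1) ⟶ coneX S F n
  | 0 => biprod.desc (chainsD F 0) (chainsMap Φ 0)
  | n + 1 => coneStep Φ n

lemma coneStep_desc (Φ : S ⟶ F) :
    coneStep Φ 0 ≫ biprod.desc (chainsD F 0) (chainsMap Φ 0) = 0 := by
  rw [coneStep, biprod.lift_desc]
  apply biprod.hom_ext'
  · simp only [Preadditive.comp_add, biprod.inl_desc_assoc, chainsD_comp, zero_comp, add_zero,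
      comp_zero]
  · simp only [Preadditive.comp_add, biprod.inr_desc_assoc, chainsMap_comm, Preadditive.neg_comp,
      add_neg_cancel, comp_zero]

lemma coneStep_comp (Φ : S ⟶ F) (n : ℕ) : coneStep Φ (n + 1) ≫ coneStep Φ n = 0 := by
  unfold coneStep
  apply biprod.hom_ext <;> apply biprod.hom_ext' <;>
    simp only [Category.assoc, biprod.lift_fst, biprod.lift_snd, biprod.lift_desc,
      Preadditive.comp_add, biprod.inl_desc_assoc, biprod.inr_desc_assoc, chainsD_comp,
      chainsMap_comm, Preadditive.neg_comp, Preadditive.comp_neg, zero_comp, comp_zero,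
      add_neg_cancel, add_zero, neg_zero]

lemma coneD_comp (Φ : S ⟶ F) (n : ℕ) : coneD Φ (n + 1) ≫ coneD Φ n = 0 := by
  cases n with
  | zero => exact coneStep_desc Φ
  | succ n => exact coneStep_comp Φ n

lemma inl_coneStep (Φ : S ⟶ F) (n : ℕ) :
    biprod.inl ≫ coneStep Φ n = chainsD F (n + 1) ≫ biprod.inl := by
  unfold coneStep
  apply biprod.hom_ext <;> simp

lemma inr_coneStep (Φ : S ⟶ F) (n : ℕ) :
    biprod.inr ≫ coneStep Φ n = chainsMap Φ (n + 1) ≫ biprod.inl - chainsD S n ≫ biprod.inr := by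
  unfold coneStep
  apply biprod.hom_ext <;> simp

lemma inr_coneStep_assoc (Φ : S ⟶ F) (n : ℕ) {Z : TopCat.{u} ⥤ ModuleCat.{u} R}
    (h : chainsAt F (n + 1) ⊞ chainsAt S n ⟶ Z) :
    biprod.inr ≫ coneStep Φ n ≫ h =
      (chainsMap Φ (n + 1) ≫ biprod.inl - chainsD S n ≫ biprod.inr) ≫ h := by
  rw [← inr_coneStep, Category.assoc]

lemma coneStep_fst (Φ : S ⟶ F) (n : ℕ) :
    coneStep Φ n ≫ biprod.fst = biprod.desc (chainsD F (n + 1)) (chainsMap Φ (n + 1)) :=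
  biprod.lift_fst _ _

lemma coneStep_snd (Φ : S ⟶ F) (n : ℕ) :
    coneStep Φ n ≫ biprod.snd = -(biprod.snd ≫ chainsD S n) := by
  unfold coneStep
  rw [biprod.lift_snd, biprod.desc_eq]
  simp

lemma app_apply_of_comp {A B C : TopCat.{u} ⥤ ModuleCat.{u} R} {f : A ⟶ B} {g : B ⟶ C}
    {h : A ⟶ C} (e : f ≫ g = h) (M : TopCat.{u}) (x : A.obj M) :
    g.app M (f.app M x) = h.app M x := by
  subst e; rfl

/-- Natural data that exhibit a chain map as a homotopy equivalence. -/
lemma exists_homotopyInverse (Φ : S ⟶ F) (hS : ∀ n, RelProjective (chainsAt S n))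
    (hF : ∀ n, RelProjective (chainsAt F n))
    (h0 : ∀ M : TopCat.{u}, (ContinuousMap.id M).Nullhomotopic → ∀ x : (F.obj M).X 0,
      ∃ (y : (F.obj M).X 1) (s : (S.obj M).X 0), (F.obj M).d 1 0 y + (Φ.app M).f 0 s = x)
    (h1 : ∀ M : TopCat.{u}, (ContinuousMap.id M).Nullhomotopic → ∀ (s : (S.obj M).X 0)
      (y : (F.obj M).X 1), (F.obj M).d 1 0 y + (Φ.app M).f 0 s = 0 → ∃ t, (S.obj M).d 1 0 t = s)
    (hS' : ∀ M : TopCat.{u}, (ContinuousMap.id M).Nullhomotopic → ∀ n (s : (S.obj M).X (n + 1)),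
      (S.obj M).d (n + 1) n s = 0 → ∃ t, (S.obj M).d (n + 2) (n + 1) t = s)
    (hF' : ∀ M : TopCat.{u}, (ContinuousMap.id M).Nullhomotopic → ∀ n (s : (F.obj M).X (n + 1)),
      (F.obj M).d (n + 1) n s = 0 → ∃ t, (F.obj M).d (n + 2) (n + 1) t = s) :
    ∃ (α : ∀ n, chainsAt F n ⟶ chainsAt F (n + 1)) (ψ : ∀ n, chainsAt F n ⟶ chainsAt S n)
      (γ : ∀ n, chainsAt S n ⟶ chainsAt S (n + 1)),
      α 0 ≫ chainsD F 0 + ψ 0 ≫ chainsMap Φ 0 = 𝟙 _ ∧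
      (∀ n, chainsD F n ≫ α n + (α (n + 1) ≫ chainsD F (n + 1) +
        ψ (n + 1) ≫ chainsMap Φ (n + 1)) = 𝟙 _) ∧
      (∀ n, chainsD F n ≫ ψ n = ψ (n + 1) ≫ chainsD S n) ∧
      chainsMap Φ 0 ≫ ψ 0 = 𝟙 _ + γ 0 ≫ chainsD S 0 ∧
      ∀ n, chainsMap Φ (n + 1) ≫ ψ (n + 1) =
        𝟙 _ + chainsD S n ≫ γ n + γ (n + 1) ≫ chainsD S (n + 1) := by
  have hK : ∀ n, RelProjective (coneX S F n) := by
    rintro (_ | n)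
    · exact hF 0
    · exact (hF (n + 1)).biprod (hS n)
  have e0 : ∀ M : TopCat.{u}, (ContinuousMap.id M).Nullhomotopic →
      ∀ x : (coneX S F 0).obj M, ∃ y : (coneX S F 1).obj M, (coneD Φ 0).app M y = x := by
    intro M hM x
    obtain ⟨y, s, hx⟩ := h0 M hM x
    refine ⟨(biprod.inl : chainsAt F 1 ⟶ chainsAt F 1 ⊞ chainsAt S 0).app M y +
      (biprod.inr : chainsAt S 0 ⟶ chainsAt F 1 ⊞ chainsAt S 0).app M s, ?_⟩
    refine (map_add ((biprod.desc (chainsD F 0) (chainsMap Φ 0)).app M).hom _ _).trans ?_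
    refine Eq.trans ?_ hx
    exact congrArg₂ (· + ·) (app_apply_of_comp (biprod.inl_desc (chainsD F 0) (chainsMap Φ 0)) M y)
      (app_apply_of_comp (biprod.inr_desc (chainsD F 0) (chainsMap Φ 0)) M s)
  have e1 : ∀ M : TopCat.{u}, (ContinuousMap.id M).Nullhomotopic →
      ∀ (n : ℕ) (x : (coneX S F (n + 1)).obj M), (coneD Φ n).app M x = 0 →
        ∃ y : (coneX S F (n + 2)).obj M, (coneD Φ (n + 1)).app M y = x := by
    have key : ∀ M : TopCat.{u}, (ContinuousMap.id M).Nullhomotopic → ∀ n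
        (x : (chainsAt F (n + 1) ⊞ chainsAt S n).obj M),
        (biprod.desc (chainsD F n) (chainsMap Φ n)).app M x = 0 →
        (∃ t, (chainsD S n).app M t = (biprod.snd : chainsAt F (n + 1) ⊞ chainsAt S n ⟶ _).app M x) →
        ∃ y, (coneStep Φ n).app M y = x := by
      rintro M hM n x hx ⟨t, ht⟩
      have e1 : (chainsD F n).app M ((biprod.fst : chainsAt F (n + 1) ⊞ chainsAt S n ⟶ _).app M x) +
          (chainsMap Φ n).app M ((biprod.snd : chainsAt F (n + 1) ⊞ chainsAt S n ⟶ _).app M x) = 0 := by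
        rw [biprod.desc_eq] at hx
        exact hx
      obtain ⟨w, hw⟩ := hF' M hM n
        ((biprod.fst : chainsAt F (n + 1) ⊞ chainsAt S n ⟶ _).app M x +
          (chainsMap Φ (n + 1)).app M t) (by
          refine (map_add ((chainsD F n).app M).hom _ _).trans ?_
          refine Eq.trans ?_ e1
          refine congrArg₂ (· + ·) rfl ?_
          refine (app_apply_of_comp (chainsMap_comm Φ n) M t).trans ?_
          exact congrArg ((chainsMap Φ n).app M) ht)
      refine ⟨(biprod.inl : _ ⟶ chainsAt F (n + 2) ⊞ chainsAt S (n + 1)).app M w -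
        (biprod.inr : _ ⟶ chainsAt F (n + 2) ⊞ chainsAt S (n + 1)).app M t, ?_⟩
      refine (map_sub ((coneStep Φ n).app M).hom _ _).trans ?_
      have e2 := app_apply_of_comp (inl_coneStep Φ n) M w
      have e3 := app_apply_of_comp (inr_coneStep Φ n) M t
      refine (congrArg₂ (· - ·) e2 e3).trans ?_
      have hw' : (chainsD F (n + 1)).app M w = _ := hw
      have e4 : x = (biprod.inl : _ ⟶ chainsAt F (n + 1) ⊞ chainsAt S n).app M
            ((biprod.fst : chainsAt F (n + 1) ⊞ chainsAt S n ⟶ _).app M x) +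
          (biprod.inr : _ ⟶ chainsAt F (n + 1) ⊞ chainsAt S n).app M
            ((biprod.snd : chainsAt F (n + 1) ⊞ chainsAt S n ⟶ _).app M x) :=
        (LinearMap.congr_fun (congrArg ModuleCat.Hom.hom
          (NatTrans.congr_app (biprod.total (X := chainsAt F (n + 1)) (Y := chainsAt S n)) M)) x).symm
      refine Eq.trans ?_ e4.symm
      change (biprod.inl : _ ⟶ chainsAt F (n + 1) ⊞ chainsAt S n).app M ((chainsD F (n + 1)).app M w) -
        ((biprod.inl : _ ⟶ chainsAt F (n + 1) ⊞ chainsAt S n).app M ((chainsMap Φ (n + 1)).app M t) -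
          (biprod.inr : _ ⟶ chainsAt F (n + 1) ⊞ chainsAt S n).app M ((chainsD S n).app M t)) = _
      rw [hw', ht]
      rw [map_add]
      abel
    rintro M hM (_ | n) x hx
    · refine key M hM 0 x hx (h1 M hM _ ((biprod.fst : chainsAt F 1 ⊞ chainsAt S 0 ⟶ _).app M x) ?_)
      have hx' : (biprod.desc (chainsD F 0) (chainsMap Φ 0)).app M x = 0 := hx
      rw [biprod.desc_eq] at hx'
      exact hx'
    · have hx' : (coneStep Φ n).app M x = 0 := hx
      refine key M hM (n + 1) x ?_ (hS' M hM n _ ?_)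
      · refine (app_apply_of_comp (coneStep_fst Φ n) M x).symm.trans ?_
        rw [hx']
        exact map_zero _
      · have e := app_apply_of_comp (coneStep_snd Φ n) M x
        rw [hx'] at e
        exact neg_eq_zero.1 (e.symm.trans (map_zero _))
  obtain ⟨h, hz, hs⟩ := exists_contraction (coneX S F) (coneD Φ) (coneD_comp Φ) hK e0 e1
  let h' : ∀ n, chainsAt F (n + 1) ⊞ chainsAt S n ⟶ chainsAt F (n + 2) ⊞ chainsAt S (n + 1) :=
    fun n => h (n + 1)
  let z : chainsAt F 0 ⟶ chainsAt F 1 ⊞ chainsAt S 0 := h 0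
  let t : ∀ n, chainsAt F n ⟶ chainsAt F (n + 1) ⊞ chainsAt S n := fun n =>
    match n with
    | 0 => z
    | n + 1 => biprod.inl ≫ h' n
  have hz' : z ≫ biprod.desc (chainsD F 0) (chainsMap Φ 0) = 𝟙 _ := hz
  have hs0 : biprod.desc (chainsD F 0) (chainsMap Φ 0) ≫ z + h' 0 ≫ coneStep Φ 0 = 𝟙 _ := hs 0
  have hs' : ∀ n, coneStep Φ n ≫ h' n + h' (n + 1) ≫ coneStep Φ (n + 1) = 𝟙 _ :=
    fun n => hs (n + 1)
  have hA : ∀ n, chainsD F n ≫ t n + t (n + 1) ≫ coneStep Φ n = biprod.inl := by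
    rintro (_ | n)
    · have := biprod.inl ≫= hs0
      rw [Preadditive.comp_add, biprod.inl_desc_assoc, Category.comp_id] at this
      simpa [t] using this
    · have := biprod.inl ≫= hs' n
      rw [Preadditive.comp_add, ← Category.assoc, inl_coneStep, Category.comp_id] at this
      simpa [t] using this
  refine ⟨fun n => t n ≫ biprod.fst, fun n => t n ≫ biprod.snd,
    fun n => biprod.inr ≫ h' n ≫ biprod.snd, ?_, fun n => ?_, fun n => ?_, ?_, fun n => ?_⟩
  · rw [← hz', biprod.desc_eq, Preadditive.comp_add, Category.assoc, Category.assoc]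
  · have := hA n =≫ biprod.fst
    simp only [Preadditive.add_comp, Category.assoc, coneStep_fst, biprod.desc_eq,
      Preadditive.comp_add, biprod.inl_fst] at this
    simpa only [Category.assoc] using this
  · have := hA n =≫ biprod.snd
    rw [Preadditive.add_comp, Category.assoc, Category.assoc, coneStep_snd,
      biprod.inl_snd, Preadditive.comp_neg, add_neg_eq_zero] at this
    exact this.trans (Category.assoc _ _ _).symm
  · have := biprod.inr ≫= hs0 =≫ biprod.snd
    simp only [Preadditive.add_comp, Preadditive.comp_add, Category.assoc, Category.id_comp,
      biprod.inr_desc_assoc, coneStep_snd, Preadditive.comp_neg, biprod.inr_snd] at this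
    rw [add_neg_eq_iff_eq_add] at this
    simpa only [Category.assoc] using this
  · have := biprod.inr ≫= hs' n =≫ biprod.snd
    simp only [Preadditive.add_comp, Preadditive.comp_add, Category.assoc, Category.id_comp,
      inr_coneStep_assoc, coneStep_snd, Preadditive.comp_neg, biprod.inr_snd,
      Preadditive.sub_comp] at this
    rw [add_neg_eq_iff_eq_add, sub_eq_iff_eq_add] at this
    change chainsMap Φ (n + 1) ≫ (biprod.inl ≫ h' n) ≫ biprod.snd = _
    rw [Category.assoc, this]
    simp only [Category.assoc]
    abel

end AcyclicModels

end
end Freehedral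

namespace Freehedral
noncomputable section
variable {R : Type u} [CommRing R]

section HomotopyEquivalence
variable {K L M : ChainComplex (ModuleCat.{u} R) ℕ}

/-- A homotopy given by its components of degree one. -/
def homotopyOfComponents (f g : K ⟶ L) (s : ∀ n, K.X n ⟶ L.X (n + 1))
    (h0 : f.f 0 = s 0 ≫ L.d 1 0 + g.f 0)
    (h1 : ∀ n, f.f (n + 1) = K.d (n + 1) n ≫ s n + s (n + 1) ≫ L.d (n + 2) (n + 1) + g.f (n + 1)) :
    Homotopy f g where
  hom i j := if h : i + 1 = j then s i ≫ eqToHom (by rw [h]) else 0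
  zero i j hij := dif_neg hij
  comm i := by
    cases i with
    | zero =>
      rw [Homotopy.dNext_zero_chainComplex, Homotopy.prevD_chainComplex, h0]
      simp
    | succ n =>
      rw [Homotopy.dNext_succ_chainComplex, Homotopy.prevD_chainComplex, h1]
      simp

lemma cohomologyMap_id (n : ℕ) : cohomologyMap (𝟙 K) n = LinearMap.id := by
  refine Submodule.linearMap_qext _ (LinearMap.ext fun x => ?_)
  refine congrArg Submodule.Quotient.mk (Subtype.ext ?_)
  change (𝟙 K : K ⟶ K).f n ≫ x.1 = x.1
  simp

lemma cohomologyMap_comp (f : K ⟶ L) (g : L ⟶ M) (n : ℕ) :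
    cohomologyMap (f ≫ g) n = cohomologyMap f n ∘ₗ cohomologyMap g n := by
  refine Submodule.linearMap_qext _ (LinearMap.ext fun x => ?_)
  refine congrArg Submodule.Quotient.mk (Subtype.ext ?_)
  change (f ≫ g).f n ≫ x.1 = f.f n ≫ g.f n ≫ x.1
  simp

lemma cohomologyMap_eq_of_homotopy {f g : K ⟶ L} (h : Homotopy f g) (n : ℕ) :
    cohomologyMap f n = cohomologyMap g n := by
  refine Submodule.linearMap_qext _ (LinearMap.ext fun x => ?_)
  refine (Submodule.Quotient.eq _).2 ?_
  change f.f n ≫ x.1 - g.f n ≫ x.1 ∈ coboundaries K n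
  have hx : L.d (n + 1) n ≫ x.1 = 0 := x.2
  rw [← Preadditive.sub_comp, h.comm n, add_sub_cancel_right]
  cases n with
  | zero =>
    rw [Homotopy.dNext_zero_chainComplex, Homotopy.prevD_chainComplex, zero_add, Category.assoc, hx,
      Limits.comp_zero]
    exact Submodule.zero_mem _
  | succ n =>
    rw [Homotopy.dNext_succ_chainComplex, Homotopy.prevD_chainComplex, Preadditive.add_comp,
      Category.assoc, Category.assoc, hx, Limits.comp_zero, add_zero]
    exact coboundary_mem n (h.hom n (n + 1) ≫ x.1)

lemma cohomologyMap_bijective (e : HomotopyEquiv K L) (n : ℕ) :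
    Function.Bijective (cohomologyMap e.hom n) := by
  have h1 := cohomologyMap_eq_of_homotopy e.homotopyHomInvId n
  have h2 := cohomologyMap_eq_of_homotopy e.homotopyInvHomId n
  rw [cohomologyMap_comp, cohomologyMap_id] at h1 h2
  exact Function.bijective_iff_has_inverse.2 ⟨cohomologyMap e.inv n,
    LinearMap.congr_fun h2, LinearMap.congr_fun h1⟩

lemma isIso_homologyMap (e : HomotopyEquiv K L) (n : ℕ) :
    IsIso (HomologicalComplex.homologyMap e.hom n) :=
  (e.toHomologyIso n).isIso_hom

lemma exists_homotopyEquiv {S F : TopCat.{u} ⥤ ChainComplex (ModuleCat.{u} R) ℕ} (Φ : S ⟶ F)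
    (h : ∃ (α : ∀ n, chainsAt F n ⟶ chainsAt F (n + 1)) (ψ : ∀ n, chainsAt F n ⟶ chainsAt S n)
      (γ : ∀ n, chainsAt S n ⟶ chainsAt S (n + 1)),
      α 0 ≫ chainsD F 0 + ψ 0 ≫ chainsMap Φ 0 = 𝟙 _ ∧
      (∀ n, chainsD F n ≫ α n + (α (n + 1) ≫ chainsD F (n + 1) +
        ψ (n + 1) ≫ chainsMap Φ (n + 1)) = 𝟙 _) ∧
      (∀ n, chainsD F n ≫ ψ n = ψ (n + 1) ≫ chainsD S n) ∧
      chainsMap Φ 0 ≫ ψ 0 = 𝟙 _ + γ 0 ≫ chainsD S 0 ∧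
      ∀ n, chainsMap Φ (n + 1) ≫ ψ (n + 1) =
        𝟙 _ + chainsD S n ≫ γ n + γ (n + 1) ≫ chainsD S (n + 1)) (Y : TopCat.{u}) :
    ∃ e : HomotopyEquiv (S.obj Y) (F.obj Y), e.hom = Φ.app Y := by
  obtain ⟨α, ψ, γ, h1, h2, h3, h4, h5⟩ := h
  refine ⟨{
    hom := Φ.app Y
    inv := { f := fun n => (ψ n).app Y, comm' := ?_ }
    homotopyHomInvId := homotopyOfComponents _ _ (fun n => (γ n).app Y) ?_ fun n => ?_
    homotopyInvHomId := (homotopyOfComponents _ _ (fun n => (α n).app Y) ?_ fun n => ?_).symm }, rfl⟩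
  · rintro i j hij
    obtain rfl : j + 1 = i := hij
    exact (NatTrans.congr_app (h3 j) Y).symm
  · exact (NatTrans.congr_app h4 Y).trans (add_comm _ _)
  · refine (NatTrans.congr_app (h5 n) Y).trans ?_
    rw [add_assoc]
    exact add_comm _ _
  · exact (NatTrans.congr_app h1 Y).symm
  · refine (NatTrans.congr_app (h2 n) Y).symm.trans ?_
    rw [← add_assoc]
    rfl

end HomotopyEquivalence

end
end Freehedral

namespace Freehedral
noncomputable section
variable {R : Type u} [CommRing R]

section NormalizedChains
variable {M : TopCat.{u}}

lemma normalizedChains_induction {n : ℕ} {P : NormalizedChains R M n → Prop}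
    (x : NormalizedChains R M n) (h0 : P 0) (hadd : ∀ x y, P x → P y → P (x + y))
    (hsmul : ∀ (r : R) (c : Cell M n), P (r • cellClass R c)) : P x := by
  induction x using Submodule.Quotient.induction_on with
  | _ x =>
    induction x using Finsupp.induction_linear with
    | zero => exact h0
    | add x y hx hy => exact hadd _ _ hx hy
    | single c r =>
      have := hsmul r c
      rwa [cellClass, ← Submodule.Quotient.mk_smul, Finsupp.smul_single, smul_eq_mul, mul_one] at this

lemma normalizedChains_hom_ext {n : ℕ} {N : Type*} [AddCommGroup N] [Module R N]
    {α β : NormalizedChains R M n →ₗ[R] N} (h : ∀ c, α (cellClass R c) = β (cellClass R c)) : α = β :=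
  Submodule.linearMap_qext _ (Finsupp.lhom_ext' fun c => LinearMap.ext_ring (h c))

/-- The linear map on normalized chains with given values on cells. -/
def normalizedLift {n : ℕ} {N : Type*} [AddCommGroup N] [Module R N] (v : Cell M n → N)
    (hv : ∀ c, c.IsDegenerate → v c = 0) : NormalizedChains R M n →ₗ[R] N :=
  Submodule.liftQ _ (Finsupp.linearCombination R v) (by
    refine Submodule.span_le.2 ?_
    rintro _ ⟨c, hc, rfl⟩
    simp [hv c hc])

lemma normalizedLift_cellClass {n : ℕ} {N : Type*} [AddCommGroup N] [Module R N] (v : Cell M n → N)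
    (hv : ∀ c, c.IsDegenerate → v c = 0) (c : Cell M n) :
    normalizedLift v hv (cellClass R c) = v c := by
  change Finsupp.linearCombination R v (Finsupp.single c 1) = v c
  simp

end NormalizedChains

section Models
open Simplicial

lemma id_nullhomotopic_simplex (n : SimplexCategory) :
    (ContinuousMap.id (SimplexCategory.toTop.{u}.obj n)).Nullhomotopic := by
  have h1 : ContractibleSpace (stdSimplex ℝ (Fin (n.len + 1))) :=
    (convex_stdSimplex ℝ _).contractibleSpace ⟨_, single_mem_stdSimplex ℝ 0⟩
  have h2 : ContractibleSpace (ULift.{u} (stdSimplex ℝ (Fin (n.len + 1)))) :=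
    Homeomorph.ulift.contractibleSpace
  exact @id_nullhomotopic (ULift.{u} (stdSimplex ℝ (Fin (n.len + 1)))) _ h2

lemma relProjective_singular (n : ℕ) : RelProjective (chainsAt (singularComplexFunctor R) n) := by
  intro A B f φ h
  let Δ : TopCat.{u} := SimplexCategory.toTop.{u}.obj ⦋n⦌
  obtain ⟨a, ha⟩ := h Δ (id_nullhomotopic_simplex _)
    (((TopCat.toSSet.obj Δ).ιChainComplex (R := ModuleCat.of R R)
      (show (TopCat.toSSet.obj Δ) _⦋n⦌ from ⟨𝟙 Δ⟩)).hom (1 : R))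
  let g : ∀ {Y : TopCat.{u}}, (TopCat.toSSet.obj Y) _⦋n⦌ → (Δ ⟶ Y) := fun σ => σ.down
  let ψ : ∀ Y : TopCat.{u}, ((TopCat.toSSet.obj Y).chainComplex (ModuleCat.of R R)).X n ⟶ A.obj Y :=
    fun Y => ((TopCat.toSSet.obj Y).isColimitChainComplexXCofan (ModuleCat.of R R) n).desc
      (Limits.Cofan.mk _ fun σ => ModuleCat.ofHom (LinearMap.toSpanSingleton R _ (A.map (g σ) a)))
  have hψ : ∀ (Y : TopCat.{u}) (σ : (TopCat.toSSet.obj Y) _⦋n⦌),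
      (TopCat.toSSet.obj Y).ιChainComplex σ ≫ ψ Y =
        ModuleCat.ofHom (LinearMap.toSpanSingleton R _ (A.map (g σ) a)) := fun Y σ =>
    ((TopCat.toSSet.obj Y).isColimitChainComplexXCofan (ModuleCat.of R R) n).fac
      (Limits.Cofan.mk _ fun σ => ModuleCat.ofHom (LinearMap.toSpanSingleton R _ (A.map (g σ) a))) ⟨σ⟩
  have hmap : ∀ {Y Z : TopCat.{u}} (q : Y ⟶ Z) (σ : (TopCat.toSSet.obj Y) _⦋n⦌),
      (TopCat.toSSet.obj Y).ιChainComplex σ ≫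
        ((singularComplexFunctor R).map q).f n =
      (TopCat.toSSet.obj Z).ιChainComplex ((TopCat.toSSet.map q).app _ σ) := fun q σ =>
    SSet.ι_chainComplexMap_f _ _ (TopCat.toSSet.map q) _ σ
  refine ⟨{ app := ψ, naturality := fun Y Z q => ?_ }, ?_⟩
  · refine SSet.chainComplex_hom_ext fun σ => ?_
    have e1 := hmap q σ =≫ ψ Z
    have e2 := hψ Y σ =≫ A.map q
    refine ((Category.assoc _ _ _).symm.trans (e1.trans (hψ Z _))).trans (Eq.trans ?_ (e2.symm.trans (Category.assoc _ _ _)))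
    refine ModuleCat.hom_ext (LinearMap.ext_ring ?_)
    change (1 : R) • A.map (g σ ≫ q) a = A.map q ((1 : R) • A.map (g σ) a)
    rw [one_smul, one_smul, Functor.map_comp_apply]
  · ext Y : 2
    refine SSet.chainComplex_hom_ext fun σ => ?_
    have e1 := hψ Y σ =≫ f.app Y
    refine ((Category.assoc _ _ _).symm.trans e1).trans ?_
    refine ModuleCat.hom_ext (LinearMap.ext_ring ?_)
    change f.app Y ((1 : R) • A.map (g σ) a) = φ.app Y _
    rw [one_smul]
    have e2 : f.app Y (A.map (g σ) a) = B.map (g σ) (f.app Δ a) :=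
      LinearMap.congr_fun (congrArg ModuleCat.Hom.hom (f.naturality (g σ))) a
    rw [e2, ha]
    refine (LinearMap.congr_fun (congrArg ModuleCat.Hom.hom (φ.naturality (g σ))) _).symm.trans ?_
    refine congrArg (φ.app Y) ?_
    exact LinearMap.congr_fun (congrArg ModuleCat.Hom.hom (hmap (g σ) ⟨𝟙 Δ⟩)) (1 : R)

/-- The cube as an object of the category of spaces. -/
def cubeSpace (n : ℕ) : TopCat.{u} := TopCat.of (ULift.{u} (Fin n → unitInterval))

lemma id_nullhomotopic_cube (n : ℕ) : (ContinuousMap.id (cubeSpace.{u} n)).Nullhomotopic := by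
  refine ⟨ULift.up fun _ => 0, ⟨{
    toFun := fun q => ULift.up fun i => unitInterval.symm q.1 * q.2.down i
    continuous_toFun := ?_
    map_zero_left := fun x => ?_
    map_one_left := fun x => ?_ }⟩⟩
  · refine continuous_uliftUp.comp (continuous_pi fun i => ?_)
    refine (unitInterval.continuous_symm.comp continuous_fst).mul ?_
    exact (continuous_apply i).comp (continuous_uliftDown.comp continuous_snd)
  · simp
    rfl
  · simp
    rfl

/-- The universal cell of a given shape. -/
def universalCell {n : ℕ} (k m l : ℕ) (h : k + m + l = n) : Cell (cubeSpace.{u} n) n :=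
  ⟨k, m, l, h, ⟨ULift.up, continuous_uliftUp⟩⟩

/-- The morphism given by a cell. -/
def Cell.toHom {Y : TopCat.{u}} {n : ℕ} (c : Cell Y n) : cubeSpace.{u} n ⟶ Y :=
  TopCat.ofHom (c.map.comp ⟨ULift.down, continuous_uliftDown⟩)

/-- The map of the cube that replaces a coordinate by `0`. -/
def eraseCoord {n : ℕ} (p : Fin n) : cubeSpace.{u} n ⟶ cubeSpace.{u} n :=
  TopCat.ofHom ⟨fun x => ULift.up (Function.update x.down p 0),
    continuous_uliftUp.comp (continuous_uliftDown.update p continuous_const)⟩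

lemma eraseCoord_comp_self {n : ℕ} (p : Fin n) :
    eraseCoord.{u} p ≫ eraseCoord p = eraseCoord p := by
  ext x
  exact congrArg ULift.up (Function.update_idem _ _ _)

lemma eraseCoord_comm {n : ℕ} (p q : Fin n) :
    eraseCoord.{u} p ≫ eraseCoord q = eraseCoord q ≫ eraseCoord p := by
  rcases eq_or_ne p q with rfl | h
  · rfl
  · ext x
    exact congrArg ULift.up (Function.update_comm h _ _ _)

lemma normalizedMap_cellClass {Y Z : TopCat.{u}} (g : Y ⟶ Z) {n : ℕ} (c : Cell Y n) :
    normalizedMap R g n (cellClass R c) = cellClass R (c.postcomp g.hom) := by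
  change Submodule.Quotient.mk (Finsupp.mapDomain _ (Finsupp.single c (1 : R))) = _
  rw [Finsupp.mapDomain_single]
  rfl

lemma cellClass_universalCell_eraseCoord {n : ℕ} (k m l : ℕ) (h : k + m + l = n) (p : Fin n)
    (hp : p.1 < k ∨ k + m ≤ p.1) :
    cellClass R ((universalCell.{u} k m l h).postcomp (eraseCoord p).hom) = 0 :=
  cellClass_eq_zero ⟨p, hp, fun x y hxy => congrArg ULift.up <| funext fun j => by
    change Function.update x p 0 j = Function.update y p 0 j
    rcases eq_or_ne j p with rfl | hj
    · simp
    · simp [hj, hxy j hj]⟩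

lemma exists_normalized_lift {A B : TopCat.{u} ⥤ ModuleCat.{u} R} {n : ℕ} (f : A ⟶ B)
    (φ : chainsAt (normalizedComplexFunctor R) n ⟶ B) (k m l : ℕ) (hd : k + m + l = n)
    (h : ∃ a : A.obj (cubeSpace n), f.app _ a = φ.app _ (cellClass R (universalCell k m l hd)))
    (P : Finset (Fin n)) (hP : ∀ p ∈ P, p.1 < k ∨ k + m ≤ p.1) :
    ∃ a : A.obj (cubeSpace n), f.app _ a = φ.app _ (cellClass R (universalCell k m l hd)) ∧
      ∀ p ∈ P, A.map (eraseCoord p) a = 0 := by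
  induction P using Finset.induction_on with
  | empty =>
    obtain ⟨a, ha⟩ := h
    exact ⟨a, ha, by simp⟩
  | insert q P hq ih =>
    obtain ⟨a, ha, hz⟩ := ih fun p hp => hP p (Finset.mem_insert_of_mem hp)
    refine ⟨a - A.map (eraseCoord q) a, ?_, fun p hp => ?_⟩
    · have e1 : f.app _ (A.map (eraseCoord q) a) = B.map (eraseCoord q) (f.app _ a) :=
        LinearMap.congr_fun (congrArg ModuleCat.Hom.hom (f.naturality (eraseCoord q))) a
      have e2 : B.map (eraseCoord q) (φ.app _ (cellClass R (universalCell k m l hd))) = 0 := by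
        refine (LinearMap.congr_fun (congrArg ModuleCat.Hom.hom (φ.naturality (eraseCoord q)))
          (cellClass R (universalCell k m l hd))).symm.trans ?_
        refine (congrArg (φ.app _) (normalizedMap_cellClass (eraseCoord q) _)).trans ?_
        rw [cellClass_universalCell_eraseCoord k m l hd q (hP q (Finset.mem_insert_self _ _))]
        exact map_zero _
      rw [map_sub, e1, ha, e2, sub_zero]
    · rw [map_sub, ← Functor.map_comp_apply]
      rcases Finset.mem_insert.1 hp with rfl | hp
      · rw [eraseCoord_comp_self, sub_self]
      · rw [hz p hp, eraseCoord_comm, Functor.map_comp_apply, hz p hp, map_zero, sub_zero]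

lemma relProjective_normalized (n : ℕ) :
    RelProjective (chainsAt (normalizedComplexFunctor R) n) := by
  classical
  intro A B f φ h
  have key : ∀ (k m l : ℕ) (hd : k + m + l = n), ∃ a : A.obj (cubeSpace n),
      f.app _ a = φ.app _ (cellClass R (universalCell k m l hd)) ∧
        ∀ p : Fin n, (p.1 < k ∨ k + m ≤ p.1) → A.map (eraseCoord p) a = 0 := fun k m l hd => by
    obtain ⟨a, h1, h2⟩ := exists_normalized_lift f φ k m l hd
      (h _ (id_nullhomotopic_cube n) _)
      (Finset.univ.filter fun p : Fin n => p.1 < k ∨ k + m ≤ p.1) (by simp)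
    exact ⟨a, h1, fun p hp => h2 p (by simpa using hp)⟩
  choose a ha hz using key
  let v : ∀ {Y : TopCat.{u}}, Cell Y n → A.obj Y := fun c => A.map c.toHom (a c.k c.m c.l c.dim_eq)
  have hv : ∀ {Y : TopCat.{u}} (c : Cell Y n), c.IsDegenerate → v c = 0 := by
    rintro Y c ⟨p, hp, hc⟩
    have e : c.toHom = eraseCoord p ≫ c.toHom := by
      ext x
      exact hc _ _ fun j hj => (Function.update_of_ne hj _ _).symm
    change A.map c.toHom _ = 0
    rw [e, Functor.map_comp_apply, hz _ _ _ _ p hp, map_zero]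
  let ψ : ∀ Y : TopCat.{u}, NormalizedChains R Y n →ₗ[R] A.obj Y := fun Y => normalizedLift v hv
  have hψ : ∀ {Y : TopCat.{u}} (c : Cell Y n), ψ Y (cellClass R c) = v c :=
    fun {Y} c => normalizedLift_cellClass v hv c
  refine ⟨{ app := fun Y => ModuleCat.ofHom (ψ Y), naturality := fun Y Z q => ?_ }, ?_⟩
  · refine ModuleCat.hom_ext (normalizedChains_hom_ext fun c => ?_)
    change ψ Z (normalizedMap R q n (cellClass R c)) = A.map q (ψ Y (cellClass R c))
    rw [normalizedMap_cellClass, hψ, hψ]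
    exact Functor.map_comp_apply A c.toHom q _
  · ext Y : 2
    refine ModuleCat.hom_ext (normalizedChains_hom_ext fun c => ?_)
    change f.app Y (ψ Y (cellClass R c)) = φ.app Y (cellClass R c)
    rw [hψ]
    refine (LinearMap.congr_fun (congrArg ModuleCat.Hom.hom (f.naturality c.toHom)) _).trans ?_
    refine (congrArg (B.map c.toHom) (ha _ _ _ _)).trans ?_
    refine (LinearMap.congr_fun (congrArg ModuleCat.Hom.hom (φ.naturality c.toHom)) _).symm.trans ?_
    refine congrArg (φ.app Y) ?_
    exact normalizedMap_cellClass c.toHom _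

end Models

end
end Freehedral

namespace Freehedral
noncomputable section
variable {R : Type u} [CommRing R]

section SingularAcyclic
open Simplicial
variable {M : TopCat.{u}}

/-- The chain homotopy from the identity to the map induced by a constant map, factored through the
point. -/
lemma singular_homotopy (hM : (ContinuousMap.id M).Nullhomotopic) :
    ∃ i : TopCat.of PUnit.{u + 1} ⟶ M, Nonempty (Homotopy
      (𝟙 ((singularComplexFunctor R).obj M))
      ((singularComplexFunctor R).map (TopCat.ofHom (ContinuousMap.const M PUnit.unit)) ≫
        (singularComplexFunctor R).map i)) := by
  obtain ⟨y, ⟨H⟩⟩ := hM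
  let i : TopCat.of PUnit.{u + 1} ⟶ M := TopCat.ofHom (ContinuousMap.const _ y)
  let H' : TopCat.Homotopy (𝟙 M) (TopCat.ofHom (ContinuousMap.const M PUnit.unit) ≫ i) := H
  exact ⟨i, ⟨((Homotopy.ofEq (CategoryTheory.Functor.map_id _ _).symm).trans
    (H'.singularChainComplexFunctorObjMap (ModuleCat.of R R))).trans
      (Homotopy.ofEq (CategoryTheory.Functor.map_comp _ _ _))⟩⟩

lemma singular_exact (hM : (ContinuousMap.id M).Nullhomotopic) (n : ℕ)
    (s : ((singularComplexFunctor R).obj M).X (n + 1))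
    (hs : ((singularComplexFunctor R).obj M).d (n + 1) n s = 0) :
    ∃ t, ((singularComplexFunctor R).obj M).d (n + 2) (n + 1) t = s := by
  obtain ⟨i, ⟨h⟩⟩ := singular_homotopy (R := R) hM
  have hc := h.comm (n + 1)
  rw [Homotopy.dNext_succ_chainComplex, Homotopy.prevD_chainComplex] at hc
  have hc' := LinearMap.congr_fun (congrArg ModuleCat.Hom.hom hc) s
  let r : M ⟶ TopCat.of PUnit.{u + 1} := TopCat.ofHom (ContinuousMap.const M PUnit.unit)
  let P := (singularComplexFunctor R).obj (TopCat.of PUnit.{u + 1})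
  have hex : P.ExactAt (n + 1) :=
    AlgebraicTopology.singularChainComplexFunctor_exactAt_of_totallyDisconnectedSpace _ _ _ _
      (Nat.succ_ne_zero n)
  rw [P.exactAt_iff' (n + 2) (n + 1) n (by simp) (by simp),
    ShortComplex.moduleCat_exact_iff] at hex
  obtain ⟨w, hw⟩ := hex (((singularComplexFunctor R).map r).f (n + 1) s) (by
    refine (LinearMap.congr_fun (congrArg ModuleCat.Hom.hom
      (((singularComplexFunctor R).map r).comm (n + 1) n)) s).trans ?_
    exact (congrArg (((singularComplexFunctor R).map r).f n).hom hs).trans (map_zero _))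
  refine ⟨h.hom (n + 1) (n + 2) s + ((singularComplexFunctor R).map i).f (n + 2) w, ?_⟩
  rw [map_add]
  refine Eq.trans ?_ hc'.symm
  have e1 : ((singularComplexFunctor R).obj M).d (n + 2) (n + 1)
      (((singularComplexFunctor R).map i).f (n + 2) w) =
      ((singularComplexFunctor R).map i).f (n + 1) (P.d (n + 2) (n + 1) w) :=
    LinearMap.congr_fun (congrArg ModuleCat.Hom.hom
      (((singularComplexFunctor R).map i).comm (n + 2) (n + 1))) w
  have e2 : h.hom n (n + 1) (((singularComplexFunctor R).obj M).d (n + 1) n s) = 0 :=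
    (congrArg _ hs).trans (map_zero _)
  rw [e1]
  refine Eq.trans ?_ (congrArg (· + _) (congrArg (· + _) e2)).symm
  rw [zero_add]
  exact congrArg _ (congrArg _ hw)

lemma singular_exact_zero (hM : (ContinuousMap.id M).Nullhomotopic)
    (s : ((singularComplexFunctor R).obj M).X 0)
    (hs : (simplicialOne (R := R) (TopCat.toSSet.obj M)).hom s = 0) :
    ∃ t, ((singularComplexFunctor R).obj M).d 1 0 t = s := by
  obtain ⟨i, ⟨h⟩⟩ := singular_homotopy (R := R) hM
  have hc := h.comm 0
  rw [Homotopy.dNext_zero_chainComplex, Homotopy.prevD_chainComplex, zero_add] at hc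
  have hc' := LinearMap.congr_fun (congrArg ModuleCat.Hom.hom hc) s
  let r : M ⟶ TopCat.of PUnit.{u + 1} := TopCat.ofHom (ContinuousMap.const M PUnit.unit)
  let σ₀ : (TopCat.toSSet.obj M) _⦋0⦌ := ⟨TopCat.ofHom (ContinuousMap.const _ PUnit.unit) ≫ i⟩
  have key : ((singularComplexFunctor R).map r ≫ (singularComplexFunctor R).map i).f 0 =
      simplicialOne (R := R) (TopCat.toSSet.obj M) ≫ (TopCat.toSSet.obj M).ιChainComplex σ₀ := by
    rw [← CategoryTheory.Functor.map_comp]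
    refine SSet.chainComplex_hom_ext fun σ => ?_
    refine (SSet.ι_chainComplexMap_f _ _ (TopCat.toSSet.map (r ≫ i)) _ σ).trans ?_
    have e : (TopCat.toSSet.obj M).ιChainComplex σ ≫ simplicialOne (R := R) (TopCat.toSSet.obj M) =
        𝟙 _ := by
      refine ModuleCat.hom_ext (LinearMap.ext_ring ?_)
      exact simplexValue_cochainOfValues _ _ σ
    refine Eq.trans ?_ (Category.assoc _ _ _)
    rw [e, Category.id_comp]
    rfl
  have e0 : ((singularComplexFunctor R).map r ≫ (singularComplexFunctor R).map i).f 0 s = 0 := by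
    refine (LinearMap.congr_fun (congrArg ModuleCat.Hom.hom key) s).trans ?_
    exact (congrArg ((TopCat.toSSet.obj M).ιChainComplex (R := ModuleCat.of R R) σ₀).hom hs).trans (map_zero _)
  exact ⟨h.hom 0 1 s, (hc'.trans ((congrArg _ e0).trans (add_zero _))).symm⟩

end SingularAcyclic

end
end Freehedral

namespace Freehedral
noncomputable section
variable {R : Type u} [CommRing R]

section NormalizedAcyclic
variable {M : TopCat.{u}}

lemma simplexCell_surjective (c : Cell M 0) : ∃ σ, simplexCell (Y := M) σ = c := by
  refine ⟨(M.toSSetObjEquiv _).symm (ContinuousMap.const _ (c.map 0)), Cell.ext_aux ?_ ?_ ?_⟩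
  · have := c.dim_eq; change 0 = c.m; omega
  · have := c.dim_eq; change 0 = c.k; omega
  · ext x
    simp only [simplexCell, Equiv.apply_symm_apply, ContinuousMap.comp_apply,
      ContinuousMap.const_apply]
    congr 1
    exact Subsingleton.elim _ _

lemma exists_simplex_chain (x : NormalizedChains R M 0) :
    ∃ s, ((simplexToCell R).app M).f 0 s = x := by
  let φ := (simplexToCellF R M 0).hom
  refine normalizedChains_induction (P := fun x => ∃ s, ((simplexToCell R).app M).f 0 s = x) x
    ⟨0, map_zero φ⟩ ?_ fun r c => ?_
  · rintro _ _ ⟨s, rfl⟩ ⟨t, rfl⟩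
    exact ⟨s + t, map_add φ s t⟩
  · obtain ⟨σ, rfl⟩ := simplexCell_surjective c
    refine ⟨(show ModuleCat.of R R ⟶ (TopCat.toSSet.obj M |>.chainComplex (ModuleCat.of R R)).X 0 from
      (TopCat.toSSet.obj M).ιChainComplex σ).hom r, ?_⟩
    exact LinearMap.congr_fun (congrArg ModuleCat.Hom.hom (ι_simplexToCellF σ)) r

lemma freehedralOne_normalizedD (x : NormalizedChains R M 1) :
    (freehedralOne (R := R) M).hom (normalizedD R M 0 x) = 0 := by
  let φ : NormalizedChains R M 0 →ₗ[R] R := (freehedralOne (R := R) M).hom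
  have hφ : ∀ c : Cell M 0, φ (cellClass R c) = 1 := fun c => by
    refine (cellValue_eq c _).symm.trans ?_
    exact cellValue_cochainOfCells _ _ _
  change φ _ = 0
  refine LinearMap.congr_fun (f := φ ∘ₗ normalizedD R M 0) (g := 0)
    (normalizedChains_hom_ext fun c => ?_) x
  have hm : c.m ≤ 1 := by have := c.dim_eq; omega
  rw [LinearMap.comp_apply, normalizedD_cellClass_eq, Finset.Icc_eq_empty (a := 2) (by omega)]
  simp [hφ]

/-- The cone over a cell: the homotopy `H` is applied along a new last direction of `I^l`. -/
def coneCell {y : M} (H : (ContinuousMap.id M).Homotopy (ContinuousMap.const _ y)) {n : ℕ}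
    (c : Cell M n) : Cell M (n + 1) :=
  ⟨c.k, c.m, c.l + 1, by have := c.dim_eq; omega,
    ⟨fun x => H (coord x n, c.map (Fin.init x)),
      H.continuous.comp ((continuous_coord n).prodMk (c.map.continuous.comp
        (continuous_pi fun j => continuous_apply _)))⟩⟩

variable {y : M} (H : (ContinuousMap.id M).Homotopy (ContinuousMap.const _ y))

lemma coneCell_isDegenerate {n : ℕ} {c : Cell M n} (hc : c.IsDegenerate) :
    (coneCell H c).IsDegenerate := by
  obtain ⟨p, hp, h⟩ := hc
  refine ⟨p.castSucc, hp, fun x x' hx => ?_⟩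
  have e1 : coord x n = coord x' n := by
    have := hx (Fin.last n) (Fin.castSucc_lt_last p).ne'
    simpa [coord, Fin.last] using this
  change H (_, _) = H (_, _)
  rw [e1, h (Fin.init x) (Fin.init x') fun j hj => hx _ (by simpa using hj)]

lemma coord_init {n : ℕ} (x : Fin (n + 1) → unitInterval) {j : ℕ} (hj : j < n) :
    coord (Fin.init x) j = coord x j := by
  have : j < n + 1 := by omega
  simp [coord, hj, this, Fin.init]

/-- The index of the face of a cone that is the cone over a face. -/
def coneIndex (m l e i : ℕ) : ℕ := if e = 2 ∨ i ≤ m + l then i else i + 1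

lemma face_coneCell {n : ℕ} (c : Cell M (n + 1)) (e i : ℕ) (hA : Cell.Adm (n + 1) c.m e i) :
    Cell.face e (coneIndex c.m c.l e i) (coneCell H c) = coneCell H (Cell.face e i c) := by
  have hd := c.dim_eq
  have hA' : Cell.Adm (n + 1 + 1) (coneCell H c).m e (coneIndex c.m c.l e i) := by
    change Cell.Adm (n + 1 + 1) c.m _ _
    unfold Cell.Adm coneIndex at *
    split_ifs <;> omega
  obtain ⟨r1, r2, r3⟩ := Cell.face_spec c e i hA
  obtain ⟨s1, s2, s3⟩ := Cell.face_spec _ _ _ hA'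
  change _ = Cell.faceM c.m e (coneIndex c.m c.l e i) at s1
  change _ = Cell.faceK c.k c.m (c.l + 1) e (coneIndex c.m c.l e i) at s2
  change _ = (coneCell H c).map.comp
    (Cell.faceMap (n + 1) c.k c.m (c.l + 1) e (coneIndex c.m c.l e i)) at s3
  have hA2 : 1 ≤ i ∧ i ≤ n + 1 ∧ (e = 2 → i ≤ c.m) ∧ (e = 0 ∨ e = 1 ∨ e = 2) := by
    unfold Cell.Adm at hA; omega
  refine Cell.ext_aux ?_ ?_ ?_
  · rw [s1]
    change _ = (Cell.face e i c).m
    rw [r1]; unfold Cell.faceM coneIndex; split_ifs <;> omega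
  · rw [s2]
    change _ = (Cell.face e i c).k
    rw [r2]; unfold Cell.faceK coneIndex; split_ifs <;> omega
  · rw [s3]
    ext x
    change H (coord (Cell.faceMap (n + 1) c.k c.m (c.l + 1) e _ x) (n + 1), c.map _) =
      H (coord x n, (Cell.face e i c).map _)
    rw [r3, ContinuousMap.comp_apply]
    refine congrArg₂ (fun a b => H (a, b)) ?_ (congrArg c.map (Cell.coord_ext fun t ht => ?_))
    · rw [Cell.coord_faceMap _ _ _ _ _ _ _ _ (by omega)]
      unfold Cell.faceVal coneIndex
      split_ifs <;> first | omega | rfl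
    · rw [coord_init _ ht, Cell.coord_faceMap _ _ _ _ _ _ _ _ (by omega),
        Cell.coord_faceMap _ _ _ _ _ _ _ _ ht]
      have h1 : t < n → coord (Fin.init x) t = coord x t := fun h => coord_init _ h
      have h2 : t ≠ 0 → coord (Fin.init x) (t - 1) = coord x (t - 1) :=
        fun h => coord_init _ (by omega)
      unfold Cell.faceVal coneIndex
      by_cases he : e = 2
      · simp only [he, if_true, true_or]
        split_ifs <;> first | rfl | (rw [h1 (by omega)]) | (rw [h2 (by omega)])
      · simp only [he, if_false, false_or]
        split_ifs <;> first | omega | rfl | (rw [h1 (by omega)]) | (rw [h2 (by omega)])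

lemma face_zero_coneCell {n : ℕ} (c : Cell M n) :
    Cell.face 0 (c.m + c.l + 1) (coneCell H c) = c := by
  have hd := c.dim_eq
  have hA : Cell.Adm (n + 1) (coneCell H c).m 0 (c.m + c.l + 1) := by unfold Cell.Adm; omega
  obtain ⟨s1, s2, s3⟩ := Cell.face_spec _ _ _ hA
  refine Cell.ext_aux ?_ ?_ ?_
  · rw [s1]; simp [Cell.faceM, coneCell]
  · rw [s2]; simp [Cell.faceK, coneCell]
  · rw [s3]
    ext x
    change H (coord (Cell.faceMap n c.k c.m (c.l + 1) 0 _ x) n, c.map _) = c.map x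
    have e1 : coord (Cell.faceMap n c.k c.m (c.l + 1) 0 (c.m + c.l + 1) x) n = 0 := by
      rw [Cell.coord_faceMap _ _ _ _ _ _ _ _ (by omega)]
      unfold Cell.faceVal
      simp only [show (0 : ℕ) ≠ 2 by decide, if_false]
      split_ifs <;> first | omega | rfl
    rw [e1, H.apply_zero]
    refine congrArg c.map (Cell.coord_ext fun t ht => ?_)
    rw [coord_init _ ht, Cell.coord_faceMap _ _ _ _ _ _ _ _ (by omega)]
    change Cell.faceVal c.k c.m (c.l + 1) 0 (c.m + c.l + 1) (coord x) t = _
    unfold Cell.faceVal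
    simp only [show (0 : ℕ) ≠ 2 by decide, if_false]
    split_ifs <;> first | omega | rfl

lemma face_one_coneCell {n : ℕ} (c : Cell M n) :
    Cell.face 1 (c.m + c.l + 1) (coneCell H c) = c.postcomp (ContinuousMap.const _ y) := by
  have hd := c.dim_eq
  have hA : Cell.Adm (n + 1) (coneCell H c).m 1 (c.m + c.l + 1) := by
    change Cell.Adm (n + 1) c.m _ _
    unfold Cell.Adm; omega
  obtain ⟨s1, s2, s3⟩ := Cell.face_spec _ _ _ hA
  refine Cell.ext_aux ?_ ?_ ?_
  · rw [s1]; simp [Cell.faceM, coneCell, Cell.postcomp]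
  · rw [s2]; simp [Cell.faceK, coneCell, Cell.postcomp]
  · rw [s3]
    ext x
    change H (coord (Cell.faceMap n c.k c.m (c.l + 1) 1 _ x) n, c.map _) = y
    have e1 : coord (Cell.faceMap n c.k c.m (c.l + 1) 1 (c.m + c.l + 1) x) n = 1 := by
      rw [Cell.coord_faceMap _ _ _ _ _ _ _ _ (by omega)]
      unfold Cell.faceVal
      simp only [show (1 : ℕ) ≠ 2 by decide, if_false]
      split_ifs <;> first | contradiction | omega | rfl
    rw [e1, H.apply_one]
    rfl

/-- The cone operator on normalized chains. -/
def coneMap (n : ℕ) : NormalizedChains R M n →ₗ[R] NormalizedChains R M (n + 1) :=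
  normalizedLift (fun c => (-1 : R) ^ (c.m + c.l) • cellClass R (coneCell H c)) fun c hc => by
    rw [cellClass_eq_zero (coneCell_isDegenerate H hc), smul_zero]

lemma coneMap_cellClass {n : ℕ} (c : Cell M n) :
    coneMap (R := R) H n (cellClass R c) = (-1 : R) ^ (c.m + c.l) • cellClass R (coneCell H c) :=
  normalizedLift_cellClass _ _ _

lemma adms_coneCell {n m l : ℕ} (h : m + l ≤ n + 1) : Cell.adms (n + 2) m =
    insert (0, m + l + 1) (insert (1, m + l + 1)
      ((Cell.adms (n + 1) m).image fun q => (q.1, coneIndex m l q.1 q.2))) := by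
  ext ⟨e, i⟩
  rw [Cell.mem_adms (by omega)]
  simp only [Finset.mem_insert, Finset.mem_image, Prod.exists, Prod.mk.injEq]
  constructor
  · intro hA
    by_cases hi : i = m + l + 1 ∧ e ≠ 2
    · unfold Cell.Adm at hA; omega
    · refine Or.inr (Or.inr ⟨e, if e = 2 ∨ i ≤ m + l then i else i - 1, ?_, rfl, ?_⟩)
      · rw [Cell.mem_adms (by omega)]
        unfold Cell.Adm at *
        split_ifs <;> omega
      · unfold Cell.Adm at hA
        unfold coneIndex
        split_ifs <;> omega
  · rintro (⟨rfl, rfl⟩ | ⟨rfl, rfl⟩ | ⟨e, i, hq, rfl, rfl⟩)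
    · unfold Cell.Adm; omega
    · unfold Cell.Adm; omega
    · rw [Cell.mem_adms (by omega)] at hq
      unfold Cell.Adm coneIndex at *
      split_ifs <;> omega

lemma sum_adms_coneCell {A : Type*} [AddCommMonoid A] {n m l : ℕ} (h : m + l ≤ n + 1)
    (F : ℕ × ℕ → A) : ∑ q ∈ Cell.adms (n + 2) m, F q = F (0, m + l + 1) + (F (1, m + l + 1) +
      ∑ q ∈ Cell.adms (n + 1) m, F (q.1, coneIndex m l q.1 q.2)) := by
  have key : ∀ e, ((e = 0 ∨ e = 1) → (e, m + l + 1) ∉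
      (Cell.adms (n + 1) m).image fun q => (q.1, coneIndex m l q.1 q.2)) := by
    intro e he hm
    simp only [Finset.mem_image, Prod.exists, Prod.mk.injEq] at hm
    obtain ⟨e', i, -, rfl, hi⟩ := hm
    unfold coneIndex at hi
    split_ifs at hi <;> omega
  rw [adms_coneCell h, Finset.sum_insert, Finset.sum_insert (key 1 (Or.inr rfl)),
    Finset.sum_image]
  · rintro ⟨e, i⟩ _ ⟨e', i'⟩ _ h
    simp only [Prod.mk.injEq] at h
    obtain ⟨rfl, h⟩ := h
    unfold coneIndex at h
    refine Prod.ext rfl ?_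
    change i = i'
    split_ifs at h <;> omega
  · rw [Finset.mem_insert, not_or]
    exact ⟨by simp, key 0 (Or.inl rfl)⟩

lemma normalizedD_coneMap {n : ℕ} (x : NormalizedChains R M (n + 1)) :
    normalizedD R M (n + 1) (coneMap H (n + 1) x) + coneMap H n (normalizedD R M n x) =
      normalizedMap R (TopCat.ofHom (ContinuousMap.const M y)) (n + 1) x - x := by
  refine LinearMap.congr_fun (f := normalizedD R M (n + 1) ∘ₗ coneMap H (n + 1) +
    coneMap H n ∘ₗ normalizedD R M n) (g := normalizedMap R
      (TopCat.ofHom (ContinuousMap.const M y)) (n + 1) - LinearMap.id)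
    (normalizedChains_hom_ext fun c => ?_) x
  have hd := c.dim_eq
  simp only [LinearMap.add_apply, LinearMap.comp_apply, LinearMap.sub_apply, LinearMap.id_apply]
  rw [coneMap_cellClass, map_smul, normalizedD_cellClass, normalizedD_cellClass,
    normalizedMap_cellClass, map_sum]
  change _ • (∑ q ∈ Cell.adms (n + 2) c.m, _) + _ = _
  rw [sum_adms_coneCell (l := c.l) (by omega)]
  simp only []
  rw [face_zero_coneCell, face_one_coneCell, smul_add, smul_add, Finset.smul_sum, add_assoc _ _ (∑ q ∈ _, _),
    add_assoc _ _ (∑ q ∈ _, _), ← Finset.sum_add_distrib, Finset.sum_eq_zero, add_zero, smul_smul, smul_smul,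
    ← pow_add, ← pow_add]
  · have o1 : Odd (c.m + c.l + Cell.sgnExp (n + 1 + 1) 0 (c.m + c.l + 1)) := by
      unfold Cell.sgnExp; exact ⟨c.m + c.l, by simp; ring⟩
    have o2 : Even (c.m + c.l + Cell.sgnExp (n + 1 + 1) 1 (c.m + c.l + 1)) := by
      unfold Cell.sgnExp; exact ⟨c.m + c.l + 1, by simp; ring⟩
    rw [o1.neg_one_pow, o2.neg_one_pow, TopCat.hom_ofHom]
    module
  · rintro ⟨e, i⟩ hq
    have hA : Cell.Adm (n + 1) c.m e i := (Cell.mem_adms (by omega)).1 hq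
    obtain ⟨r1, r2, r3⟩ := Cell.face_spec c e i hA
    have hf := (Cell.face e i c).dim_eq
    rw [map_smul, coneMap_cellClass, face_coneCell H c e i hA, smul_smul, smul_smul, ← pow_add,
      ← pow_add, ← add_smul]
    have : Odd ((c.m + c.l + Cell.sgnExp (n + 1 + 1) e (coneIndex c.m c.l e i)) +
        (Cell.sgnExp (n + 1) e i + ((Cell.face e i c).m + (Cell.face e i c).l))) := by
      unfold Cell.faceM at r1
      unfold Cell.faceK at r2
      unfold Cell.Adm at hA
      unfold Cell.sgnExp coneIndex
      rcases hA with ⟨rfl, h⟩ | ⟨rfl, h⟩ | ⟨rfl, h⟩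
      · simp only [show (0 : ℕ) ≠ 2 by decide, if_true, if_false, false_or] at *
        rw [Nat.odd_iff]
        split_ifs at * <;> omega
      · simp only [show (1 : ℕ) ≠ 2 by decide, show (1 : ℕ) ≠ 0 by decide, if_true, if_false,
          false_or] at *
        rw [Nat.odd_iff]
        split_ifs at * <;> omega
      · simp only [show (2 : ℕ) ≠ 0 by decide, show (2 : ℕ) ≠ 1 by decide, if_true, if_false,
          true_or] at *
        rw [show (i - 1) * (n + 1 + 1) = (i - 1) * (n + 1) + (i - 1) by ring, Nat.odd_iff]
        generalize (i - 1) * (n + 1) = t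
        omega
    rw [Nat.odd_add] at this
    rcases Nat.even_or_odd (c.m + c.l + Cell.sgnExp (n + 1 + 1) e (coneIndex c.m c.l e i)) with h | h
    · rw [h.neg_one_pow, Odd.neg_one_pow (Nat.not_even_iff_odd.1 fun h' =>
        Nat.not_odd_iff_even.2 h (this.2 h'))]
      simp
    · rw [h.neg_one_pow, (this.1 h).neg_one_pow]
      simp

/-- The constant cell of type `(0, n, 0)`. -/
def constCell (y : M) (n : ℕ) : Cell M n := ⟨0, n, 0, by omega, ContinuousMap.const _ y⟩

lemma cellClass_postcomp_const (y : M) {n : ℕ} (c : Cell M n) :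
    cellClass R (c.postcomp (ContinuousMap.const M y)) =
      if c.k = 0 ∧ c.l = 0 then cellClass R (constCell y n) else 0 := by
  have hd := c.dim_eq
  split_ifs with h
  · congr 1
    refine Cell.ext_aux ?_ ?_ ?_
    · change c.m = n; omega
    · exact h.1
    · rfl
  · refine cellClass_eq_zero ?_
    rcases Nat.eq_zero_or_pos c.k with hk | hk
    · refine ⟨⟨n - 1, by omega⟩, Or.inr ?_, fun _ _ _ => rfl⟩
      change c.k + c.m ≤ n - 1; omega
    · exact ⟨⟨0, by omega⟩, Or.inl hk, fun _ _ _ => rfl⟩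

lemma normalizedMap_const (y : M) {n : ℕ} (x : NormalizedChains R M n) :
    ∃ r : R, normalizedMap R (TopCat.ofHom (ContinuousMap.const M y)) n x =
      r • cellClass R (constCell y n) := by
  refine normalizedChains_induction (P := fun x => ∃ r : R, normalizedMap R
    (TopCat.ofHom (ContinuousMap.const M y)) n x = r • cellClass R (constCell y n)) x
    ⟨0, by simp⟩ ?_ fun r c => ?_
  · rintro _ _ ⟨r, hr⟩ ⟨s, hs⟩
    exact ⟨r + s, by rw [map_add, hr, hs, add_smul]⟩
  · refine ⟨if c.k = 0 ∧ c.l = 0 then r else 0, ?_⟩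
    rw [map_smul, normalizedMap_cellClass, TopCat.hom_ofHom, cellClass_postcomp_const]
    split_ifs <;> simp

lemma cellClass_face_constCell (y : M) {n e i : ℕ} (h : Cell.Adm (n + 1) (n + 1) e i) :
    cellClass R (Cell.face e i (constCell y (n + 1))) =
      if Cell.faceM (n + 1) e i = n then cellClass R (constCell y n) else 0 := by
  have hf := (Cell.face e i (constCell y (n + 1))).dim_eq
  obtain ⟨s1, s2, s3⟩ := Cell.face_spec (constCell y (n + 1)) e i h
  have : Cell.face e i (constCell y (n + 1)) =
      (Cell.face e i (constCell y (n + 1))).postcomp (ContinuousMap.const M y) :=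
    Cell.ext_aux rfl rfl s3
  rw [this, cellClass_postcomp_const]
  change _ = Cell.faceM (n + 1) e i at s1
  refine if_congr ?_ rfl rfl
  omega

lemma normalizedD_constCell (y : M) (n : ℕ) :
    normalizedD R M n (cellClass R (constCell y (n + 1))) =
      (∑ j ∈ Finset.range n, (-1 : R) ^ j) • cellClass R (constCell y n) := by
  have e0 : ∀ j ∈ Finset.range (n + 1), cellClass R ((constCell y (n + 1)).d0 (j + 1)) =
      if j = n then cellClass R (constCell y n) else 0 := fun j hj => by
    rw [Finset.mem_range] at hj
    refine (cellClass_face_constCell y (e := 0) (by unfold Cell.Adm; omega)).trans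
      (if_congr ?_ rfl rfl)
    simp only [Cell.faceM, if_true]
    split_ifs <;> omega
  have e1 : ∀ j ∈ Finset.range (n + 1), cellClass R ((constCell y (n + 1)).d1 (j + 1)) =
      cellClass R (constCell y n) := fun j hj => by
    rw [Finset.mem_range] at hj
    by_cases h : j = 0
    · subst h
      exact (cellClass_face_constCell y (e := 2) (i := 1) (by unfold Cell.Adm; omega)).trans
        (if_pos rfl)
    · refine (cellClass_face_constCell y (e := 1) (by unfold Cell.Adm; omega)).trans (if_pos ?_)
      simp only [Cell.faceM, show (1 : ℕ) ≠ 0 by decide, if_true, if_false]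
      split_ifs <;> omega
  have e2 : ∀ i ∈ Finset.Icc 2 (n + 1), cellClass R ((constCell y (n + 1)).d2 i) = 0 :=
    fun i hi => by
    rw [Finset.mem_Icc] at hi
    refine (cellClass_face_constCell y (e := 2) (by unfold Cell.Adm; omega)).trans (if_neg ?_)
    change n + 1 - i ≠ n
    omega
  rw [normalizedD_cellClass_eq, Finset.sum_eq_zero (s := Finset.Icc 2 _), add_zero]
  · rw [← Finset.Ico_succ_right_eq_Icc, Finset.sum_Ico_eq_sum_range]
    simp only [Nat.succ_eq_succ, Nat.succ_eq_add_one, Nat.add_sub_cancel]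
    rw [Finset.sum_congr rfl fun j hj => by rw [add_comm 1 j, e0 j hj, e1 j hj],
      Finset.sum_range_succ, if_pos rfl, sub_self, smul_zero, add_zero, Finset.sum_smul]
    refine Finset.sum_congr rfl fun j hj => ?_
    rw [if_neg (Finset.mem_range.1 hj).ne, zero_sub, pow_succ]
    module
  · intro i hi
    rw [e2 i hi, smul_zero]

lemma eq_zero_of_smul_constCell {y : M} {n : ℕ} {r : R}
    (h : r • cellClass R (constCell y n) = 0) : r = 0 := by
  let φ : NormalizedChains R M n →ₗ[R] R :=
    normalizedLift (fun c => if c.m = n then 1 else 0) fun c hc => if_neg fun hm => by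
      obtain ⟨p, hp, -⟩ := hc
      have := c.dim_eq
      have := p.2
      omega
  have := congrArg φ h
  rw [map_smul, map_zero, normalizedLift_cellClass] at this
  simpa [constCell] using this

lemma normalizedD_normalizedD (n : ℕ) (x : NormalizedChains R M (n + 2)) :
    normalizedD R M n (normalizedD R M (n + 1) x) = 0 := by
  have := (normalizedComplex R M).d_comp_d (n + 2) (n + 1) n
  rw [normalizedComplex_d, normalizedComplex_d] at this
  exact LinearMap.congr_fun (congrArg ModuleCat.Hom.hom this) x

/-- The normalized complex of a contractible space is acyclic in positive degrees. -/
lemma normalizedD_exact (hM : (ContinuousMap.id M).Nullhomotopic) (n : ℕ)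
    (x : NormalizedChains R M (n + 1)) (hx : normalizedD R M n x = 0) :
    ∃ t, normalizedD R M (n + 1) t = x := by
  obtain ⟨y, ⟨H⟩⟩ := hM
  have h := normalizedD_coneMap H x
  rw [hx, map_zero, add_zero] at h
  obtain ⟨r, hr⟩ := normalizedMap_const y x
  rw [hr] at h
  suffices ∃ t, normalizedD R M (n + 1) t = r • cellClass R (constCell y (n + 1)) by
    obtain ⟨t, ht⟩ := this
    exact ⟨t - coneMap H (n + 1) x, by rw [map_sub, ht, h, sub_sub_cancel]⟩
  rcases Nat.even_or_odd n with hn | hn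
  · refine ⟨r • cellClass R (constCell y (n + 2)), ?_⟩
    rw [map_smul, normalizedD_constCell, neg_one_geom_sum, if_neg (by simpa using hn.add_one),
      one_smul]
  · refine ⟨0, ?_⟩
    have h' := congrArg (normalizedD R M n) h
    rw [normalizedD_normalizedD, map_sub, hx, sub_zero, map_smul, normalizedD_constCell,
      neg_one_geom_sum, if_neg (by simpa using hn), one_smul] at h'
    rw [map_zero, eq_zero_of_smul_constCell h'.symm, zero_smul]

end NormalizedAcyclic

end
end Freehedral

namespace Freehedral
noncomputable section
variable {R : Type u} [CommRing R]

lemma normalizedComplex_d_apply {M : TopCat.{u}} (n : ℕ) (x : NormalizedChains R M (n + 1)) :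
    ((normalizedComplexFunctor R).obj M).d (n + 1) n x = normalizedD R M n x :=
  LinearMap.congr_fun (congrArg ModuleCat.Hom.hom (normalizedComplex_d R M n)) x

lemma simplicialOne_eq_zero {M : TopCat.{u}} (s : ((singularComplexFunctor R).obj M).X 0)
    (y : NormalizedChains R M 1)
    (h : normalizedD R M 0 y + (show NormalizedChains R M 0 from
      ((simplexToCell R).app M).f 0 s) = 0) :
    (simplicialOne (R := R) (TopCat.toSSet.obj M)).hom s = 0 := by
  let φ : NormalizedChains R M 0 →ₗ[R] R := (freehedralOne (R := R) M).hom
  have h1 := congrArg φ h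
  rw [map_add, map_zero] at h1
  have h2 : φ (normalizedD R M 0 y) = 0 := freehedralOne_normalizedD y
  rw [h2, zero_add] at h1
  rw [← cochainMap_freehedralOne]
  exact h1

variable (R) in
lemma exists_homotopyEquiv_simplexToCell (Y : TopCat.{u}) :
    ∃ e : HomotopyEquiv ((singularComplexFunctor R).obj Y) ((normalizedComplexFunctor R).obj Y),
      e.hom = (simplexToCell R).app Y := by
  refine exists_homotopyEquiv _ (exists_homotopyInverse _ relProjective_singular
    relProjective_normalized (fun M _ x => ?_) (fun M hM s y h => ?_)
    (fun M hM n s hs => singular_exact hM n s hs) fun M hM n x hx => ?_) Y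
  · obtain ⟨s, hs⟩ := exists_simplex_chain (R := R) x
    refine ⟨0, s, Eq.trans ?_ hs⟩
    let D := (((normalizedComplexFunctor R).obj M).d 1 0).hom
    exact (congrArg (· + _) (map_zero D)).trans (zero_add _)
  · refine singular_exact_zero hM s (simplicialOne_eq_zero s y ?_)
    exact (congrArg (fun z : NormalizedChains R M 0 => z + (show NormalizedChains R M 0 from
      ((simplexToCell R).app M).f 0 s)) (normalizedComplex_d_apply 0 y)).symm.trans h
  · obtain ⟨t, ht⟩ := normalizedD_exact hM n x ((normalizedComplex_d_apply n x).symm.trans hx)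
    exact ⟨t, (normalizedComplex_d_apply (n + 1) t).trans ht⟩

end
end Freehedral

theorem mainTheorem7 (R : Type u) [CommRing R] :
    ∃ Φ : Freehedral.singularComplexFunctor R ⟶ Freehedral.normalizedComplexFunctor R,
      ∀ Y : TopCat.{u},
        (∀ n : ℕ, IsIso (HomologicalComplex.homologyMap (Φ.app Y) n)) ∧
        (∀ n : ℕ, Function.Bijective (Freehedral.cohomologyMap (Φ.app Y) n)) ∧
        Freehedral.cochainMap (Φ.app Y) 0 (Freehedral.freehedralOne (R := R) Y) =
          Freehedral.simplicialOne (R := R) (TopCat.toSSet.obj Y) ∧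
        ∃ (hF : Freehedral.IsLeibniz (Freehedral.freehedralCup (R := R) Y))
          (hS : Freehedral.IsLeibniz (Freehedral.singularCup (R := R) Y)),
          ∀ (p q r : ℕ) (h : p + q = r)
            (a : Freehedral.Cohomology ((Freehedral.normalizedComplexFunctor R).obj Y) p)
            (b : Freehedral.Cohomology ((Freehedral.normalizedComplexFunctor R).obj Y) q),
            Freehedral.cohomologyMap (Φ.app Y) r (Freehedral.cohomologyMul _ hF h a b) =
              Freehedral.cohomologyMul _ hS h (Freehedral.cohomologyMap (Φ.app Y) p a)
                (Freehedral.cohomologyMap (Φ.app Y) q b) := by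
  refine ⟨Freehedral.simplexToCell R, fun Y => ?_⟩
  obtain ⟨e, he⟩ := Freehedral.exists_homotopyEquiv_simplexToCell R Y
  refine ⟨fun n => ?_, fun n => ?_, Freehedral.cochainMap_freehedralOne Y,
    Freehedral.isLeibniz_freehedralCup Y, Freehedral.isLeibniz_alexanderWhitney,
    fun p q r h a b => Freehedral.cohomologyMap_freehedralCup _ _ h a b⟩
  · rw [← he]
    exact Freehedral.isIso_homologyMap e n
  · rw [← he]
    exact Freehedral.cohomologyMap_bijective e n
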